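/- **Setting.** Let $\mathcal M$ be a smooth compact manifold with boundary $\mathcal N$, let $\wp:\mathcal N\to\mathcal Y$ be a smooth fibration with (compact) fibers $\mathcal Z_y=\wp^{-1}(y)$, and let $x\ge 0$ be a fixed smooth defining function of $\mathcal N$. Let $E\to\mathcal M$ be a smooth Hermitian vector bundle, $\mathfrak m$ a smooth positive density on $\mathcal M$ and $\mathfrak m_b=x^{-1}\mathfrak m$; $x^{-1}L^2_b(\mathcal M;E)$ is the $L^2$ space of sections of $E$ with respect to $x^{2}\mathfrak m_b$. Let $\mathfrak m_{\mathcal N}$ be the density on $\mathcal N$ with $\mathfrak m=|dx|\otimes\mathfrak m_{\mathcal N}$ along $\mathcal N$; fix a smooth positive density $\mathfrak m_{\mathcal Y}$ on $\mathcal Y$ and let $\mathfrak m_{\mathcal Z_y}$ be the density on $\mathcal Z_y$ with $\mathfrak m_{\mathcal N}=\mathfrak m_{\mathcal Z_y}\otimes\mathfrak m_{\mathcal Y}$ along $\mathcal Z_y$ (changing $\mathfrak m_{\mathcal Y}$ only multiplies $\mathfrak m_{\mathcal Z_y}$ by a positive constant). $\mathrm{Diff}^2_e(\mathcal M;E)$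 is the space of edge differential operators of order at most $2$, i.e. of sums of operators $B D_1D_2$ on $C^\infty(\mathcal M;E)$, where $B$ is a smooth bundle endomorphism and each $D_i$ satisfies $D_i(fs)=(V_if)s+fD_is$ with $V_i$ a smooth vector field which along $\mathcal N$ is tangent to the fibers of $\wp$. Let $A=x^{-2}P$ with $P\in\mathrm{Diff}^2_e(\mathcal M;E)$. * *The $w$-principal symbol.* The bundle ${}^wT^*\mathcal M$ is the vector bundle whose smooth sections are the smooth real $1$-forms on $\mathcal M$ which along $\mathcal N$ are conormal to the fibers of $\wp$. The symbol ${}^w\sigma(A)$ assigns to $\boldsymbol\xi\in{}^wT_p^*\mathcal M$ an endomorphism of $E_p$. It is smooth up to the boundary (along smooth sections of ${}^wT^*\mathcal M$), and over the interior it is given by ${}^w\sigma(A)(df)\psi=\lim_{\varrho\to\infty}\varrho^{-2}e^{-i\varrho f}A(e^{i\varrho f}\psi)$ for $\psi\in C_c^\infty(\mathring{\mathcal M};E)$ and $f\in C^\infty(\mathcal M;\mathbb R)$ such that $f|_{\mathcal N}=\wp^*g$ for some $g\in C^\infty(\mathcal Y)$. * *The indicial family.* For $\sigma\in\mathbb C$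 let $P_\sigma=x^{-i\sigma}Px^{i\sigma}\in\mathrm{Diff}^2_e(\mathcal M;E)$. Then ${}^b\widehat P(y,\sigma)$ is the operator on $C^\infty(\mathcal Z_y;E_{\mathcal Z_y})$ with ${}^b\widehat P(y,\sigma)(U|_{\mathcal Z_y})=(P_\sigma U)|_{\mathcal Z_y}$ for $U\in C^\infty(\mathcal M;E)$. * *The normal family.* Let $\mathcal N^\wedge=\mathcal N\times[0,\infty)$ be the inward normal bundle, trivialized by $dx$, with coordinate $x$ in the second factor, let $E^\wedge$ be the lift of $E|_{\mathcal N}$ and $\mathcal Z_y^\wedge=\mathcal Z_y\times[0,\infty)$. The spaces $x^{-1}L^2_b(\mathcal N^\wedge;E^\wedge)$ and $x^{-1}L^2_b(\mathcal Z_y^\wedge;E_{\mathcal Z_y^\wedge})$ are formed with $x^2\,\frac{dx}{x}\otimes\mathfrak m_{\mathcal N}$ and $x^2\,\frac{dx}{x}\otimes\mathfrak m_{\mathcal Z_y}$. Fix a tubular neighborhood map $\Phi$ from $\mathcal N\times[0,\varepsilon)$ onto a neighborhood of $\mathcal N$ in $\mathcal M$ (the identity on $\mathcal N$ and tangent to the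 identity on the normal bundle) and a smooth bundle isomorphism $E^\wedge\to E$ over $\Phi$ which is the identity over $\mathcal N$, such that the resulting push-forward $\Phi_*$ of sections is isometric between the $x^{-1}L^2_b$ spaces; let $\Phi^*$ be its inverse. With $\kappa_\varrho u(z,x)=\varrho u(z,\varrho x)$, the operator $A_\wedge(\boldsymbol\eta)$, $\boldsymbol\eta\in T_y^*\mathcal Y$, on $C_c^\infty(\mathring{\mathcal Z}_y^\wedge;E_{\mathcal Z_y^\wedge})$ is given by $$A_\wedge(\boldsymbol\eta)(U|_{\mathcal Z_y^\wedge})=\Big(\lim_{\varrho\to\infty}\varrho^{-2}\kappa_\varrho^{-1}e^{-i\varrho\,\wp^*g}\,\Phi^*A\Phi_*\,e^{i\varrho\,\wp^*g}\kappa_\varrho U\Big)\Big|_{\mathcal Z_y^\wedge}$$ (pointwise limit) for all $U\in C_c^\infty(\mathring{\mathcal N}^\wedge;E^\wedge)$ and all real $g\in C^\infty(\mathcal Y)$ with $dg(y)=\boldsymbol\eta$. **Lemma (Symmetry).** Suppose that $A=A^\star\ge 1$ on $C_c^\infty(\mathring{\mathcal M};E)$ in $x^{-1}L^2_b$, i.e.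 $\langle Au,v\rangle=\langle u,Av\rangle$ and $\langle Au,u\rangle\ge\langle u,u\rangle$ for all $u,v\in C_c^\infty(\mathring{\mathcal M};E)$. Then ${}^w\sigma(A)$, ${}^b\widehat P$ and $A_\wedge$ are well defined by the above, and: (a) ${}^w\sigma(A)={}^w\sigma(A)^\star$ and $\operatorname{spec}({}^w\sigma(A))\subset[0,\infty)$ everywhere on ${}^wT^*\mathcal M$, including over the boundary. (b) For all $y\in\mathcal Y$ and $\sigma\in\mathbb C$, ${}^b\widehat P(y,\sigma)=[{}^b\widehat P(y,\overline\sigma)]^\star$ on $C^\infty(\mathcal Z_y;E_{\mathcal Z_y})$, i.e. $\langle{}^b\widehat P(y,\sigma)u,v\rangle=\langle u,{}^b\widehat P(y,\overline\sigma)v\rangle$ in $L^2(\mathcal Z_y,\mathfrak m_{\mathcal Z_y};E_{\mathcal Z_y})$ for all $u,v\in C^\infty(\mathcal Z_y;E_{\mathcal Z_y})$. (c) For all $y\in\mathcal Y$, $\boldsymbol\eta\in T_y^*\mathcal Y$ and $u,v\in C_c^\infty(\mathring{\mathcal Z}_y^\wedge;E_{\mathcal Z_y^\wedge})$, in $x^{-1}L^2_b(\mathcal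 Z_y^\wedge;E_{\mathcal Z_y^\wedge})$, $$\langle A_\wedge(\boldsymbol\eta)u,v\rangle=\langle u,A_\wedge(\boldsymbol\eta)v\rangle,\qquad \langle A_\wedge(\boldsymbol\eta)u,u\rangle\ge 0 .$$ -/

import Mathlib

open Bundle Filter Topology MeasureTheory Set
open scoped Manifold ContDiff ENNReal

noncomputable section

namespace Wedge

/-! ### Smooth complex Hermitian vector bundles and their sections -/

/-- A smooth Hermitian vector bundle, presented as a smooth real vector bundle whose fibres are complex
inner product spaces such that multiplication by `i` is smooth and the Hermitian metric (equivalently,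
by polarization, its quadratic form on the total space) is smooth. -/
class SmoothHermitianBundle {B EB HB : Type*} [NormedAddCommGroup EB] [NormedSpace ℝ EB]
    [TopologicalSpace HB] (IB : ModelWithCorners ℝ EB HB) [TopologicalSpace B] [ChartedSpace HB B]
    (F : Type*) [NormedAddCommGroup F] [NormedSpace ℝ F] (E : B → Type*)
    [TopologicalSpace (TotalSpace F E)] [∀ p, NormedAddCommGroup (E p)]
    [∀ p, InnerProductSpace ℂ (E p)] [FiberBundle F E] : Prop where
  contMDiff_I_smul : ContMDiff (IB.prod 𝓘(ℝ, F)) (IB.prod 𝓘(ℝ, F)) ∞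
    (fun v : TotalSpace F E => TotalSpace.mk' F v.proj (Complex.I • v.snd))
  contMDiff_norm_sq : ContMDiff (IB.prod 𝓘(ℝ, F)) 𝓘(ℝ, ℝ) ∞
    (fun v : TotalSpace F E => ‖v.snd‖ ^ 2)

section Sections

variable {B EB HB : Type*} [NormedAddCommGroup EB] [NormedSpace ℝ EB]
  [TopologicalSpace HB] (IB : ModelWithCorners ℝ EB HB) [TopologicalSpace B] [ChartedSpace HB B]
  (F : Type*) [NormedAddCommGroup F] [NormedSpace ℝ F] (E : B → Type*)
  [TopologicalSpace (TotalSpace F E)] [∀ p, NormedAddCommGroup (E p)]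
  [∀ p, InnerProductSpace ℂ (E p)] [FiberBundle F E]
  {X EX HX : Type*} [NormedAddCommGroup EX] [NormedSpace ℝ EX]
  [TopologicalSpace HX] (J : ModelWithCorners ℝ EX HX) [TopologicalSpace X] [ChartedSpace HX X]

/-- `u` is a smooth section of the pull-back of `E` along `b : X → B`. -/
def IsSmoothAlong (b : X → B) (u : ∀ p, E (b p)) : Prop :=
  ContMDiff J (IB.prod 𝓘(ℝ, F)) ∞ (fun p => TotalSpace.mk' F (b p) (u p))

variable {IB F E J}

theorem IsSmoothAlong.I_smul [SmoothHermitianBundle IB F E] {b : X → B} {u : ∀ p, E (b p)}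
    (hu : IsSmoothAlong IB F E J b u) :
    IsSmoothAlong IB F E J b (fun p => Complex.I • u p) :=
  (SmoothHermitianBundle.contMDiff_I_smul (IB := IB) (F := F) (E := E)).comp hu

variable [VectorBundle ℝ F E]

theorem IsSmoothAlong.zero [ContMDiffVectorBundle ∞ F E IB] {b : X → B} (hb : ContMDiff J IB ∞ b) :
    IsSmoothAlong IB F E J b 0 :=
  (Bundle.contMDiff_zeroSection ℝ E).comp hb

theorem IsSmoothAlong.add {b : X → B} {u v : ∀ p, E (b p)}
    (hu : IsSmoothAlong IB F E J b u) (hv : IsSmoothAlong IB F E J b v) :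
    IsSmoothAlong IB F E J b (fun p => u p + v p) := by
  intro p
  have hu' := (contMDiffAt_totalSpace).1 (hu p)
  have hv' := (contMDiffAt_totalSpace).1 (hv p)
  refine (contMDiffAt_totalSpace).2 ⟨hu'.1, (hu'.2.add hv'.2).congr_of_eventuallyEq ?_⟩
  have hc : ContinuousAt b p := hu'.1.continuousAt
  filter_upwards [hc.preimage_mem_nhds ((trivializationAt F E (b p)).open_baseSet.mem_nhds
    (FiberBundle.mem_baseSet_trivializationAt F E (b p)))] with q hq
  exact ((trivializationAt F E (b p)).linear ℝ hq).1 _ _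

theorem IsSmoothAlong.smul {b : X → B} {u : ∀ p, E (b p)} {f : X → ℝ}
    (hf : ContMDiff J 𝓘(ℝ, ℝ) ∞ f) (hu : IsSmoothAlong IB F E J b u) :
    IsSmoothAlong IB F E J b (fun p => f p • u p) := by
  intro p
  have hu' := (contMDiffAt_totalSpace).1 (hu p)
  refine (contMDiffAt_totalSpace).2 ⟨hu'.1, ((hf p).smul hu'.2).congr_of_eventuallyEq ?_⟩
  have hc : ContinuousAt b p := hu'.1.continuousAt
  filter_upwards [hc.preimage_mem_nhds ((trivializationAt F E (b p)).open_baseSet.mem_nhds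
    (FiberBundle.mem_baseSet_trivializationAt F E (b p)))] with q hq
  exact ((trivializationAt F E (b p)).linear ℝ hq).2 _ _

variable (IB F E J) [ContMDiffVectorBundle ∞ F E IB] [SmoothHermitianBundle IB F E]

/-- The smooth sections of the pull-back of `E` along the smooth map `b`, i.e. `C^∞(X; b^*E)`. -/
def smoothSections (b : X → B) (hb : ContMDiff J IB ∞ b) : Submodule ℂ (∀ p, E (b p)) where
  carrier := {u | IsSmoothAlong IB F E J b u}
  zero_mem' := IsSmoothAlong.zero hb
  add_mem' hu hv := hu.add hv
  smul_mem' c u hu := by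
    have h := (hu.smul (f := fun _ => c.re) contMDiff_const).add
      ((hu.I_smul).smul (f := fun _ => c.im) contMDiff_const)
    have e : (c • u : ∀ p, E (b p)) = fun p => c.re • u p + c.im • Complex.I • u p := by
      funext p
      conv_lhs => rw [← Complex.re_add_im c]
      simp only [Pi.smul_apply, add_smul, mul_smul, Complex.coe_smul]
    rw [e]
    exact h

/-- The smooth sections along `b` whose support is a compact subset of `U`, i.e.
`C_c^∞(U; b^*E)`, extended by zero. -/
def compactSections (b : X → B) (hb : ContMDiff J IB ∞ b) (U : Set X) :
    Submodule ℂ (∀ p, E (b p)) where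
  carrier := {u | u ∈ smoothSections IB F E J b hb ∧
    ∃ K : Set X, IsCompact K ∧ K ⊆ U ∧ ∀ p, p ∉ K → u p = 0}
  zero_mem' := ⟨Submodule.zero_mem _, ∅, isCompact_empty, empty_subset _, fun _ _ => rfl⟩
  add_mem' := by
    rintro u v ⟨hu, K, hK, hKU, hK0⟩ ⟨hv, L, hL, hLU, hL0⟩
    refine ⟨Submodule.add_mem _ hu hv, K ∪ L, hK.union hL, union_subset hKU hLU, fun p hp => ?_⟩
    rw [Set.mem_union, not_or] at hp
    simp [hK0 p hp.1, hL0 p hp.2]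
  smul_mem' := by
    rintro c u ⟨hu, K, hK, hKU, hK0⟩
    exact ⟨Submodule.smul_mem _ c hu, K, hK, hKU, fun p hp => by simp [hK0 p hp]⟩

end Sections

/-- The `L²` pairing `∫ ⟨u, v⟩ dμ` of sections of a Hermitian bundle, linear in `u` and
conjugate-linear in `v`. -/
def l2Pairing {X : Type*} [MeasurableSpace X] {W : X → Type*} [∀ p, NormedAddCommGroup (W p)]
    [∀ p, InnerProductSpace ℂ (W p)] (μ : Measure X) (u v : ∀ p, W p) : ℂ :=
  ∫ p, inner ℂ (v p) (u p) ∂μ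

/-! ### Densities -/

/-- `μ` is (integration against) a smooth positive density: in each chart it is a smooth positive
function, up to the boundary, times Lebesgue measure. -/
def IsSmoothPositiveDensity {n : ℕ} {H X : Type*} [TopologicalSpace H]
    (J : ModelWithCorners ℝ (EuclideanSpace ℝ (Fin n)) H) [TopologicalSpace X] [ChartedSpace H X]
    [MeasurableSpace X] (μ : Measure X) : Prop :=
  ∀ p : X, ∃ w : EuclideanSpace ℝ (Fin n) → ℝ,
    ContDiffOn ℝ ∞ w (extChartAt J p).target ∧ (∀ v ∈ (extChartAt J p).target, 0 < w v) ∧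
    (μ.restrict (extChartAt J p).source).map (extChartAt J p) =
      (volume.restrict (extChartAt J p).target).withDensity (fun v => ENNReal.ofReal (w v))

/-- The measure `x² 𝔪_b`, where `𝔪_b = x⁻¹ 𝔪`. Its `L²` space is `x⁻¹ L²_b`. -/
def wedgeMeasure {X : Type*} [MeasurableSpace X] (μ : Measure X) (x : X → ℝ) : Measure X :=
  (μ.withDensity (fun p => ENNReal.ofReal (x p)⁻¹)).withDensity
    (fun p => ENNReal.ofReal ((x p) ^ 2))

/-! ### Compact manifolds with fibred boundary -/

/-- A manifold `M` with boundary `N` (included by `incl`), a fibration `proj : N → Y` (as `N` will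
be compact, this is a surjective submersion), and a boundary defining function `x`. The dimensions
of the fibres, of `Y`, of `N` and of `M` are `k`, `q`, `k + q` and `k + q + 1`. -/
structure FiberedBoundary (k q : ℕ) (M N Y : Type*)
    [TopologicalSpace M] [ChartedSpace (EuclideanHalfSpace (k + q + 1)) M]
    [TopologicalSpace N] [ChartedSpace (EuclideanSpace ℝ (Fin (k + q))) N]
    [TopologicalSpace Y] [ChartedSpace (EuclideanSpace ℝ (Fin q)) Y] where
  incl : N → M
  isSmoothEmbedding_incl :
    Manifold.IsSmoothEmbedding (𝓡 (k + q)) (𝓡∂ (k + q + 1)) ∞ incl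
  range_incl : range incl = (𝓡∂ (k + q + 1)).boundary M
  proj : N → Y
  isSubmersion_proj : Manifold.IsSubmersion (𝓡 (k + q)) (𝓡 q) ∞ proj
  surjective_proj : Function.Surjective proj
  x : M → ℝ
  contMDiff_x : ContMDiff (𝓡∂ (k + q + 1)) 𝓘(ℝ, ℝ) ∞ x
  x_nonneg : ∀ p, 0 ≤ x p
  x_eq_zero_iff : ∀ p, x p = 0 ↔ p ∈ (𝓡∂ (k + q + 1)).boundary M
  mfderiv_x_ne_zero : ∀ z, mfderiv (𝓡∂ (k + q + 1)) 𝓘(ℝ, ℝ) x (incl z) ≠ 0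


section Geometry

variable {k q : ℕ} {M N Y : Type*}
  [TopologicalSpace M] [ChartedSpace (EuclideanHalfSpace (k + q + 1)) M]
  [TopologicalSpace N] [ChartedSpace (EuclideanSpace ℝ (Fin (k + q))) N]
  [TopologicalSpace Y] [ChartedSpace (EuclideanSpace ℝ (Fin q)) Y]

theorem FiberedBoundary.contMDiff_incl (G : FiberedBoundary k q M N Y) :
    ContMDiff (𝓡 (k + q)) (𝓡∂ (k + q + 1)) ∞ G.incl :=
  G.isSmoothEmbedding_incl.contMDiff

/-- `Z` (via `incl`) is the fibre `𝒵_y` of the boundary fibration over `y`, as a manifold. -/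
structure FiberModel (G : FiberedBoundary k q M N Y) (y : Y) (Z : Type*) [TopologicalSpace Z]
    [ChartedSpace (EuclideanSpace ℝ (Fin k)) Z] where
  incl : Z → N
  isSmoothEmbedding_incl : Manifold.IsSmoothEmbedding (𝓡 k) (𝓡 (k + q)) ∞ incl
  range_incl : range incl = G.proj ⁻¹' {y}

section

variable {G : FiberedBoundary k q M N Y} {y : Y} {Z : Type*} [TopologicalSpace Z]
    [ChartedSpace (EuclideanSpace ℝ (Fin k)) Z]

/-- The inclusion of the fibre `𝒵_y` into `M`. -/
def FiberModel.inclM (j : FiberModel G y Z) (z : Z) : M := G.incl (j.incl z)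

theorem FiberModel.contMDiff_inclM (j : FiberModel G y Z) :
    ContMDiff (𝓡 k) (𝓡∂ (k + q + 1)) ∞ j.inclM :=
  G.contMDiff_incl.comp j.isSmoothEmbedding_incl.contMDiff

end

/-- `μN` is the density induced on the boundary, `𝔪 = |dx| ⊗ μN` along `N`: it is the density at
`0` of the push-forward of `𝔪` by `x`. This determines the finite measure `μN`. -/
def IsBoundaryDensity [MeasurableSpace M] [MeasurableSpace N] (G : FiberedBoundary k q M N Y)
    (μ : Measure M) (μN : Measure N) : Prop :=
  ∀ f : M → ℝ, Continuous f →
    Tendsto (fun ε : ℝ => ε⁻¹ * ∫ p in {p | G.x p < ε}, f p ∂μ) (𝓝[>] 0)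
      (𝓝 (∫ z, f (G.incl z) ∂μN))

/-- `μZ` is the density induced on the fibre over `y`, `μN = μZ ⊗ μY` along `𝒵_y`: it is the
Radon-Nikodym derivative at `y` of the push-forward of `μN` by `proj` with respect to `μY`. This
determines the finite measure `μZ`; another choice of `μY` only changes it by a constant. -/
def IsFiberDensity {G : FiberedBoundary k q M N Y} {y : Y} {Z : Type*} [TopologicalSpace Z]
    [ChartedSpace (EuclideanSpace ℝ (Fin k)) Z] [MeasurableSpace N] [MeasurableSpace Y]
    [MeasurableSpace Z] (j : FiberModel G y Z) (μN : Measure N) (μY : Measure Y)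
    (μZ : Measure Z) : Prop :=
  ∀ f : N → ℝ, Continuous f →
    Tendsto (fun B : Set Y => (μY B).toReal⁻¹ * ∫ z in G.proj ⁻¹' B, f z ∂μN)
      ((𝓝 y).smallSets ⊓ 𝓟 {B | IsOpen B ∧ y ∈ B}) (𝓝 (∫ z, f (j.incl z) ∂μZ))

/-! ### Edge vector fields and the wedge cotangent bundle -/

variable [IsManifold (𝓡∂ (k + q + 1)) ∞ M]

/-- Smooth vector fields on `M`. -/
def IsSmoothVectorField (V : ∀ p : M, TangentSpace (𝓡∂ (k + q + 1)) p) : Prop :=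
  ContMDiff (𝓡∂ (k + q + 1)) (𝓡∂ (k + q + 1)).tangent ∞
    (fun p => (⟨p, V p⟩ : TangentBundle (𝓡∂ (k + q + 1)) M))

/-- Smooth vector fields on `M` that along the boundary are tangent to the fibres of `proj`. -/
def IsEdgeVectorField (G : FiberedBoundary k q M N Y)
    (V : ∀ p : M, TangentSpace (𝓡∂ (k + q + 1)) p) : Prop :=
  IsSmoothVectorField V ∧ ∀ z : N, ∃ w : TangentSpace (𝓡 (k + q)) z,
    mfderiv (𝓡 (k + q)) (𝓡 q) G.proj z w = 0 ∧
    mfderiv (𝓡 (k + q)) (𝓡∂ (k + q + 1)) G.incl z w = V (G.incl z)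

/-- The derivative `V f` of a function along a vector field. -/
def derivAlong (V : ∀ p : M, TangentSpace (𝓡∂ (k + q + 1)) p) (f : M → ℝ) (p : M) : ℝ :=
  mfderiv (𝓡∂ (k + q + 1)) 𝓘(ℝ, ℝ) f p (V p)

/-- The space of smooth sections of the wedge cotangent bundle: the smooth (real) `1`-forms on `M`
which along the boundary are conormal to the fibres of `proj`. -/
def wedgeForms (G : FiberedBoundary k q M N Y) :
    Submodule ℝ (∀ p : M, TangentSpace (𝓡∂ (k + q + 1)) p →L[ℝ] ℝ) where
  carrier := {φ | (∀ V, IsSmoothVectorField V →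
      ContMDiff (𝓡∂ (k + q + 1)) 𝓘(ℝ, ℝ) ∞ (fun p => (φ p (V p) : ℝ))) ∧
    ∀ (z : N) (w : TangentSpace (𝓡 (k + q)) z), mfderiv (𝓡 (k + q)) (𝓡 q) G.proj z w = 0 →
      φ (G.incl z) (mfderiv (𝓡 (k + q)) (𝓡∂ (k + q + 1)) G.incl z w) = 0}
  zero_mem' := ⟨fun _ _ => contMDiff_const, fun _ _ _ => rfl⟩
  add_mem' := by
    rintro φ ψ ⟨h1, h2⟩ ⟨h3, h4⟩
    refine ⟨fun V hV => (h1 V hV).add (h3 V hV), fun z w hw => ?_⟩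
    have e1 := h2 z w hw
    have e2 := h4 z w hw
    simp only [Pi.add_apply, add_apply, e1, e2, add_zero]
  smul_mem' := by
    rintro c φ ⟨h1, h2⟩
    refine ⟨fun V hV => (contMDiff_const (c := c)).mul (h1 V hV), fun z w hw => ?_⟩
    have e1 := h2 z w hw
    simp only [Pi.smul_apply, smul_apply, e1, smul_zero]

/-- `I_p 𝒞`, where `𝒞` is the module of wedge `1`-forms and `I_p` the ideal of smooth functions
vanishing at `p`. -/
def vanishingForms (G : FiberedBoundary k q M N Y) (p : M) :
    Submodule ℝ (∀ p : M, TangentSpace (𝓡∂ (k + q + 1)) p →L[ℝ] ℝ) :=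
  Submodule.span ℝ {φ | ∃ (h : M → ℝ), ∃ ψ ∈ wedgeForms G,
    ContMDiff (𝓡∂ (k + q + 1)) 𝓘(ℝ, ℝ) ∞ h ∧ h p = 0 ∧ ∀ p', φ p' = h p' • ψ p'}

/-- Two sections of the wedge cotangent bundle agree at `p`: they differ by an element of `I_p 𝒞`. -/
def wedgeSetoid (G : FiberedBoundary k q M N Y) (p : M) : Setoid (wedgeForms G) where
  r φ ψ := φ.1 - ψ.1 ∈ vanishingForms G p
  iseqv :=
    { refl := fun φ => by rw [sub_self]; exact Submodule.zero_mem _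
      symm := fun {φ ψ} h => by rw [← neg_sub]; exact Submodule.neg_mem _ h
      trans := fun {φ ψ χ} h h' => by
        rw [← sub_add_sub_cancel φ.1 ψ.1 χ.1]; exact Submodule.add_mem _ h h' }

/-- The fibre `𝒞 / I_p 𝒞` at `p` of the wedge cotangent bundle, that is, of the vector bundle whose
module of smooth sections is `𝒞 = wedgeForms G`. -/
def WedgeCotangent (G : FiberedBoundary k q M N Y) (p : M) : Type _ :=
  Quotient (wedgeSetoid G p)

/-- The value at `p` of a section of the wedge cotangent bundle. -/
def wedgeValue (G : FiberedBoundary k q M N Y) (p : M) (φ : wedgeForms G) : WedgeCotangent G p :=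
  Quotient.mk (wedgeSetoid G p) φ

/-- The ring `ℛ` of smooth functions on `M` whose restriction to the boundary is the pull-back of a
smooth function on `Y`. -/
def IsBasic (G : FiberedBoundary k q M N Y) (f : M → ℝ) : Prop :=
  ContMDiff (𝓡∂ (k + q + 1)) 𝓘(ℝ, ℝ) ∞ f ∧
    ∃ g : Y → ℝ, ContMDiff (𝓡 q) 𝓘(ℝ, ℝ) ∞ g ∧ ∀ z, f (G.incl z) = g (G.proj z)

/-! ### Edge differential operators -/

section Operators

variable (G : FiberedBoundary k q M N Y)
  (F : Type*) [NormedAddCommGroup F] [NormedSpace ℝ F] (E : M → Type*)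
  [TopologicalSpace (TotalSpace F E)] [∀ p, NormedAddCommGroup (E p)]
  [∀ p, InnerProductSpace ℂ (E p)] [FiberBundle F E] [VectorBundle ℝ F E]
  [ContMDiffVectorBundle ∞ F E (𝓡∂ (k + q + 1))]
  [SmoothHermitianBundle (𝓡∂ (k + q + 1)) F E]

/-- `C^∞(M; E)`. -/
abbrev Sec (k q : ℕ) {M : Type*} [TopologicalSpace M]
    [ChartedSpace (EuclideanHalfSpace (k + q + 1)) M]
    (F : Type*) [NormedAddCommGroup F] [NormedSpace ℝ F] (E : M → Type*)
    [TopologicalSpace (TotalSpace F E)] [∀ p, NormedAddCommGroup (E p)]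
    [∀ p, InnerProductSpace ℂ (E p)] [FiberBundle F E] [VectorBundle ℝ F E]
    [ContMDiffVectorBundle ∞ F E (𝓡∂ (k + q + 1))]
    [SmoothHermitianBundle (𝓡∂ (k + q + 1)) F E] : Submodule ℂ (∀ p, E p) :=
  smoothSections (𝓡∂ (k + q + 1)) F E (𝓡∂ (k + q + 1)) (fun p : M => p) contMDiff_id

/-- `C_c^∞(int M; E)`. -/
abbrev TestSec (k q : ℕ) {M : Type*} [TopologicalSpace M]
    [ChartedSpace (EuclideanHalfSpace (k + q + 1)) M]
    (F : Type*) [NormedAddCommGroup F] [NormedSpace ℝ F] (E : M → Type*)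
    [TopologicalSpace (TotalSpace F E)] [∀ p, NormedAddCommGroup (E p)]
    [∀ p, InnerProductSpace ℂ (E p)] [FiberBundle F E] [VectorBundle ℝ F E]
    [ContMDiffVectorBundle ∞ F E (𝓡∂ (k + q + 1))]
    [SmoothHermitianBundle (𝓡∂ (k + q + 1)) F E] : Submodule ℂ (∀ p, E p) :=
  compactSections (𝓡∂ (k + q + 1)) F E (𝓡∂ (k + q + 1)) (fun p : M => p) contMDiff_id
    ((𝓡∂ (k + q + 1)).interior M)

variable {F E}

/-- Multiplication of a smooth section by a smooth real function. -/
def mulSec (f : M → ℝ) (hf : ContMDiff (𝓡∂ (k + q + 1)) 𝓘(ℝ, ℝ) ∞ f) (s : Sec k q F E) :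
    Sec k q F E :=
  ⟨fun p => f p • s.1 p, IsSmoothAlong.smul hf s.2⟩

variable (F E)

/-- The smooth bundle endomorphisms of `E`, as the `C^∞(M)`-linear operators on `C^∞(M; E)`. -/
def bundleEnd (k q : ℕ) {M : Type*} [TopologicalSpace M]
    [ChartedSpace (EuclideanHalfSpace (k + q + 1)) M]
    (F : Type*) [NormedAddCommGroup F] [NormedSpace ℝ F] (E : M → Type*)
    [TopologicalSpace (TotalSpace F E)] [∀ p, NormedAddCommGroup (E p)]
    [∀ p, InnerProductSpace ℂ (E p)] [FiberBundle F E] [VectorBundle ℝ F E]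
    [ContMDiffVectorBundle ∞ F E (𝓡∂ (k + q + 1))]
    [SmoothHermitianBundle (𝓡∂ (k + q + 1)) F E] : Set (Module.End ℂ (Sec k q F E)) :=
  {B | ∀ f hf s, B (mulSec f hf s) = mulSec f hf (B s)}

/-- The operators `∇_V + B` with `V` an edge vector field, `∇` a connection on `E` and `B` a bundle
endomorphism: the operators `D` with `D (f s) = (V f) s + f D s`. -/
def edgeDerivations : Set (Module.End ℂ (Sec k q F E)) :=
  {D | ∃ V : ∀ p : M, TangentSpace (𝓡∂ (k + q + 1)) p, IsEdgeVectorField G V ∧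
    ∀ f hf s p, (D (mulSec f hf s)).1 p =
      derivAlong V f p • s.1 p + f p • (D s).1 p}

/-- `Diff_e^m(M; E)`: the sums of operators `B D₁ ⋯ D_m` with `B` a bundle endomorphism and each
`D_i` of the form `∇_V + B_i` with `V` an edge vector field. As `D_i = 1` is allowed, operators of
lower order are included. -/
def edgeDiffOps (m : ℕ) : Submodule ℂ (Module.End ℂ (Sec k q F E)) :=
  Submodule.span ℂ (bundleEnd k q F E) * (Submodule.span ℂ (edgeDerivations G F E)) ^ m

variable {F E}

open Classical in
/-- `P u`, for a section `u` not bundled with the proof of its smoothness. -/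
def applyOp (P : Module.End ℂ (Sec k q F E)) (u : ∀ p, E p) : ∀ p, E p :=
  if h : u ∈ Sec k q F E then (P ⟨u, h⟩).1 else 0

/-- The wedge operator `A = x⁻² P` (over the interior of `M`). -/
def wedgeOp (P : Module.End ℂ (Sec k q F E)) (u : ∀ p, E p) : ∀ p, E p :=
  fun p => ((G.x p) ^ 2)⁻¹ • applyOp P u p

/-! ### The three symbols -/

/-- `S` is the wedge-principal symbol of `A = x⁻² P`, a function on the wedge cotangent bundle with
values in the endomorphisms of `E`. Over the interior, `S(df) ψ = lim ρ⁻² e^{-iρf} A (e^{iρf} ψ)` for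
`f` in the ring `ℛ`, and `S` is smooth up to the boundary; this determines `S`. -/
def IsWedgeSymbol (P : Module.End ℂ (Sec k q F E))
    (S : ∀ p : M, WedgeCotangent G p → (E p →ₗ[ℂ] E p)) : Prop :=
  (∀ (f : M → ℝ) (φ : wedgeForms G), IsBasic G f →
    (∀ p v, φ.1 p v = mfderiv (𝓡∂ (k + q + 1)) 𝓘(ℝ, ℝ) f p v) →
    ∀ ψ ∈ TestSec k q F E, ∀ p ∈ (𝓡∂ (k + q + 1)).interior M,
      Tendsto (fun ρ : ℝ => (ρ ^ 2)⁻¹ • Complex.exp (-(Complex.I * ρ * f p)) •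
          wedgeOp G P (fun p' => Complex.exp (Complex.I * ρ * f p') • ψ p') p)
        atTop (𝓝 (S p (wedgeValue G p φ) (ψ p)))) ∧
  ∀ (φ : wedgeForms G), ∀ ψ ∈ Sec k q F E,
    (fun p => S p (wedgeValue G p φ) (ψ p)) ∈ Sec k q F E

variable {G} in
/-- `C^∞(𝒵_y; E)`. -/
abbrev FiberSec {y : Y} {Z : Type*} [TopologicalSpace Z]
    [ChartedSpace (EuclideanSpace ℝ (Fin k)) Z] (F : Type*) [NormedAddCommGroup F]
    [NormedSpace ℝ F] (E : M → Type*) [TopologicalSpace (TotalSpace F E)]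
    [∀ p, NormedAddCommGroup (E p)] [∀ p, InnerProductSpace ℂ (E p)] [FiberBundle F E]
    [VectorBundle ℝ F E] [ContMDiffVectorBundle ∞ F E (𝓡∂ (k + q + 1))]
    [SmoothHermitianBundle (𝓡∂ (k + q + 1)) F E] (j : FiberModel G y Z) :
    Submodule ℂ (∀ z, E (j.inclM z)) :=
  smoothSections (𝓡∂ (k + q + 1)) F E (𝓡 k) j.inclM j.contMDiff_inclM

variable {G} in
/-- `L` is the indicial operator `^bP̂(y, σ)` on the fibre `𝒵_y`: the restriction to `𝒵_y` of the
edge operator `Q = x^{-iσ} P x^{iσ}` on `C^∞(M; E)`. -/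
def IsIndicialOperator (P : Module.End ℂ (Sec k q F E)) {y : Y} {Z : Type*} [TopologicalSpace Z]
    [ChartedSpace (EuclideanSpace ℝ (Fin k)) Z] (j : FiberModel G y Z) (σ : ℂ)
    (L : Module.End ℂ (FiberSec F E j)) : Prop :=
  ∃ Q ∈ edgeDiffOps G F E 2,
    (∀ u ∈ TestSec k q F E, ∀ p ∈ (𝓡∂ (k + q + 1)).interior M,
      applyOp Q u p = ((G.x p : ℂ) ^ (-(Complex.I * σ))) •
        applyOp P (fun p' => ((G.x p' : ℂ) ^ (Complex.I * σ)) • u p') p) ∧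
    ∀ (U : Sec k q F E) (u : FiberSec F E j), (∀ z, u.1 z = U.1 (j.inclM z)) →
      ∀ z, (L u).1 z = (Q U).1 (j.inclM z)

/-! ### The normal family -/

/-- `C_c^∞(N × (0, ∞); E^∧)`, where `N^∧ = N × [0, ∞)` is the inward pointing normal bundle,
trivialized by `dx`, and `E^∧` is the lift of `E|_N`. -/
abbrev NormalTestSec (F : Type*) [NormedAddCommGroup F] [NormedSpace ℝ F] (E : M → Type*)
    [TopologicalSpace (TotalSpace F E)] [∀ p, NormedAddCommGroup (E p)]
    [∀ p, InnerProductSpace ℂ (E p)] [FiberBundle F E] [VectorBundle ℝ F E]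
    [ContMDiffVectorBundle ∞ F E (𝓡∂ (k + q + 1))]
    [SmoothHermitianBundle (𝓡∂ (k + q + 1)) F E] (T : Set ℝ) :
    Submodule ℂ (∀ n : N × ℝ, E (G.incl n.1)) :=
  compactSections (𝓡∂ (k + q + 1)) F E ((𝓡 (k + q)).prod 𝓘(ℝ, ℝ))
    (fun n : N × ℝ => G.incl n.1) (G.contMDiff_incl.comp contMDiff_fst) (univ ×ˢ T)

variable {G} in
/-- `C_c^∞(𝒵_y × (0, ∞); E)`, sections over the interior of `𝒵_y^∧ = 𝒵_y × [0, ∞)`. -/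
abbrev FiberTestSec {y : Y} {Z : Type*} [TopologicalSpace Z]
    [ChartedSpace (EuclideanSpace ℝ (Fin k)) Z] (F : Type*) [NormedAddCommGroup F]
    [NormedSpace ℝ F] (E : M → Type*) [TopologicalSpace (TotalSpace F E)]
    [∀ p, NormedAddCommGroup (E p)] [∀ p, InnerProductSpace ℂ (E p)] [FiberBundle F E]
    [VectorBundle ℝ F E] [ContMDiffVectorBundle ∞ F E (𝓡∂ (k + q + 1))]
    [SmoothHermitianBundle (𝓡∂ (k + q + 1)) F E] (j : FiberModel G y Z) :
    Submodule ℂ (∀ n : Z × ℝ, E (j.inclM n.1)) :=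
  compactSections (𝓡∂ (k + q + 1)) F E ((𝓡 k).prod 𝓘(ℝ, ℝ))
    (fun n : Z × ℝ => j.inclM n.1) (j.contMDiff_inclM.comp contMDiff_fst) (univ ×ˢ Ioi 0)

/-- The measure `x² 𝔪_b^∧ = x² (dx / x) ⊗ μ` on `X × (0, ∞)`, whose `L²` space is `x⁻¹ L²_b`. -/
def cylinderMeasure {X : Type*} [MeasurableSpace X] (μ : Measure X) : Measure (X × ℝ) :=
  wedgeMeasure (μ.prod (volume.restrict (Ioi (0 : ℝ)))) Prod.snd

open Classical in
/-- The push-forward `Φ_* u`, where `Φ` maps part of `N × [0, ∞)` to `M` and `T z p` maps the fibre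
`E_z` of `E^∧` to `E_p`, for `p` on the image of the ray over `z`. -/
def pushSec (Φ : PartialEquiv (N × ℝ) M) (T : ∀ (z : N) (p : M), E (G.incl z) ≃ₗ[ℂ] E p)
    (u : ∀ n : N × ℝ, E (G.incl n.1)) : ∀ p, E p :=
  fun p => if p ∈ Φ.target then T (Φ.symm p).1 p (u (Φ.symm p)) else 0

/-- The pull-back `Φ^*`, inverse to `Φ_*` on sections supported in the image of `Φ`. -/
def pullSec (Φ : PartialEquiv (N × ℝ) M) (T : ∀ (z : N) (p : M), E (G.incl z) ≃ₗ[ℂ] E p)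
    (w : ∀ p, E p) : ∀ n : N × ℝ, E (G.incl n.1) :=
  fun n => (T n.1 (Φ n)).symm (w (Φ n))

variable (F E) in
/-- Geometric data trivializing `M` and `E` near the boundary: a tubular neighbourhood map `Φ` from
`N × [0, ε)` onto a neighbourhood of the boundary which is the identity on `N` and tangent to the
identity on the normal bundle, and a smooth bundle isomorphism `T` from `E^∧` to `E` over `Φ`, the
identity over `N`, such that `Φ_*` is an isometry between the `x⁻¹ L²_b` spaces. -/
structure Collar [MeasurableSpace M] [MeasurableSpace N] (μ : Measure M) (μN : Measure N) where
  ε : ℝ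
  ε_pos : 0 < ε
  Φ : PartialEquiv (N × ℝ) M
  source_eq : Φ.source = univ ×ˢ Ico 0 ε
  isOpen_target : IsOpen Φ.target
  contMDiffOn_Φ : ContMDiffOn ((𝓡 (k + q)).prod 𝓘(ℝ, ℝ)) (𝓡∂ (k + q + 1)) ∞ Φ Φ.source
  contMDiffOn_symm :
    ContMDiffOn (𝓡∂ (k + q + 1)) ((𝓡 (k + q)).prod 𝓘(ℝ, ℝ)) ∞ Φ.symm Φ.target
  Φ_zero : ∀ z, Φ (z, 0) = G.incl z
  hasDerivWithinAt_x : ∀ z, HasDerivWithinAt (fun s => G.x (Φ (z, s))) 1 (Ici 0) 0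
  T : ∀ (z : N) (p : M), E (G.incl z) ≃ₗ[ℂ] E p
  T_incl : ∀ z, T z (G.incl z) = LinearEquiv.refl ℂ (E (G.incl z))
  contMDiffOn_T : ∀ u : ∀ n : N × ℝ, E (G.incl n.1),
    IsSmoothAlong (𝓡∂ (k + q + 1)) F E ((𝓡 (k + q)).prod 𝓘(ℝ, ℝ))
      (fun n : N × ℝ => G.incl n.1) u →
    ContMDiffOn ((𝓡 (k + q)).prod 𝓘(ℝ, ℝ)) ((𝓡∂ (k + q + 1)).prod 𝓘(ℝ, F)) ∞
      (fun n => TotalSpace.mk' F (Φ n) (T n.1 (Φ n) (u n))) Φ.source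
  isometry : ∀ u ∈ NormalTestSec G F E (Ioo 0 ε), ∀ v ∈ NormalTestSec G F E (Ioo 0 ε),
    l2Pairing (wedgeMeasure μ G.x) (pushSec G Φ T u) (pushSec G Φ T v) =
      l2Pairing (cylinderMeasure μN) u v

/-- The dilation `κ_ρ u (z, x) = ρ u (z, ρ x)`. -/
def dilate (ρ : ℝ) (u : ∀ n : N × ℝ, E (G.incl n.1)) : ∀ n : N × ℝ, E (G.incl n.1) :=
  fun n => ρ • u (n.1, ρ * n.2)

/-- Multiplication by `e^{iρg}`, `g` a function on `Y` pulled back to `N^∧`. -/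
def modulate (ρ : ℝ) (g : Y → ℝ) (u : ∀ n : N × ℝ, E (G.incl n.1)) :
    ∀ n : N × ℝ, E (G.incl n.1) :=
  fun n => Complex.exp (Complex.I * ρ * g (G.proj n.1)) • u n

variable {G} in
/-- `ρ⁻² κ_ρ⁻¹ e^{-iρg} Φ^* A Φ_* e^{iρg} κ_ρ u`, where `A = x⁻² P`. -/
def normalApprox [MeasurableSpace M] [MeasurableSpace N] {μ : Measure M} {μN : Measure N}
    (C : Collar G F E μ μN) (P : Module.End ℂ (Sec k q F E)) (g : Y → ℝ)
    (u : ∀ n : N × ℝ, E (G.incl n.1)) (ρ : ℝ) : ∀ n : N × ℝ, E (G.incl n.1) :=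
  fun n => (ρ ^ 2)⁻¹ • dilate G ρ⁻¹ (modulate G (-ρ) g (pullSec G C.Φ C.T
    (wedgeOp G P (pushSec G C.Φ C.T (modulate G ρ g (dilate G ρ u)))))) n

variable {G} in
/-- `L` is the value `A_∧(η)` at the covector `η ∈ T_y^*Y` of the normal family of `A = x⁻² P`, an
operator on sections over the interior of `𝒵_y^∧`: for every function `g` on `Y` with `dg = η` at `y`
and every extension `U` of `u` to `N^∧`, `A_∧(η) u` is the restriction to `𝒵_y^∧` of
`lim ρ⁻² κ_ρ⁻¹ e^{-iρg} Φ^* A Φ_* e^{iρg} κ_ρ U`. -/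
def IsNormalOperator [MeasurableSpace M] [MeasurableSpace N] {μ : Measure M} {μN : Measure N}
    (C : Collar G F E μ μN) (P : Module.End ℂ (Sec k q F E)) {y : Y} {Z : Type*}
    [TopologicalSpace Z] [ChartedSpace (EuclideanSpace ℝ (Fin k)) Z] (j : FiberModel G y Z)
    (η : TangentSpace (𝓡 q) y →L[ℝ] ℝ) (L : Module.End ℂ (FiberTestSec F E j)) : Prop :=
  ∀ g : Y → ℝ, ContMDiff (𝓡 q) 𝓘(ℝ, ℝ) ∞ g →
    (∀ w, mfderiv (𝓡 q) 𝓘(ℝ, ℝ) g y w = η w) →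
    ∀ U ∈ NormalTestSec G F E (Ioi 0), ∀ u : FiberTestSec F E j,
      (∀ n : Z × ℝ, u.1 n = U (j.incl n.1, n.2)) →
      ∀ (z : Z) (s : ℝ), 0 < s →
        Tendsto (fun ρ : ℝ => normalApprox C P g U ρ (j.incl z, s)) atTop (𝓝 ((L u).1 (z, s)))

end Operators

end Geometry

end Wedge

end

set_option linter.unusedSectionVars false

/-! Everything at the boundary rests on one computation. An edge vector field `V` annihilates, along
the boundary, every basic function, and a smooth function vanishing on the boundary is divisible by
`x`. Hence V x = x a and V g = x b with `a`, `b` smooth, for every basic `g`. Let a derivation `D`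
over `V` act on e^{iρg} W(p, ρx), where W is a section over M × ℝ supported in s₀ ≤ s ≤ s₁ with s₀ >
0. The result is e^{iρg} W₁(p, ρx) with W₁ = D W + a s ∂_s W + i b s W, in which ρ no longer occurs.
So `P` lifts to an operator on M × ℝ that is independent of ρ (`NormalForm.apply_scaled`).

On such sections the pairing of x⁻²P, taken in the measure x² 𝔪_b = x 𝔪, equals ρ ∫ κ(p, ρx) d𝔪 with
κ = s⁻¹⟨lift W, W'⟩. By the definition of the boundary density this tends, as ρ → ∞, to the integral
of κ over N × (0, ∞) (`tendsto_boundary`). Symmetry and nonnegativity hold for every ρ > 0, so they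
survive in the limit. Along the boundary the lift commutes with multiplication by functions pulled
back from Y; inserting such cutoffs and using the definition of the fibre density isolates a single
fibre (`fiber_symmetric`, `fiber_nonneg`).

For (c), the collar turns a modulated and dilated section, for large ρ, into ρ times a section of
the above form, where `g` has differential η at `y`; thus A_∧(η) is s⁻² times the lift restricted to
the fibre. For (b), take g = 0 and pair W = s^{iσ} s β(s) U with W' = s^{iσ̄} φ(s) V, where φ = 1
near supp β. Apart from the indicial operator, the terms are total derivatives in s on one side and
vanish on the other, and what remains is (b) multiplied by ∫ β > 0.

For (a), conjugation by e^{iρf} makes `P` a quadratic polynomial in ρ whose leading coefficient is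
x² times the symbol. The symbol is minus a sum of products of two slopes φ(V)/x with a bundle
endomorphism, hence smooth up to the boundary. Testing on e^{iρf} χ u and dividing by ρ² shows that
its quadratic form is real and nonnegative over the interior; continuity and density of the interior
give the boundary points. -/

noncomputable section

namespace Wedge

/-! ### Bump functions on compact manifolds -/

section Bumps

variable {X EX HX : Type*} [NormedAddCommGroup EX] [NormedSpace ℝ EX] [FiniteDimensional ℝ EX]
  [TopologicalSpace HX] (J : ModelWithCorners ℝ EX HX) [TopologicalSpace X] [ChartedSpace HX X]
  [IsManifold J ∞ X]

/-- A finite family of bump functions on a compact manifold, subordinate to a family of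
neighbourhoods, without common zeros. -/
theorem exists_finset_bumps [T2Space X] [CompactSpace X] (U : X → Set X) (hU : ∀ p, U p ∈ 𝓝 p) :
    ∃ (t : Finset X) (ψ : X → X → ℝ), (∀ p, ContMDiff J 𝓘(ℝ, ℝ) ∞ (ψ p)) ∧
      (∀ p, tsupport (ψ p) ⊆ U p) ∧ ∀ x, 0 < ∑ p ∈ t, ψ p x ^ 2 := by
  have h : ∀ p, ∃ f : SmoothBumpFunction J p, tsupport f ⊆ U p := fun p => by
    obtain ⟨f, -, hf⟩ := (SmoothBumpFunction.nhds_basis_tsupport (I := J) p).mem_iff.1 (hU p)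
    exact ⟨f, hf⟩
  choose f hf using h
  obtain ⟨t, ht⟩ := CompactSpace.elim_nhds_subcover (fun p => Function.support (f p))
    (fun p => (f p).support_mem_nhds)
  refine ⟨t, fun p => f p, fun p => (f p).contMDiff, hf, fun x => ?_⟩
  have hx : x ∈ ⋃ p ∈ t, Function.support (f p) := by rw [ht]; trivial
  simp only [mem_iUnion, exists_prop] at hx
  obtain ⟨p, hp, hpx⟩ := hx
  exact Finset.sum_pos' (fun _ _ => sq_nonneg _) ⟨p, hp, by
    have : f p x ≠ 0 := hpx
    positivity⟩

end Bumps

/-! ### Finite global frames of a vector bundle -/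

section Frame

variable {B EB HB : Type*} [NormedAddCommGroup EB] [NormedSpace ℝ EB]
  [TopologicalSpace HB] (IB : ModelWithCorners ℝ EB HB) [TopologicalSpace B] [ChartedSpace HB B]
  (F : Type*) [NormedAddCommGroup F] [NormedSpace ℝ F] (E : B → Type*)
  [TopologicalSpace (TotalSpace F E)] [∀ p, NormedAddCommGroup (E p)]
  [∀ p, InnerProductSpace ℂ (E p)] [FiberBundle F E]

/-- A finite family of global smooth sections spanning `E`, with smooth coefficient functionals. -/
structure GlobalFrame where
  ι : Type
  fintype : Fintype ι
  e : ι → ∀ p, E p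
  coeff : ι → ∀ p, E p →ₗ[ℝ] ℝ
  smooth_e : ∀ i, IsSmoothAlong IB F E IB (fun p => p) (e i)
  smooth_coeff : ∀ i, ContMDiff (IB.prod 𝓘(ℝ, F)) 𝓘(ℝ, ℝ) ∞
    (fun v : TotalSpace F E => coeff i v.proj v.snd)
  sum_coeff : ∀ p (v : E p), ∑ i, coeff i p v • e i p = v

attribute [instance] GlobalFrame.fintype

/-- Local frames are extended by zero with bump functions and put side by side. The sections are not
linearly independent; only the reconstruction identity holds, and it suffices to reduce questions on
sections to real-valued coefficient functions. -/
theorem nonempty_globalFrame [FiniteDimensional ℝ EB] [IsManifold IB ∞ B] [T2Space B]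
    [CompactSpace B] [FiniteDimensional ℝ F] [VectorBundle ℝ F E] [ContMDiffVectorBundle ∞ F E IB] :
    Nonempty (GlobalFrame IB F E) := by
  obtain ⟨t, ψ, hψ, hψU, hpos⟩ := exists_finset_bumps IB
    (fun p : B => (trivializationAt F E p).baseSet)
    (fun p => (trivializationAt F E p).open_baseSet.mem_nhds
      (FiberBundle.mem_baseSet_trivializationAt F E p))
  let b := Module.finBasis ℝ F
  have hS : ContMDiff IB 𝓘(ℝ, ℝ) ∞ (fun x => ∑ p ∈ t, ψ p x ^ 2) :=
    contMDiff_finsetSum fun p _ => (hψ p).pow 2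
  -- One factor `ψ` extends the local frame by zero and the weight `w` extends the local
  -- coordinates; the normalization makes ∑ w ψ = 1.
  let w : B → B → ℝ := fun p x => ψ p x * (∑ p ∈ t, ψ p x ^ 2)⁻¹
  have hw : ∀ p, ContMDiff IB 𝓘(ℝ, ℝ) ∞ (w p) := fun p =>
    (hψ p).mul (hS.inv₀ fun x => (hpos x).ne')
  have hwt : ∀ p, tsupport (w p) ⊆ (trivializationAt F E p).baseSet := fun p =>
    (tsupport_mul_subset_left).trans (hψU p)
  refine ⟨⟨Fin t.card × Fin (Module.finrank ℝ F), inferInstance,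
    fun i p => ψ (t.equivFin.symm i.1) p •
      (trivializationAt F E (t.equivFin.symm i.1 : B)).localFrame b i.2 p,
    fun i p => w (t.equivFin.symm i.1) p • ((b.coord i.2).comp
      ((trivializationAt F E (t.equivFin.symm i.1 : B)).linearMapAt ℝ p)), ?_, ?_, ?_⟩⟩
  · intro i
    exact ContMDiffOn.smul_section_of_tsupport (hψ _).contMDiffOn
      (trivializationAt F E (t.equivFin.symm i.1 : B)).open_baseSet (hψU _)
      (Bundle.Trivialization.contMDiffOn_localFrame_baseSet _ _ b i.2)
  · intro i
    set a : B := (t.equivFin.symm i.1 : t).1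
    set T := trivializationAt F E a
    refine contMDiff_of_tsupport fun v hv => ?_
    have hvT : v.proj ∈ T.baseSet := by
      have h1 : tsupport (fun v : TotalSpace F E => w a v.proj •
          ((b.coord i.2).comp (T.linearMapAt ℝ v.proj)) v.snd) ⊆
          TotalSpace.proj ⁻¹' tsupport (w a) := by
        refine closure_minimal (fun u hu => subset_closure ?_)
          ((isClosed_tsupport _).preimage (FiberBundle.continuous_proj F E))
        intro h0
        exact hu (by simp [h0])
      exact hwt a (h1 hv)
    have hT : ContMDiffAt (IB.prod 𝓘(ℝ, F)) (IB.prod 𝓘(ℝ, F)) ∞ T v :=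
      (T.contMDiffOn (IB := IB) (n := ∞) v (T.mem_source.2 hvT)).contMDiffAt
        (T.open_source.mem_nhds (T.mem_source.2 hvT))
    have hT2 : ContMDiffAt (IB.prod 𝓘(ℝ, F)) 𝓘(ℝ, ℝ) ∞
        (fun u : TotalSpace F E => (LinearMap.toContinuousLinearMap (b.coord i.2)) (T u).2) v :=
      ((LinearMap.toContinuousLinearMap (b.coord i.2)).contMDiff.contMDiffAt).comp v hT.snd
    refine (((hw a).contMDiffAt.comp v (contMDiffAt_proj E)).mul hT2).congr_of_eventuallyEq ?_
    filter_upwards [T.open_source.mem_nhds (T.mem_source.2 hvT)] with u hu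
    have hu' := T.mem_source.1 hu
    have h1 : (trivializationAt F E a).linearMapAt ℝ u.proj u.snd = (T u).2 := by
      rw [Trivialization.linearMapAt_apply, if_pos hu']
    simp [h1]
  · intro p v
    rw [Fintype.sum_prod_type]
    have key : ∀ a : B, ∑ i, (w a p • ((b.coord i).comp
        ((trivializationAt F E a).linearMapAt ℝ p))) v • ψ a p •
        (trivializationAt F E a).localFrame b i p = (w a p * ψ a p) • v := by
      intro a
      by_cases hp : p ∈ (trivializationAt F E a).baseSet
      · have h1 : ∑ i, b.repr (((trivializationAt F E a).linearMapAt ℝ p) v) i •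
            (trivializationAt F E a).localFrame b i p = v := by
          have h2 := (((trivializationAt F E a).basisAt b hp).sum_repr v)
          conv_rhs => rw [← h2]
          refine Finset.sum_congr rfl fun i _ => ?_
          rw [Trivialization.localFrame_apply_of_mem_baseSet _ _ hp]
          simp [Trivialization.basisAt, Trivialization.linearMapAt_apply, hp]
        conv_rhs => rw [← h1]
        rw [Finset.smul_sum]
        refine Finset.sum_congr rfl fun i _ => ?_
        simp only [LinearMap.smul_apply, LinearMap.comp_apply, Module.Basis.coord_apply, smul_smul,
          smul_eq_mul]
        congr 1; ring
      · have h0 : ψ a p = 0 := by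
          by_contra h
          exact hp (hψU a (subset_closure h))
        simp [h0]
    simp only [key]
    rw [← Finset.sum_smul]
    have : ∑ x : Fin t.card, w (t.equivFin.symm x) p * ψ (t.equivFin.symm x) p = 1 := by
      rw [t.equivFin.symm.sum_comp (fun a : t => w a p * ψ a p)]
      rw [Finset.sum_coe_sort t (fun a => w a p * ψ a p)]
      have : ∀ a, w a p * ψ a p = ψ a p ^ 2 * (∑ p' ∈ t, ψ p' p ^ 2)⁻¹ := fun a => by
        simp only [w]; ring
      simp only [this]
      rw [← Finset.sum_mul, mul_inv_cancel₀ (hpos p).ne']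
    rw [this, one_smul]

end Frame

/-! ### Smooth sections along a map -/

section Along

variable {B EB HB : Type*} [NormedAddCommGroup EB] [NormedSpace ℝ EB]
  [TopologicalSpace HB] {IB : ModelWithCorners ℝ EB HB} [TopologicalSpace B] [ChartedSpace HB B]
  {F : Type*} [NormedAddCommGroup F] [NormedSpace ℝ F] {E : B → Type*}
  [TopologicalSpace (TotalSpace F E)] [∀ p, NormedAddCommGroup (E p)]
  [∀ p, InnerProductSpace ℂ (E p)] [FiberBundle F E]
  {X EX HX : Type*} [NormedAddCommGroup EX] [NormedSpace ℝ EX]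
  [TopologicalSpace HX] {J : ModelWithCorners ℝ EX HX} [TopologicalSpace X] [ChartedSpace HX X]

theorem GlobalFrame.smooth_coeff_along (Φ : GlobalFrame IB F E) (i : Φ.ι) {b : X → B}
    {u : ∀ p, E (b p)} (hu : IsSmoothAlong IB F E J b u) :
    ContMDiff J 𝓘(ℝ, ℝ) ∞ (fun p => Φ.coeff i (b p) (u p)) :=
  (Φ.smooth_coeff i).comp hu

theorem IsSmoothAlong.comp_map {u : ∀ p, E p} (hu : IsSmoothAlong IB F E IB (fun p => p) u)
    {b : X → B} (hb : ContMDiff J IB ∞ b) : IsSmoothAlong IB F E J b (fun p => u (b p)) := by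
  have h : ContMDiff IB (IB.prod 𝓘(ℝ, F)) ∞ (fun p => TotalSpace.mk' F p (u p)) := hu
  exact h.comp hb

section VB
variable [VectorBundle ℝ F E] [ContMDiffVectorBundle ∞ F E IB]

theorem IsSmoothAlong.sum {ι : Type*} (t : Finset ι) {b : X → B} (hb : ContMDiff J IB ∞ b)
    {u : ι → ∀ p, E (b p)} (hu : ∀ i ∈ t, IsSmoothAlong IB F E J b (u i)) :
    IsSmoothAlong IB F E J b (fun p => ∑ i ∈ t, u i p) := by
  classical
  induction t using Finset.induction_on with
  | empty => simpa using show IsSmoothAlong IB F E J b (fun _ => 0) from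
      IsSmoothAlong.zero (F := F) (E := E) hb
  | insert a s ha ih =>
    simp only [Finset.sum_insert ha]
    exact (hu a (Finset.mem_insert_self a s)).add
      (ih fun i hi => hu i (Finset.mem_insert_of_mem hi))

theorem IsSmoothAlong.smul_complex [SmoothHermitianBundle IB F E] {b : X → B} {u : ∀ p, E (b p)}
    {f : X → ℂ} (hf : ContMDiff J 𝓘(ℝ, ℂ) ∞ f) (hu : IsSmoothAlong IB F E J b u) :
    IsSmoothAlong IB F E J b (fun p => f p • u p) := by
  have hre : ContMDiff J 𝓘(ℝ, ℝ) ∞ (fun p => (f p).re) := Complex.reCLM.contMDiff.comp hf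
  have him : ContMDiff J 𝓘(ℝ, ℝ) ∞ (fun p => (f p).im) := Complex.imCLM.contMDiff.comp hf
  have h := (hu.smul hre).add (hu.I_smul.smul him)
  have e : (fun p => f p • u p) = fun p => (f p).re • u p + (f p).im • Complex.I • u p := by
    funext p
    conv_lhs => rw [← Complex.re_add_im (f p)]
    simp only [add_smul, mul_smul, Complex.coe_smul]
  rw [e]
  exact h

/-- The real part of the inner product of smooth sections is smooth. -/
theorem IsSmoothAlong.re_inner [SmoothHermitianBundle IB F E] {b : X → B} {u v : ∀ p, E (b p)}
    (hu : IsSmoothAlong IB F E J b u) (hv : IsSmoothAlong IB F E J b v) :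
    ContMDiff J 𝓘(ℝ, ℝ) ∞ (fun p => (inner ℂ (v p) (u p)).re) := by
  have hn : ∀ {w : ∀ p, E (b p)}, IsSmoothAlong IB F E J b w →
      ContMDiff J 𝓘(ℝ, ℝ) ∞ (fun p => ‖w p‖ ^ 2) := fun hw =>
    (SmoothHermitianBundle.contMDiff_norm_sq (IB := IB) (F := F) (E := E)).comp hw
  -- Polarization: 2 Re⟨v, u⟩ = ‖v + u‖² − ‖v‖² − ‖u‖².
  have h := (contMDiff_const (c := (2⁻¹ : ℝ))).mul (((hn (hv.add hu)).sub (hn hv)).sub (hn hu))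
  refine h.congr fun p => ?_
  have := norm_add_sq (𝕜 := ℂ) (v p) (u p)
  simp only [RCLike.re_to_complex] at this
  simp only [Pi.mul_apply]
  linarith

/-- The inner product is conjugate-linear in its first slot, so Im⟨v, u⟩ = Re⟨iv, u⟩. -/
theorem IsSmoothAlong.im_inner [SmoothHermitianBundle IB F E] {b : X → B} {u v : ∀ p, E (b p)}
    (hu : IsSmoothAlong IB F E J b u) (hv : IsSmoothAlong IB F E J b v) :
    ContMDiff J 𝓘(ℝ, ℝ) ∞ (fun p => (inner ℂ (v p) (u p)).im) := by
  refine (hu.re_inner hv.I_smul).congr fun p => ?_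
  simp

theorem IsSmoothAlong.continuous_inner [SmoothHermitianBundle IB F E] {b : X → B}
    {u v : ∀ p, E (b p)}
    (hu : IsSmoothAlong IB F E J b u) (hv : IsSmoothAlong IB F E J b v) :
    Continuous (fun p => (inner ℂ (v p) (u p) : ℂ)) := by
  have h1 := (hu.re_inner hv).continuous
  have h2 := (hu.im_inner hv).continuous
  have h : Continuous (fun p => ((inner ℂ (v p) (u p) : ℂ).re : ℂ) +
      ((inner ℂ (v p) (u p) : ℂ).im : ℂ) * Complex.I) := by fun_prop
  simpa only [Complex.re_add_im] using h

end VB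
end Along

/-! ### Derivatives along vector fields, on a manifold and on its product with the line -/

section Derivatives

variable {X EX HX : Type*} [NormedAddCommGroup EX] [NormedSpace ℝ EX]
  [TopologicalSpace HX] {J : ModelWithCorners ℝ EX HX} [TopologicalSpace X] [ChartedSpace HX X]
  [IsManifold J ∞ X]
  {Q EQ HQ : Type*} [NormedAddCommGroup EQ] [NormedSpace ℝ EQ]
  [TopologicalSpace HQ] {JQ : ModelWithCorners ℝ EQ HQ} [TopologicalSpace Q] [ChartedSpace HQ Q]
  [IsManifold JQ ∞ Q]

/-- The derivative of a family of smooth functions along a family of tangent vectors is smooth. -/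
theorem contMDiff_mfderiv_apply {f : Q → X → ℝ}
    (hf : ContMDiff (JQ.prod J) 𝓘(ℝ, ℝ) ∞ (Function.uncurry f)) {g : Q → X}
    {v : ∀ q, TangentSpace J (g q)}
    (hv : ContMDiff JQ J.tangent ∞ (fun q => (⟨g q, v q⟩ : TangentBundle J X))) :
    ContMDiff JQ 𝓘(ℝ, ℝ) ∞ (fun q => (mfderiv J 𝓘(ℝ, ℝ) (f q) (g q) (v q) : ℝ)) := by
  have : IsManifold J 1 X := IsManifold.of_le (n := ∞) (by norm_cast)
  have : IsManifold JQ 1 Q := IsManifold.of_le (n := ∞) (by norm_cast)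
  have hg : ContMDiff JQ J ∞ g := (contMDiff_proj (TangentSpace J : X → Type _)).comp hv
  intro q
  have hϕ := ContMDiffAt.mfderiv (I := J) (I' := 𝓘(ℝ, ℝ)) (J := JQ) (m := ∞) (n := ∞) f g
    (hf (q, g q)) (hg q) (by norm_cast)
  have hb : ContMDiff JQ 𝓘(ℝ, ℝ) ∞ (fun q => f q (g q)) := hf.comp (contMDiff_id.prodMk hg)
  have h := ContMDiffAt.clm_apply_of_inCoordinates (n := ∞) (IM := JQ) (F₁ := EX) (F₂ := ℝ)
    (E₁ := (TangentSpace J : X → Type _)) (E₂ := (TangentSpace 𝓘(ℝ, ℝ) : ℝ → Type _))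
    (b₁ := g) (b₂ := fun q => f q (g q))
    (ϕ := fun q => mfderiv J 𝓘(ℝ, ℝ) (f q) (g q)) (v := v) hϕ (hv q) (hb q)
  exact (contMDiff_snd_tangentBundle_modelSpace ℝ 𝓘(ℝ, ℝ)).contMDiffAt.comp q h

/-- The derivative of a function along a vector field. -/
def dirDeriv (V : ∀ p : X, TangentSpace J p) (f : X → ℝ) (p : X) : ℝ :=
  mfderiv J 𝓘(ℝ, ℝ) f p (V p)

theorem contMDiff_dirDeriv {V : ∀ p : X, TangentSpace J p}
    (hV : ContMDiff J J.tangent ∞ (fun p => (⟨p, V p⟩ : TangentBundle J X))) {f : X → ℝ}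
    (hf : ContMDiff J 𝓘(ℝ, ℝ) ∞ f) : ContMDiff J 𝓘(ℝ, ℝ) ∞ (dirDeriv V f) :=
  contMDiff_mfderiv_apply (JQ := J) (f := fun _ p => f p) (g := fun p => p) (v := V)
    (hf.comp contMDiff_snd) hV

/-- The derivative in the first variable of a function on `X × ℝ` along a vector field on `X`. -/
def fstDeriv (V : ∀ p : X, TangentSpace J p) (f : X × ℝ → ℝ) (n : X × ℝ) : ℝ :=
  dirDeriv V (fun p => f (p, n.2)) n.1

/-- The derivative in the second variable of a function on `X × ℝ`. -/
def sndDeriv (f : X × ℝ → ℝ) (n : X × ℝ) : ℝ := deriv (fun s => f (n.1, s)) n.2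

theorem contMDiff_fstDeriv {V : ∀ p : X, TangentSpace J p}
    (hV : ContMDiff J J.tangent ∞ (fun p => (⟨p, V p⟩ : TangentBundle J X))) {f : X × ℝ → ℝ}
    (hf : ContMDiff (J.prod 𝓘(ℝ, ℝ)) 𝓘(ℝ, ℝ) ∞ f) :
    ContMDiff (J.prod 𝓘(ℝ, ℝ)) 𝓘(ℝ, ℝ) ∞ (fstDeriv V f) := by
  refine contMDiff_mfderiv_apply (JQ := J.prod 𝓘(ℝ, ℝ)) (f := fun (n : X × ℝ) p => f (p, n.2))
    (g := fun n : X × ℝ => n.1) (v := fun n => V n.1) ?_ (hV.comp contMDiff_fst)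
  exact hf.comp (contMDiff_snd.prodMk (contMDiff_snd.comp contMDiff_fst))

theorem contMDiff_sndDeriv {f : X × ℝ → ℝ}
    (hf : ContMDiff (J.prod 𝓘(ℝ, ℝ)) 𝓘(ℝ, ℝ) ∞ f) :
    ContMDiff (J.prod 𝓘(ℝ, ℝ)) 𝓘(ℝ, ℝ) ∞ (sndDeriv f) := by
  have h := contMDiff_mfderiv_apply (JQ := J.prod 𝓘(ℝ, ℝ)) (J := 𝓘(ℝ, ℝ))
    (f := fun (n : X × ℝ) s => f (n.1, s))
    (g := fun n : X × ℝ => n.2) (v := fun _ => (1 : ℝ))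
    (hf.comp ((contMDiff_fst.comp contMDiff_fst).prodMk contMDiff_snd)) ?_
  · refine h.congr fun n => ?_
    rw [sndDeriv, mfderiv_eq_fderiv]
    rfl
  · have h1 : ContMDiff 𝓘(ℝ, ℝ) 𝓘(ℝ, ℝ).tangent ∞
        (fun s : ℝ => (⟨s, (1 : ℝ)⟩ : TangentBundle 𝓘(ℝ, ℝ) ℝ)) :=
      contMDiff_vectorSpace_iff_contDiff.2 contDiff_const
    exact h1.comp contMDiff_snd

theorem contDiff_slice_snd {f : X × ℝ → ℝ} (hf : ContMDiff (J.prod 𝓘(ℝ, ℝ)) 𝓘(ℝ, ℝ) ∞ f)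
    (p : X) : ContDiff ℝ ∞ (fun s => f (p, s)) :=
  contMDiff_iff_contDiff.1 (hf.comp (contMDiff_const.prodMk contMDiff_id))

theorem hasDerivAt_sndDeriv {f : X × ℝ → ℝ} (hf : ContMDiff (J.prod 𝓘(ℝ, ℝ)) 𝓘(ℝ, ℝ) ∞ f)
    (p : X) (s : ℝ) : HasDerivAt (fun s => f (p, s)) (sndDeriv f (p, s)) s :=
  ((contDiff_slice_snd hf p).differentiable (by simp)).differentiableAt.hasDerivAt

/-- The chain rule for `p ↦ f (p, θ p)`. -/
theorem dirDeriv_graph {V : ∀ p : X, TangentSpace J p} {f : X × ℝ → ℝ}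
    (hf : ContMDiff (J.prod 𝓘(ℝ, ℝ)) 𝓘(ℝ, ℝ) ∞ f) {θ : X → ℝ} (hθ : ContMDiff J 𝓘(ℝ, ℝ) ∞ θ)
    (p : X) : dirDeriv V (fun p => f (p, θ p)) p =
      fstDeriv V f (p, θ p) + dirDeriv V θ p * sndDeriv f (p, θ p) := by
  have hfd : MDifferentiableAt (J.prod 𝓘(ℝ, ℝ)) 𝓘(ℝ, ℝ) f (p, θ p) :=
    (hf (p, θ p)).mdifferentiableAt (by simp)
  have hθd : MDifferentiableAt J 𝓘(ℝ, ℝ) θ p := (hθ p).mdifferentiableAt (by simp)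
  have h1 : HasMFDerivAt J (J.prod 𝓘(ℝ, ℝ)) (fun p => (p, θ p)) p
      ((ContinuousLinearMap.id ℝ (TangentSpace J p)).prod (mfderiv J 𝓘(ℝ, ℝ) θ p)) :=
    (hasMFDerivAt_id p).prodMk hθd.hasMFDerivAt
  have h2 := hfd.hasMFDerivAt.comp p h1
  have h3 := h2.mfderiv
  have hA : (fstDeriv V f (p, θ p) : ℝ) =
      mfderiv (J.prod 𝓘(ℝ, ℝ)) 𝓘(ℝ, ℝ) f (p, θ p) (V p, (0 : ℝ)) := by
    have h4 : HasMFDerivAt J (J.prod 𝓘(ℝ, ℝ)) (fun q : X => (q, θ p)) p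
        ((ContinuousLinearMap.id ℝ (TangentSpace J p)).prod 0) :=
      (hasMFDerivAt_id p).prodMk (hasMFDerivAt_const _ _)
    have h5 := (hfd.hasMFDerivAt.comp p h4).mfderiv
    have h6 : fstDeriv V f (p, θ p) = mfderiv J 𝓘(ℝ, ℝ) (f ∘ fun q : X => (q, θ p)) p (V p) := rfl
    rw [h6, h5]
    rfl
  have hB : (sndDeriv f (p, θ p) : ℝ) =
      mfderiv (J.prod 𝓘(ℝ, ℝ)) 𝓘(ℝ, ℝ) f (p, θ p) ((0 : TangentSpace J p), (1 : ℝ)) := by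
    have h4 : HasMFDerivAt 𝓘(ℝ, ℝ) (J.prod 𝓘(ℝ, ℝ)) (fun s : ℝ => (p, s)) (θ p)
        ((0 : TangentSpace 𝓘(ℝ, ℝ) (θ p) →L[ℝ] TangentSpace J p).prod
          (ContinuousLinearMap.id ℝ (TangentSpace 𝓘(ℝ, ℝ) (θ p)))) :=
      (hasMFDerivAt_const _ _).prodMk (hasMFDerivAt_id _)
    have h5 := (hfd.hasMFDerivAt.comp (θ p) h4).mfderiv
    rw [sndDeriv, ← fderiv_apply_one_eq_deriv, ← mfderiv_eq_fderiv]
    have h6 : mfderiv 𝓘(ℝ, ℝ) 𝓘(ℝ, ℝ) (fun s => f (p, s)) (θ p) =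
      mfderiv 𝓘(ℝ, ℝ) 𝓘(ℝ, ℝ) (f ∘ fun s : ℝ => (p, s)) (θ p) := rfl
    change mfderiv 𝓘(ℝ, ℝ) 𝓘(ℝ, ℝ) (fun s => f (p, s)) (θ p) (1 : ℝ) = _
    rw [h6, h5]
    rfl
  rw [hA, hB]
  have h7 : dirDeriv V (fun p => f (p, θ p)) p =
      mfderiv (J.prod 𝓘(ℝ, ℝ)) 𝓘(ℝ, ℝ) f (p, θ p) (V p, dirDeriv V θ p) := by
    rw [dirDeriv]
    have h8 : mfderiv J 𝓘(ℝ, ℝ) (fun p => f (p, θ p)) p =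
      mfderiv J 𝓘(ℝ, ℝ) (f ∘ fun p : X => (p, θ p)) p := rfl
    rw [h8, h3]
    rfl
  rw [h7]
  set c : ℝ := dirDeriv V θ p
  -- The graph map sends `V` to (V, Vθ), which splits into a horizontal and a vertical part;
  -- linearity of the total derivative gives the two terms.
  have h9 : ((V p, c) : TangentSpace (J.prod 𝓘(ℝ, ℝ)) (p, θ p)) =
      ((V p, (0 : ℝ)) : TangentSpace J p × ℝ) + c • (((0 : TangentSpace J p), (1 : ℝ)) :
        TangentSpace J p × ℝ) := by
    refine Prod.ext ?_ ?_
    · simp only [Prod.fst_add, Prod.smul_fst, smul_zero, add_zero]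
      rfl
    · simp
  erw [h9]
  erw [map_add, map_smul]
  rfl

section Algebra

variable {V : ∀ p : X, TangentSpace J p} {f g : X → ℝ}

theorem dirDeriv_mul (hf : ContMDiff J 𝓘(ℝ, ℝ) ∞ f) (hg : ContMDiff J 𝓘(ℝ, ℝ) ∞ g) (p : X) :
    dirDeriv V (fun p => f p * g p) p = f p * dirDeriv V g p + dirDeriv V f p * g p := by
  have h := ((hf p).mdifferentiableAt (by simp)).hasMFDerivAt.mul
    ((hg p).mdifferentiableAt (by simp)).hasMFDerivAt
  have h' : mfderiv J 𝓘(ℝ, ℝ) (fun p => f p * g p) p = _ := h.mfderiv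
  rw [dirDeriv, h', mul_comm (dirDeriv V f p)]
  rfl

theorem dirDeriv_const (c : ℝ) (p : X) : dirDeriv V (fun _ => c) p = 0 := by
  rw [dirDeriv, mfderiv_const]
  rfl

/-- The chain rule for the composition with a function of one variable. -/
theorem dirDeriv_comp {h : ℝ → ℝ} (hf : ContMDiff J 𝓘(ℝ, ℝ) ∞ f) {p : X} {h' : ℝ}
    (hh : HasDerivAt h h' (f p)) :
    dirDeriv V (fun p => h (f p)) p = h' * dirDeriv V f p := by
  have h1 := hh.hasFDerivAt.hasMFDerivAt.comp p
    ((hf p).mdifferentiableAt (by simp)).hasMFDerivAt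
  have h2 : mfderiv J 𝓘(ℝ, ℝ) (fun p => h (f p)) p = _ := h1.mfderiv
  rw [dirDeriv, h2]
  change dirDeriv V f p • h' = _
  rw [smul_eq_mul, mul_comm]

theorem dirDeriv_congr {p : X} (h : f =ᶠ[𝓝 p] g) : dirDeriv V f p = dirDeriv V g p := by
  rw [dirDeriv, dirDeriv, h.mfderiv_eq]
  rfl

end Algebra

end Derivatives

universe u

/-! ### Differentiation under the integral, up to the boundary -/

section ParametricIntegral

variable {E : Type*} [NormedAddCommGroup E] [NormedSpace ℝ E]

/-- Differentiation under the integral sign, up to the boundary of a convex set. -/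
theorem hasFDerivWithinAt_parametric_integral {G : Type*} [NormedAddCommGroup G] [NormedSpace ℝ G]
    [CompleteSpace G] {s : Set E} (hs : Convex ℝ s) {F : ℝ × E → G} {D : ℝ × E → (E →L[ℝ] G)}
    (hF : ContinuousOn F (Icc 0 1 ×ˢ s)) (hD : ContinuousOn D (Icc 0 1 ×ˢ s))
    (hFD : ∀ t ∈ Icc (0 : ℝ) 1, ∀ v ∈ s, HasFDerivWithinAt (fun w => F (t, w)) (D (t, v)) s v)
    {v : E} (hv : v ∈ s) :
    HasFDerivWithinAt (fun w => ∫ t in (0 : ℝ)..1, F (t, w)) (∫ t in (0 : ℝ)..1, D (t, v)) s v := by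
  have hslice : ∀ w : E, w ∈ s → ContinuousOn (fun t : ℝ => (t, w)) (uIcc 0 1) := fun w _ => by
    fun_prop
  have hmaps : ∀ w : E, w ∈ s → MapsTo (fun t : ℝ => (t, w)) (uIcc 0 1) (Icc 0 1 ×ˢ s) :=
    fun w hw t ht => ⟨by rwa [uIcc_of_le zero_le_one] at ht, hw⟩
  have hFi : ∀ w ∈ s, IntervalIntegrable (fun t => F (t, w)) volume 0 1 := fun w hw =>
    (hF.comp (hslice w hw) (hmaps w hw)).intervalIntegrable
  have hDi : IntervalIntegrable (fun t => D (t, v)) volume 0 1 :=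
    (hD.comp (hslice v hv) (hmaps v hv)).intervalIntegrable
  rw [hasFDerivWithinAt_iff_isLittleO, Asymptotics.isLittleO_iff]
  intro ε hε
  -- Compactness of [0, 1] makes the continuity of `D` at `v` uniform in `t`. The mean value
  -- inequality on the convex set `s ∩ ball` then bounds the remainder for all `t` at once.
  have huc : ∀ᶠ w in 𝓝[s] v, ∀ t ∈ Icc (0 : ℝ) 1, dist (D (t, w)) (D (t, v)) < ε := by
    have hD' : ContinuousOn (fun p : E × ℝ => D (p.2, p.1)) (s ×ˢ Icc (0 : ℝ) 1) :=
      hD.comp (by fun_prop) fun p hp => ⟨hp.2, hp.1⟩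
    have h := IsCompact.mem_uniformity_of_prod (f := fun (w : E) (t : ℝ) => D (t, w))
      isCompact_Icc hD' hv (Metric.dist_mem_uniformity hε)
    obtain ⟨u, hu, hu'⟩ := h
    filter_upwards [hu] with w hw t ht using by
      exact hu' w hw t ht
  obtain ⟨δ, hδ, hball⟩ := Metric.mem_nhdsWithin_iff.1 huc
  filter_upwards [inter_mem_nhdsWithin s (Metric.ball_mem_nhds v hδ)] with w hw
  have hconv : Convex ℝ (s ∩ Metric.ball v δ) := hs.inter (convex_ball v δ)
  have hb : ∀ t ∈ Icc (0 : ℝ) 1, ‖F (t, w) - F (t, v) - D (t, v) (w - v)‖ ≤ ε * ‖w - v‖ := by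
    intro t ht
    refine hconv.norm_image_sub_le_of_norm_hasFDerivWithin_le' (f := fun w => F (t, w))
      (f' := fun w => D (t, w)) (fun x hx => (hFD t ht x hx.1).mono inter_subset_left)
      (fun x hx => ?_) ⟨hv, Metric.mem_ball_self hδ⟩ hw
    rw [← dist_eq_norm]
    exact (hball ⟨hx.2, hx.1⟩ t ht).le
  have e : (∫ t in (0 : ℝ)..1, F (t, w)) - (∫ t in (0 : ℝ)..1, F (t, v)) -
      (∫ t in (0 : ℝ)..1, D (t, v)) (w - v) =
      ∫ t in (0 : ℝ)..1, (F (t, w) - F (t, v) - D (t, v) (w - v)) := by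
    rw [intervalIntegral.integral_sub ((hFi w hw.1).sub (hFi v hv)),
      intervalIntegral.integral_sub (hFi w hw.1) (hFi v hv),
      ContinuousLinearMap.intervalIntegral_apply hDi]
    have hc : ContinuousOn (fun t => D (t, v) (w - v)) (uIcc (0 : ℝ) 1) :=
      (hD.comp (hslice v hv) (hmaps v hv)).clm_apply continuousOn_const
    exact hc.intervalIntegrable
  rw [e]
  have := intervalIntegral.norm_integral_le_of_norm_le_const (a := (0 : ℝ)) (b := 1)
    (C := ε * ‖w - v‖) (f := fun t => F (t, w) - F (t, v) - D (t, v) (w - v)) (fun t ht => by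
      rw [uIoc_of_le zero_le_one] at ht
      exact hb t ⟨ht.1.le, ht.2⟩)
  simpa using this

/-- The integral of a smooth function of a parameter is smooth, up to the boundary of a convex set. -/
theorem contDiffOn_parametric_integral {E G : Type u} [NormedAddCommGroup E]
    [NormedSpace ℝ E] [NormedAddCommGroup G] [NormedSpace ℝ G] [CompleteSpace G] {s : Set E}
    (hs : Convex ℝ s) (hsu : UniqueDiffOn ℝ s)
    {F : ℝ × E → G} (hF : ContDiffOn ℝ ∞ F (Icc 0 1 ×ˢ s)) :
    ContDiffOn ℝ ∞ (fun v => ∫ t in (0 : ℝ)..1, F (t, v)) s := by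
  have hu : UniqueDiffOn ℝ (Icc (0 : ℝ) 1 ×ˢ s) := (uniqueDiffOn_Icc zero_lt_one).prod hsu
  -- The induction on the order of smoothness replaces `G` by `E →L[ℝ] G`, so the one-derivative
  -- step must hold for every target. A common universe for `E` and `G` keeps the new target
  -- admissible.
  have step : ∀ {G : Type u} [NormedAddCommGroup G] [NormedSpace ℝ G] [CompleteSpace G]
      (F : ℝ × E → G), ContDiffOn ℝ ∞ F (Icc 0 1 ×ˢ s) →
      ∃ D : ℝ × E → (E →L[ℝ] G), ContDiffOn ℝ ∞ D (Icc 0 1 ×ˢ s) ∧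
        ∀ v ∈ s, HasFDerivWithinAt (fun w => ∫ t in (0 : ℝ)..1, F (t, w))
          (∫ t in (0 : ℝ)..1, D (t, v)) s v := by
    intro G _ _ _ F hF
    have hF' : ContDiffOn ℝ ∞ (fderivWithin ℝ F (Icc 0 1 ×ˢ s)) (Icc 0 1 ×ˢ s) :=
      hF.fderivWithin hu (by norm_cast)
    have hD : ContDiffOn ℝ ∞ (fun p => (fderivWithin ℝ F (Icc 0 1 ×ˢ s) p).comp
        (ContinuousLinearMap.inr ℝ ℝ E)) (Icc 0 1 ×ˢ s) :=
      hF'.clm_comp contDiffOn_const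
    refine ⟨_, hD, fun v hv => ?_⟩
    refine hasFDerivWithinAt_parametric_integral hs hF.continuousOn hD.continuousOn ?_ hv
    intro t ht w hw
    have h1 : HasFDerivWithinAt F (fderivWithin ℝ F (Icc 0 1 ×ˢ s) (t, w)) (Icc 0 1 ×ˢ s) (t, w) :=
      (hF.differentiableOn (by simp) (t, w) ⟨ht, hw⟩).hasFDerivWithinAt
    exact h1.comp w (hasFDerivAt_prodMk_right t w).hasFDerivWithinAt fun x hx => ⟨ht, hx⟩
  rw [contDiffOn_infty]
  intro n
  induction n generalizing G with
  | zero =>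
    obtain ⟨D, -, hD⟩ := step F hF
    have hc : ContinuousOn (fun v => ∫ t in (0 : ℝ)..1, F (t, v)) s :=
      fun v hv => (hD v hv).continuousWithinAt
    simpa using hc
  | succ n ih =>
    obtain ⟨D, hDc, hD⟩ := step F hF
    have h := (contDiffOn_succ_iff_hasFDerivWithinAt_of_uniqueDiffOn (n := (n : WithTop ℕ∞))
      (f := fun v => ∫ t in (0 : ℝ)..1, F (t, v)) hsu).2
      ⟨fun h => by simp at h, _, ih hDc, hD⟩
    exact_mod_cast h

end ParametricIntegral

/-! ### Hadamard division by a coordinate in the half space -/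

section HalfSpace

variable {n : ℕ} [NeZero n]

/-- Division by the first coordinate, near a boundary point of the half space. -/
theorem exists_contDiffOn_eq_mul_coord {c : EuclideanSpace ℝ (Fin n)} (hc : c 0 = 0) {r : ℝ}
    (hr : 0 < r) {f : EuclideanSpace ℝ (Fin n) → ℝ}
    (hf : ContDiffOn ℝ ∞ f ({v | 0 ≤ v 0} ∩ Metric.ball c r))
    (h0 : ∀ v ∈ Metric.ball c r, v 0 = 0 → f v = 0) :
    ∃ a : EuclideanSpace ℝ (Fin n) → ℝ, ContDiffOn ℝ ∞ a ({v | 0 ≤ v 0} ∩ Metric.ball c r) ∧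
      ∀ v ∈ {v : EuclideanSpace ℝ (Fin n) | 0 ≤ v 0} ∩ Metric.ball c r, f v = v 0 * a v := by
  set s := {v : EuclideanSpace ℝ (Fin n) | 0 ≤ v 0} ∩ Metric.ball c r with hsdef
  let e0 : EuclideanSpace ℝ (Fin n) := EuclideanSpace.single 0 1
  have he0 : e0 0 = 1 := by simp [e0]
  have hcoord : Continuous fun v : EuclideanSpace ℝ (Fin n) => v 0 := by fun_prop
  have hconv : Convex ℝ s := by
    refine Convex.inter ?_ (convex_ball c r)
    intro x hx y hy a b ha hb _
    simp only [mem_ofPred_eq, PiLp.add_apply, PiLp.smul_apply, smul_eq_mul] at *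
    positivity
  have hint : (interior s).Nonempty := by
    have ho : IsOpen ({v : EuclideanSpace ℝ (Fin n) | 0 < v 0} ∩ Metric.ball c r) :=
      (isOpen_lt continuous_const hcoord).inter Metric.isOpen_ball
    refine ⟨c + (r / 2) • e0, interior_maximal (s := s) (t := {v : EuclideanSpace ℝ (Fin n) | 0 < v 0} ∩ Metric.ball c r)
      (fun v hv => ⟨(show 0 < v 0 from hv.1).le, hv.2⟩) ho ⟨?_, ?_⟩⟩
    · simp [hc, he0, hr]
    · simp [e0, norm_smul, abs_of_pos hr, hr]
  have hsu : UniqueDiffOn ℝ s := uniqueDiffOn_convex hconv hint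
  let pr : EuclideanSpace ℝ (Fin n) → EuclideanSpace ℝ (Fin n) := fun v => v - v 0 • e0
  have hpr0 : ∀ v, pr v 0 = 0 := fun v => by simp [pr, he0]
  -- Since `c 0 = 0`, replacing the first coordinate by zero does not increase the distance to `c`.
  have hprs : ∀ v ∈ s, pr v ∈ s := by
    intro v hv
    refine ⟨(hpr0 v).ge, ?_⟩
    refine lt_of_le_of_lt ?_ (show dist v c < r from hv.2)
    rw [EuclideanSpace.dist_eq, EuclideanSpace.dist_eq]
    refine Real.sqrt_le_sqrt (Finset.sum_le_sum fun i _ => ?_)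
    by_cases hi : i = 0
    · subst hi
      rw [hpr0, hc]; simp [sq_nonneg]
    · have : pr v i = v i := by simp [pr, e0, hi]
      rw [this]
  -- The segment from `pr v` to `v` has velocity `v 0 • e0`. As `f (pr v) = 0`, integrating the
  -- derivative of `f` along it gives `f v` as `v 0` times an integral that is smooth in `v`.
  let A : ℝ × EuclideanSpace ℝ (Fin n) → EuclideanSpace ℝ (Fin n) := fun p =>
    pr p.2 + (p.1 * p.2 0) • e0
  have hA : ContDiff ℝ ∞ A := by
    have h1 : ContDiff ℝ ∞ fun p : ℝ × EuclideanSpace ℝ (Fin n) => p.2 0 := by fun_prop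
    exact (contDiff_snd.sub (h1.smul contDiff_const)).add
      ((contDiff_fst.mul h1).smul contDiff_const)
  have hAs : MapsTo A (Icc 0 1 ×ˢ s) s := by
    rintro ⟨t, v⟩ ⟨ht, hv⟩
    have h := hconv (hprs v hv) hv (sub_nonneg.2 ht.2) ht.1 (by ring)
    have e : A (t, v) = (1 - t) • pr v + t • v := by
      simp only [A, pr]; module
    rwa [e]
  have hf' : ContDiffOn ℝ ∞ (fun w => fderivWithin ℝ f s w e0) s :=
    (hf.fderivWithin hsu (by norm_cast)).clm_apply contDiffOn_const
  refine ⟨fun v => ∫ t in (0 : ℝ)..1, fderivWithin ℝ f s (A (t, v)) e0,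
    contDiffOn_parametric_integral hconv hsu (hf'.comp hA.contDiffOn hAs), fun v hv => ?_⟩
  have hAv : ∀ t : ℝ, HasDerivAt (fun t => A (t, v)) (v 0 • e0) t := by
    intro t
    have h := (((hasDerivAt_id t).mul_const (v 0)).smul_const e0).const_add (pr v)
    rw [one_mul] at h
    exact h
  have hmaps : MapsTo (fun t => A (t, v)) (Icc 0 1) s := fun t ht => hAs ⟨ht, hv⟩
  have hder : ∀ t ∈ Icc (0 : ℝ) 1, HasDerivWithinAt (fun t => f (A (t, v)))
      (v 0 * fderivWithin ℝ f s (A (t, v)) e0) (Icc 0 1) t := by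
    intro t ht
    have h := (hf.differentiableOn (by simp) _ (hmaps ht)).hasFDerivWithinAt.comp_hasDerivWithinAt
      t (hAv t).hasDerivWithinAt hmaps
    rw [map_smul, smul_eq_mul] at h
    exact h
  have hcont : ContinuousOn (fun t => v 0 * fderivWithin ℝ f s (A (t, v)) e0) (Icc 0 1) :=
    continuousOn_const.mul (hf'.continuousOn.comp
      (fun t _ => (hAv t).continuousAt.continuousWithinAt) hmaps)
  have h := intervalIntegral.integral_eq_sub_of_hasDerivAt_of_le zero_le_one
    (f := fun t => f (A (t, v))) (f' := fun t => v 0 * fderivWithin ℝ f s (A (t, v)) e0)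
    (fun t ht => (hder t ht).continuousWithinAt)
    (fun t ht => (hder t ⟨ht.1.le, ht.2.le⟩).hasDerivAt (Icc_mem_nhds ht.1 ht.2))
    (ContinuousOn.intervalIntegrable (by rwa [uIcc_of_le zero_le_one]))
  rw [intervalIntegral.integral_const_mul] at h
  have h1 : A (1, v) = v := by simp only [A, pr]; module
  have h2 : A (0, v) = pr v := by simp [A]
  rw [h1, h2, h0 _ (hprs v hv).2 (hpr0 v), sub_zero] at h
  exact h.symm

end HalfSpace

/-! ### Division by the defining function, and density of the interior -/

section Division

variable {k q : ℕ} {M N Y : Type*}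
  [TopologicalSpace M] [ChartedSpace (EuclideanHalfSpace (k + q + 1)) M]
  [TopologicalSpace N] [ChartedSpace (EuclideanSpace ℝ (Fin (k + q))) N]
  [TopologicalSpace Y] [ChartedSpace (EuclideanSpace ℝ (Fin q)) Y]
  [IsManifold (𝓡∂ (k + q + 1)) ∞ M]

theorem extChartAt_boundary_coord {p : M} (hp : p ∈ (𝓡∂ (k + q + 1)).boundary M) :
    (extChartAt (𝓡∂ (k + q + 1)) p p) 0 = 0 := by
  have h : extChartAt (𝓡∂ (k + q + 1)) p p ∈ frontier (range (𝓡∂ (k + q + 1))) := hp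
  rw [frontier_range_modelWithCornersEuclideanHalfSpace] at h
  exact h.symm

theorem extChartAt_symm_mem_boundary {p : M} {v : EuclideanSpace ℝ (Fin (k + q + 1))}
    (hv : v ∈ (extChartAt (𝓡∂ (k + q + 1)) p).target) (hv0 : v 0 = 0) :
    (extChartAt (𝓡∂ (k + q + 1)) p).symm v ∈ (𝓡∂ (k + q + 1)).boundary M := by
  by_contra h
  rw [← ModelWithCorners.compl_interior, mem_compl_iff, not_not] at h
  have hs := (extChartAt (𝓡∂ (k + q + 1)) p).map_target hv
  have h2 := ((𝓡∂ (k + q + 1)).isInteriorPoint_iff_of_mem_atlas (n := ∞) (by simp)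
    (chart_mem_atlas _ p) (by rwa [extChartAt_source] at hs)).1 h
  have h3 : (extChartAt (𝓡∂ (k + q + 1)) p) ((extChartAt (𝓡∂ (k + q + 1)) p).symm v) ∈
      interior (extChartAt (𝓡∂ (k + q + 1)) p).target := h2
  rw [(extChartAt (𝓡∂ (k + q + 1)) p).right_inv hv] at h3
  have h4 := interior_mono (extChartAt_target_subset_range (I := 𝓡∂ (k + q + 1)) p) h3
  rw [interior_range_modelWithCornersEuclideanHalfSpace] at h4
  exact absurd hv0 (ne_of_gt h4)

theorem contDiffOn_comp_extChartAt_symm {f : M → ℝ}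
    (hf : ContMDiff (𝓡∂ (k + q + 1)) 𝓘(ℝ, ℝ) ∞ f) (p : M) :
    ContDiffOn ℝ ∞ (f ∘ (extChartAt (𝓡∂ (k + q + 1)) p).symm)
      (extChartAt (𝓡∂ (k + q + 1)) p).target :=
  contMDiffOn_iff_contDiffOn.1 (hf.comp_contMDiffOn (contMDiffOn_extChartAt_symm p))

/-- A smooth function that vanishes on the boundary is divisible by the defining function. -/
theorem FiberedBoundary.exists_eq_x_mul [T2Space M] [CompactSpace M]
    (G : FiberedBoundary k q M N Y) {f : M → ℝ} (hf : ContMDiff (𝓡∂ (k + q + 1)) 𝓘(ℝ, ℝ) ∞ f)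
    (hf0 : ∀ p ∈ (𝓡∂ (k + q + 1)).boundary M, f p = 0) :
    ∃ a : M → ℝ, ContMDiff (𝓡∂ (k + q + 1)) 𝓘(ℝ, ℝ) ∞ a ∧ ∀ p, f p = G.x p * a p := by
  -- The equation for the value of the quotient at a point is affine, hence defines a convex set, so
  -- local quotients can be averaged by a partition of unity.
  suffices hloc : ∀ p : M, ∃ U ∈ 𝓝 p, ∃ g : M → ℝ,
      ContMDiffOn (𝓡∂ (k + q + 1)) 𝓘(ℝ, ℝ) ∞ g U ∧ ∀ y ∈ U, g y ∈ {a : ℝ | f y = G.x y * a} by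
    have hconv : ∀ p : M, Convex ℝ {a : ℝ | f p = G.x p * a} := by
      intro p a ha b hb α β _ _ hαβ
      have ha' : f p = G.x p * a := ha
      have hb' : f p = G.x p * b := hb
      change f p = G.x p * (α * a + β * b)
      calc f p = α * f p + β * f p := by rw [← add_mul, hαβ, one_mul]
        _ = α * (G.x p * a) + β * (G.x p * b) := by rw [← ha', ← hb']
        _ = _ := by ring
    obtain ⟨a, ha⟩ := exists_contMDiffMap_forall_mem_convex_of_local (𝓡∂ (k + q + 1))
      (n := (⊤ : ℕ∞)) hconv hloc
    exact ⟨a, a.contMDiff, ha⟩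
  intro p
  by_cases hp : p ∈ (𝓡∂ (k + q + 1)).boundary M
  swap
  · have hx : G.x p ≠ 0 := fun h => hp ((G.x_eq_zero_iff p).1 h)
    refine ⟨{p | G.x p ≠ 0}, (isOpen_ne_fun G.contMDiff_x.continuous continuous_const).mem_nhds hx,
      fun p => f p / G.x p, ?_, fun y hy => ?_⟩
    · exact hf.contMDiffOn.div₀ G.contMDiff_x.contMDiffOn fun y hy => hy
    · have : G.x y ≠ 0 := hy
      simp only [mem_ofPred_eq]
      field_simp
  set φ := extChartAt (𝓡∂ (k + q + 1)) p with hφ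
  have hc : (φ p) 0 = 0 := extChartAt_boundary_coord hp
  have hrange : range (𝓡∂ (k + q + 1)) = {y | 0 ≤ y 0} :=
    range_modelWithCornersEuclideanHalfSpace (k + q + 1)
  obtain ⟨r, hr, hrt⟩ := Metric.mem_nhdsWithin_iff.1
    (extChartAt_target_mem_nhdsWithin (I := 𝓡∂ (k + q + 1)) p)
  have hst : {v | 0 ≤ v 0} ∩ Metric.ball (φ p) r ⊆ φ.target := by
    rw [inter_comm, ← hrange]; exact hrt
  have hz : ∀ g : M → ℝ, (∀ p ∈ (𝓡∂ (k + q + 1)).boundary M, g p = 0) →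
      ∀ v ∈ Metric.ball (φ p) r, v 0 = 0 → (g ∘ φ.symm) v = 0 := fun g hg v hv hv0 =>
    hg _ (extChartAt_symm_mem_boundary (hst ⟨hv0.ge, hv⟩) hv0)
  obtain ⟨b, hb, hfb⟩ := exists_contDiffOn_eq_mul_coord hc hr
    ((contDiffOn_comp_extChartAt_symm hf p).mono hst) (hz f hf0)
  obtain ⟨d, hd, hxd⟩ := exists_contDiffOn_eq_mul_coord hc hr
    ((contDiffOn_comp_extChartAt_symm G.contMDiff_x p).mono hst)
    (hz G.x fun p hp => (G.x_eq_zero_iff p).2 hp)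
  have hcs : φ p ∈ {v | 0 ≤ v 0} ∩ Metric.ball (φ p) r := ⟨hc.ge, Metric.mem_ball_self hr⟩
  -- In the chart x = v₀ d with v₀ = 0 at `p`; if `d` vanished there too, the differential of `x`
  -- would be zero at a boundary point.
  have hd0 : d (φ p) ≠ 0 := by
    intro h0
    obtain ⟨z, hz⟩ : p ∈ range G.incl := by rw [G.range_incl]; exact hp
    refine G.mfderiv_x_ne_zero z ?_
    rw [hz]
    have hnhds : {v | 0 ≤ v 0} ∩ Metric.ball (φ p) r ∈ 𝓝[range (𝓡∂ (k + q + 1))] (φ p) := by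
      rw [hrange]
      exact inter_mem_nhdsWithin _ (Metric.ball_mem_nhds _ hr)
    have h1 : HasFDerivWithinAt (fun v : EuclideanSpace ℝ (Fin (k + q + 1)) => (v 0 * d v : ℝ))
        (0 : EuclideanSpace ℝ (Fin (k + q + 1)) →L[ℝ] ℝ)
        ({v | 0 ≤ v 0} ∩ Metric.ball (φ p) r) (φ p) := by
      let π₀ : EuclideanSpace ℝ (Fin (k + q + 1)) →L[ℝ] ℝ :=
        (EuclideanSpace.proj (0 : Fin (k + q + 1)) : EuclideanSpace ℝ (Fin (k + q + 1)) →L[ℝ] ℝ)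
      have h2 := (π₀.hasFDerivWithinAt
        (x := φ p) (s := {v | 0 ≤ v 0} ∩ Metric.ball (φ p) r)).mul
        (hd.differentiableOn (by simp) _ hcs).hasFDerivWithinAt
      refine h2.congr_fderiv ?_
      have hc' : π₀ (φ p) = 0 := hc
      rw [h0, hc']; simp
    have h3 : HasFDerivWithinAt (G.x ∘ φ.symm) (0 : EuclideanSpace ℝ (Fin (k + q + 1)) →L[ℝ] ℝ)
        (range (𝓡∂ (k + q + 1))) (φ p) :=
      (h1.congr hxd (hxd _ hcs)).mono_of_mem_nhdsWithin hnhds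
    have h4 : HasMFDerivAt (𝓡∂ (k + q + 1)) 𝓘(ℝ, ℝ) G.x p
        (0 : EuclideanSpace ℝ (Fin (k + q + 1)) →L[ℝ] ℝ) := by
      refine ⟨G.contMDiff_x.continuous.continuousAt, ?_⟩
      have e : writtenInExtChartAt (𝓡∂ (k + q + 1)) 𝓘(ℝ, ℝ) p G.x = G.x ∘ φ.symm := by
        rw [writtenInExtChartAt, extChartAt_model_space_eq_id]
        rfl
      rw [e]
      exact h3
    exact h4.mfderiv
  have hdn : ∀ᶠ v in 𝓝[{v | 0 ≤ v 0} ∩ Metric.ball (φ p) r] (φ p), d v ≠ 0 :=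
    (hd.continuousOn _ hcs).eventually_ne hd0
  obtain ⟨r', hr', hd'⟩ := Metric.mem_nhdsWithin_iff.1 hdn
  have hU : φ.source ∩ φ ⁻¹' (Metric.ball (φ p) r ∩ Metric.ball (φ p) r') ∈ 𝓝 p := by
    rw [hφ, extChartAt_source]
    exact (isOpen_extChartAt_preimage (I := 𝓡∂ (k + q + 1)) p
      (Metric.isOpen_ball.inter Metric.isOpen_ball)).mem_nhds
      ⟨mem_chart_source _ p, Metric.mem_ball_self hr, Metric.mem_ball_self hr'⟩
  have hmaps : ∀ y ∈ φ.source ∩ φ ⁻¹' (Metric.ball (φ p) r ∩ Metric.ball (φ p) r'),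
      φ y ∈ ({v | 0 ≤ v 0} ∩ Metric.ball (φ p) r) ∩ {v | d v ≠ 0} := by
    intro y hy
    have h1 : φ y ∈ {v : EuclideanSpace ℝ (Fin (k + q + 1)) | 0 ≤ v 0} := by
      rw [← hrange]
      exact extChartAt_target_subset_range p (φ.map_source hy.1)
    exact ⟨⟨h1, hy.2.1⟩, hd' ⟨hy.2.2, h1, hy.2.1⟩⟩
  -- Both `f` and `x` are v₀ times a smooth function, so their quotient is b / d where `d` does not
  -- vanish.
  refine ⟨_, hU, fun y => b (φ y) / d (φ y), ?_, fun y hy => ?_⟩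
  · have h1 : ContDiffOn ℝ ∞ (fun v => b v / d v)
        (({v | 0 ≤ v 0} ∩ Metric.ball (φ p) r) ∩ {v | d v ≠ 0}) :=
      (hb.mono inter_subset_left).div (hd.mono inter_subset_left) fun v hv => hv.2
    refine h1.contMDiffOn.comp ((contMDiffOn_extChartAt (I := 𝓡∂ (k + q + 1)) (x := p)).mono ?_) hmaps
    rw [← extChartAt_source (𝓡∂ (k + q + 1))]
    exact inter_subset_left
  · have hm := hmaps y hy
    have e1 := hfb _ hm.1
    have e2 := hxd _ hm.1
    simp only [Function.comp_apply] at e1 e2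
    have hl : (extChartAt (𝓡∂ (k + q + 1)) p).symm (φ y) = y := φ.left_inv hy.1
    rw [hl] at e1 e2
    have : d (φ y) ≠ 0 := hm.2
    simp only [mem_ofPred_eq]
    rw [e1, e2]
    field_simp

/-- The interior is dense. -/
theorem dense_interior_manifold : Dense ((𝓡∂ (k + q + 1)).interior M) := by
  intro p
  by_cases hp : p ∈ (𝓡∂ (k + q + 1)).interior M
  · exact subset_closure hp
  have hpb : p ∈ (𝓡∂ (k + q + 1)).boundary M := by
    rw [← ModelWithCorners.compl_interior]; exact hp
  rw [mem_closure_iff_nhds]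
  intro t ht
  have hc := extChartAt_boundary_coord hpb
  have h1 : (extChartAt (𝓡∂ (k + q + 1)) p).symm ⁻¹' t ∩ (extChartAt (𝓡∂ (k + q + 1)) p).target ∈
      𝓝[range (𝓡∂ (k + q + 1))] (extChartAt (𝓡∂ (k + q + 1)) p p) :=
    inter_mem ((continuousAt_extChartAt_symm p).continuousWithinAt.preimage_mem_nhdsWithin
      (by rwa [extChartAt_to_inv])) (extChartAt_target_mem_nhdsWithin p)
  obtain ⟨r, hr, hrt⟩ := Metric.mem_nhdsWithin_iff.1 h1
  set c := extChartAt (𝓡∂ (k + q + 1)) p p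
  -- A small move in the inward coordinate leaves the boundary without leaving the neighbourhood.
  let v : EuclideanSpace ℝ (Fin (k + q + 1)) := c + (r / 2) • EuclideanSpace.single 0 1
  have hv0 : 0 < v 0 := by simp [v, hc, hr]
  have hv : v ∈ Metric.ball c r ∩ range (𝓡∂ (k + q + 1)) := by
    refine ⟨by simp [v, norm_smul, abs_of_pos hr, hr], ?_⟩
    rw [range_modelWithCornersEuclideanHalfSpace]
    exact hv0.le
  obtain ⟨hvt, hvT⟩ := hrt hv
  refine ⟨_, hvt, ?_⟩
  have hs := (extChartAt (𝓡∂ (k + q + 1)) p).map_target hvT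
  refine ((𝓡∂ (k + q + 1)).isInteriorPoint_iff_of_mem_atlas (n := ∞) (by simp)
    (chart_mem_atlas _ p) (by rwa [extChartAt_source] at hs)).2 ?_
  change extChartAt (𝓡∂ (k + q + 1)) p _ ∈ interior (extChartAt (𝓡∂ (k + q + 1)) p).target
  rw [(extChartAt (𝓡∂ (k + q + 1)) p).right_inv hvT]
  have h5 : v ∈ interior (range (𝓡∂ (k + q + 1))) := by
    rw [interior_range_modelWithCornersEuclideanHalfSpace]; exact hv0
  obtain ⟨y, hy⟩ := hv.2
  rw [extChartAt_target] at hvT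
  have hyt : y ∈ (chartAt (EuclideanHalfSpace (k + q + 1)) p).target := by
    have := hvT.1
    rwa [mem_preimage, ← hy, ModelWithCorners.left_inv] at this
  have h6 := (chartAt (EuclideanHalfSpace (k + q + 1)) p).mem_interior_extend_target
    (I := 𝓡∂ (k + q + 1)) hyt (by rw [hy]; exact h5)
  rw [hy] at h6
  exact h6

end Division

/-! ### Edge vector fields, derivations and bundle endomorphisms -/

section OperatorCalculus

variable {k q : ℕ} {M N Y : Type*}
  [TopologicalSpace M] [ChartedSpace (EuclideanHalfSpace (k + q + 1)) M]
  [TopologicalSpace N] [ChartedSpace (EuclideanSpace ℝ (Fin (k + q))) N]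
  [TopologicalSpace Y] [ChartedSpace (EuclideanSpace ℝ (Fin q)) Y]
  [IsManifold (𝓡∂ (k + q + 1)) ∞ M]
  {G : FiberedBoundary k q M N Y}
  {F : Type*} [NormedAddCommGroup F] [NormedSpace ℝ F] {E : M → Type*}
  [TopologicalSpace (TotalSpace F E)] [∀ p, NormedAddCommGroup (E p)]
  [∀ p, InnerProductSpace ℂ (E p)] [FiberBundle F E] [VectorBundle ℝ F E]
  [ContMDiffVectorBundle ∞ F E (𝓡∂ (k + q + 1))]
  [SmoothHermitianBundle (𝓡∂ (k + q + 1)) F E]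

/-! ### Edge vector fields -/

/-- An edge vector field annihilates, along the boundary, the functions that are constant along the
fibres. -/
theorem IsEdgeVectorField.dirDeriv_incl {V : ∀ p : M, TangentSpace (𝓡∂ (k + q + 1)) p}
    (hV : IsEdgeVectorField G V) {f : M → ℝ} (hf : ContMDiff (𝓡∂ (k + q + 1)) 𝓘(ℝ, ℝ) ∞ f)
    {h : Y → ℝ} (hh : ContMDiff (𝓡 q) 𝓘(ℝ, ℝ) ∞ h) (hfh : ∀ z, f (G.incl z) = h (G.proj z))
    (z : N) : dirDeriv V f (G.incl z) = 0 := by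
  obtain ⟨w, hw, hwV⟩ := hV.2 z
  have h1 : (mfderiv (𝓡∂ (k + q + 1)) 𝓘(ℝ, ℝ) f (G.incl z)).comp
      (mfderiv (𝓡 (k + q)) (𝓡∂ (k + q + 1)) G.incl z) =
      (mfderiv (𝓡 q) 𝓘(ℝ, ℝ) h (G.proj z)).comp (mfderiv (𝓡 (k + q)) (𝓡 q) G.proj z) := by
    rw [← mfderiv_comp z ((hf _).mdifferentiableAt (by simp))
      ((G.contMDiff_incl z).mdifferentiableAt (by simp)),
      ← mfderiv_comp z ((hh _).mdifferentiableAt (by simp))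
      ((G.isSubmersion_proj.contMDiff z).mdifferentiableAt (by simp))]
    congr 1
    funext z
    exact hfh z
  have h2 := DFunLike.congr_fun h1 w
  have h3 : mfderiv (𝓡 q) 𝓘(ℝ, ℝ) h (G.proj z) (mfderiv (𝓡 (k + q)) (𝓡 q) G.proj z w) = 0 := by
    rw [hw]
    exact map_zero _
  rw [dirDeriv, ← hwV]
  exact h2.trans h3

theorem FiberedBoundary.x_incl (G : FiberedBoundary k q M N Y) (z : N) : G.x (G.incl z) = 0 :=
  (G.x_eq_zero_iff _).2 (G.range_incl ▸ mem_range_self z)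

theorem FiberedBoundary.x_pos_iff (G : FiberedBoundary k q M N Y) (p : M) :
    0 < G.x p ↔ p ∈ (𝓡∂ (k + q + 1)).interior M := by
  rw [(G.x_nonneg p).lt_iff_ne', ne_eq, G.x_eq_zero_iff,
    ModelWithCorners.interior, ModelWithCorners.boundary, mem_ofPred_eq, mem_ofPred_eq,
    ModelWithCorners.isInteriorPoint_iff_not_isBoundaryPoint]

variable [T2Space M] [CompactSpace M]

theorem FiberedBoundary.exists_eq_x_mul' {f : M → ℝ}
    (hf : ContMDiff (𝓡∂ (k + q + 1)) 𝓘(ℝ, ℝ) ∞ f) (hf0 : ∀ z, f (G.incl z) = 0) :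
    ∃ a : M → ℝ, ContMDiff (𝓡∂ (k + q + 1)) 𝓘(ℝ, ℝ) ∞ a ∧ ∀ p, f p = G.x p * a p := by
  refine G.exists_eq_x_mul hf fun p hp => ?_
  rw [← G.range_incl] at hp
  obtain ⟨z, rfl⟩ := hp
  exact hf0 z

/-- The derivative of a basic function along an edge field vanishes on the boundary, so it can be
divided by `x`. For `f = x` this gives the coefficient `a` of s ∂_s in the lifted operators; for a
phase function it gives the slope `b`. -/
theorem IsEdgeVectorField.exists_eq_x_mul {V : ∀ p : M, TangentSpace (𝓡∂ (k + q + 1)) p}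
    (hV : IsEdgeVectorField G V) {f : M → ℝ} (hf : IsBasic G f) :
    ∃ a : M → ℝ, ContMDiff (𝓡∂ (k + q + 1)) 𝓘(ℝ, ℝ) ∞ a ∧
      ∀ p, dirDeriv V f p = G.x p * a p := by
  obtain ⟨hf, h, hh, hfh⟩ := hf
  exact FiberedBoundary.exists_eq_x_mul' (contMDiff_dirDeriv hV.1 hf)
    (hV.dirDeriv_incl hf hh hfh)

theorem FiberedBoundary.isBasic_x (G : FiberedBoundary k q M N Y) : IsBasic G G.x :=
  ⟨G.contMDiff_x, fun _ => 0, contMDiff_const, fun z => G.x_incl z⟩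

/-- Two continuous functions with the same product with `x` agree. -/
theorem FiberedBoundary.eq_of_x_mul_eq (G : FiberedBoundary k q M N Y) {a b : M → ℝ}
    (ha : Continuous a) (hb : Continuous b) (h : ∀ p, G.x p * a p = G.x p * b p) : a = b := by
  refine ha.ext_on (dense_interior_manifold (k := k) (q := q)) hb fun p hp => ?_
  exact mul_left_cancel₀ ((G.x_pos_iff p).2 hp).ne' (h p)

/-! ### Complex multiples of sections -/

/-- Multiplication of a smooth section by a smooth complex function. -/
def mulSecC (f : M → ℂ) (hf : ContMDiff (𝓡∂ (k + q + 1)) 𝓘(ℝ, ℂ) ∞ f) (s : Sec k q F E) :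
    Sec k q F E :=
  ⟨fun p => f p • s.1 p, IsSmoothAlong.smul_complex hf s.2⟩

theorem contMDiff_re {f : M → ℂ} (hf : ContMDiff (𝓡∂ (k + q + 1)) 𝓘(ℝ, ℂ) ∞ f) :
    ContMDiff (𝓡∂ (k + q + 1)) 𝓘(ℝ, ℝ) ∞ (fun p => (f p).re) := Complex.reCLM.contMDiff.comp hf

theorem contMDiff_im {f : M → ℂ} (hf : ContMDiff (𝓡∂ (k + q + 1)) 𝓘(ℝ, ℂ) ∞ f) :
    ContMDiff (𝓡∂ (k + q + 1)) 𝓘(ℝ, ℝ) ∞ (fun p => (f p).im) := Complex.imCLM.contMDiff.comp hf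

theorem mulSecC_eq {f : M → ℂ} (hf : ContMDiff (𝓡∂ (k + q + 1)) 𝓘(ℝ, ℂ) ∞ f) (s : Sec k q F E) :
    mulSecC f hf s = mulSec _ (contMDiff_re hf) s + Complex.I • mulSec _ (contMDiff_im hf) s := by
  ext p
  change f p • s.1 p = (f p).re • s.1 p + Complex.I • (f p).im • s.1 p
  conv_lhs => rw [← Complex.re_add_im (f p)]
  rw [add_smul, mul_comm, mul_smul, Complex.coe_smul, Complex.coe_smul]

/-- The derivative of a complex function along a vector field. -/
def dirDerivC (V : ∀ p : M, TangentSpace (𝓡∂ (k + q + 1)) p) (f : M → ℂ) (p : M) : ℂ :=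
  dirDeriv V (fun p => (f p).re) p + Complex.I * dirDeriv V (fun p => (f p).im) p

theorem bundleEnd_mulSecC {B : Module.End ℂ (Sec k q F E)} (hB : B ∈ bundleEnd k q F E)
    {f : M → ℂ} (hf : ContMDiff (𝓡∂ (k + q + 1)) 𝓘(ℝ, ℂ) ∞ f) (s : Sec k q F E) :
    B (mulSecC f hf s) = mulSecC f hf (B s) := by
  rw [mulSecC_eq, mulSecC_eq, map_add, map_smul, hB _ (contMDiff_re hf), hB _ (contMDiff_im hf)]

/-- `D` is a derivation over the edge vector field `V`. -/
def IsDerivationOver (V : ∀ p : M, TangentSpace (𝓡∂ (k + q + 1)) p)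
    (D : Module.End ℂ (Sec k q F E)) : Prop :=
  ∀ f hf s p, (D (mulSec f hf s)).1 p = dirDeriv V f p • s.1 p + f p • (D s).1 p

theorem IsDerivationOver.mulSecC {V : ∀ p : M, TangentSpace (𝓡∂ (k + q + 1)) p}
    {D : Module.End ℂ (Sec k q F E)} (hD : IsDerivationOver V D)
    {f : M → ℂ} (hf : ContMDiff (𝓡∂ (k + q + 1)) 𝓘(ℝ, ℂ) ∞ f) (s : Sec k q F E) (p : M) :
    (D (mulSecC f hf s)).1 p = dirDerivC V f p • s.1 p + f p • (D s).1 p := by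
  rw [mulSecC_eq, map_add, map_smul]
  change (D (mulSec _ (contMDiff_re hf) s)).1 p +
    Complex.I • (D (mulSec _ (contMDiff_im hf) s)).1 p = _
  rw [hD _ (contMDiff_re hf), hD _ (contMDiff_im hf), dirDerivC]
  conv_rhs => rw [← Complex.re_add_im (f p)]
  simp only [← Complex.coe_smul]
  module

/-! ### The normal form of second order edge operators -/

theorem bundleEnd_smul {B : Module.End ℂ (Sec k q F E)} (hB : B ∈ bundleEnd k q F E) (c : ℂ) :
    c • B ∈ bundleEnd k q F E := by
  intro f hf s
  rw [LinearMap.smul_apply, LinearMap.smul_apply, hB f hf s]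
  ext p
  change c • f p • (B s).1 p = f p • c • (B s).1 p
  rw [smul_comm]

/-- A product of spans is the span of the products; addition is recorded by a disjoint union of
index types, and scalars are absorbed into the bundle endomorphisms. -/
theorem exists_normalForm {P : Module.End ℂ (Sec k q F E)} (hP : P ∈ edgeDiffOps G F E 2) :
    ∃ (ι : Type) (_ : Fintype ι) (B D D' : ι → Module.End ℂ (Sec k q F E)),
      (∀ i, B i ∈ bundleEnd k q F E) ∧ (∀ i, D i ∈ edgeDerivations G F E) ∧
      (∀ i, D' i ∈ edgeDerivations G F E) ∧ P = ∑ i, B i * (D i * D' i) := by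
  rw [edgeDiffOps, pow_two, Submodule.span_mul_span, Submodule.span_mul_span] at hP
  induction hP using Submodule.span_induction with
  | mem T hT =>
    obtain ⟨B, hB, R, ⟨D, hD, D', hD', rfl⟩, rfl⟩ := hT
    exact ⟨Unit, inferInstance, fun _ => B, fun _ => D, fun _ => D', fun _ => hB, fun _ => hD,
      fun _ => hD', by simp⟩
  | zero => exact ⟨Empty, inferInstance, nofun, nofun, nofun, nofun, nofun, nofun, by simp⟩
  | add S T _ _ hS hT =>
    obtain ⟨ι, _, B, D, D', hB, hD, hD', rfl⟩ := hS
    obtain ⟨ι', _, C, R, R', hC, hR, hR', rfl⟩ := hT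
    refine ⟨ι ⊕ ι', inferInstance, Sum.elim B C, Sum.elim D R, Sum.elim D' R', ?_, ?_, ?_, ?_⟩
    · rintro (i | i); exacts [hB i, hC i]
    · rintro (i | i); exacts [hD i, hR i]
    · rintro (i | i); exacts [hD' i, hR' i]
    · simp
  | smul c T _ hT =>
    obtain ⟨ι, _, B, D, D', hB, hD, hD', rfl⟩ := hT
    refine ⟨ι, inferInstance, fun i => c • B i, D, D', fun i => bundleEnd_smul (hB i) c, hD, hD', ?_⟩
    simp [Finset.smul_sum]

/-! ### Locality -/

variable (Φ : GlobalFrame (𝓡∂ (k + q + 1)) F E)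

/-- The sections of a global frame. -/
def GlobalFrame.sec (i : Φ.ι) : Sec k q F E := ⟨Φ.e i, Φ.smooth_e i⟩

/-- The coefficients of a section in a global frame. -/
def GlobalFrame.coord (i : Φ.ι) (s : Sec k q F E) (p : M) : ℝ := Φ.coeff i p (s.1 p)

theorem GlobalFrame.contMDiff_coord (i : Φ.ι) (s : Sec k q F E) :
    ContMDiff (𝓡∂ (k + q + 1)) 𝓘(ℝ, ℝ) ∞ (Φ.coord i s) :=
  Φ.smooth_coeff_along i s.2

theorem sec_sum_apply {ι : Type*} (t : Finset ι) (s : ι → Sec k q F E) (p : M) :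
    (∑ i ∈ t, s i).1 p = ∑ i ∈ t, (s i).1 p := by
  rw [Submodule.coe_sum, Finset.sum_apply]

theorem GlobalFrame.sum_mulSec (s : Sec k q F E) :
    ∑ i, mulSec _ (Φ.contMDiff_coord i s) (Φ.sec i) = s := by
  ext p
  rw [sec_sum_apply]
  exact Φ.sum_coeff p (s.1 p)

/-- Linearity over functions, applied to the frame expansion, shows that the value at `p` depends
only on the value of `s` at `p`. This is how an operator on global sections acquires an action on
fibres. -/
theorem bundleEnd_apply_eq {B : Module.End ℂ (Sec k q F E)} (hB : B ∈ bundleEnd k q F E)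
    (s : Sec k q F E) (p : M) :
    (B s).1 p = ∑ i, Φ.coeff i p (s.1 p) • (B (Φ.sec i)).1 p := by
  conv_lhs => rw [← Φ.sum_mulSec s, map_sum, sec_sum_apply]
  refine Finset.sum_congr rfl fun i _ => ?_
  rw [hB]
  rfl

/-- The Leibniz rule on the frame expansion: all dependence on derivatives of `s` passes through
scalar coefficient functions, so chain rules and vanishing statements need only be known for
functions. -/
theorem IsDerivationOver.apply_eq {V : ∀ p : M, TangentSpace (𝓡∂ (k + q + 1)) p}
    {D : Module.End ℂ (Sec k q F E)} (hD : IsDerivationOver V D) (s : Sec k q F E) (p : M) :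
    (D s).1 p = ∑ i, (dirDeriv V (Φ.coord i s) p • Φ.e i p +
      Φ.coeff i p (s.1 p) • (D (Φ.sec i)).1 p) := by
  conv_lhs => rw [← Φ.sum_mulSec s, map_sum, sec_sum_apply]
  refine Finset.sum_congr rfl fun i _ => ?_
  rw [hD]
  rfl

/-- A section through a given vector. -/
def GlobalFrame.through (p : M) (v : E p) : Sec k q F E := ∑ i, (Φ.coeff i p v : ℂ) • Φ.sec i

theorem GlobalFrame.through_apply (p : M) (v : E p) : (Φ.through p v).1 p = v := by
  rw [GlobalFrame.through, sec_sum_apply]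
  conv_rhs => rw [← Φ.sum_coeff p v]
  refine Finset.sum_congr rfl fun i _ => ?_
  change (Φ.coeff i p v : ℂ) • Φ.e i p = _
  rw [Complex.coe_smul]

theorem bundleEnd_congr (Φ : GlobalFrame (𝓡∂ (k + q + 1)) F E) {B : Module.End ℂ (Sec k q F E)} (hB : B ∈ bundleEnd k q F E)
    {s t : Sec k q F E} {p : M} (h : s.1 p = t.1 p) : (B s).1 p = (B t).1 p := by
  rw [bundleEnd_apply_eq Φ hB, bundleEnd_apply_eq Φ hB, h]

/-- The action of a bundle endomorphism on a fibre. -/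
def fiberEnd {B : Module.End ℂ (Sec k q F E)} (hB : B ∈ bundleEnd k q F E) (p : M) :
    E p →ₗ[ℂ] E p where
  toFun v := (B (Φ.through p v)).1 p
  map_add' v w := by
    rw [bundleEnd_congr Φ hB (t := Φ.through p v + Φ.through p w), map_add]
    · rfl
    · change _ = (Φ.through p v).1 p + (Φ.through p w).1 p
      simp only [Φ.through_apply]
  map_smul' c v := by
    rw [bundleEnd_congr Φ hB (t := c • Φ.through p v), map_smul]
    · rfl
    · change _ = c • (Φ.through p v).1 p
      simp only [Φ.through_apply]

theorem fiberEnd_apply {B : Module.End ℂ (Sec k q F E)} (hB : B ∈ bundleEnd k q F E) (p : M)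
    (s : Sec k q F E) : fiberEnd Φ hB p (s.1 p) = (B s).1 p :=
  bundleEnd_congr Φ hB (Φ.through_apply p _)

end OperatorCalculus

/-! ### The rescaling limit of integrals concentrating at the boundary -/

section LimitLemma

variable {X N : Type*} [TopologicalSpace X] [CompactSpace X] [MeasurableSpace X] [BorelSpace X]
  [TopologicalSpace N] [CompactSpace N] [MeasurableSpace N] [BorelSpace N]
  {μ : Measure X} [IsFiniteMeasure μ] {μN : Measure N} [IsFiniteMeasure μN] {x : X → ℝ} {i : N → X}

theorem exists_bound_of_eq_zero {k : X × ℝ → ℝ} (hk : Continuous k) {s₁ : ℝ}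
    (h0 : ∀ p s, s ∉ Icc 0 s₁ → k (p, s) = 0) : ∃ C, 0 ≤ C ∧ ∀ n, |k n| ≤ C := by
  obtain ⟨C, hC⟩ := (isCompact_univ.prod (isCompact_Icc (a := (0 : ℝ)) (b := s₁))).exists_bound_of_continuousOn
    hk.continuousOn
  refine ⟨max C 0, le_max_right _ _, fun ⟨p, s⟩ => ?_⟩
  by_cases hs : s ∈ Icc 0 s₁
  · exact (hC (p, s) ⟨mem_univ _, hs⟩).trans (le_max_left _ _)
  · rw [h0 p s hs, abs_zero]
    exact le_max_right _ _

theorem integrable_of_bound {Ω : Type*} [MeasurableSpace Ω] {ν : Measure Ω} [IsFiniteMeasure ν]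
    {f : Ω → ℝ} (hf : AEStronglyMeasurable f ν) {C : ℝ} (hC : ∀ n, |f n| ≤ C) : Integrable f ν :=
  Integrable.of_bound hf C (Eventually.of_forall hC)

/-- A layer-cake formula. Since `k` vanishes at `s₁`, k(p, ρx) is minus the integral of its
derivative `g` from ρx to `s₁`; Fubini then produces integrals over the sublevel sets x < t/ρ, the
only ones that the definition of the boundary density controls. -/
theorem integral_comp_mul_eq {k g : X × ℝ → ℝ} (hx : Continuous x) (hx0 : ∀ p, 0 ≤ x p)
    (hg : Continuous g)
    (hkg : ∀ p t, HasDerivAt (fun s => k (p, s)) (g (p, t)) t) {s₁ : ℝ}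
    (hk0 : ∀ p s, s ∉ Ioo 0 s₁ → k (p, s) = 0) {C : ℝ} (hC : ∀ n, |g n| ≤ C)
    {ρ : ℝ} (hρ : 0 < ρ) :
    Integrable (fun t => ∫ p in {p | x p < t / ρ}, g (p, t) ∂μ) (volume.restrict (Ioc 0 s₁)) ∧
    ∫ p, k (p, ρ * x p) ∂μ =
      - ∫ t in Ioc 0 s₁, (∫ p in {p | x p < t / ρ}, g (p, t) ∂μ) := by
  have hS : MeasurableSet {n : X × ℝ | ρ * x n.1 < n.2} :=
    measurableSet_lt (by fun_prop) measurable_snd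
  have hint : Integrable (indicator {n : X × ℝ | ρ * x n.1 < n.2} g)
      (μ.prod (volume.restrict (Ioc 0 s₁))) :=
    (integrable_of_bound hg.aestronglyMeasurable hC).indicator hS
  have h1 : ∀ t, ∫ p in {p | x p < t / ρ}, g (p, t) ∂μ =
      ∫ p, indicator {n : X × ℝ | ρ * x n.1 < n.2} g (p, t) ∂μ := by
    intro t
    have hm : MeasurableSet {p : X | x p < t / ρ} := measurableSet_lt hx.measurable measurable_const
    rw [← integral_indicator hm]
    refine integral_congr_ae (Eventually.of_forall fun p => ?_)
    simp only [indicator, mem_ofPred_eq, lt_div_iff₀' hρ]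
  have h2 : ∀ p, k (p, ρ * x p) =
      - ∫ t in Ioc 0 s₁, indicator {n : X × ℝ | ρ * x n.1 < n.2} g (p, t) := by
    intro p
    have h3 : ∀ t, indicator {n : X × ℝ | ρ * x n.1 < n.2} g (p, t) =
        indicator (Ioi (ρ * x p)) (fun t => g (p, t)) t := fun t => rfl
    simp only [h3]
    rw [setIntegral_indicator measurableSet_Ioi, Ioc_inter_Ioi]
    have hp : 0 ≤ ρ * x p := mul_nonneg hρ.le (hx0 p)
    rw [max_eq_right hp]
    rcases le_or_gt (ρ * x p) s₁ with h | h
    · rw [← intervalIntegral.integral_of_le h,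
        intervalIntegral.integral_eq_sub_of_hasDerivAt (fun t _ => hkg p t)
          ((hg.comp (by fun_prop : Continuous fun t : ℝ => (p, t))).intervalIntegrable _ _),
        hk0 p s₁ (by simp), zero_sub, neg_neg]
    · rw [Ioc_eq_empty (not_lt.2 h.le), setIntegral_empty, neg_zero]
      exact hk0 p _ fun h' => absurd h'.2 (not_lt.2 h.le)
  constructor
  · simp only [h1]
    exact hint.integral_prod_right
  · simp only [h1, h2]
    rw [integral_neg, integral_integral_swap]
    exact hint

/-- In the layer-cake formula ρ times the integral over x < t/ρ tends to t times the boundary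
integral. The limit −∫ t g dt is turned back into ∫ k dt by parts. -/
theorem tendsto_mul_integral_comp_mul {k g : X × ℝ → ℝ} (hx : Continuous x) (hx0 : ∀ p, 0 ≤ x p)
    (hi : Continuous i)
    (H : ∀ f : X → ℝ, Continuous f →
      Tendsto (fun ε : ℝ => ε⁻¹ * ∫ p in {p | x p < ε}, f p ∂μ) (𝓝[>] 0) (𝓝 (∫ z, f (i z) ∂μN)))
    (hk : Continuous k) (hg : Continuous g)
    (hkg : ∀ p t, HasDerivAt (fun s => k (p, s)) (g (p, t)) t) {s₁ : ℝ} (hs₁ : 0 < s₁)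
    (hk0 : ∀ p s, s ∉ Ioo 0 s₁ → k (p, s) = 0) :
    Tendsto (fun ρ : ℝ => ρ * ∫ p, k (p, ρ * x p) ∂μ) atTop
      (𝓝 (∫ z, (∫ s in Ioc 0 s₁, k (i z, s)) ∂μN)) := by
  have hg0 : ∀ p s, s ∉ Icc 0 s₁ → g (p, s) = 0 := by
    intro p s hs
    have h1 : (fun s => k (p, s)) =ᶠ[𝓝 s] fun _ => 0 := by
      filter_upwards [isClosed_Icc.isOpen_compl.mem_nhds hs] with t ht
      exact hk0 p t fun h => ht (Ioo_subset_Icc_self h)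
    exact (hkg p s).unique ((hasDerivAt_const s (0 : ℝ)).congr_of_eventuallyEq h1)
  obtain ⟨C, hC0, hC⟩ := exists_bound_of_eq_zero hg hg0
  have hrep : ∀ z, ∫ s in Ioc 0 s₁, k (i z, s) = - ∫ t in Ioc 0 s₁, t * g (i z, t) := by
    intro z
    have hc : Continuous fun t : ℝ => (i z, t) := by fun_prop
    have h1 : ∀ t ∈ uIcc 0 s₁, HasDerivAt (fun t => t * k (i z, t))
        (1 * k (i z, t) + t * g (i z, t)) t := fun t _ => (hasDerivAt_id t).mul (hkg (i z) t)
    have i1 : IntervalIntegrable (fun t => 1 * k (i z, t)) volume 0 s₁ :=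
      (continuous_const.mul (hk.comp hc)).intervalIntegrable _ _
    have i2 : IntervalIntegrable (fun t => t * g (i z, t)) volume 0 s₁ :=
      (continuous_id.mul (hg.comp hc)).intervalIntegrable _ _
    have h2 := intervalIntegral.integral_eq_sub_of_hasDerivAt h1 (i1.add i2)
    rw [intervalIntegral.integral_add i1 i2, hk0 (i z) s₁ (by simp), mul_zero, zero_mul,
      sub_zero] at h2
    simp only [one_mul] at h2
    rw [← intervalIntegral.integral_of_le hs₁.le, ← intervalIntegral.integral_of_le hs₁.le]
    exact eq_neg_of_add_eq_zero_left h2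
  have hint : Integrable (fun n : N × ℝ => n.2 * g (i n.1, n.2))
      (μN.prod (volume.restrict (Ioc 0 s₁))) := by
    have hc : Continuous fun n : N × ℝ => n.2 * g (i n.1, n.2) :=
      continuous_snd.mul (hg.comp ((hi.comp continuous_fst).prodMk continuous_snd))
    refine integrable_of_bound (C := s₁ * C) hc.aestronglyMeasurable fun n => ?_
    by_cases hn : n.2 ∈ Icc 0 s₁
    · have h1 : |n.2| ≤ s₁ := by rw [abs_of_nonneg hn.1]; exact hn.2
      have h2 := hC (i n.1, n.2)
      rw [abs_mul]
      gcongr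
    · rw [hg0 _ _ hn, mul_zero, abs_zero]
      positivity
  have hlim : ∫ z, (∫ s in Ioc 0 s₁, k (i z, s)) ∂μN =
      ∫ t in Ioc 0 s₁, -(t * ∫ z, g (i z, t) ∂μN) := by
    simp only [hrep]
    rw [integral_neg, integral_integral_swap hint, ← integral_neg]
    simp only [integral_const_mul]
  rw [hlim]
  -- The hypothesis for the constant function 1 bounds the rescaled mass of the largest sublevel
  -- set, which dominates the integrands for all t ≤ `s₁`.
  have hmass : ∀ᶠ ρ : ℝ in atTop, ρ * μ.real {p | x p < s₁ / ρ} ≤ s₁ * (μN.real univ + 1) := by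
    have hε : Tendsto (fun ρ : ℝ => s₁ / ρ) atTop (𝓝[>] 0) := by
      refine tendsto_nhdsWithin_iff.2 ⟨tendsto_const_nhds.div_atTop tendsto_id, ?_⟩
      filter_upwards [eventually_gt_atTop 0] with ρ hρ
      exact div_pos hs₁ hρ
    have h := (H (fun _ => 1) continuous_const).comp hε
    have h' := h.eventually_le_const (u := μN.real univ + 1) (by simp)
    filter_upwards [h', eventually_gt_atTop 0] with ρ h1 hρ
    simp only [Function.comp_apply, integral_const, smul_eq_mul, mul_one, measureReal_restrict_apply_univ,
      inv_div] at h1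
    rw [div_mul_eq_mul_div, div_le_iff₀ hs₁] at h1
    linarith
  have hconv : Tendsto (fun ρ : ℝ => ∫ t in Ioc 0 s₁,
      -(ρ * ∫ p in {p | x p < t / ρ}, g (p, t) ∂μ)) atTop
      (𝓝 (∫ t in Ioc 0 s₁, -(t * ∫ z, g (i z, t) ∂μN))) := by
    refine tendsto_integral_filter_of_dominated_convergence
      (fun _ => s₁ * (μN.real univ + 1) * C) ?_ ?_ (integrable_const _) ?_
    · filter_upwards [eventually_gt_atTop 0] with ρ hρ
      exact ((integral_comp_mul_eq hx hx0 hg hkg hk0 hC hρ).1.const_mul ρ).neg.aestronglyMeasurable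
    · filter_upwards [hmass, eventually_gt_atTop 0] with ρ h1 hρ
      filter_upwards [ae_restrict_mem measurableSet_Ioc] with t ht
      rw [norm_neg, norm_mul, Real.norm_of_nonneg hρ.le]
      have h2 : ‖∫ p in {p | x p < t / ρ}, g (p, t) ∂μ‖ ≤ C * μ.real {p | x p < t / ρ} :=
        norm_setIntegral_le_of_norm_le_const (measure_lt_top _ _) fun p _ => hC _
      have h3 : μ.real {p | x p < t / ρ} ≤ μ.real {p | x p < s₁ / ρ} := by
        refine measureReal_mono (fun p hp => lt_of_lt_of_le (show x p < t / ρ from hp) ?_)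
        gcongr
        exact ht.2
      calc _ ≤ ρ * (C * μ.real {p | x p < s₁ / ρ}) := by gcongr; exact h2.trans (by gcongr)
        _ = (ρ * μ.real {p | x p < s₁ / ρ}) * C := by ring
        _ ≤ _ := by gcongr
    · filter_upwards [ae_restrict_mem measurableSet_Ioc] with t ht
      have hε : Tendsto (fun ρ : ℝ => t / ρ) atTop (𝓝[>] 0) := by
        refine tendsto_nhdsWithin_iff.2 ⟨tendsto_const_nhds.div_atTop tendsto_id, ?_⟩
        filter_upwards [eventually_gt_atTop 0] with ρ hρ
        exact div_pos ht.1 hρ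
      have h := ((H (fun p => g (p, t)) (by fun_prop)).comp hε).const_mul t
      refine h.neg.congr' ?_
      filter_upwards [eventually_gt_atTop 0] with ρ hρ
      have ht0 : t ≠ 0 := ht.1.ne'
      simp only [Function.comp_apply]
      field_simp
  refine hconv.congr' ?_
  filter_upwards [eventually_gt_atTop 0] with ρ hρ
  rw [(integral_comp_mul_eq hx hx0 hg hkg hk0 hC hρ).2, integral_neg, integral_const_mul, mul_neg]

end LimitLemma

/-! ### The measure of x⁻¹L²_b as x times the density -/

section WedgeMeasure

theorem integral_wedgeMeasure {X : Type*} [MeasurableSpace X] {μ : Measure X} {x : X → ℝ}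
    (hx : Measurable x) (hx0 : ∀ᵐ p ∂μ, 0 ≤ x p) {W : Type*} [NormedAddCommGroup W] [NormedSpace ℝ W]
    (f : X → W) : ∫ p, f p ∂(wedgeMeasure μ x) = ∫ p, x p • f p ∂μ := by
  rw [wedgeMeasure, integral_withDensity_eq_integral_toReal_smul (by fun_prop)
    (Eventually.of_forall fun _ => ENNReal.ofReal_lt_top),
    integral_withDensity_eq_integral_toReal_smul (by fun_prop)
    (Eventually.of_forall fun _ => ENNReal.ofReal_lt_top)]
  refine integral_congr_ae ?_
  filter_upwards [hx0] with p hp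
  rw [ENNReal.toReal_ofReal (by positivity), ENNReal.toReal_ofReal (by positivity), smul_smul]
  congr 1
  -- At x = 0 the product of the two densities and `x` both vanish, the inverse of zero being zero.
  rcases hp.eq_or_lt with h | h
  · rw [← h]; simp
  · field_simp

end WedgeMeasure

/-! ### Compactness of boundary, base and fibres; localization to a fibre -/

section FiberLemma

variable {k q : ℕ} {M N Y Z : Type*}
  [TopologicalSpace M] [ChartedSpace (EuclideanHalfSpace (k + q + 1)) M]
  [TopologicalSpace N] [ChartedSpace (EuclideanSpace ℝ (Fin (k + q))) N]
  [TopologicalSpace Y] [ChartedSpace (EuclideanSpace ℝ (Fin q)) Y]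
  [TopologicalSpace Z] [ChartedSpace (EuclideanSpace ℝ (Fin k)) Z]

theorem FiberedBoundary.isClosedEmbedding_incl [T2Space M] (G : FiberedBoundary k q M N Y) :
    IsClosedEmbedding G.incl := by
  refine ⟨G.isSmoothEmbedding_incl.isEmbedding, ?_⟩
  rw [G.range_incl]
  have h : (𝓡∂ (k + q + 1)).boundary M = G.x ⁻¹' {0} := by
    ext p
    exact (G.x_eq_zero_iff p).symm
  rw [h]
  exact isClosed_singleton.preimage G.contMDiff_x.continuous

theorem FiberedBoundary.compactSpace_boundary [T2Space M] [CompactSpace M]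
    (G : FiberedBoundary k q M N Y) : CompactSpace N := G.isClosedEmbedding_incl.compactSpace

theorem FiberedBoundary.t2Space_boundary [T2Space M] (G : FiberedBoundary k q M N Y) : T2Space N :=
  G.isSmoothEmbedding_incl.isEmbedding.t2Space

theorem FiberedBoundary.continuous_proj (G : FiberedBoundary k q M N Y) : Continuous G.proj :=
  G.isSubmersion_proj.contMDiff.continuous

theorem FiberedBoundary.compactSpace_base [T2Space M] [CompactSpace M]
    (G : FiberedBoundary k q M N Y) : CompactSpace Y := by
  have := G.compactSpace_boundary
  refine ⟨?_⟩
  rw [← G.surjective_proj.range_eq]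
  exact isCompact_range G.continuous_proj

theorem FiberModel.isClosedEmbedding_incl [T2Space Y] {G : FiberedBoundary k q M N Y} {y : Y}
    (j : FiberModel G y Z) : IsClosedEmbedding j.incl := by
  refine ⟨j.isSmoothEmbedding_incl.isEmbedding, ?_⟩
  rw [j.range_incl]
  exact isClosed_singleton.preimage G.continuous_proj

theorem FiberModel.compactSpace [T2Space M] [CompactSpace M] [T2Space Y]
    {G : FiberedBoundary k q M N Y} {y : Y} (j : FiberModel G y Z) : CompactSpace Z := by
  have := G.compactSpace_boundary
  exact j.isClosedEmbedding_incl.compactSpace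

theorem FiberModel.proj_incl {G : FiberedBoundary k q M N Y} {y : Y} (j : FiberModel G y Z) (z : Z) :
    G.proj (j.incl z) = y := by
  have h : j.incl z ∈ G.proj ⁻¹' {y} := j.range_incl ▸ mem_range_self z
  exact h

variable [MeasurableSpace N] [BorelSpace N] [MeasurableSpace Y] [BorelSpace Y]
  [MeasurableSpace Z]

/-- The fibre integral of a function is nonnegative as soon as its integrals against the squares of
the basic functions are. -/
theorem IsFiberDensity.integral_nonneg [T2Space M] [CompactSpace M] [T2Space Y]
    [IsManifold (𝓡 q) ∞ Y]
    {G : FiberedBoundary k q M N Y} {y : Y} {j : FiberModel G y Z} {μN : Measure N}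
    [IsFiniteMeasure μN] {μY : Measure Y} {μZ : Measure Z} (hμZ : IsFiberDensity j μN μY μZ)
    {f : N → ℝ} (hf : Continuous f)
    (h : ∀ χ : Y → ℝ, ContMDiff (𝓡 q) 𝓘(ℝ, ℝ) ∞ χ → 0 ≤ ∫ z, χ (G.proj z) ^ 2 * f z ∂μN) :
    0 ≤ ∫ z, f (j.incl z) ∂μZ := by
  have := G.compactSpace_boundary
  have := G.compactSpace_base
  -- Choose a smooth θ ≥ 0 with support exactly `B`. The functions nθ/(1 + nθ) are smooth, lie in
  -- [0, 1] and converge pointwise to the indicator of `B`, as do their squares.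
  have hopen : ∀ B : Set Y, IsOpen B → 0 ≤ ∫ z in G.proj ⁻¹' B, f z ∂μN := by
    intro B hB
    obtain ⟨θ, hθB, hθ, hθ0⟩ := hB.exists_contMDiff_support_eq (𝓡 q)
    have hθ' : ∀ y, 0 ≤ θ y := hθ0
    have hlim : Tendsto (fun n : ℕ => ∫ z, (n * θ (G.proj z) / (1 + n * θ (G.proj z))) ^ 2 * f z ∂μN)
        atTop (𝓝 (∫ z, indicator (G.proj ⁻¹' B) f z ∂μN)) := by
      obtain ⟨C, hC⟩ := (isCompact_univ (X := N)).exists_bound_of_continuousOn hf.continuousOn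
      refine tendsto_integral_of_dominated_convergence (fun _ => C) (fun n => ?_)
        (integrable_const _) (fun n => Eventually.of_forall fun z => ?_)
        (Eventually.of_forall fun z => ?_)
      · have hc : Continuous fun z => (n * θ (G.proj z) / (1 + n * θ (G.proj z))) ^ 2 * f z := by
          have h1 := G.continuous_proj
          have h2 := hθ.continuous
          refine Continuous.mul (Continuous.pow (Continuous.div (by fun_prop) (by fun_prop)
            fun z => ?_) 2) hf
          have := hθ' (G.proj z)
          positivity
        exact hc.aestronglyMeasurable
      · have h1 := hθ' (G.proj z)
        have h2 : n * θ (G.proj z) / (1 + n * θ (G.proj z)) ≤ 1 := by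
          rw [div_le_one (by positivity)]
          linarith
        have h3 : (n * θ (G.proj z) / (1 + n * θ (G.proj z))) ^ 2 ≤ 1 :=
          pow_le_one₀ (by positivity) h2
        rw [norm_mul, Real.norm_of_nonneg (by positivity)]
        exact (mul_le_of_le_one_left (norm_nonneg _) h3).trans (hC z (mem_univ z))
      · by_cases hz : G.proj z ∈ B
        · have hpos : 0 < θ (G.proj z) := by
            refine lt_of_le_of_ne (hθ' _) fun h0 => ?_
            rw [← hθB] at hz
            exact hz h0.symm
          rw [indicator_of_mem (show z ∈ G.proj ⁻¹' B from hz)]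
          have h1 : Tendsto (fun n : ℕ => n * θ (G.proj z) / (1 + n * θ (G.proj z))) atTop (𝓝 1) := by
            have h2 : Tendsto (fun n : ℕ => 1 - (1 + (n : ℝ) * θ (G.proj z))⁻¹) atTop
                (𝓝 (1 - 0)) := by
              refine tendsto_const_nhds.sub (tendsto_inv_atTop_zero.comp ?_)
              exact tendsto_atTop_add_const_left _ _
                (tendsto_natCast_atTop_atTop.atTop_mul_const hpos)
            rw [sub_zero] at h2
            refine h2.congr fun n => ?_
            have : (0 : ℝ) < 1 + n * θ (G.proj z) := by positivity
            field_simp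
            ring
          simpa using (h1.pow 2).mul_const (f z)
        · rw [indicator_of_notMem (show z ∉ G.proj ⁻¹' B from hz)]
          have h0 : θ (G.proj z) = 0 := by
            by_contra h0
            exact hz (hθB ▸ h0)
          simp [h0]
    rw [integral_indicator (G.continuous_proj.measurable hB.measurableSet)] at hlim
    refine ge_of_tendsto' hlim fun n => ?_
    refine h (fun y => n * θ y / (1 + n * θ y)) ?_
    refine ContMDiff.div₀ (contMDiff_const.mul hθ) (contMDiff_const.add (contMDiff_const.mul hθ))
      fun y => ?_
    have := hθ' y
    positivity
  -- The filter of shrinking open neighbourhoods is proper, so limits along it preserve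
  -- inequalities.
  have hne : ((𝓝 y).smallSets ⊓ 𝓟 {B | IsOpen B ∧ y ∈ B}).NeBot := by
    rw [inf_principal_neBot_iff]
    intro U hU
    obtain ⟨t, ht, htU⟩ := (hasBasis_smallSets _).mem_iff.1 hU
    obtain ⟨B, hBt, hB, hyB⟩ := mem_nhds_iff.1 ht
    exact ⟨B, htU hBt, hB, hyB⟩
  refine ge_of_tendsto (hμZ f hf) ?_
  filter_upwards [mem_inf_of_right (mem_principal_self _)] with B hB
  exact mul_nonneg (by positivity) (hopen B hB.1)

end FiberLemma

/-! ### Smooth positive densities -/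

section Density

variable {n : ℕ} {H X : Type*} [TopologicalSpace H]
  {J : ModelWithCorners ℝ (EuclideanSpace ℝ (Fin n)) H} [TopologicalSpace X] [ChartedSpace H X]
  [MeasurableSpace X] [BorelSpace X] {μ : Measure X}

/-- Near each point the density is at most its value there plus one in the chart, so the measure is
locally finite; compactness makes it finite. -/
theorem IsSmoothPositiveDensity.isFiniteMeasure [CompactSpace X]
    (hμ : IsSmoothPositiveDensity J μ) : IsFiniteMeasure μ := by
  have hloc : ∀ p : X, μ.FiniteAtFilter (𝓝 p) := by
    intro p
    obtain ⟨w, hw, -, hmap⟩ := hμ p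
    have hp := mem_extChartAt_target (I := J) p
    have h1 : ∀ᶠ v in 𝓝[(extChartAt J p).target] (extChartAt J p p), w v < w (extChartAt J p p) + 1 :=
      (hw.continuousOn _ hp).eventually_lt_const (by linarith)
    obtain ⟨r, hr, hball⟩ := Metric.mem_nhdsWithin_iff.1 h1
    refine ⟨extChartAt J p ⁻¹' Metric.ball (extChartAt J p p) r ∩ (extChartAt J p).source, ?_, ?_⟩
    · exact inter_mem ((continuousAt_extChartAt p).preimage_mem_nhds (Metric.ball_mem_nhds _ hr))
        (extChartAt_source_mem_nhds p)
    · have hm : AEMeasurable (extChartAt J p) (μ.restrict (extChartAt J p).source) :=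
        (continuousOn_extChartAt p).aemeasurable (isOpen_extChartAt_source p).measurableSet
      have h2 := congrArg (fun ν => ν (Metric.ball (extChartAt J p p) r)) hmap
      rw [Measure.map_apply_of_aemeasurable hm measurableSet_ball,
        Measure.restrict_apply₀' (isOpen_extChartAt_source p).measurableSet.nullMeasurableSet] at h2
      rw [h2, withDensity_apply _ measurableSet_ball,
        Measure.restrict_restrict measurableSet_ball]
      refine lt_of_le_of_lt (setLIntegral_mono (g := fun _ => ENNReal.ofReal (w (extChartAt J p p) + 1))
        measurable_const fun v hv => ENNReal.ofReal_le_ofReal (hball hv).le) ?_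
      rw [setLIntegral_const]
      exact ENNReal.mul_lt_top ENNReal.ofReal_lt_top
        ((measure_mono inter_subset_left).trans_lt measure_ball_lt_top)
  refine ⟨isCompact_univ.measure_lt_top_of_nhdsWithin fun p _ => ?_⟩
  rw [nhdsWithin_univ]
  exact hloc p

/-- At an interior point the chart image of `O` contains a full ball, and a positive function has
positive Lebesgue integral over it. -/
theorem IsSmoothPositiveDensity.measure_pos (hμ : IsSmoothPositiveDensity J μ) {O : Set X}
    (hO : IsOpen O) {p : X} (hp : p ∈ O) (hpi : J.IsInteriorPoint p) : 0 < μ O := by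
  obtain ⟨w, hw, hpos, hmap⟩ := hμ p
  have hpt := mem_extChartAt_target (I := J) p
  have h1 : (extChartAt J p).target ∈ 𝓝 (extChartAt J p p) := by
    refine mem_of_superset (isOpen_interior.mem_nhds (J.isInteriorPoint_iff.1 hpi)) interior_subset
  have h2 : (extChartAt J p).symm ⁻¹' O ∈ 𝓝 (extChartAt J p p) := by
    refine (continuousAt_extChartAt_symm p).preimage_mem_nhds (hO.mem_nhds ?_)
    rwa [extChartAt_to_inv]
  obtain ⟨r, hr, hball⟩ := Metric.mem_nhds_iff.1 (inter_mem h1 h2)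
  have hm : AEMeasurable (extChartAt J p) (μ.restrict (extChartAt J p).source) :=
    (continuousOn_extChartAt p).aemeasurable (isOpen_extChartAt_source p).measurableSet
  have h3 := congrArg (fun ν => ν (Metric.ball (extChartAt J p p) r)) hmap
  rw [Measure.map_apply_of_aemeasurable hm measurableSet_ball,
    Measure.restrict_apply₀' (isOpen_extChartAt_source p).measurableSet.nullMeasurableSet,
    withDensity_apply _ measurableSet_ball, Measure.restrict_restrict measurableSet_ball,
    inter_eq_left.2 (hball.trans inter_subset_left)] at h3
  have hsub : extChartAt J p ⁻¹' Metric.ball (extChartAt J p p) r ∩ (extChartAt J p).source ⊆ O := by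
    rintro p' ⟨h4, h5⟩
    have h6 := (hball h4).2
    rwa [mem_preimage, (extChartAt J p).left_inv h5] at h6
  refine lt_of_lt_of_le ?_ (measure_mono hsub)
  rw [h3, pos_iff_ne_zero]
  have hsubt : Metric.ball (extChartAt J p p) r ⊆ (extChartAt J p).target :=
    hball.trans inter_subset_left
  have hwm : AEMeasurable (fun v => ENNReal.ofReal (w v))
      (volume.restrict (Metric.ball (extChartAt J p p) r)) :=
    ((hw.continuousOn.mono hsubt).aemeasurable measurableSet_ball).ennreal_ofReal
  rw [Ne, lintegral_eq_zero_iff' hwm, Filter.EventuallyEq, ae_restrict_iff' measurableSet_ball]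
  intro h0
  have h4 : volume (Metric.ball (extChartAt J p p) r) = 0 := by
    refine measure_mono_null (fun v hv => ?_) (ae_iff.1 h0)
    have := hpos v (hsubt hv)
    simp only [mem_ofPred_eq, Pi.zero_apply, ENNReal.ofReal_eq_zero, not_le, Classical.not_imp]
    exact ⟨hv, this⟩
  exact (Metric.measure_ball_pos volume _ hr).ne' h4

/-- A continuous function is nonnegative at an interior point as soon as its integrals against the
squares of test functions are. -/
theorem IsSmoothPositiveDensity.nonneg_of_integral [T2Space X] [CompactSpace X]
    [IsManifold J ∞ X] (hμ : IsSmoothPositiveDensity J μ) {f : X → ℝ} {U : Set X} (hU : IsOpen U)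
    (hUi : ∀ p ∈ U, J.IsInteriorPoint p)
    (hf : ContinuousOn f U) (h : ∀ χ : X → ℝ, ContMDiff J 𝓘(ℝ, ℝ) ∞ χ → tsupport χ ⊆ U →
      0 ≤ ∫ p, χ p ^ 2 * f p ∂μ) {p : X} (hp : p ∈ U) : 0 ≤ f p := by
  have := hμ.isFiniteMeasure
  by_contra! hneg
  -- If `f p < 0`, a bump supported where `f < f p / 2` gives an integral at most (f p / 2) ∫ θ²,
  -- which is strictly negative.
  have hO : {p' | p' ∈ U ∧ f p' < f p / 2} ∈ 𝓝 p := by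
    have h1 := (hf.continuousAt (hU.mem_nhds hp)).eventually_lt_const (show f p < f p / 2 by linarith)
    filter_upwards [h1, hU.mem_nhds hp] with p' h2 h3 using ⟨h3, h2⟩
  obtain ⟨θ, -, hθ⟩ := (SmoothBumpFunction.nhds_basis_tsupport (I := J) p).mem_iff.1 hO
  have hθs : ContMDiff J 𝓘(ℝ, ℝ) ∞ θ := θ.contMDiff
  have h1 := h θ hθs fun p' hp' => (hθ hp').1
  have hc : Continuous fun p' => θ p' ^ 2 := hθs.continuous.pow 2
  have hi : Integrable (fun p' => θ p' ^ 2) μ := by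
    obtain ⟨C, hC⟩ := (isCompact_univ (X := X)).exists_bound_of_continuousOn hc.continuousOn
    exact Integrable.of_bound hc.aestronglyMeasurable C (Eventually.of_forall fun p' => hC p' (mem_univ _))
  have hle : ∀ p', θ p' ^ 2 * f p' ≤ θ p' ^ 2 * (f p / 2) := by
    intro p'
    by_cases hp' : p' ∈ tsupport θ
    · exact mul_le_mul_of_nonneg_left (hθ hp').2.le (sq_nonneg _)
    · rw [image_eq_zero_of_notMem_tsupport hp']
      simp
  have hcf : Continuous fun p' => θ p' ^ 2 * f p' := by
    rw [continuous_iff_continuousAt]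
    intro p'
    by_cases hp' : p' ∈ tsupport θ
    · exact hc.continuousAt.mul (hf.continuousAt (hU.mem_nhds (hθ hp').1))
    · refine (continuousAt_const (y := (0 : ℝ))).congr ?_
      filter_upwards [(isClosed_tsupport θ).isOpen_compl.mem_nhds hp'] with p'' hp''
      rw [image_eq_zero_of_notMem_tsupport hp'']
      simp
  have hif : Integrable (fun p' => θ p' ^ 2 * f p') μ := by
    obtain ⟨C, hC⟩ := (isCompact_univ (X := X)).exists_bound_of_continuousOn hcf.continuousOn
    exact Integrable.of_bound hcf.aestronglyMeasurable C
      (Eventually.of_forall fun p' => hC p' (mem_univ _))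
  have h2 : ∫ p', θ p' ^ 2 * f p' ∂μ ≤ ∫ p', θ p' ^ 2 * (f p / 2) ∂μ :=
    integral_mono hif (hi.mul_const _) hle
  have h3 : 0 < ∫ p', θ p' ^ 2 ∂μ := by
    rw [integral_pos_iff_support_of_nonneg (fun _ => sq_nonneg _) hi]
    have hone : θ p = 1 := θ.eq_one
    refine lt_of_lt_of_le (hμ.measure_pos (hc.isOpen_support) (p := p) ?_ (hUi p hp)) le_rfl
    rw [Function.mem_support, hone]
    norm_num
  rw [integral_mul_const] at h2
  nlinarith

end Density

/-! ### Smooth extension from embedded submanifolds -/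

section Extension

variable {X EX HX : Type*} [NormedAddCommGroup EX] [NormedSpace ℝ EX]
  [TopologicalSpace HX] {J : ModelWithCorners ℝ EX HX} [TopologicalSpace X] [ChartedSpace HX X]
  {S ES HS : Type*} [NormedAddCommGroup ES] [NormedSpace ℝ ES]
  [TopologicalSpace HS] {JS : ModelWithCorners ℝ ES HS} [TopologicalSpace S] [ChartedSpace HS S]
  [IsManifold JS ∞ S] [JS.Boundaryless] [IsManifold J ∞ X] {i : S → X}

/-- An embedded submanifold is locally a smooth retract. -/
theorem exists_local_retraction (hi : Manifold.IsSmoothEmbedding JS J ∞ i) (z : S) :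
    ∃ (O : Set X) (r : X → S), IsOpen O ∧ i z ∈ O ∧ ContMDiffOn J JS ∞ r O ∧
      ∀ z', i z' ∈ O → r (i z') = z' := by
  have h := hi.isImmersion.isImmersionAt z
  -- Being an embedding matters here: inside `O₁` no other sheet of `S` appears, since the preimage
  -- of `O₁` is just the chart domain.
  obtain ⟨O₁, hO₁, hO₁S⟩ := hi.isEmbedding.isInducing.isOpen_iff.1 h.domChart.open_source
  -- In adapted charts `i` is the inclusion of the first factor, so projecting to that factor
  -- retracts onto the submanifold.
  let κ : X → ES := fun p => (h.equiv.symm (h.codChart.extend J p)).1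
  have hκ : ContMDiffOn J 𝓘(ℝ, ES) ∞ κ h.codChart.source := by
    have h1 : ContDiff ℝ ∞ fun v => (h.equiv.symm v).1 :=
      contDiff_fst.comp h.equiv.symm.contDiff
    exact h1.contMDiff.comp_contMDiffOn
      (OpenPartialHomeomorph.contMDiffOn_extend h.codChart_mem_maximalAtlas)
  have hκi : ∀ z' ∈ h.domChart.source, κ (i z') = h.domChart.extend JS z' := by
    intro z' hz'
    have h1 : h.domChart.extend JS z' ∈ (h.domChart.extend JS).target :=
      (h.domChart.extend JS).map_source (by rwa [OpenPartialHomeomorph.extend_source])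
    have h2 := h.writtenInCharts h1
    simp only [Function.comp_apply] at h2
    rw [(h.domChart.extend JS).left_inv (by rwa [OpenPartialHomeomorph.extend_source])] at h2
    change (h.equiv.symm (h.codChart.extend J (i z'))).1 = _
    rw [h2, ContinuousLinearEquiv.symm_apply_apply]
  have htarget : IsOpen (h.domChart.extend JS).target :=
    OpenPartialHomeomorph.isOpen_extend_target _
  have hO₂ : IsOpen (h.codChart.source ∩ κ ⁻¹' (h.domChart.extend JS).target) :=
    hκ.continuousOn.isOpen_inter_preimage h.codChart.open_source htarget
  refine ⟨O₁ ∩ (h.codChart.source ∩ κ ⁻¹' (h.domChart.extend JS).target),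
    fun p => (h.domChart.extend JS).symm (κ p), hO₁.inter hO₂, ?_, ?_, ?_⟩
  · have hz : z ∈ i ⁻¹' O₁ := hO₁S ▸ h.mem_domChart_source
    refine ⟨hz, h.mem_codChart_source, ?_⟩
    rw [mem_preimage, hκi z h.mem_domChart_source]
    exact (h.domChart.extend JS).map_source
      (by rw [OpenPartialHomeomorph.extend_source]; exact h.mem_domChart_source)
  · refine (contMDiffOn_extend_symm h.domChart_mem_maximalAtlas).comp
      (hκ.mono fun p hp => hp.2.1) fun p hp => ?_
    rw [← OpenPartialHomeomorph.extend_target']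
    exact hp.2.2
  · intro z' hz'
    have hz'' : z' ∈ h.domChart.source := by
      rw [← hO₁S]
      exact hz'.1
    dsimp only
    rw [hκi z' hz'']
    exact (h.domChart.extend JS).left_inv (by rwa [OpenPartialHomeomorph.extend_source])

/-- The local retraction is a smooth left inverse, so its derivative is a left inverse of the
derivative of `i`. -/
theorem mfderiv_injective_of_isSmoothEmbedding (hi : Manifold.IsSmoothEmbedding JS J ∞ i) (z : S) :
    Function.Injective (mfderiv JS J i z) := by
  obtain ⟨O, r, hO, hz, hr, hri⟩ := exists_local_retraction hi z
  have h1 : MDifferentiableAt J JS r (i z) :=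
    (hr.contMDiffAt (hO.mem_nhds hz)).mdifferentiableAt (by simp)
  have h2 : MDifferentiableAt JS J i z := (hi.contMDiff z).mdifferentiableAt (by simp)
  have h3 : r ∘ i =ᶠ[𝓝 z] id := by
    filter_upwards [hi.contMDiff.continuous.continuousAt.preimage_mem_nhds (hO.mem_nhds hz)]
      with z' hz' using hri z' hz'
  have h4 : (mfderiv J JS r (i z)).comp (mfderiv JS J i z) = ContinuousLinearMap.id ℝ _ := by
    rw [← mfderiv_comp z h1 h2, h3.mfderiv_eq, mfderiv_id]
  intro v w hvw
  have h5 := DFunLike.congr_fun h4 v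
  have h6 := DFunLike.congr_fun h4 w
  rw [ContinuousLinearMap.comp_apply] at h5 h6
  rw [hvw] at h5
  exact h5.symm.trans h6

/-- Functions on an embedded compact submanifold extend, with a parameter. -/
theorem exists_extension [FiniteDimensional ℝ EX] [T2Space X] [CompactSpace X]
    (hi : Manifold.IsSmoothEmbedding JS J ∞ i) (hic : IsClosed (range i)) {f : S × ℝ → ℝ}
    (hf : ContMDiff (JS.prod 𝓘(ℝ, ℝ)) 𝓘(ℝ, ℝ) ∞ f) :
    ∃ g : X × ℝ → ℝ, ContMDiff (J.prod 𝓘(ℝ, ℝ)) 𝓘(ℝ, ℝ) ∞ g ∧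
      (∀ z s, g (i z, s) = f (z, s)) ∧ ∀ s, (∀ z, f (z, s) = 0) → ∀ p, g (p, s) = 0 := by
  have hloc : ∀ p : X, ∃ (O : Set X) (h : X × ℝ → ℝ), IsOpen O ∧ p ∈ O ∧
      ContMDiffOn (J.prod 𝓘(ℝ, ℝ)) 𝓘(ℝ, ℝ) ∞ h (O ×ˢ univ) ∧
      (∀ z, i z ∈ O → ∀ s, h (i z, s) = f (z, s)) ∧
      ∀ s, (∀ z, f (z, s) = 0) → ∀ p, h (p, s) = 0 := by
    intro p
    by_cases hp : p ∈ range i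
    · obtain ⟨z, rfl⟩ := hp
      obtain ⟨O, r, hO, hz, hr, hri⟩ := exists_local_retraction hi z
      refine ⟨O, fun n => f (r n.1, n.2), hO, hz, ?_, fun z' hz' s => ?_, fun s hs p => hs _⟩
      · refine hf.comp_contMDiffOn (ContMDiffOn.prodMk ?_ contMDiff_snd.contMDiffOn)
        exact hr.comp contMDiff_fst.contMDiffOn fun n hn => hn.1
      · simp only [hri z' hz']
    · refine ⟨(range i)ᶜ, fun _ => 0, hic.isOpen_compl, hp, contMDiffOn_const,
        fun z hz => absurd (mem_range_self z) hz, fun _ _ _ => rfl⟩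
  choose O h hO hpO hh hhi hh0 using hloc
  obtain ⟨t, ψ, hψ, hψO, hpos⟩ := exists_finset_bumps J O fun p => (hO p).mem_nhds (hpO p)
  have hsum : ContMDiff J 𝓘(ℝ, ℝ) ∞ fun p => ∑ a ∈ t, ψ a p ^ 2 :=
    contMDiff_finsetSum fun a _ => (hψ a).pow 2
  -- A weighted mean of the local extensions. The weights do not involve the parameter, so a slice
  -- on which `f` vanishes extends by zero; this later controls supports in the ℝ direction.
  refine ⟨fun n => (∑ a ∈ t, ψ a n.1 ^ 2)⁻¹ * ∑ a ∈ t, ψ a n.1 ^ 2 * h a n, ?_, ?_, ?_⟩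
  · refine ((hsum.comp contMDiff_fst).inv₀ fun n => (hpos n.1).ne').mul
      (contMDiff_finsetSum fun a _ => ?_)
    intro n
    by_cases hn : n.1 ∈ tsupport (ψ a)
    · have h1 := (hh a).contMDiffAt (x := n) (((hO a).prod isOpen_univ).mem_nhds
        ⟨hψO a hn, mem_univ _⟩)
      exact ((((hψ a).comp contMDiff_fst).pow 2) n).mul h1
    · refine (contMDiffAt_const (c := (0 : ℝ))).congr_of_eventuallyEq ?_
      have h1 : ∀ᶠ n' in 𝓝 n, n'.1 ∉ tsupport (ψ a) :=
        continuous_fst.continuousAt.preimage_mem_nhds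
          ((isClosed_tsupport (ψ a)).isOpen_compl.mem_nhds hn)
      filter_upwards [h1] with n' hn'
      rw [image_eq_zero_of_notMem_tsupport hn']
      ring
  · intro z s
    have h1 : ∀ a ∈ t, ψ a (i z) ^ 2 * h a (i z, s) = ψ a (i z) ^ 2 * f (z, s) := by
      intro a _
      by_cases hn : i z ∈ tsupport (ψ a)
      · rw [hhi a z (hψO a hn)]
      · rw [image_eq_zero_of_notMem_tsupport hn]
        ring
    simp only
    rw [Finset.sum_congr rfl h1, ← Finset.sum_mul, inv_mul_cancel_left₀ (hpos _).ne']
  · intro s hs p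
    simp only [fun a => hh0 a s hs p, mul_zero, Finset.sum_const_zero]

end Extension

/-! ### Tangent spaces of the fibres; extension of sections from a fibre -/

section Tangent

variable {k q : ℕ} {M N Y : Type*}
  [TopologicalSpace M] [ChartedSpace (EuclideanHalfSpace (k + q + 1)) M]
  [TopologicalSpace N] [ChartedSpace (EuclideanSpace ℝ (Fin (k + q))) N]
  [TopologicalSpace Y] [ChartedSpace (EuclideanSpace ℝ (Fin q)) Y]
  [IsManifold (𝓡∂ (k + q + 1)) ∞ M] [IsManifold (𝓡 (k + q)) ∞ N] [IsManifold (𝓡 q) ∞ Y]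
  {G : FiberedBoundary k q M N Y} {y : Y} {Z : Type*} [TopologicalSpace Z]
  [ChartedSpace (EuclideanSpace ℝ (Fin k)) Z] [IsManifold (𝓡 k) ∞ Z]

/-- In submersion charts the fibration is a projection. Freezing the second component at its value
for `z` gives a smooth local section through `z`, whose derivative is a right inverse. -/
theorem FiberedBoundary.mfderiv_proj_surjective (G : FiberedBoundary k q M N Y) (z : N) :
    Function.Surjective (mfderiv (𝓡 (k + q)) (𝓡 q) G.proj z) := by
  have h : Manifold.IsSubmersionAt (𝓡 (k + q)) (𝓡 q) ∞ G.proj z := G.isSubmersion_proj.isSubmersionAt z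
  have hzs : z ∈ (h.domChart.extend (𝓡 (k + q))).source := by
    rw [OpenPartialHomeomorph.extend_source]
    exact h.mem_domChart_source
  have hys : G.proj z ∈ (h.codChart.extend (𝓡 q)).source := by
    rw [OpenPartialHomeomorph.extend_source]
    exact h.mem_codChart_source
  let τ : Y → EuclideanSpace ℝ (Fin (k + q)) := fun y =>
    h.equiv.symm (h.codChart.extend (𝓡 q) y, (h.equiv (h.domChart.extend (𝓡 (k + q)) z)).2)
  have hpz : h.codChart.extend (𝓡 q) (G.proj z) =
      (h.equiv (h.domChart.extend (𝓡 (k + q)) z)).1 := by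
    have h2 := h.writtenInCharts ((h.domChart.extend (𝓡 (k + q))).map_source hzs)
    simp only [Function.comp_apply] at h2
    rwa [(h.domChart.extend (𝓡 (k + q))).left_inv hzs] at h2
  have hτz : τ (G.proj z) = h.domChart.extend (𝓡 (k + q)) z := by
    simp only [τ]
    rw [hpz]
    exact h.equiv.symm_apply_apply _
  have hτ : ContMDiffOn (𝓡 q) 𝓘(ℝ, EuclideanSpace ℝ (Fin (k + q))) ∞ τ h.codChart.source := by
    have h1 : ContDiff ℝ ∞ fun v => h.equiv.symm
        (v, (h.equiv (h.domChart.extend (𝓡 (k + q)) z)).2) :=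
      h.equiv.symm.contDiff.comp (contDiff_id.prodMk contDiff_const)
    exact h1.contMDiff.comp_contMDiffOn
      (OpenPartialHomeomorph.contMDiffOn_extend h.codChart_mem_maximalAtlas)
  have htarget : IsOpen (h.domChart.extend (𝓡 (k + q))).target :=
    OpenPartialHomeomorph.isOpen_extend_target _
  have hτt : τ (G.proj z) ∈ (h.domChart.extend (𝓡 (k + q))).target := by
    rw [hτz]
    exact (h.domChart.extend (𝓡 (k + q))).map_source hzs
  have hτc : ContMDiffAt (𝓡 q) 𝓘(ℝ, EuclideanSpace ℝ (Fin (k + q))) ∞ τ (G.proj z) :=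
    hτ.contMDiffAt (h.codChart.open_source.mem_nhds h.mem_codChart_source)
  have hσ : ContMDiffAt (𝓡 q) (𝓡 (k + q)) ∞
      (fun y => (h.domChart.extend (𝓡 (k + q))).symm (τ y)) (G.proj z) := by
    have h1 := (contMDiffOn_extend_symm h.domChart_mem_maximalAtlas)
    rw [← OpenPartialHomeomorph.extend_target'] at h1
    exact (h1.contMDiffAt (htarget.mem_nhds hτt)).comp _ hτc
  have hev : G.proj ∘ (fun y => (h.domChart.extend (𝓡 (k + q))).symm (τ y)) =ᶠ[𝓝 (G.proj z)] id := by
    filter_upwards [hτc.continuousAt.preimage_mem_nhds (htarget.mem_nhds hτt),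
      h.codChart.open_source.mem_nhds h.mem_codChart_source] with y' hy' hy's
    have h2 := h.writtenInCharts hy'
    simp only [Function.comp_apply, τ, ContinuousLinearEquiv.apply_symm_apply] at h2
    have h3 : (h.domChart.extend (𝓡 (k + q))).symm (τ y') ∈ h.domChart.source := by
      rw [← OpenPartialHomeomorph.extend_source (I := 𝓡 (k + q))]
      exact (h.domChart.extend (𝓡 (k + q))).map_target hy'
    refine (h.codChart.extend (𝓡 q)).injOn ?_ ?_ h2
    · rw [OpenPartialHomeomorph.extend_source]
      exact h.source_subset_preimage_source h3
    · rwa [OpenPartialHomeomorph.extend_source]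
  have hσz : (h.domChart.extend (𝓡 (k + q))).symm (τ (G.proj z)) = z := by
    rw [hτz]
    exact (h.domChart.extend (𝓡 (k + q))).left_inv hzs
  have h5 : mfderiv (𝓡 q) (𝓡 q)
      (G.proj ∘ (fun y => (h.domChart.extend (𝓡 (k + q))).symm (τ y))) (G.proj z) =
      ContinuousLinearMap.id ℝ _ := by
    rw [hev.mfderiv_eq, mfderiv_id]
  rw [mfderiv_comp (G.proj z) ((G.isSubmersion_proj.contMDiff _).mdifferentiableAt (by simp))
    (hσ.mdifferentiableAt (by simp)), hσz] at h5
  intro v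
  exact ⟨_, DFunLike.congr_fun h5 v⟩

/-- The tangent space of the fibre is the kernel of the derivative of the fibration. -/
theorem FiberModel.exists_mfderiv_eq (j : FiberModel G y Z) (z : Z)
    (w : TangentSpace (𝓡 (k + q)) (j.incl z))
    (hw : mfderiv (𝓡 (k + q)) (𝓡 q) G.proj (j.incl z) w = 0) :
    ∃ v : TangentSpace (𝓡 k) z, mfderiv (𝓡 k) (𝓡 (k + q)) j.incl z v = w := by
  let A : EuclideanSpace ℝ (Fin k) →ₗ[ℝ] EuclideanSpace ℝ (Fin (k + q)) :=
    (mfderiv (𝓡 k) (𝓡 (k + q)) j.incl z).toLinearMap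
  let B : EuclideanSpace ℝ (Fin (k + q)) →ₗ[ℝ] EuclideanSpace ℝ (Fin q) :=
    (mfderiv (𝓡 (k + q)) (𝓡 q) G.proj (j.incl z)).toLinearMap
  have hA : Function.Injective A := mfderiv_injective_of_isSmoothEmbedding j.isSmoothEmbedding_incl z
  have hB : Function.Surjective B := G.mfderiv_proj_surjective (j.incl z)
  have hBA : LinearMap.range A ≤ LinearMap.ker B := by
    rintro _ ⟨v, rfl⟩
    have h1 : mfderiv (𝓡 k) (𝓡 q) (G.proj ∘ j.incl) z = 0 := by
      have h2 : G.proj ∘ j.incl = fun _ => y := funext j.proj_incl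
      rw [h2, mfderiv_const]
    rw [mfderiv_comp z ((G.isSubmersion_proj.contMDiff _).mdifferentiableAt (by simp))
      ((j.isSmoothEmbedding_incl.contMDiff z).mdifferentiableAt (by simp))] at h1
    exact DFunLike.congr_fun h1 v
  -- The kernel has dimension (k + q) − q = k, and the injective map from the tangent space of the
  -- fibre has rank k.
  have hdim : Module.finrank ℝ (LinearMap.ker B) ≤ Module.finrank ℝ (LinearMap.range A) := by
    have h1 := B.finrank_range_add_finrank_ker
    rw [LinearMap.range_eq_top.2 hB, finrank_top, finrank_euclideanSpace_fin,
      finrank_euclideanSpace_fin] at h1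
    rw [LinearMap.finrank_range_of_inj hA, finrank_euclideanSpace_fin]
    omega
  have h2 := Submodule.eq_of_le_of_finrank_le hBA hdim
  have h3 : w ∈ LinearMap.ker B := hw
  rw [← h2] at h3
  exact h3

/-- An edge vector field is tangent to the fibres. -/
theorem IsEdgeVectorField.dirDeriv_inclM {V : ∀ p : M, TangentSpace (𝓡∂ (k + q + 1)) p}
    (hV : IsEdgeVectorField G V) (j : FiberModel G y Z) {f : M → ℝ}
    (hf : ContMDiff (𝓡∂ (k + q + 1)) 𝓘(ℝ, ℝ) ∞ f) (hfj : ∀ z, f (j.inclM z) = 0) (z : Z) :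
    dirDeriv V f (j.inclM z) = 0 := by
  obtain ⟨w, hw, hwV⟩ := hV.2 (j.incl z)
  obtain ⟨v, rfl⟩ := j.exists_mfderiv_eq z w hw
  have h1 : mfderiv (𝓡 k) 𝓘(ℝ, ℝ) (f ∘ (G.incl ∘ j.incl)) z = 0 := by
    have h2 : f ∘ (G.incl ∘ j.incl) = fun _ => 0 := funext hfj
    rw [h2, mfderiv_const]
  have h3 := (G.contMDiff_incl (j.incl z)).mdifferentiableAt (by simp)
  have h4 := (j.isSmoothEmbedding_incl.contMDiff z).mdifferentiableAt (by simp)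
  rw [mfderiv_comp z ((hf _).mdifferentiableAt (by simp)) (h3.comp z h4),
    mfderiv_comp z h3 h4] at h1
  have h5 := DFunLike.congr_fun h1 v
  rw [dirDeriv, FiberModel.inclM, ← hwV]
  exact h5

/-- Basic functions with given boundary values. -/
theorem FiberedBoundary.exists_isBasic_extension [T2Space M] [CompactSpace M]
    (G : FiberedBoundary k q M N Y) {g : Y → ℝ} (hg : ContMDiff (𝓡 q) 𝓘(ℝ, ℝ) ∞ g) :
    ∃ f : M → ℝ, IsBasic G f ∧ ∀ z, f (G.incl z) = g (G.proj z) := by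
  obtain ⟨f, hf, hfi, -⟩ := exists_extension G.isSmoothEmbedding_incl
    G.isClosedEmbedding_incl.isClosed_range
    (f := fun n : N × ℝ => g (G.proj n.1))
    (hg.comp (G.isSubmersion_proj.contMDiff.comp contMDiff_fst))
  have h : ContMDiff (𝓡∂ (k + q + 1)) 𝓘(ℝ, ℝ) ∞ (fun p => f (p, 0)) :=
    hf.comp (contMDiff_id.prodMk contMDiff_const)
  exact ⟨fun p => f (p, 0), ⟨h, g, hg, fun z => hfi z 0⟩, fun z => hfi z 0⟩

variable {F : Type*} [NormedAddCommGroup F] [NormedSpace ℝ F] [FiniteDimensional ℝ F] {E : M → Type*}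
  [TopologicalSpace (TotalSpace F E)] [∀ p, NormedAddCommGroup (E p)]
  [∀ p, InnerProductSpace ℂ (E p)] [FiberBundle F E] [VectorBundle ℝ F E]
  [ContMDiffVectorBundle ∞ F E (𝓡∂ (k + q + 1))]
  [SmoothHermitianBundle (𝓡∂ (k + q + 1)) F E]

/-- Sections along an embedded compact submanifold extend, with a parameter. -/
theorem exists_section_extension [T2Space M] [CompactSpace M]
    {X EX HX : Type*} [NormedAddCommGroup EX] [NormedSpace ℝ EX]
    [TopologicalSpace HX] {J : ModelWithCorners ℝ EX HX} [TopologicalSpace X] [ChartedSpace HX X]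
    {S ES HS : Type*} [NormedAddCommGroup ES] [NormedSpace ℝ ES]
    [TopologicalSpace HS] {JS : ModelWithCorners ℝ ES HS} [TopologicalSpace S] [ChartedSpace HS S]
    [IsManifold JS ∞ S] [JS.Boundaryless] [IsManifold J ∞ X] {i : S → X}
    [FiniteDimensional ℝ EX] [T2Space X] [CompactSpace X]
    (hi : Manifold.IsSmoothEmbedding JS J ∞ i) (hic : IsClosed (range i))
    {b : X → M} (hb : ContMDiff J (𝓡∂ (k + q + 1)) ∞ b) {u : ∀ n : S × ℝ, E (b (i n.1))}
    (hu : IsSmoothAlong (𝓡∂ (k + q + 1)) F E (JS.prod 𝓘(ℝ, ℝ)) (fun n : S × ℝ => b (i n.1)) u) :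
    ∃ U : ∀ n : X × ℝ, E (b n.1),
      IsSmoothAlong (𝓡∂ (k + q + 1)) F E (J.prod 𝓘(ℝ, ℝ)) (fun n : X × ℝ => b n.1) U ∧
      (∀ z s, U (i z, s) = u (z, s)) ∧ ∀ s, (∀ z, u (z, s) = 0) → ∀ p, U (p, s) = 0 := by
  obtain ⟨Φ⟩ := nonempty_globalFrame (𝓡∂ (k + q + 1)) F E
  have h := fun l => exists_extension hi hic (Φ.smooth_coeff_along l hu)
  choose g hg hgi hg0 using h
  refine ⟨fun n => ∑ l, g l n • Φ.e l (b n.1), ?_, fun z s => ?_, fun s hs p => ?_⟩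
  · have hbf : ContMDiff (J.prod 𝓘(ℝ, ℝ)) (𝓡∂ (k + q + 1)) ∞ fun n : X × ℝ => b n.1 :=
      hb.comp contMDiff_fst
    exact IsSmoothAlong.sum _ hbf fun l _ => ((Φ.smooth_e l).comp_map hbf).smul (hg l)
  · simp only [hgi]
    exact Φ.sum_coeff _ _
  · refine Finset.sum_eq_zero fun l _ => ?_
    simp only
    rw [hg0 l s (fun z => by rw [hs z, map_zero]) p, zero_smul]

/-- Extension proceeds from the fibre to the boundary and from there to `M`, with a dummy parameter
set to 0 at the end. -/
theorem FiberModel.exists_sec_extension [T2Space M] [CompactSpace M] [T2Space Y]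
    (j : FiberModel G y Z) (u : FiberSec F E j) :
    ∃ U : Sec k q F E, ∀ z, u.1 z = U.1 (j.inclM z) := by
  have := G.compactSpace_boundary
  have := G.t2Space_boundary
  have hu : IsSmoothAlong (𝓡∂ (k + q + 1)) F E ((𝓡 k).prod 𝓘(ℝ, ℝ))
      (fun n : Z × ℝ => G.incl (j.incl n.1)) (fun n => u.1 n.1) := by
    have h : ContMDiff (𝓡 k) ((𝓡∂ (k + q + 1)).prod 𝓘(ℝ, F)) ∞
      (fun z => TotalSpace.mk' F (j.inclM z) (u.1 z)) := u.2
    exact h.comp contMDiff_fst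
  obtain ⟨V, hV, hVi, -⟩ := exists_section_extension j.isSmoothEmbedding_incl
    j.isClosedEmbedding_incl.isClosed_range G.contMDiff_incl hu
  obtain ⟨U, hU, hUi, -⟩ := exists_section_extension (b := fun p : M => p) G.isSmoothEmbedding_incl
    G.isClosedEmbedding_incl.isClosed_range contMDiff_id hV
  refine ⟨⟨fun p => U (p, 0), ?_⟩, fun z => ?_⟩
  · have h : ContMDiff ((𝓡∂ (k + q + 1)).prod 𝓘(ℝ, ℝ)) ((𝓡∂ (k + q + 1)).prod 𝓘(ℝ, F)) ∞
      (fun n : M × ℝ => TotalSpace.mk' F n.1 (U n)) := hU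
    exact h.comp (contMDiff_id.prodMk contMDiff_const)
  · exact ((hUi (j.incl z) 0).trans (hVi z 0)).symm

/-- Vanishing slices extend by zero, so the extension is supported over the projection to (0, ∞) of
the original support, which is compact together with `N`. -/
theorem FiberModel.exists_normalTestSec_extension [T2Space M] [CompactSpace M] [T2Space Y]
    (j : FiberModel G y Z) (u : FiberTestSec F E j) :
    ∃ U ∈ NormalTestSec G F E (Ioi 0), ∀ n : Z × ℝ, u.1 n = U (j.incl n.1, n.2) := by
  have := G.compactSpace_boundary
  have := G.t2Space_boundary
  obtain ⟨hu, K, hK, hKs, hK0⟩ := u.2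
  have hu' : IsSmoothAlong (𝓡∂ (k + q + 1)) F E ((𝓡 k).prod 𝓘(ℝ, ℝ))
      (fun n : Z × ℝ => G.incl (j.incl n.1)) u.1 := hu
  obtain ⟨U, hU, hUi, hU0⟩ := exists_section_extension j.isSmoothEmbedding_incl
    j.isClosedEmbedding_incl.isClosed_range G.contMDiff_incl hu'
  refine ⟨U, ⟨hU, univ ×ˢ (Prod.snd '' K), isCompact_univ.prod (hK.image continuous_snd), ?_, ?_⟩,
    fun n => (hUi n.1 n.2).symm⟩
  · rintro ⟨p, s⟩ ⟨-, n, hn, rfl⟩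
    exact ⟨mem_univ _, (hKs hn).2⟩
  · rintro ⟨p, s⟩ hn
    refine hU0 s (fun z => hK0 _ fun hz => hn ⟨mem_univ _, (z, s), hz, rfl⟩) p

end Tangent

/-! ### Edge operators acting on sections over M × ℝ -/

section CylinderCalculus

variable {k q : ℕ} {M N Y : Type*}
  [TopologicalSpace M] [ChartedSpace (EuclideanHalfSpace (k + q + 1)) M]
  [TopologicalSpace N] [ChartedSpace (EuclideanSpace ℝ (Fin (k + q))) N]
  [TopologicalSpace Y] [ChartedSpace (EuclideanSpace ℝ (Fin q)) Y]
  [IsManifold (𝓡∂ (k + q + 1)) ∞ M]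
  {G : FiberedBoundary k q M N Y}
  {F : Type*} [NormedAddCommGroup F] [NormedSpace ℝ F] {E : M → Type*}
  [TopologicalSpace (TotalSpace F E)] [∀ p, NormedAddCommGroup (E p)]
  [∀ p, InnerProductSpace ℂ (E p)] [FiberBundle F E] [VectorBundle ℝ F E]
  [ContMDiffVectorBundle ∞ F E (𝓡∂ (k + q + 1))]
  [SmoothHermitianBundle (𝓡∂ (k + q + 1)) F E]
  [T2Space M] [CompactSpace M] [FiniteDimensional ℝ F]

/-! ### Edge derivations -/

variable (G F E) in
/-- An edge derivation `D` over the vector field `V`, with `V x = x a`. -/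
structure EdgeDerivation where
  D : Module.End ℂ (Sec k q F E)
  V : ∀ p : M, TangentSpace (𝓡∂ (k + q + 1)) p
  isEdge : IsEdgeVectorField G V
  isDerivation : IsDerivationOver V D
  a : M → ℝ
  smooth_a : ContMDiff (𝓡∂ (k + q + 1)) 𝓘(ℝ, ℝ) ∞ a
  V_x : ∀ p, dirDeriv V G.x p = G.x p * a p

theorem exists_edgeDerivation {D : Module.End ℂ (Sec k q F E)} (hD : D ∈ edgeDerivations G F E) :
    ∃ R : EdgeDerivation G F E, R.D = D := by
  obtain ⟨V, hV, hDV⟩ := hD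
  obtain ⟨a, ha, hax⟩ := hV.exists_eq_x_mul G.isBasic_x
  exact ⟨⟨D, V, hV, hDV, a, ha, hax⟩, rfl⟩

theorem EdgeDerivation.mem (R : EdgeDerivation G F E) : R.D ∈ edgeDerivations G F E :=
  ⟨R.V, R.isEdge, R.isDerivation⟩

variable (G) in
/-- A presentation of a second order edge operator as a sum of products. -/
structure NormalForm (P : Module.End ℂ (Sec k q F E)) where
  ι : Type
  fintype : Fintype ι
  B : ι → Module.End ℂ (Sec k q F E)
  isEnd : ∀ i, B i ∈ bundleEnd k q F E
  R : ι → EdgeDerivation G F E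
  R' : ι → EdgeDerivation G F E
  eq : P = ∑ i, B i * ((R i).D * (R' i).D)

attribute [instance] NormalForm.fintype

theorem nonempty_normalForm {P : Module.End ℂ (Sec k q F E)} (hP : P ∈ edgeDiffOps G F E 2) :
    Nonempty (NormalForm G P) := by
  obtain ⟨ι, hι, B, D, D', hB, hD, hD', rfl⟩ := exists_normalForm hP
  choose R hR using fun i => exists_edgeDerivation (hD i)
  choose R' hR' using fun i => exists_edgeDerivation (hD' i)
  exact ⟨⟨ι, hι, B, hB, R, R', by simp only [hR, hR']⟩⟩

/-- Multiplication by a smooth real function, as an operator. -/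
def mulOp (f : M → ℝ) (hf : ContMDiff (𝓡∂ (k + q + 1)) 𝓘(ℝ, ℝ) ∞ f) :
    Module.End ℂ (Sec k q F E) where
  toFun s := mulSec f hf s
  map_add' s t := by
    ext p
    exact smul_add _ _ _
  map_smul' c s := by
    ext p
    exact smul_comm _ _ _

theorem mulOp_apply {f : M → ℝ} (hf : ContMDiff (𝓡∂ (k + q + 1)) 𝓘(ℝ, ℝ) ∞ f)
    (s : Sec k q F E) (p : M) : (mulOp f hf s).1 p = f p • s.1 p := rfl

theorem IsDerivationOver.add_smul_mulOp {V : ∀ p : M, TangentSpace (𝓡∂ (k + q + 1)) p}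
    {D : Module.End ℂ (Sec k q F E)} (hD : IsDerivationOver V D) (w : ℂ) {m : M → ℝ}
    (hm : ContMDiff (𝓡∂ (k + q + 1)) 𝓘(ℝ, ℝ) ∞ m) : IsDerivationOver V (D + w • mulOp m hm) := by
  intro f hf s p
  change (D (mulSec f hf s)).1 p + w • m p • f p • s.1 p =
    dirDeriv V f p • s.1 p + f p • ((D s).1 p + w • m p • s.1 p)
  rw [hD f hf s p]
  simp only [← Complex.coe_smul]
  module

/-! ### Sections over the cylinder `M × ℝ` -/

variable (k q F E) in
/-- The smooth sections of the lift of `E` to `M × ℝ`. -/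
abbrev CylSec : Submodule ℂ (∀ n : M × ℝ, E n.1) :=
  smoothSections (𝓡∂ (k + q + 1)) F E ((𝓡∂ (k + q + 1)).prod 𝓘(ℝ, ℝ)) (fun n : M × ℝ => n.1)
    contMDiff_fst

namespace CylSec

/-- The restriction of a section over the cylinder to the graph of a function. -/
def graph (θ : M → ℝ) (hθ : ContMDiff (𝓡∂ (k + q + 1)) 𝓘(ℝ, ℝ) ∞ θ) (W : CylSec k q F E) :
    Sec k q F E :=
  ⟨fun p => W.1 (p, θ p), by
    have h : ContMDiff ((𝓡∂ (k + q + 1)).prod 𝓘(ℝ, ℝ)) ((𝓡∂ (k + q + 1)).prod 𝓘(ℝ, F)) ∞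
      (fun n : M × ℝ => TotalSpace.mk' F n.1 (W.1 n)) := W.2
    exact h.comp (contMDiff_id.prodMk hθ)⟩

/-- The restriction of a section over the cylinder to a slice. -/
def slice (s : ℝ) (W : CylSec k q F E) : Sec k q F E := graph (fun _ => s) contMDiff_const W

/-- The restriction of a section over the cylinder to a line. -/
def along (W : CylSec k q F E) (p : M) (t : ℝ) : E p := W.1 (p, t)

theorem contMDiff_coord (Φ : GlobalFrame (𝓡∂ (k + q + 1)) F E) (i : Φ.ι) (W : CylSec k q F E) :
    ContMDiff ((𝓡∂ (k + q + 1)).prod 𝓘(ℝ, ℝ)) 𝓘(ℝ, ℝ) ∞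
      (fun n : M × ℝ => Φ.coeff i n.1 (W.1 n)) :=
  Φ.smooth_coeff_along i W.2

theorem hasDerivAt_along (Φ : GlobalFrame (𝓡∂ (k + q + 1)) F E) (W : CylSec k q F E) (p : M) (s : ℝ) :
    HasDerivAt (along W p)
      (∑ i, sndDeriv (fun n : M × ℝ => Φ.coeff i n.1 (W.1 n)) (p, s) • Φ.e i p) s := by
  have h := HasDerivAt.fun_sum (u := Finset.univ) fun i _ =>
    (hasDerivAt_sndDeriv (contMDiff_coord Φ i W) p s).smul_const (Φ.e i p)
  refine h.congr_of_eventuallyEq (Eventually.of_forall fun t => ?_)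
  exact (Φ.sum_coeff p (W.1 (p, t))).symm

theorem differentiableAt_along (W : CylSec k q F E) (p : M) (s : ℝ) :
    DifferentiableAt ℝ (along W p) s := by
  obtain ⟨Φ⟩ := nonempty_globalFrame (𝓡∂ (k + q + 1)) F E
  exact (hasDerivAt_along Φ W p s).differentiableAt

/-- The chain rule for edge derivations along a graph. -/
theorem derivation_graph {V : ∀ p : M, TangentSpace (𝓡∂ (k + q + 1)) p}
    {D : Module.End ℂ (Sec k q F E)} (hD : IsDerivationOver V D) {θ : M → ℝ}
    (hθ : ContMDiff (𝓡∂ (k + q + 1)) 𝓘(ℝ, ℝ) ∞ θ) (W : CylSec k q F E) (p : M) :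
    (D (graph θ hθ W)).1 p = (D (slice (θ p) W)).1 p +
      dirDeriv V θ p • deriv (along W p) (θ p) := by
  obtain ⟨Φ⟩ := nonempty_globalFrame (𝓡∂ (k + q + 1)) F E
  rw [hD.apply_eq Φ, hD.apply_eq Φ, (hasDerivAt_along Φ W p (θ p)).deriv, Finset.smul_sum,
    ← Finset.sum_add_distrib]
  refine Finset.sum_congr rfl fun i _ => ?_
  -- The vertical derivative arises only from the coefficients, through the scalar chain rule on the
  -- graph; the terms without derivatives agree on graph and slice.
  have h1 : dirDeriv V (Φ.coord i (graph θ hθ W)) p =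
      fstDeriv V (fun n : M × ℝ => Φ.coeff i n.1 (W.1 n)) (p, θ p) +
        dirDeriv V θ p * sndDeriv (fun n : M × ℝ => Φ.coeff i n.1 (W.1 n)) (p, θ p) :=
    dirDeriv_graph (contMDiff_coord Φ i W) hθ p
  have h2 : dirDeriv V (Φ.coord i (slice (θ p) W)) p =
      fstDeriv V (fun n : M × ℝ => Φ.coeff i n.1 (W.1 n)) (p, θ p) := rfl
  rw [h1, h2]
  change _ + Φ.coeff i p (W.1 (p, θ p)) • (D (Φ.sec i)).1 p = _ +
    Φ.coeff i p (W.1 (p, θ p)) • (D (Φ.sec i)).1 p + _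
  rw [add_smul, mul_smul]
  abel

/-- The action of a derivation on the cylinder, in the frame. -/
theorem isSmooth_derivation_slice {V : ∀ p : M, TangentSpace (𝓡∂ (k + q + 1)) p}
    (hV : IsSmoothVectorField V) {D : Module.End ℂ (Sec k q F E)} (hD : IsDerivationOver V D)
    (W : CylSec k q F E) :
    (fun n : M × ℝ => (D (slice n.2 W)).1 n.1) ∈ CylSec k q F E := by
  obtain ⟨Φ⟩ := nonempty_globalFrame (𝓡∂ (k + q + 1)) F E
  have h : (fun n : M × ℝ => (D (slice n.2 W)).1 n.1) = fun n : M × ℝ =>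
      ∑ i, (fstDeriv V (fun n : M × ℝ => Φ.coeff i n.1 (W.1 n)) n • Φ.e i n.1 +
        Φ.coeff i n.1 (W.1 n) • (D (Φ.sec i)).1 n.1) := by
    funext n
    rw [hD.apply_eq Φ]
    rfl
  rw [h]
  refine IsSmoothAlong.sum _ contMDiff_fst fun i _ => IsSmoothAlong.add ?_ ?_
  · exact ((Φ.smooth_e i).comp_map contMDiff_fst).smul (contMDiff_fstDeriv hV (contMDiff_coord Φ i W))
  · exact ((D (Φ.sec i)).2.comp_map contMDiff_fst).smul (contMDiff_coord Φ i W)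

theorem isSmooth_deriv (W : CylSec k q F E) :
    (fun n : M × ℝ => deriv (along W n.1) n.2) ∈ CylSec k q F E := by
  obtain ⟨Φ⟩ := nonempty_globalFrame (𝓡∂ (k + q + 1)) F E
  simp only [fun n : M × ℝ => (hasDerivAt_along Φ W n.1 n.2).deriv]
  refine IsSmoothAlong.sum _ contMDiff_fst fun i _ => ?_
  exact ((Φ.smooth_e i).comp_map contMDiff_fst).smul (contMDiff_sndDeriv (contMDiff_coord Φ i W))

theorem isSmooth_bundleEnd_slice {B : Module.End ℂ (Sec k q F E)} (hB : B ∈ bundleEnd k q F E)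
    (W : CylSec k q F E) : (fun n : M × ℝ => (B (slice n.2 W)).1 n.1) ∈ CylSec k q F E := by
  obtain ⟨Φ⟩ := nonempty_globalFrame (𝓡∂ (k + q + 1)) F E
  simp only [fun n : M × ℝ => bundleEnd_apply_eq Φ hB (slice n.2 W) n.1]
  refine IsSmoothAlong.sum _ contMDiff_fst fun i _ => ?_
  exact ((B (Φ.sec i)).2.comp_map contMDiff_fst).smul (contMDiff_coord Φ i W)

/-- The action on the cylinder of a bundle endomorphism. -/
def liftEnd {B : Module.End ℂ (Sec k q F E)} (hB : B ∈ bundleEnd k q F E) :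
    Module.End ℂ (CylSec k q F E) where
  toFun W := ⟨_, isSmooth_bundleEnd_slice hB W⟩
  map_add' W W' := by
    ext n
    change (B (slice n.2 (W + W'))).1 n.1 = (B (slice n.2 W)).1 n.1 + (B (slice n.2 W')).1 n.1
    have h : slice n.2 (W + W') = slice n.2 W + slice n.2 W' := rfl
    rw [h, map_add]
    rfl
  map_smul' c W := by
    ext n
    change (B (slice n.2 (c • W))).1 n.1 = c • (B (slice n.2 W)).1 n.1
    have h : slice n.2 (c • W) = c • slice n.2 W := rfl
    rw [h, map_smul]
    rfl

/-- The action on the cylinder of an edge derivation: the operator corresponding to `D` on the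
sections `e^{iρg} W(p, ρ x)`, where `V g = x b`. -/
def liftDer (R : EdgeDerivation G F E) (b : M → ℝ)
    (hb : ContMDiff (𝓡∂ (k + q + 1)) 𝓘(ℝ, ℝ) ∞ b) : Module.End ℂ (CylSec k q F E) where
  toFun W := ⟨fun n => (R.D (slice n.2 W)).1 n.1 + ((R.a n.1 * n.2) •
      deriv (along W n.1) n.2 + (b n.1 * n.2) • (Complex.I • W.1 n)),
    IsSmoothAlong.add (isSmooth_derivation_slice R.isEdge.1 R.isDerivation W) (IsSmoothAlong.add
      (IsSmoothAlong.smul (u := fun n : M × ℝ => deriv (along W n.1) n.2)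
        ((R.smooth_a.comp contMDiff_fst).mul contMDiff_snd) (isSmooth_deriv W))
      (IsSmoothAlong.smul ((hb.comp contMDiff_fst).mul contMDiff_snd)
        (IsSmoothAlong.I_smul W.2)))⟩
  map_add' W W' := by
    ext n
    change (R.D (slice n.2 (W + W'))).1 n.1 + ((R.a n.1 * n.2) •
      deriv (fun t => along W n.1 t + along W' n.1 t) n.2 +
        (b n.1 * n.2) • (Complex.I • (W.1 n + W'.1 n))) =
      (R.D (slice n.2 W)).1 n.1 + ((R.a n.1 * n.2) •
      deriv (along W n.1) n.2 + (b n.1 * n.2) • (Complex.I • W.1 n)) +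
      ((R.D (slice n.2 W')).1 n.1 + ((R.a n.1 * n.2) •
      deriv (along W' n.1) n.2 + (b n.1 * n.2) • (Complex.I • W'.1 n)))
    have h : slice n.2 (W + W') = slice n.2 W + slice n.2 W' := rfl
    rw [h, map_add, deriv_fun_add (differentiableAt_along W _ _) (differentiableAt_along W' _ _)]
    change (R.D (slice n.2 W)).1 n.1 + (R.D (slice n.2 W')).1 n.1 + _ = _
    simp only [smul_add]
    change _ + (_ • deriv (along W n.1) n.2 + _ • deriv (along W' n.1) n.2 + _) = _
    abel
  map_smul' c W := by
    ext n
    change (R.D (slice n.2 (c • W))).1 n.1 + ((R.a n.1 * n.2) •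
      deriv (fun t => c • along W n.1 t) n.2 +
        (b n.1 * n.2) • (Complex.I • (c • W.1 n))) =
      c • ((R.D (slice n.2 W)).1 n.1 + ((R.a n.1 * n.2) •
      deriv (along W n.1) n.2 + (b n.1 * n.2) • (Complex.I • W.1 n)))
    have h : slice n.2 (c • W) = c • slice n.2 W := rfl
    rw [h, map_smul, deriv_fun_const_smul c (differentiableAt_along W _ _)]
    change c • (R.D (slice n.2 W)).1 n.1 + _ = _
    simp only [smul_add, smul_comm c]

theorem liftEnd_apply {B : Module.End ℂ (Sec k q F E)} (hB : B ∈ bundleEnd k q F E)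
    (W : CylSec k q F E) (p : M) (s : ℝ) : (liftEnd hB W).1 (p, s) = (B (slice s W)).1 p := rfl

theorem liftDer_apply (R : EdgeDerivation G F E) {b : M → ℝ}
    (hb : ContMDiff (𝓡∂ (k + q + 1)) 𝓘(ℝ, ℝ) ∞ b) (W : CylSec k q F E) (p : M) (s : ℝ) :
    (liftDer R b hb W).1 (p, s) = (R.D (slice s W)).1 p +
      ((R.a p * s) • deriv (along W p) s + (b p * s) • (Complex.I • W.1 (p, s))) := rfl

end CylSec

end CylinderCalculus

/-! ### Conjugation with the scaling ρx and the phase, and restriction to invariant sets -/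

section Conjugation

variable {k q : ℕ} {M N Y : Type*}
  [TopologicalSpace M] [ChartedSpace (EuclideanHalfSpace (k + q + 1)) M]
  [TopologicalSpace N] [ChartedSpace (EuclideanSpace ℝ (Fin (k + q))) N]
  [TopologicalSpace Y] [ChartedSpace (EuclideanSpace ℝ (Fin q)) Y]
  [IsManifold (𝓡∂ (k + q + 1)) ∞ M]
  {G : FiberedBoundary k q M N Y}
  {F : Type*} [NormedAddCommGroup F] [NormedSpace ℝ F] {E : M → Type*}
  [TopologicalSpace (TotalSpace F E)] [∀ p, NormedAddCommGroup (E p)]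
  [∀ p, InnerProductSpace ℂ (E p)] [FiberBundle F E] [VectorBundle ℝ F E]
  [ContMDiffVectorBundle ∞ F E (𝓡∂ (k + q + 1))]
  [SmoothHermitianBundle (𝓡∂ (k + q + 1)) F E]
  [T2Space M] [CompactSpace M] [FiniteDimensional ℝ F]

/-- The function `e^{iρg}`. -/
def phase (ρ : ℝ) (g : M → ℝ) (p : M) : ℂ := Complex.exp (Complex.I * ρ * g p)

theorem phase_eq (ρ : ℝ) (g : M → ℝ) (p : M) :
    phase ρ g p = Real.cos (ρ * g p) + Complex.I * Real.sin (ρ * g p) := by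
  rw [phase, show Complex.I * ρ * g p = ((ρ * g p : ℝ) : ℂ) * Complex.I by push_cast; ring,
    Complex.exp_mul_I, Complex.ofReal_cos, Complex.ofReal_sin, mul_comm Complex.I]

theorem phase_re (ρ : ℝ) (g : M → ℝ) (p : M) : (phase ρ g p).re = Real.cos (ρ * g p) := by
  rw [phase_eq]
  simp only [Complex.add_re, Complex.ofReal_re, Complex.mul_re, Complex.I_re, Complex.I_im,
    Complex.ofReal_im]
  ring

theorem phase_im (ρ : ℝ) (g : M → ℝ) (p : M) : (phase ρ g p).im = Real.sin (ρ * g p) := by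
  rw [phase_eq]
  simp only [Complex.add_im, Complex.ofReal_re, Complex.mul_im, Complex.I_re, Complex.I_im,
    Complex.ofReal_im]
  ring

theorem norm_phase (ρ : ℝ) (g : M → ℝ) (p : M) : ‖phase ρ g p‖ = 1 := by
  rw [phase, show Complex.I * ρ * g p = ((ρ * g p : ℝ) : ℂ) * Complex.I by push_cast; ring]
  exact Complex.norm_exp_ofReal_mul_I _

theorem contMDiff_phase (ρ : ℝ) {g : M → ℝ} (hg : ContMDiff (𝓡∂ (k + q + 1)) 𝓘(ℝ, ℝ) ∞ g) :
    ContMDiff (𝓡∂ (k + q + 1)) 𝓘(ℝ, ℂ) ∞ (phase ρ g) := by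
  have h : ContDiff ℝ ∞ fun t : ℝ => Complex.exp (Complex.I * ρ * t) :=
    ContDiff.cexp (contDiff_const.mul Complex.ofRealCLM.contDiff)
  exact h.contMDiff.comp hg

theorem dirDerivC_phase {V : ∀ p : M, TangentSpace (𝓡∂ (k + q + 1)) p} (ρ : ℝ) {g : M → ℝ}
    (hg : ContMDiff (𝓡∂ (k + q + 1)) 𝓘(ℝ, ℝ) ∞ g) (p : M) :
    dirDerivC V (phase ρ g) p = Complex.I * (ρ * dirDeriv V g p : ℝ) * phase ρ g p := by
  have h1 : HasDerivAt (fun t : ℝ => Real.cos (ρ * t)) (-Real.sin (ρ * g p) * ρ) (g p) := by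
    simpa using ((hasDerivAt_id (g p)).const_mul ρ).cos
  have h2 : HasDerivAt (fun t : ℝ => Real.sin (ρ * t)) (Real.cos (ρ * g p) * ρ) (g p) := by
    simpa using ((hasDerivAt_id (g p)).const_mul ρ).sin
  simp only [dirDerivC, phase_re, phase_im]
  rw [dirDeriv_comp hg h1, dirDeriv_comp hg h2, phase_eq]
  push_cast
  linear_combination (-(ρ : ℂ) * dirDeriv V g p * Complex.sin (ρ * g p)) * Complex.I_sq

theorem contMDiff_const_mul_x (G : FiberedBoundary k q M N Y) (ρ : ℝ) :
    ContMDiff (𝓡∂ (k + q + 1)) 𝓘(ℝ, ℝ) ∞ (fun p => ρ * G.x p) :=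
  contMDiff_const.mul G.contMDiff_x

variable (G) in
/-- The section `e^{iρg} W(p, ρx)`. -/
def scaled (ρ : ℝ) (g : M → ℝ) (hg : ContMDiff (𝓡∂ (k + q + 1)) 𝓘(ℝ, ℝ) ∞ g)
    (W : CylSec k q F E) : Sec k q F E :=
  mulSecC (phase ρ g) (contMDiff_phase ρ hg) (CylSec.graph _ (contMDiff_const_mul_x G ρ) W)

theorem scaled_apply (ρ : ℝ) {g : M → ℝ} (hg : ContMDiff (𝓡∂ (k + q + 1)) 𝓘(ℝ, ℝ) ∞ g)
    (W : CylSec k q F E) (p : M) :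
    (scaled G ρ g hg W).1 p = phase ρ g p • W.1 (p, ρ * G.x p) := rfl

theorem bundleEnd_scaled {B : Module.End ℂ (Sec k q F E)} (hB : B ∈ bundleEnd k q F E) (ρ : ℝ)
    {g : M → ℝ} (hg : ContMDiff (𝓡∂ (k + q + 1)) 𝓘(ℝ, ℝ) ∞ g) (W : CylSec k q F E) :
    B (scaled G ρ g hg W) = scaled G ρ g hg (CylSec.liftEnd hB W) := by
  obtain ⟨Φ⟩ := nonempty_globalFrame (𝓡∂ (k + q + 1)) F E
  rw [scaled, bundleEnd_mulSecC hB]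
  ext p
  rw [scaled_apply, CylSec.liftEnd_apply]
  change phase ρ g p • (B (CylSec.graph _ (contMDiff_const_mul_x G ρ) W)).1 p = _
  rw [bundleEnd_congr Φ hB]
  rfl

/-- With s = ρx one has V(ρx) = a s and V(ρg) = b s, so after the substitution neither the chain
rule term nor the derivative of the phase contains ρ. -/
theorem EdgeDerivation.apply_scaled (R : EdgeDerivation G F E) (ρ : ℝ)
    {g : M → ℝ} (hg : ContMDiff (𝓡∂ (k + q + 1)) 𝓘(ℝ, ℝ) ∞ g) {b : M → ℝ}
    (hb : ContMDiff (𝓡∂ (k + q + 1)) 𝓘(ℝ, ℝ) ∞ b) (hgb : ∀ p, dirDeriv R.V g p = G.x p * b p)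
    (W : CylSec k q F E) :
    R.D (scaled G ρ g hg W) = scaled G ρ g hg (CylSec.liftDer R b hb W) := by
  ext p
  have h1 : dirDeriv R.V (fun p => ρ * G.x p) p = R.a p * (ρ * G.x p) := by
    rw [dirDeriv_mul contMDiff_const G.contMDiff_x, dirDeriv_const, R.V_x]
    ring
  rw [scaled, R.isDerivation.mulSecC, dirDerivC_phase ρ hg, scaled_apply, CylSec.liftDer_apply,
    CylSec.derivation_graph R.isDerivation, h1, hgb]
  change _ • W.1 (p, ρ * G.x p) + _ = _
  simp only [← Complex.coe_smul, smul_add, smul_smul]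
  rw [add_comm, add_assoc]
  congr 3
  push_cast
  ring

/-- The functions `b` with `V g = x b`, for the vector fields of a normal form. -/
structure NormalForm.Slopes {P : Module.End ℂ (Sec k q F E)} (nf : NormalForm G P) (g : M → ℝ) where
  b : nf.ι → M → ℝ
  b' : nf.ι → M → ℝ
  smooth_b : ∀ i, ContMDiff (𝓡∂ (k + q + 1)) 𝓘(ℝ, ℝ) ∞ (b i)
  smooth_b' : ∀ i, ContMDiff (𝓡∂ (k + q + 1)) 𝓘(ℝ, ℝ) ∞ (b' i)
  eq_b : ∀ i p, dirDeriv (nf.R i).V g p = G.x p * b i p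
  eq_b' : ∀ i p, dirDeriv (nf.R' i).V g p = G.x p * b' i p

theorem NormalForm.nonempty_slopes {P : Module.End ℂ (Sec k q F E)} (nf : NormalForm G P)
    {g : M → ℝ} (hg : IsBasic G g) : Nonempty (nf.Slopes g) := by
  choose b hb hgb using fun i => (nf.R i).isEdge.exists_eq_x_mul hg
  choose b' hb' hgb' using fun i => (nf.R' i).isEdge.exists_eq_x_mul hg
  exact ⟨⟨b, b', hb, hb', hgb, hgb'⟩⟩

/-- The operator on the cylinder corresponding to a second order edge operator `P` acting on
sections `e^{iρg} W(p, ρ x)`. -/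
def NormalForm.lift {P : Module.End ℂ (Sec k q F E)} (nf : NormalForm G P) {g : M → ℝ}
    (sl : nf.Slopes g) : Module.End ℂ (CylSec k q F E) :=
  ∑ i, CylSec.liftEnd (nf.isEnd i) * (CylSec.liftDer (nf.R i) (sl.b i) (sl.smooth_b i) *
    CylSec.liftDer (nf.R' i) (sl.b' i) (sl.smooth_b' i))

theorem applyOp_eq (P : Module.End ℂ (Sec k q F E)) (u : Sec k q F E) :
    applyOp P u.1 = (P u).1 := by
  rw [applyOp, dif_pos u.2]

theorem cylSec_sum_apply {ι : Type*} (t : Finset ι) (W : ι → CylSec k q F E) (n : M × ℝ) :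
    (∑ i ∈ t, W i).1 n = ∑ i ∈ t, (W i).1 n := by
  rw [Submodule.coe_sum, Finset.sum_apply]

theorem NormalForm.lift_apply {P : Module.End ℂ (Sec k q F E)} (nf : NormalForm G P) {g : M → ℝ}
    (sl : nf.Slopes g) (W : CylSec k q F E) :
    nf.lift sl W = ∑ i, CylSec.liftEnd (nf.isEnd i) (CylSec.liftDer (nf.R i) (sl.b i) (sl.smooth_b i)
      (CylSec.liftDer (nf.R' i) (sl.b' i) (sl.smooth_b' i) W)) := by
  rw [NormalForm.lift, LinearMap.sum_apply]
  rfl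

/-- The lifted operator is the same for every ρ, which is what makes limits as ρ → ∞ of pairings and
of rescaled operators computable. -/
theorem NormalForm.apply_scaled {P : Module.End ℂ (Sec k q F E)} (nf : NormalForm G P) {g : M → ℝ}
    (hg : ContMDiff (𝓡∂ (k + q + 1)) 𝓘(ℝ, ℝ) ∞ g) (sl : nf.Slopes g) (ρ : ℝ) (W : CylSec k q F E) :
    P (scaled G ρ g hg W) = scaled G ρ g hg (nf.lift sl W) := by
  have h : P (scaled G ρ g hg W) = ∑ i, nf.B i ((nf.R i).D ((nf.R' i).D (scaled G ρ g hg W))) := by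
    conv_lhs => rw [nf.eq]
    rw [LinearMap.sum_apply]
    rfl
  rw [h, nf.lift_apply]
  ext p
  rw [sec_sum_apply, scaled_apply, cylSec_sum_apply, Finset.smul_sum]
  refine Finset.sum_congr rfl fun i _ => ?_
  rw [(nf.R' i).apply_scaled ρ hg (sl.smooth_b' i) (sl.eq_b' i),
    (nf.R i).apply_scaled ρ hg (sl.smooth_b i) (sl.eq_b i), bundleEnd_scaled (nf.isEnd i),
    scaled_apply]

/-! ### Supports -/

/-- The support of `W` is contained in `M × [s₀, s₁]`. -/
def SuppIn (W : CylSec k q F E) (s₀ s₁ : ℝ) : Prop :=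
  ∀ p s, s ∉ Icc s₀ s₁ → W.1 (p, s) = 0

theorem SuppIn.slice_eq_zero {W : CylSec k q F E} {s₀ s₁ : ℝ} (h : SuppIn W s₀ s₁) {s : ℝ}
    (hs : s ∉ Icc s₀ s₁) : CylSec.slice s W = 0 := by
  ext p
  exact h p s hs

theorem SuppIn.liftEnd {W : CylSec k q F E} {s₀ s₁ : ℝ} (h : SuppIn W s₀ s₁)
    {B : Module.End ℂ (Sec k q F E)} (hB : B ∈ bundleEnd k q F E) :
    SuppIn (CylSec.liftEnd hB W) s₀ s₁ := by
  intro p s hs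
  rw [CylSec.liftEnd_apply, h.slice_eq_zero hs, map_zero]
  rfl

theorem SuppIn.liftDer {W : CylSec k q F E} {s₀ s₁ : ℝ} (h : SuppIn W s₀ s₁)
    (R : EdgeDerivation G F E) {b : M → ℝ} (hb : ContMDiff (𝓡∂ (k + q + 1)) 𝓘(ℝ, ℝ) ∞ b) :
    SuppIn (CylSec.liftDer R b hb W) s₀ s₁ := by
  intro p s hs
  have h1 : CylSec.along W p =ᶠ[𝓝 s] fun _ => 0 := by
    filter_upwards [isClosed_Icc.isOpen_compl.mem_nhds hs] with t ht using h p t ht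
  rw [CylSec.liftDer_apply, h.slice_eq_zero hs, map_zero, h1.deriv_eq, deriv_const, h p s hs]
  change (0 : E p) + _ = 0
  simp

theorem SuppIn.sum {ι : Type*} {t : Finset ι} {W : ι → CylSec k q F E} {s₀ s₁ : ℝ}
    (h : ∀ i ∈ t, SuppIn (W i) s₀ s₁) : SuppIn (∑ i ∈ t, W i) s₀ s₁ := by
  intro p s hs
  rw [cylSec_sum_apply]
  exact Finset.sum_eq_zero fun i hi => h i hi p s hs

theorem SuppIn.lift {W : CylSec k q F E} {s₀ s₁ : ℝ} (h : SuppIn W s₀ s₁)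
    {P : Module.End ℂ (Sec k q F E)} (nf : NormalForm G P) {g : M → ℝ} (sl : nf.Slopes g) :
    SuppIn (nf.lift sl W) s₀ s₁ := by
  rw [nf.lift_apply]
  exact SuppIn.sum fun i _ => ((h.liftDer _ _).liftDer _ _).liftEnd _

/-! ### Restriction to invariant sets -/

variable (G) in
/-- The edge vector fields are tangent to the set `S`. -/
def IsEdgeInvariant (S : Set M) : Prop :=
  ∀ V : ∀ p : M, TangentSpace (𝓡∂ (k + q + 1)) p, IsEdgeVectorField G V → ∀ f : M → ℝ,
    ContMDiff (𝓡∂ (k + q + 1)) 𝓘(ℝ, ℝ) ∞ f → (∀ p ∈ S, f p = 0) → ∀ p ∈ S, dirDeriv V f p = 0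

theorem isEdgeInvariant_boundary : IsEdgeInvariant G (range G.incl) := by
  rintro V hV f hf h0 _ ⟨z, rfl⟩
  exact hV.dirDeriv_incl hf (h := fun _ => 0) contMDiff_const (fun z => h0 _ (mem_range_self z)) z

theorem isEdgeInvariant_fiber [IsManifold (𝓡 (k + q)) ∞ N] [IsManifold (𝓡 q) ∞ Y] {y : Y}
    {Z : Type*} [TopologicalSpace Z] [ChartedSpace (EuclideanSpace ℝ (Fin k)) Z]
    [IsManifold (𝓡 k) ∞ Z] (j : FiberModel G y Z) : IsEdgeInvariant G (range j.inclM) := by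
  rintro V hV f hf h0 _ ⟨z, rfl⟩
  exact hV.dirDeriv_inclM j hf (fun z => h0 _ (mem_range_self z)) z

/-- The frame coefficients of `u` vanish on `S`, hence so do their derivatives along fields tangent
to `S`. -/
theorem IsEdgeInvariant.derivation_eq_zero {S : Set M} (hS : IsEdgeInvariant G S)
    (R : EdgeDerivation G F E) {u : Sec k q F E} (hu : ∀ p ∈ S, u.1 p = 0) :
    ∀ p ∈ S, (R.D u).1 p = 0 := by
  intro p hp
  obtain ⟨Φ⟩ := nonempty_globalFrame (𝓡∂ (k + q + 1)) F E
  rw [R.isDerivation.apply_eq Φ]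
  refine Finset.sum_eq_zero fun i _ => ?_
  rw [hS R.V R.isEdge _ (Φ.contMDiff_coord i u) (fun p' hp' => by
    rw [GlobalFrame.coord, hu p' hp', map_zero]) p hp, hu p hp, map_zero, zero_smul, zero_smul,
    add_zero]

theorem IsEdgeInvariant.derivation_eq_smul {S : Set M} (hS : IsEdgeInvariant G S)
    (R : EdgeDerivation G F E) {u v : Sec k q F E} {κ : M → ℝ}
    (hκ : ContMDiff (𝓡∂ (k + q + 1)) 𝓘(ℝ, ℝ) ∞ κ) (hκV : ∀ p ∈ S, dirDeriv R.V κ p = 0)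
    (hu : ∀ p ∈ S, v.1 p = κ p • u.1 p) :
    ∀ p ∈ S, (R.D v).1 p = κ p • (R.D u).1 p := by
  intro p hp
  have h1 := hS.derivation_eq_zero R (u := v - mulSec κ hκ u) (fun p' hp' => by
    change v.1 p' - κ p' • u.1 p' = 0
    rw [hu p' hp', sub_self]) p hp
  rw [map_sub] at h1
  change (R.D v).1 p - (R.D (mulSec κ hκ u)).1 p = 0 at h1
  rw [R.isDerivation, hκV p hp, zero_smul, zero_add] at h1
  exact sub_eq_zero.1 h1

theorem IsEdgeInvariant.liftDer_eq_smul {S : Set M} (hS : IsEdgeInvariant G S)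
    (R : EdgeDerivation G F E) {W W' : CylSec k q F E} {κ : M → ℝ}
    (hκ : ContMDiff (𝓡∂ (k + q + 1)) 𝓘(ℝ, ℝ) ∞ κ) (hκV : ∀ p ∈ S, dirDeriv R.V κ p = 0)
    {b b' : M → ℝ} (hb : ContMDiff (𝓡∂ (k + q + 1)) 𝓘(ℝ, ℝ) ∞ b)
    (hb' : ContMDiff (𝓡∂ (k + q + 1)) 𝓘(ℝ, ℝ) ∞ b') (hbb' : ∀ p ∈ S, b p = b' p)
    (hW : ∀ p ∈ S, ∀ s, W'.1 (p, s) = κ p • W.1 (p, s)) :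
    ∀ p ∈ S, ∀ s, (CylSec.liftDer R b' hb' W').1 (p, s) = κ p • (CylSec.liftDer R b hb W).1 (p, s) := by
  intro p hp s
  have h1 := hS.derivation_eq_smul R hκ hκV (u := CylSec.slice s W) (v := CylSec.slice s W')
    (fun p hp => hW p hp s) p hp
  have h2 : CylSec.along W' p = fun s => κ p • CylSec.along W p s := funext fun s => hW p hp s
  rw [CylSec.liftDer_apply, CylSec.liftDer_apply, h1, h2,
    deriv_fun_const_smul _ (CylSec.differentiableAt_along W p s), hW p hp s, hbb' p hp]
  simp only [← Complex.coe_smul, smul_add, smul_smul]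
  rw [mul_comm (κ p : ℂ) ((R.a p * s : ℝ) : ℂ)]
  congr 3
  ring

/-- Only the data on `S` matter, since every derivation involved is tangent to `S`. With κ = 1 on a
fibre this gives independence of all extensions; on the boundary with a basic κ it gives commutation
with cutoffs from the base. -/
theorem IsEdgeInvariant.lift_eq_smul {S : Set M} (hS : IsEdgeInvariant G S)
    {P : Module.End ℂ (Sec k q F E)} (nf : NormalForm G P) {W W' : CylSec k q F E} {κ : M → ℝ}
    (hκ : ContMDiff (𝓡∂ (k + q + 1)) 𝓘(ℝ, ℝ) ∞ κ)
    (hκV : ∀ V : ∀ p : M, TangentSpace (𝓡∂ (k + q + 1)) p, IsEdgeVectorField G V →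
      ∀ p ∈ S, dirDeriv V κ p = 0)
    {g g' : M → ℝ} (sl : nf.Slopes g) (sl' : nf.Slopes g')
    (hb : ∀ i, ∀ p ∈ S, sl.b i p = sl'.b i p) (hb' : ∀ i, ∀ p ∈ S, sl.b' i p = sl'.b' i p)
    (hW : ∀ p ∈ S, ∀ s, W'.1 (p, s) = κ p • W.1 (p, s)) :
    ∀ p ∈ S, ∀ s, (nf.lift sl' W').1 (p, s) = κ p • (nf.lift sl W).1 (p, s) := by
  intro p hp s
  obtain ⟨Φ⟩ := nonempty_globalFrame (𝓡∂ (k + q + 1)) F E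
  rw [nf.lift_apply, nf.lift_apply, cylSec_sum_apply, cylSec_sum_apply, Finset.smul_sum]
  refine Finset.sum_congr rfl fun i _ => ?_
  have h1 := hS.liftDer_eq_smul (nf.R i) hκ (hκV _ (nf.R i).isEdge) (sl.smooth_b i)
    (sl'.smooth_b i) (hb i) (hS.liftDer_eq_smul (nf.R' i) hκ (hκV _ (nf.R' i).isEdge)
      (sl.smooth_b' i) (sl'.smooth_b' i) (hb' i) hW) p hp s
  rw [CylSec.liftEnd_apply, CylSec.liftEnd_apply]
  have h2 := bundleEnd_congr Φ (nf.isEnd i)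
    (s := CylSec.slice s (CylSec.liftDer (nf.R i) (sl'.b i) (sl'.smooth_b i)
      (CylSec.liftDer (nf.R' i) (sl'.b' i) (sl'.smooth_b' i) W')))
    (t := mulSec κ hκ (CylSec.slice s (CylSec.liftDer (nf.R i) (sl.b i) (sl.smooth_b i)
      (CylSec.liftDer (nf.R' i) (sl.b' i) (sl.smooth_b' i) W)))) h1
  rw [h2, nf.isEnd i]
  rfl

end Conjugation

/-! ### Complex forms of the boundary limit and of the fibre localization -/

section ComplexLimits

theorem integrable_of_continuous {X : Type*} [TopologicalSpace X] [CompactSpace X]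
    [MeasurableSpace X] [BorelSpace X] {ν : Measure X} [IsFiniteMeasure ν] {f : X → ℂ}
    (hf : Continuous f) : Integrable f ν := by
  obtain ⟨C, hC⟩ := (isCompact_univ (X := X)).exists_bound_of_continuousOn hf.continuousOn
  exact Integrable.of_bound hf.aestronglyMeasurable C (Eventually.of_forall fun p => hC p (mem_univ _))

theorem setIntegral_Ioi_eq {W : Type*} [NormedAddCommGroup W] [NormedSpace ℝ W] {k : ℝ → W}
    {s₀ s₁ : ℝ} (hs₀ : 0 < s₀) (h : ∀ s ∉ Icc s₀ s₁, k s = 0) :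
    ∫ s in Ioi 0, k s = ∫ s in Icc s₀ s₁, k s := by
  refine setIntegral_eq_of_subset_of_forall_sdiff_eq_zero measurableSet_Ioi
    (fun s hs => lt_of_lt_of_le hs₀ hs.1) fun s hs => h s hs.2

theorem continuous_setIntegral_Ioi {X : Type*} [TopologicalSpace X] [FirstCountableTopology X]
    [LocallyCompactSpace X] {k : X × ℝ → ℂ} (hk : Continuous k)
    {s₀ s₁ : ℝ} (hs₀ : 0 < s₀) (h : ∀ p, ∀ s ∉ Icc s₀ s₁, k (p, s) = 0) :
    Continuous fun p => ∫ s in Ioi 0, k (p, s) := by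
  simp only [fun p => setIntegral_Ioi_eq hs₀ (h p)]
  exact continuous_parametric_integral_of_continuous (f := fun p s => k (p, s)) hk isCompact_Icc

variable {k q : ℕ} {M N Y Z : Type*}
  [TopologicalSpace M] [ChartedSpace (EuclideanHalfSpace (k + q + 1)) M]
  [TopologicalSpace N] [ChartedSpace (EuclideanSpace ℝ (Fin (k + q))) N]
  [TopologicalSpace Y] [ChartedSpace (EuclideanSpace ℝ (Fin q)) Y]
  [TopologicalSpace Z] [ChartedSpace (EuclideanSpace ℝ (Fin k)) Z]
  [IsManifold (𝓡∂ (k + q + 1)) ∞ M]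
  {G : FiberedBoundary k q M N Y} [T2Space M] [CompactSpace M]
  [MeasurableSpace M] [BorelSpace M] [MeasurableSpace N] [BorelSpace N]
  {μ : Measure M} [IsFiniteMeasure μ] {μN : Measure N} [IsFiniteMeasure μN]

theorem tendsto_boundary_real (hμN : IsBoundaryDensity G μ μN) {κ : M × ℝ → ℝ}
    (hκ : ContMDiff ((𝓡∂ (k + q + 1)).prod 𝓘(ℝ, ℝ)) 𝓘(ℝ, ℝ) ∞ κ) {s₀ s₁ : ℝ} (hs₀ : 0 < s₀)
    (h : ∀ p, ∀ s ∉ Icc s₀ s₁, κ (p, s) = 0) :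
    Tendsto (fun ρ : ℝ => ρ * ∫ p, κ (p, ρ * G.x p) ∂μ) atTop
      (𝓝 (∫ z, (∫ s in Ioi 0, κ (G.incl z, s)) ∂μN)) := by
  have := G.compactSpace_boundary
  -- The new upper bound exceeds `s₁` strictly and is positive even if [s₀, s₁] is empty.
  have hpos : 0 < max s₁ 0 + 1 := by positivity
  have h1 := tendsto_mul_integral_comp_mul (μ := μ) (μN := μN) (x := G.x) (i := G.incl) (k := κ)
    (g := sndDeriv κ) G.contMDiff_x.continuous G.x_nonneg G.contMDiff_incl.continuous hμN
    hκ.continuous (contMDiff_sndDeriv hκ).continuous (fun p t => hasDerivAt_sndDeriv hκ p t) hpos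
    (fun p s hs => h p s fun hs' => hs ⟨hs₀.trans_le hs'.1, by
      have := hs'.2
      have := le_max_left s₁ 0
      linarith⟩)
  have h2 : ∀ z, ∫ s in Ioi 0, κ (G.incl z, s) = ∫ s in Ioc 0 (max s₁ 0 + 1), κ (G.incl z, s) := by
    intro z
    refine setIntegral_eq_of_subset_of_forall_sdiff_eq_zero measurableSet_Ioi
      (fun s hs => hs.1) fun s hs => h _ s fun hs' => hs.2 ⟨hs.1, ?_⟩
    have := hs'.2
    have := le_max_left s₁ 0
    linarith
  simp only [h2]
  exact h1

theorem tendsto_boundary (hμN : IsBoundaryDensity G μ μN) {κ : M × ℝ → ℂ}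
    (hκ : ContMDiff ((𝓡∂ (k + q + 1)).prod 𝓘(ℝ, ℝ)) 𝓘(ℝ, ℂ) ∞ κ) {s₀ s₁ : ℝ} (hs₀ : 0 < s₀)
    (h : ∀ p, ∀ s ∉ Icc s₀ s₁, κ (p, s) = 0) :
    Tendsto (fun ρ : ℝ => ρ * ∫ p, κ (p, ρ * G.x p) ∂μ) atTop
      (𝓝 (∫ z, (∫ s in Ioi 0, κ (G.incl z, s)) ∂μN)) := by
  have := G.compactSpace_boundary
  have hre := tendsto_boundary_real hμN (κ := fun n => (κ n).re) (Complex.reCLM.contMDiff.comp hκ)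
    hs₀ (fun p s hs => by rw [h p s hs, Complex.zero_re])
  have him := tendsto_boundary_real hμN (κ := fun n => (κ n).im) (Complex.imCLM.contMDiff.comp hκ)
    hs₀ (fun p s hs => by rw [h p s hs, Complex.zero_im])
  have hx := G.contMDiff_x.continuous
  have hi := G.contMDiff_incl.continuous
  have hc := hκ.continuous
  have e1 : ∀ ρ : ℝ, ∫ p, κ (p, ρ * G.x p) ∂μ =
      ((∫ p, (κ (p, ρ * G.x p)).re ∂μ : ℝ) : ℂ) + ((∫ p, (κ (p, ρ * G.x p)).im ∂μ : ℝ) : ℂ) * Complex.I :=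
    fun ρ => (integral_re_add_im (integrable_of_continuous (by fun_prop))).symm
  have e2 : ∀ z, ∫ s in Ioi 0, κ (G.incl z, s) =
      ((∫ s in Ioi 0, (κ (G.incl z, s)).re : ℝ) : ℂ) +
        ((∫ s in Ioi 0, (κ (G.incl z, s)).im : ℝ) : ℂ) * Complex.I := by
    intro z
    have hcz : Continuous fun s : ℝ => κ (G.incl z, s) := by fun_prop
    refine (integral_re_add_im (𝕜 := ℂ) (f := fun s => κ (G.incl z, s)) ?_).symm
    refine (hcz.integrable_of_hasCompactSupport ?_).integrableOn
    exact HasCompactSupport.of_support_subset_isCompact isCompact_Icc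
      (fun s hs => by by_contra hs'; exact hs (h _ s hs'))
  have := G.t2Space_boundary
  have := ChartedSpace.secondCountable_of_sigmaCompact (EuclideanSpace ℝ (Fin (k + q))) N
  have hF := continuous_setIntegral_Ioi (k := fun n : N × ℝ => κ (G.incl n.1, n.2)) (by fun_prop) hs₀
    (fun z s hs => h _ s hs)
  have e3 : ∫ z, (∫ s in Ioi 0, κ (G.incl z, s)) ∂μN =
      ((∫ z, (∫ s in Ioi 0, (κ (G.incl z, s)).re) ∂μN : ℝ) : ℂ) +
        ((∫ z, (∫ s in Ioi 0, (κ (G.incl z, s)).im) ∂μN : ℝ) : ℂ) * Complex.I := by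
    rw [← integral_re_add_im (integrable_of_continuous hF)]
    simp only [e2]
    simp
  rw [e3]
  simp only [e1]
  have h5 := ((Complex.continuous_ofReal.tendsto _).comp hre).add
    (((Complex.continuous_ofReal.tendsto _).comp him).mul_const Complex.I)
  refine h5.congr fun ρ => ?_
  simp only [Function.comp_apply]
  push_cast
  ring

variable [MeasurableSpace Y] [BorelSpace Y] [MeasurableSpace Z] [BorelSpace Z]

theorem IsFiberDensity.re_integral_nonneg [T2Space Y] [IsManifold (𝓡 q) ∞ Y] {y : Y}
    {j : FiberModel G y Z} {μY : Measure Y} {μZ : Measure Z} [IsFiniteMeasure μZ]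
    (hμZ : IsFiberDensity j μN μY μZ)
    {f : N → ℂ} (hf : Continuous f)
    (h : ∀ χ : Y → ℝ, ContMDiff (𝓡 q) 𝓘(ℝ, ℝ) ∞ χ →
      0 ≤ (∫ z, ((χ (G.proj z) ^ 2 : ℝ) : ℂ) * f z ∂μN).re) :
    0 ≤ (∫ z, f (j.incl z) ∂μZ).re := by
  have := G.compactSpace_boundary
  have := j.compactSpace
  have hj := j.isSmoothEmbedding_incl.contMDiff.continuous
  have h1 := hμZ.integral_nonneg (f := fun z => (f z).re) (by fun_prop) fun χ hχ => ?_
  · have h2 := integral_re (𝕜 := ℂ) (integrable_of_continuous (ν := μZ) (hf.comp hj))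
    exact h1.trans_eq h2
  · have hχc := hχ.continuous
    have hp := G.continuous_proj
    have h3 := integral_re (𝕜 := ℂ) (integrable_of_continuous (ν := μN)
      (f := fun z => ((χ (G.proj z) ^ 2 : ℝ) : ℂ) * f z) (by fun_prop))
    have h4 := (h χ hχ).trans_eq h3.symm
    simpa only [RCLike.re_to_complex, Complex.re_ofReal_mul] using h4

theorem IsFiberDensity.integral_eq_zero [T2Space Y] [IsManifold (𝓡 q) ∞ Y] {y : Y}
    {j : FiberModel G y Z} {μY : Measure Y} {μZ : Measure Z} [IsFiniteMeasure μZ]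
    (hμZ : IsFiberDensity j μN μY μZ)
    {f : N → ℂ} (hf : Continuous f)
    (h : ∀ χ : Y → ℝ, ContMDiff (𝓡 q) 𝓘(ℝ, ℝ) ∞ χ →
      ∫ z, ((χ (G.proj z) ^ 2 : ℝ) : ℂ) * f z ∂μN = 0) :
    ∫ z, f (j.incl z) ∂μZ = 0 := by
  -- The nonnegativity statement is applied to c f for c = ±1 and ±i, which forces both parts of the
  -- integral to vanish.
  have key : ∀ c : ℂ, 0 ≤ (c * ∫ z, f (j.incl z) ∂μZ).re := by
    intro c
    rw [← integral_const_mul]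
    refine hμZ.re_integral_nonneg (f := fun z => c * f z) (by fun_prop) fun χ hχ => ?_
    have h1 : ∀ z, ((χ (G.proj z) ^ 2 : ℝ) : ℂ) * (c * f z) =
        c * (((χ (G.proj z) ^ 2 : ℝ) : ℂ) * f z) := fun z => by ring
    simp only [h1]
    rw [integral_const_mul, h χ hχ, mul_zero, Complex.zero_re]
  have h1 := key 1
  have h2 := key (-1)
  have h3 := key Complex.I
  have h4 := key (-Complex.I)
  simp only [one_mul, neg_mul, Complex.neg_re, Complex.I_mul_re, neg_neg] at h1 h2 h3 h4
  exact Complex.ext (by rw [Complex.zero_re]; linarith) (by rw [Complex.zero_im]; linarith)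

end ComplexLimits

/-! ### Passage of symmetry and positivity to the boundary and to the fibres -/

section Pairing

variable {k q : ℕ} {M N Y : Type*}
  [TopologicalSpace M] [ChartedSpace (EuclideanHalfSpace (k + q + 1)) M]
  [TopologicalSpace N] [ChartedSpace (EuclideanSpace ℝ (Fin (k + q))) N]
  [TopologicalSpace Y] [ChartedSpace (EuclideanSpace ℝ (Fin q)) Y]
  [IsManifold (𝓡∂ (k + q + 1)) ∞ M]
  {G : FiberedBoundary k q M N Y}
  {F : Type*} [NormedAddCommGroup F] [NormedSpace ℝ F] {E : M → Type*}
  [TopologicalSpace (TotalSpace F E)] [∀ p, NormedAddCommGroup (E p)]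
  [∀ p, InnerProductSpace ℂ (E p)] [FiberBundle F E] [VectorBundle ℝ F E]
  [ContMDiffVectorBundle ∞ F E (𝓡∂ (k + q + 1))]
  [SmoothHermitianBundle (𝓡∂ (k + q + 1)) F E]
  [T2Space M] [CompactSpace M] [FiniteDimensional ℝ F]
  [MeasurableSpace M] [BorelSpace M] [MeasurableSpace N] [BorelSpace N]
  {μ : Measure M} [IsFiniteMeasure μ] {μN : Measure N} [IsFiniteMeasure μN]

/-- The pointwise pairing of sections over the cylinder, divided by `s`. -/
def cylPairing (U V : CylSec k q F E) (n : M × ℝ) : ℂ := (n.2⁻¹ : ℝ) * inner ℂ (V.1 n) (U.1 n)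

theorem cylPairing_eq_zero {U V : CylSec k q F E} {s₀ s₁ : ℝ} (hV : SuppIn V s₀ s₁) (p : M) :
    ∀ s ∉ Icc s₀ s₁, cylPairing U V (p, s) = 0 := by
  intro s hs
  rw [cylPairing, hV p s hs, inner_zero_left, mul_zero]

theorem contMDiff_inner (U V : CylSec k q F E) :
    ContMDiff ((𝓡∂ (k + q + 1)).prod 𝓘(ℝ, ℝ)) 𝓘(ℝ, ℂ) ∞
      (fun n => (inner ℂ (V.1 n) (U.1 n) : ℂ)) := by
  have h1 : ContMDiff ((𝓡∂ (k + q + 1)).prod 𝓘(ℝ, ℝ)) 𝓘(ℝ, ℝ) ∞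
    (fun n => (inner ℂ (V.1 n) (U.1 n) : ℂ).re) := IsSmoothAlong.re_inner U.2 V.2
  have h2 : ContMDiff ((𝓡∂ (k + q + 1)).prod 𝓘(ℝ, ℝ)) 𝓘(ℝ, ℝ) ∞
    (fun n => (inner ℂ (V.1 n) (U.1 n) : ℂ).im) := IsSmoothAlong.im_inner U.2 V.2
  have h3 : ContDiff ℝ ∞ fun v : ℝ × ℝ => (v.1 : ℂ) + v.2 * Complex.I :=
    (Complex.ofRealCLM.contDiff.comp contDiff_fst).add
      ((Complex.ofRealCLM.contDiff.comp contDiff_snd).mul contDiff_const)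
  refine (h3.contMDiff.comp (h1.prodMk_space h2)).congr fun n => ?_
  exact (Complex.re_add_im _).symm

/-- The factor s⁻¹ is harmless because the support of `V` keeps s ≥ s₀ > 0. -/
theorem contMDiff_cylPairing (U : CylSec k q F E) {V : CylSec k q F E} {s₀ s₁ : ℝ}
    (hV : SuppIn V s₀ s₁) (hs₀ : 0 < s₀) :
    ContMDiff ((𝓡∂ (k + q + 1)).prod 𝓘(ℝ, ℝ)) 𝓘(ℝ, ℂ) ∞ (cylPairing U V) := by
  rintro ⟨p, s⟩
  rcases lt_or_ge s s₀ with hs | hs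
  · refine (contMDiffAt_const (c := (0 : ℂ))).congr_of_eventuallyEq ?_
    filter_upwards [continuous_snd.continuousAt.preimage_mem_nhds (Iio_mem_nhds hs)] with n hn
    exact cylPairing_eq_zero hV n.1 n.2 fun h => absurd h.1 (not_le.2 hn)
  · have hs' : s ≠ 0 := (hs₀.trans_le hs).ne'
    have h1 : ContDiffAt ℝ ∞ (fun t : ℝ => ((t⁻¹ : ℝ) : ℂ)) s :=
      Complex.ofRealCLM.contDiff.contDiffAt.comp s (contDiffAt_inv ℝ hs')
    have h2 : ContMDiffAt ((𝓡∂ (k + q + 1)).prod 𝓘(ℝ, ℝ)) 𝓘(ℝ, ℂ) ∞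
        (fun n : M × ℝ => ((n.2⁻¹ : ℝ) : ℂ)) (p, s) :=
      h1.contMDiffAt.comp (p, s) contMDiffAt_snd
    exact (contDiff_mul (𝕜 := ℝ) (𝔸 := ℂ)).contMDiff.contMDiffAt.comp _
      (h2.prodMk_space (contMDiff_inner U V _))

/-- The support lies in s₀ ≤ ρx ≤ s₁, a closed set that misses x = 0. -/
theorem scaled_mem_testSec {W : CylSec k q F E} {s₀ s₁ : ℝ} (hW : SuppIn W s₀ s₁) (hs₀ : 0 < s₀)
    {ρ : ℝ} {g : M → ℝ} (hg : ContMDiff (𝓡∂ (k + q + 1)) 𝓘(ℝ, ℝ) ∞ g) :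
    (scaled G ρ g hg W).1 ∈ TestSec k q F E := by
  refine ⟨(scaled G ρ g hg W).2, {p | ρ * G.x p ∈ Icc s₀ s₁}, ?_, ?_, ?_⟩
  · have h1 := G.contMDiff_x.continuous
    exact (isClosed_Icc.preimage (by fun_prop : Continuous fun p => ρ * G.x p)).isCompact
  · intro p hp
    rw [← G.x_pos_iff]
    refine lt_of_le_of_ne (G.x_nonneg p) fun h0 => ?_
    have h1 : s₀ ≤ ρ * G.x p := hp.1
    rw [← h0, mul_zero] at h1
    linarith
  · intro p hp
    rw [scaled_apply, hW p _ hp, smul_zero]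

theorem inner_phase_smul {W : Type*} [NormedAddCommGroup W] [InnerProductSpace ℂ W] {c : ℂ}
    (hc : ‖c‖ = 1) (u v : W) : inner ℂ (c • v) (c • u) = (inner ℂ v u : ℂ) := by
  rw [inner_smul_left, inner_smul_right, ← mul_assoc, mul_comm (starRingEnd ℂ c), Complex.mul_conj,
    Complex.normSq_eq_norm_sq, hc]
  simp

/-- The phases cancel. The factor x⁻² of the operator and the weight `x` of the measure combine to
x⁻¹ = ρ (ρx)⁻¹, which explains both the outer ρ and the s⁻¹ in `cylPairing`. -/
theorem pairing_scaled_left {P : Module.End ℂ (Sec k q F E)} (nf : NormalForm G P) {g : M → ℝ}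
    (hg : ContMDiff (𝓡∂ (k + q + 1)) 𝓘(ℝ, ℝ) ∞ g) (sl : nf.Slopes g) {ρ : ℝ} (hρ : 0 < ρ)
    (W W' : CylSec k q F E) :
    l2Pairing (wedgeMeasure μ G.x) (wedgeOp G P (scaled G ρ g hg W).1) (scaled G ρ g hg W').1 =
      ρ * ∫ p, cylPairing (nf.lift sl W) W' (p, ρ * G.x p) ∂μ := by
  rw [l2Pairing, integral_wedgeMeasure G.contMDiff_x.continuous.measurable
    (Eventually.of_forall G.x_nonneg), ← integral_const_mul]
  refine integral_congr_ae (Eventually.of_forall fun p => ?_)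
  simp only [wedgeOp, cylPairing]
  rw [applyOp_eq, nf.apply_scaled hg sl, scaled_apply, scaled_apply, Complex.real_smul,
    ← Complex.coe_smul, inner_smul_right, inner_phase_smul (norm_phase ρ g p), ← mul_assoc, ← mul_assoc]
  congr 1
  rcases (G.x_nonneg p).eq_or_lt with h | h
  · rw [← h]; simp
  · have h1 : (G.x p : ℂ) ≠ 0 := by exact_mod_cast h.ne'
    have h2 : (ρ : ℂ) ≠ 0 := by exact_mod_cast hρ.ne'
    push_cast
    field_simp

theorem pairing_scaled_right {P : Module.End ℂ (Sec k q F E)} (nf : NormalForm G P) {g : M → ℝ}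
    (hg : ContMDiff (𝓡∂ (k + q + 1)) 𝓘(ℝ, ℝ) ∞ g) (sl : nf.Slopes g) {ρ : ℝ} (hρ : 0 < ρ)
    (W W' : CylSec k q F E) :
    l2Pairing (wedgeMeasure μ G.x) (scaled G ρ g hg W).1 (wedgeOp G P (scaled G ρ g hg W').1) =
      ρ * ∫ p, cylPairing W (nf.lift sl W') (p, ρ * G.x p) ∂μ := by
  rw [l2Pairing, integral_wedgeMeasure G.contMDiff_x.continuous.measurable
    (Eventually.of_forall G.x_nonneg), ← integral_const_mul]
  refine integral_congr_ae (Eventually.of_forall fun p => ?_)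
  simp only [wedgeOp, cylPairing]
  rw [applyOp_eq, nf.apply_scaled hg sl, scaled_apply, scaled_apply, Complex.real_smul,
    ← Complex.coe_smul, inner_smul_left, inner_phase_smul (norm_phase ρ g p), Complex.conj_ofReal,
    ← mul_assoc, ← mul_assoc]
  congr 1
  rcases (G.x_nonneg p).eq_or_lt with h | h
  · rw [← h]; simp
  · have h1 : (G.x p : ℂ) ≠ 0 := by exact_mod_cast h.ne'
    have h2 : (ρ : ℂ) ≠ 0 := by exact_mod_cast hρ.ne'
    push_cast
    field_simp

/-- Symmetry of `x⁻² P` in `x⁻¹ L²_b`. -/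
def IsSymmetricOp (G : FiberedBoundary k q M N Y) (μ : Measure M)
    (P : Module.End ℂ (Sec k q F E)) : Prop :=
  ∀ u ∈ TestSec k q F E, ∀ v ∈ TestSec k q F E,
      l2Pairing (wedgeMeasure μ G.x) (wedgeOp G P u) v =
        l2Pairing (wedgeMeasure μ G.x) u (wedgeOp G P v)

/-- Positivity of `x⁻² P` in `x⁻¹ L²_b`. -/
def IsNonnegOp (G : FiberedBoundary k q M N Y) (μ : Measure M)
    (P : Module.End ℂ (Sec k q F E)) : Prop :=
  ∀ u ∈ TestSec k q F E, 0 ≤ (l2Pairing (wedgeMeasure μ G.x) (wedgeOp G P u) u).re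

/-- For each ρ > 0 the scaled sections are admissible in the symmetry hypothesis; the two sides
converge to the two boundary integrals. -/
theorem boundary_symmetric (hμN : IsBoundaryDensity G μ μN) {P : Module.End ℂ (Sec k q F E)}
    (hsymm : IsSymmetricOp G μ P) (nf : NormalForm G P) {g : M → ℝ}
    (hg : ContMDiff (𝓡∂ (k + q + 1)) 𝓘(ℝ, ℝ) ∞ g) (sl : nf.Slopes g)
    {W W' : CylSec k q F E} {s₀ s₁ : ℝ} (hW : SuppIn W s₀ s₁) (hW' : SuppIn W' s₀ s₁)
    (hs₀ : 0 < s₀) :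
    ∫ z, (∫ s in Ioi 0, cylPairing (nf.lift sl W) W' (G.incl z, s)) ∂μN =
      ∫ z, (∫ s in Ioi 0, cylPairing W (nf.lift sl W') (G.incl z, s)) ∂μN := by
  have h1 := tendsto_boundary hμN (contMDiff_cylPairing (nf.lift sl W) hW' hs₀) hs₀
    (cylPairing_eq_zero hW')
  have h2 := tendsto_boundary hμN (contMDiff_cylPairing W (hW'.lift nf sl) hs₀) hs₀
    (cylPairing_eq_zero (hW'.lift nf sl))
  refine tendsto_nhds_unique (h1.congr' ?_) h2
  filter_upwards [eventually_gt_atTop 0] with ρ hρ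
  rw [← pairing_scaled_left nf hg sl hρ, ← pairing_scaled_right nf hg sl hρ]
  exact hsymm _ (scaled_mem_testSec hW hs₀ hg) _ (scaled_mem_testSec hW' hs₀ hg)

theorem boundary_nonneg (hμN : IsBoundaryDensity G μ μN) {P : Module.End ℂ (Sec k q F E)}
    (hpos : IsNonnegOp G μ P) (nf : NormalForm G P) {g : M → ℝ}
    (hg : ContMDiff (𝓡∂ (k + q + 1)) 𝓘(ℝ, ℝ) ∞ g) (sl : nf.Slopes g)
    {W : CylSec k q F E} {s₀ s₁ : ℝ} (hW : SuppIn W s₀ s₁) (hs₀ : 0 < s₀) :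
    0 ≤ (∫ z, (∫ s in Ioi 0, cylPairing (nf.lift sl W) W (G.incl z, s)) ∂μN).re := by
  have h1 := tendsto_boundary hμN (contMDiff_cylPairing (nf.lift sl W) hW hs₀) hs₀
    (cylPairing_eq_zero hW)
  refine ge_of_tendsto ((Complex.continuous_re.tendsto _).comp h1) ?_
  filter_upwards [eventually_gt_atTop 0] with ρ hρ
  rw [Function.comp_apply, ← pairing_scaled_left nf hg sl hρ]
  exact hpos _ (scaled_mem_testSec hW hs₀ hg)

/-- Multiplication by a function on `M`. -/
def CylSec.mul (κ : M → ℝ) (hκ : ContMDiff (𝓡∂ (k + q + 1)) 𝓘(ℝ, ℝ) ∞ κ) (W : CylSec k q F E) :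
    CylSec k q F E :=
  ⟨fun n => κ n.1 • W.1 n, IsSmoothAlong.smul (hκ.comp contMDiff_fst) W.2⟩

theorem SuppIn.mul {W : CylSec k q F E} {s₀ s₁ : ℝ} (hW : SuppIn W s₀ s₁) {κ : M → ℝ}
    (hκ : ContMDiff (𝓡∂ (k + q + 1)) 𝓘(ℝ, ℝ) ∞ κ) : SuppIn (CylSec.mul κ hκ W) s₀ s₁ := by
  intro p s hs
  change κ p • W.1 (p, s) = 0
  rw [hW p s hs, smul_zero]

/-- Edge fields annihilate basic functions along the boundary, so there such a function passes
through the lift without producing derivatives. -/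
theorem lift_mul_incl {P : Module.End ℂ (Sec k q F E)} (nf : NormalForm G P) {g : M → ℝ}
    (sl : nf.Slopes g) {κ : M → ℝ} (hκ : IsBasic G κ) (W : CylSec k q F E) (z : N) (s : ℝ) :
    (nf.lift sl (CylSec.mul κ hκ.1 W)).1 (G.incl z, s) =
      κ (G.incl z) • (nf.lift sl W).1 (G.incl z, s) := by
  refine (isEdgeInvariant_boundary (G := G)).lift_eq_smul nf hκ.1 ?_ sl sl (fun _ _ _ => rfl)
    (fun _ _ _ => rfl) (fun _ _ _ => rfl) _ (mem_range_self z) s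
  rintro V hV _ ⟨z, rfl⟩
  obtain ⟨hκ, h, hh, hκh⟩ := hκ
  exact hV.dirDeriv_incl hκ hh hκh z

theorem cylPairing_smul {U V U' V' : CylSec k q F E} {n : M × ℝ} {c : ℝ} (hU : U'.1 n = c • U.1 n)
    (hV : V'.1 n = c • V.1 n) : cylPairing U' V' n = ((c ^ 2 : ℝ) : ℂ) * cylPairing U V n := by
  rw [cylPairing, cylPairing, hU, hV, ← Complex.coe_smul, ← Complex.coe_smul, inner_smul_left,
    inner_smul_right, Complex.conj_ofReal]
  push_cast
  ring

variable [T2Space Y] [IsManifold (𝓡 (k + q)) ∞ N] [IsManifold (𝓡 q) ∞ Y] [MeasurableSpace Y] [BorelSpace Y] {y : Y}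
  {Z : Type*} [TopologicalSpace Z] [ChartedSpace (EuclideanSpace ℝ (Fin k)) Z]
  [MeasurableSpace Z] [BorelSpace Z] {j : FiberModel G y Z} {μY : Measure Y}
  {μZ : Measure Z} [IsFiniteMeasure μZ]

theorem continuous_boundary_cylPairing (U : CylSec k q F E) {V : CylSec k q F E} {s₀ s₁ : ℝ}
    (hV : SuppIn V s₀ s₁) (hs₀ : 0 < s₀) :
    Continuous fun z => ∫ s in Ioi 0, cylPairing U V (G.incl z, s) := by
  have := G.compactSpace_boundary
  have := G.t2Space_boundary
  have := ChartedSpace.secondCountable_of_sigmaCompact (EuclideanSpace ℝ (Fin (k + q))) N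
  have h1 := (contMDiff_cylPairing U hV hs₀).continuous
  have h2 := G.contMDiff_incl.continuous
  exact continuous_setIntegral_Ioi (k := fun n : N × ℝ => cylPairing U V (G.incl n.1, n.2))
    (by fun_prop) hs₀ fun z => cylPairing_eq_zero hV (G.incl z)

/-- Replacing both sections by their products with an extension of χ ∘ proj multiplies both boundary
integrands by χ²; as χ is arbitrary, equality descends to the fibre. -/
theorem fiber_symmetric (hμN : IsBoundaryDensity G μ μN) (hμZ : IsFiberDensity j μN μY μZ)
    {P : Module.End ℂ (Sec k q F E)}
    (hsymm : IsSymmetricOp G μ P) (nf : NormalForm G P) {g : M → ℝ}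
    (hg : ContMDiff (𝓡∂ (k + q + 1)) 𝓘(ℝ, ℝ) ∞ g) (sl : nf.Slopes g)
    {W W' : CylSec k q F E} {s₀ s₁ : ℝ} (hW : SuppIn W s₀ s₁) (hW' : SuppIn W' s₀ s₁)
    (hs₀ : 0 < s₀) :
    ∫ z, (∫ s in Ioi 0, cylPairing (nf.lift sl W) W' (j.inclM z, s)) ∂μZ =
      ∫ z, (∫ s in Ioi 0, cylPairing W (nf.lift sl W') (j.inclM z, s)) ∂μZ := by
  have := G.compactSpace_boundary
  have := j.compactSpace
  have hj := j.isSmoothEmbedding_incl.contMDiff.continuous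
  have c1 := continuous_boundary_cylPairing (G := G) (nf.lift sl W) hW' hs₀
  have c2 := continuous_boundary_cylPairing (G := G) W (hW'.lift nf sl) hs₀
  have h := hμZ.integral_eq_zero (f := fun z =>
    (∫ s in Ioi 0, cylPairing (nf.lift sl W) W' (G.incl z, s)) -
      ∫ s in Ioi 0, cylPairing W (nf.lift sl W') (G.incl z, s)) (c1.sub c2) fun χ hχ => ?_
  · have i1 := integrable_of_continuous (ν := μZ) (c1.comp hj)
    have i2 := integrable_of_continuous (ν := μZ) (c2.comp hj)
    exact sub_eq_zero.1 ((integral_sub i1 i2).symm.trans h)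
  · obtain ⟨κ, hκ, hκχ⟩ := G.exists_isBasic_extension hχ
    have hp := G.continuous_proj
    have hχc := hχ.continuous
    have h1 := boundary_symmetric hμN hsymm nf hg sl (hW.mul hκ.1) (hW'.mul hκ.1) hs₀
    have e1 : ∀ z s, cylPairing (nf.lift sl (CylSec.mul κ hκ.1 W)) (CylSec.mul κ hκ.1 W')
        (G.incl z, s) = ((χ (G.proj z) ^ 2 : ℝ) : ℂ) * cylPairing (nf.lift sl W) W' (G.incl z, s) :=
      fun z s => by
        rw [← hκχ]
        exact cylPairing_smul (lift_mul_incl nf sl hκ W z s) rfl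
    have e2 : ∀ z s, cylPairing (CylSec.mul κ hκ.1 W) (nf.lift sl (CylSec.mul κ hκ.1 W'))
        (G.incl z, s) = ((χ (G.proj z) ^ 2 : ℝ) : ℂ) * cylPairing W (nf.lift sl W') (G.incl z, s) :=
      fun z s => by
        rw [← hκχ]
        exact cylPairing_smul rfl (lift_mul_incl nf sl hκ W' z s)
    simp only [e1, e2, integral_const_mul] at h1
    simp only [mul_sub]
    rw [integral_sub (integrable_of_continuous (by fun_prop)) (integrable_of_continuous (by fun_prop)),
      h1, sub_self]

theorem fiber_nonneg (hμN : IsBoundaryDensity G μ μN) (hμZ : IsFiberDensity j μN μY μZ)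
    {P : Module.End ℂ (Sec k q F E)}
    (hpos : IsNonnegOp G μ P) (nf : NormalForm G P) {g : M → ℝ}
    (hg : ContMDiff (𝓡∂ (k + q + 1)) 𝓘(ℝ, ℝ) ∞ g) (sl : nf.Slopes g)
    {W : CylSec k q F E} {s₀ s₁ : ℝ} (hW : SuppIn W s₀ s₁) (hs₀ : 0 < s₀) :
    0 ≤ (∫ z, (∫ s in Ioi 0, cylPairing (nf.lift sl W) W (j.inclM z, s)) ∂μZ).re := by
  refine hμZ.re_integral_nonneg (continuous_boundary_cylPairing (G := G) (nf.lift sl W) hW hs₀)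
    fun χ hχ => ?_
  obtain ⟨κ, hκ, hκχ⟩ := G.exists_isBasic_extension hχ
  have h1 := boundary_nonneg hμN hpos nf hg sl (hW.mul hκ.1) hs₀
  have e1 : ∀ z s, cylPairing (nf.lift sl (CylSec.mul κ hκ.1 W)) (CylSec.mul κ hκ.1 W)
      (G.incl z, s) = ((χ (G.proj z) ^ 2 : ℝ) : ℂ) * cylPairing (nf.lift sl W) W (G.incl z, s) :=
    fun z s => by
      rw [← hκχ]
      exact cylPairing_smul (lift_mul_incl nf sl hκ W z s) rfl
  simpa only [e1, integral_const_mul] using h1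

end Pairing

/-! ### Twisted operators and sections of product form -/

section ConjugatedOperators

variable {k q : ℕ} {M N Y : Type*}
  [TopologicalSpace M] [ChartedSpace (EuclideanHalfSpace (k + q + 1)) M]
  [TopologicalSpace N] [ChartedSpace (EuclideanSpace ℝ (Fin (k + q))) N]
  [TopologicalSpace Y] [ChartedSpace (EuclideanSpace ℝ (Fin q)) Y]
  [IsManifold (𝓡∂ (k + q + 1)) ∞ M]
  {G : FiberedBoundary k q M N Y}
  {F : Type*} [NormedAddCommGroup F] [NormedSpace ℝ F] {E : M → Type*}
  [TopologicalSpace (TotalSpace F E)] [∀ p, NormedAddCommGroup (E p)]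
  [∀ p, InnerProductSpace ℂ (E p)] [FiberBundle F E] [VectorBundle ℝ F E]
  [ContMDiffVectorBundle ∞ F E (𝓡∂ (k + q + 1))]
  [SmoothHermitianBundle (𝓡∂ (k + q + 1)) F E]
  [T2Space M] [CompactSpace M] [FiniteDimensional ℝ F]

/-- The edge derivation `D + w m`. -/
def EdgeDerivation.twist (R : EdgeDerivation G F E) (w : ℂ) (m : M → ℝ)
    (hm : ContMDiff (𝓡∂ (k + q + 1)) 𝓘(ℝ, ℝ) ∞ m) : EdgeDerivation G F E where
  D := R.D + w • mulOp m hm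
  V := R.V
  isEdge := R.isEdge
  isDerivation := R.isDerivation.add_smul_mulOp w hm
  a := R.a
  smooth_a := R.smooth_a
  V_x := R.V_x

theorem EdgeDerivation.twist_apply (R : EdgeDerivation G F E) (w : ℂ) {m : M → ℝ}
    (hm : ContMDiff (𝓡∂ (k + q + 1)) 𝓘(ℝ, ℝ) ∞ m) (u : Sec k q F E) (p : M) :
    ((R.twist w m hm).D u).1 p = (R.D u).1 p + w • m p • u.1 p := rfl

variable {P : Module.End ℂ (Sec k q F E)}

/-- The operator obtained from a normal form by replacing `D` by `D + w m`, for each of the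
derivations that occur. -/
def NormalForm.twistOp (nf : NormalForm G P) (w : ℂ) {m m' : nf.ι → M → ℝ}
    (hm : ∀ i, ContMDiff (𝓡∂ (k + q + 1)) 𝓘(ℝ, ℝ) ∞ (m i))
    (hm' : ∀ i, ContMDiff (𝓡∂ (k + q + 1)) 𝓘(ℝ, ℝ) ∞ (m' i)) : Module.End ℂ (Sec k q F E) :=
  ∑ i, nf.B i * (((nf.R i).twist w (m i) (hm i)).D * ((nf.R' i).twist w (m' i) (hm' i)).D)

/-- The normal form of a twisted operator. -/
def NormalForm.twist (nf : NormalForm G P) (w : ℂ) {m m' : nf.ι → M → ℝ}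
    (hm : ∀ i, ContMDiff (𝓡∂ (k + q + 1)) 𝓘(ℝ, ℝ) ∞ (m i))
    (hm' : ∀ i, ContMDiff (𝓡∂ (k + q + 1)) 𝓘(ℝ, ℝ) ∞ (m' i)) :
    NormalForm G (nf.twistOp w hm hm') where
  ι := nf.ι
  fintype := nf.fintype
  B := nf.B
  isEnd := nf.isEnd
  R i := (nf.R i).twist w (m i) (hm i)
  R' i := (nf.R' i).twist w (m' i) (hm' i)
  eq := rfl

theorem NormalForm.apply (nf : NormalForm G P) (u : Sec k q F E) :
    P u = ∑ i, nf.B i ((nf.R i).D ((nf.R' i).D u)) := by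
  conv_lhs => rw [nf.eq]
  rw [LinearMap.sum_apply]
  rfl

theorem NormalForm.apply_val (nf : NormalForm G P) (u : Sec k q F E) (p : M) :
    (P u).1 p = ∑ i, (nf.B i ((nf.R i).D ((nf.R' i).D u))).1 p := by
  rw [nf.apply, sec_sum_apply]

theorem NormalForm.mem_edgeDiffOps (nf : NormalForm G P) : P ∈ edgeDiffOps G F E 2 := by
  rw [nf.eq, edgeDiffOps, pow_two]
  exact Submodule.sum_mem _ fun i _ => Submodule.mul_mem_mul (Submodule.subset_span (nf.isEnd i))
    (Submodule.mul_mem_mul (Submodule.subset_span (nf.R i).mem)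
      (Submodule.subset_span (nf.R' i).mem))

/-- Each derivation preserves vanishing on `S`, and bundle endomorphisms act pointwise. This makes
the restriction of `P` to a fibre well defined. -/
theorem NormalForm.congr_on (nf : NormalForm G P) {S : Set M} (hS : IsEdgeInvariant G S)
    {u v : Sec k q F E} (huv : ∀ p ∈ S, u.1 p = v.1 p) : ∀ p ∈ S, (P u).1 p = (P v).1 p := by
  obtain ⟨Φ⟩ := nonempty_globalFrame (𝓡∂ (k + q + 1)) F E
  have key : ∀ (R : EdgeDerivation G F E) (u v : Sec k q F E), (∀ p ∈ S, u.1 p = v.1 p) →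
      ∀ p ∈ S, (R.D u).1 p = (R.D v).1 p := by
    intro R u v h p hp
    have h1 := hS.derivation_eq_zero R (u := u - v) (fun p hp => sub_eq_zero.2 (h p hp)) p hp
    rw [map_sub] at h1
    exact sub_eq_zero.1 h1
  intro p hp
  rw [nf.apply_val, nf.apply_val]
  exact Finset.sum_congr rfl fun i _ =>
    bundleEnd_congr Φ (nf.isEnd i) (key _ _ _ (key _ _ _ huv) p hp)

theorem isEdgeInvariant_of_isOpen {O : Set M} (hO : IsOpen O) : IsEdgeInvariant G O := by
  intro V _ f _ hf p hp
  have h : f =ᶠ[𝓝 p] fun _ => 0 := by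
    filter_upwards [hO.mem_nhds hp] with p' hp' using hf p' hp'
  rw [dirDeriv_congr h, dirDeriv_const]

/-- Moving `c` through a derivation turns `D` into D + w m. Two uses: c = x^{iσ} with w = iσ, m = a,
and c = e^{iρf} with w = iρ, m = V f. The equation is needed on an open set only, so x^{iσ} may be
altered near the boundary. -/
theorem NormalForm.apply_mulSecC (nf : NormalForm G P) (w : ℂ) {m m' : nf.ι → M → ℝ}
    (hm : ∀ i, ContMDiff (𝓡∂ (k + q + 1)) 𝓘(ℝ, ℝ) ∞ (m i))
    (hm' : ∀ i, ContMDiff (𝓡∂ (k + q + 1)) 𝓘(ℝ, ℝ) ∞ (m' i)) {c : M → ℂ}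
    (hc : ContMDiff (𝓡∂ (k + q + 1)) 𝓘(ℝ, ℂ) ∞ c) {O : Set M} (hO : IsOpen O)
    (h : ∀ i, ∀ p ∈ O, dirDerivC (nf.R i).V c p = w * m i p * c p)
    (h' : ∀ i, ∀ p ∈ O, dirDerivC (nf.R' i).V c p = w * m' i p * c p) (u : Sec k q F E) {p : M}
    (hp : p ∈ O) : (P (mulSecC c hc u)).1 p = c p • (nf.twistOp w hm hm' u).1 p := by
  obtain ⟨Φ⟩ := nonempty_globalFrame (𝓡∂ (k + q + 1)) F E
  have hS : IsEdgeInvariant G O := isEdgeInvariant_of_isOpen hO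
  have key : ∀ (R : EdgeDerivation G F E) (m : M → ℝ) (hm : ContMDiff (𝓡∂ (k + q + 1)) 𝓘(ℝ, ℝ) ∞ m),
      (∀ p ∈ O, dirDerivC R.V c p = w * m p * c p) → ∀ u v : Sec k q F E,
      (∀ p ∈ O, v.1 p = c p • u.1 p) → ∀ p ∈ O, (R.D v).1 p = c p • ((R.twist w m hm).D u).1 p := by
    intro R m hm h u v huv p hp
    have h1 := hS.derivation_eq_zero R (u := v - mulSecC c hc u)
      (fun p hp => sub_eq_zero.2 (huv p hp)) p hp
    rw [map_sub] at h1
    have h2 : (R.D v).1 p = (R.D (mulSecC c hc u)).1 p := sub_eq_zero.1 h1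
    rw [h2, R.isDerivation.mulSecC, h p hp, R.twist_apply, smul_add, ← Complex.coe_smul, smul_smul,
      smul_smul, add_comm]
    congr 2
    ring
  rw [nf.apply_val, (nf.twist w hm hm').apply_val, Finset.smul_sum]
  refine Finset.sum_congr rfl fun i _ => ?_
  have h3 := key (nf.R i) (m i) (hm i) (h i) _ _
    (key (nf.R' i) (m' i) (hm' i) (h' i) u (mulSecC c hc u) fun _ _ => rfl) p hp
  have h4 := bundleEnd_congr Φ (nf.isEnd i) (p := p)
    (s := (nf.R i).D ((nf.R' i).D (mulSecC c hc u)))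
    (t := mulSecC c hc (((nf.R i).twist w (m i) (hm i)).D (((nf.R' i).twist w (m' i) (hm' i)).D u)))
    h3
  rw [h4, bundleEnd_mulSecC (nf.isEnd i)]
  rfl

theorem dirDerivC_comp {V : ∀ p : M, TangentSpace (𝓡∂ (k + q + 1)) p} {h : ℝ → ℂ} {f : M → ℝ}
    (hf : ContMDiff (𝓡∂ (k + q + 1)) 𝓘(ℝ, ℝ) ∞ f) {p : M} {h' : ℂ}
    (hh : HasDerivAt h h' (f p)) : dirDerivC V (fun p => h (f p)) p = h' * dirDeriv V f p := by
  have h1 : HasDerivAt (fun s => (h s).re) h'.re (f p) :=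
    Complex.reCLM.hasFDerivAt.comp_hasDerivAt (f p) hh
  have h2 : HasDerivAt (fun s => (h s).im) h'.im (f p) :=
    Complex.imCLM.hasFDerivAt.comp_hasDerivAt (f p) hh
  rw [dirDerivC, dirDeriv_comp hf h1, dirDeriv_comp hf h2]
  conv_rhs => rw [← Complex.re_add_im h']
  push_cast
  ring

/-! ### Sections of product form over the cylinder -/

/-- The section `ζ(s) U` over the cylinder. -/
def tens (ζ : ℝ → ℂ) (hζ : ContDiff ℝ ∞ ζ) (U : Sec k q F E) : CylSec k q F E :=
  ⟨fun n => ζ n.2 • U.1 n.1,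
    IsSmoothAlong.smul_complex (hζ.contMDiff.comp contMDiff_snd) (U.2.comp_map contMDiff_fst)⟩

theorem tens_apply {ζ : ℝ → ℂ} (hζ : ContDiff ℝ ∞ ζ) (U : Sec k q F E) (p : M) (s : ℝ) :
    (tens ζ hζ U).1 (p, s) = ζ s • U.1 p := rfl

theorem tens_sum {ι : Type*} (t : Finset ι) {ζ : ℝ → ℂ} (hζ : ContDiff ℝ ∞ ζ)
    (U : ι → Sec k q F E) : tens ζ hζ (∑ i ∈ t, U i) = ∑ i ∈ t, tens ζ hζ (U i) := by
  ext n
  rw [cylSec_sum_apply]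
  change ζ n.2 • (∑ i ∈ t, U i).1 n.1 = _
  rw [sec_sum_apply, Finset.smul_sum]
  rfl

theorem tens_add {ζ : ℝ → ℂ} (hζ : ContDiff ℝ ∞ ζ) (U V : Sec k q F E) :
    tens ζ hζ (U + V) = tens ζ hζ U + tens ζ hζ V := by
  ext n
  exact smul_add _ _ _

/-- The operator `s ∂_s`. -/
def eulerOp (ζ : ℝ → ℂ) (s : ℝ) : ℂ := s * deriv ζ s

theorem contDiff_eulerOp {ζ : ℝ → ℂ} (hζ : ContDiff ℝ ∞ ζ) : ContDiff ℝ ∞ (eulerOp ζ) :=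
  Complex.ofRealCLM.contDiff.mul (contDiff_infty_iff_deriv.1 hζ).2

theorem liftEnd_tens {B : Module.End ℂ (Sec k q F E)} (hB : B ∈ bundleEnd k q F E)
    {ζ : ℝ → ℂ} (hζ : ContDiff ℝ ∞ ζ) (U : Sec k q F E) :
    CylSec.liftEnd hB (tens ζ hζ U) = tens ζ hζ (B U) := by
  ext ⟨p, s⟩
  rw [CylSec.liftEnd_apply, tens_apply]
  have h : CylSec.slice s (tens ζ hζ U) = ζ s • U := rfl
  rw [h, map_smul]
  rfl

theorem liftDer_tens (R : EdgeDerivation G F E) {ζ : ℝ → ℂ} (hζ : ContDiff ℝ ∞ ζ)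
    (U : Sec k q F E) : CylSec.liftDer R (fun _ => 0) contMDiff_const (tens ζ hζ U) =
      tens ζ hζ (R.D U) + tens (eulerOp ζ) (contDiff_eulerOp hζ) (mulOp R.a R.smooth_a U) := by
  ext ⟨p, s⟩
  have h1 : HasDerivAt (CylSec.along (tens ζ hζ U) p) (deriv ζ s • U.1 p) s :=
    ((hζ.differentiable (by simp)).differentiableAt.hasDerivAt).smul_const (U.1 p)
  have h : CylSec.slice s (tens ζ hζ U) = ζ s • U := rfl
  rw [CylSec.liftDer_apply, h1.deriv, h, map_smul, zero_mul, zero_smul, add_zero]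
  change ζ s • (R.D U).1 p + _ = ζ s • (R.D U).1 p + eulerOp ζ s • R.a p • U.1 p
  rw [eulerOp, ← Complex.coe_smul, ← Complex.coe_smul, smul_smul, smul_smul]
  congr 2
  push_cast
  ring

end ConjugatedOperators

/-! ### Cutoff functions on the half line and the Euler operator -/

section Cutoffs

/-- A smooth function on the line that agrees with the logarithm away from zero. -/
theorem exists_contDiff_eq_log {δ : ℝ} (hδ : 0 < δ) :
    ∃ l : ℝ → ℝ, ContDiff ℝ ∞ l ∧ ∀ s, δ ≤ s → l s = Real.log s := by
  refine ⟨fun s => Real.smoothTransition ((s - δ / 2) / (δ / 2)) * Real.log s, ?_, fun s hs => ?_⟩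
  · rw [contDiff_iff_contDiffAt]
    intro s
    rcases lt_or_ge s (δ / 2) with h | h
    · refine (contDiffAt_const (c := (0 : ℝ))).congr_of_eventuallyEq ?_
      filter_upwards [Iio_mem_nhds h] with t ht
      have ht' : t < δ / 2 := ht
      rw [Real.smoothTransition.zero_of_nonpos, zero_mul]
      exact div_nonpos_of_nonpos_of_nonneg (by linarith) (by positivity)
    · have hs : s ≠ 0 := by linarith
      refine ContDiffAt.mul ?_ (Real.contDiffAt_log.2 hs)
      exact Real.smoothTransition.contDiff.contDiffAt.comp s (by fun_prop)
  · have h1 : 1 ≤ (s - δ / 2) / (δ / 2) := by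
      rw [le_div_iff₀ (by positivity)]
      linarith
    simp only [Real.smoothTransition.one_of_one_le h1, one_mul]

/-- The function β carries the mass of the test pairing; φ is 1 near its support, so that no
derivative of φ ever meets β. -/
theorem exists_cutoffs : ∃ β φ : ℝ → ℝ, ContDiff ℝ ∞ β ∧ ContDiff ℝ ∞ φ ∧
    0 < ∫ s in Ioi 0, β s ∧ (∀ s ∉ Icc (1 : ℝ) 3, β s = 0) ∧ (∀ s ∉ Icc (1 : ℝ) 3, φ s = 0) ∧
    ∀ s ∈ tsupport β, φ =ᶠ[𝓝 s] fun _ => 1 := by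
  -- Both bumps are centred at 2. The closed support of β has radius 1/2, φ is 1 up to radius 3/4
  -- and vanishes from radius 1 on.
  let β : ContDiffBump (2 : ℝ) := ⟨1 / 4, 1 / 2, by norm_num, by norm_num⟩
  let φ : ContDiffBump (2 : ℝ) := ⟨3 / 4, 1, by norm_num, by norm_num⟩
  have hβ : ∀ s ∉ Icc (1 : ℝ) 3, β s = 0 := by
    intro s hs
    refine β.zero_of_le_dist ?_
    by_contra h
    have h' : dist s 2 < 1 / 2 := not_le.1 h
    rw [Real.dist_eq, abs_lt] at h'
    exact hs ⟨by linarith, by linarith⟩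
  refine ⟨β, φ, β.contDiff, φ.contDiff, ?_, hβ, fun s hs => ?_, fun s hs => ?_⟩
  · have h1 : ∫ s in Ioi 0, β s = ∫ s, β s := by
      refine setIntegral_eq_integral_of_forall_compl_eq_zero fun s hs => hβ s fun h => hs ?_
      exact lt_of_lt_of_le one_pos h.1
    rw [h1]
    exact β.integral_pos
  · refine φ.zero_of_le_dist ?_
    by_contra h
    have h' : dist s 2 < 1 := not_le.1 h
    rw [Real.dist_eq, abs_lt] at h'
    exact hs ⟨by linarith, by linarith⟩
  · rw [β.tsupport_eq] at hs
    have h1 : s ∈ Metric.ball (2 : ℝ) (3 / 4) :=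
      lt_of_le_of_lt hs (by norm_num : (1 / 2 : ℝ) < 3 / 4)
    filter_upwards [Metric.isOpen_ball.mem_nhds h1] with t ht
    exact φ.one_of_mem_closedBall (Metric.ball_subset_closedBall ht)

theorem eulerOp_mul {e ψ : ℝ → ℂ} (he : ContDiff ℝ ∞ e) (hψ : ContDiff ℝ ∞ ψ) (s : ℝ) :
    eulerOp (fun s => e s * ψ s) s = eulerOp e s * ψ s + e s * eulerOp ψ s := by
  rw [eulerOp, deriv_fun_mul (he.differentiable (by simp)).differentiableAt
    (hψ.differentiable (by simp)).differentiableAt, eulerOp, eulerOp]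
  ring

theorem eulerOp_eq_zero {ψ : ℝ → ℂ} {s : ℝ} {c : ℂ} (h : ψ =ᶠ[𝓝 s] fun _ => c) :
    eulerOp ψ =ᶠ[𝓝 s] fun _ => 0 := by
  filter_upwards [h.eventuallyEq_nhds] with t ht
  rw [eulerOp, ht.deriv_eq, deriv_const, mul_zero]

theorem eulerOp_eq_zero_of_notMem {ψ : ℝ → ℂ} {s₀ s₁ : ℝ} (h : ∀ s ∉ Icc s₀ s₁, ψ s = 0) :
    ∀ s ∉ Icc s₀ s₁, eulerOp ψ s = 0 := by
  intro s hs
  refine (eulerOp_eq_zero (c := 0) ?_).self_of_nhds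
  filter_upwards [isClosed_Icc.isOpen_compl.mem_nhds hs] with t ht using h t ht

end Cutoffs

/-! ### The indicial operator inside the lifted operator -/

section Indicial

variable {k q : ℕ} {M N Y : Type*}
  [TopologicalSpace M] [ChartedSpace (EuclideanHalfSpace (k + q + 1)) M]
  [TopologicalSpace N] [ChartedSpace (EuclideanSpace ℝ (Fin (k + q))) N]
  [TopologicalSpace Y] [ChartedSpace (EuclideanSpace ℝ (Fin q)) Y]
  [IsManifold (𝓡∂ (k + q + 1)) ∞ M]
  {G : FiberedBoundary k q M N Y}
  {F : Type*} [NormedAddCommGroup F] [NormedSpace ℝ F] {E : M → Type*}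
  [TopologicalSpace (TotalSpace F E)] [∀ p, NormedAddCommGroup (E p)]
  [∀ p, InnerProductSpace ℂ (E p)] [FiberBundle F E] [VectorBundle ℝ F E]
  [ContMDiffVectorBundle ∞ F E (𝓡∂ (k + q + 1))]
  [SmoothHermitianBundle (𝓡∂ (k + q + 1)) F E]
  [T2Space M] [CompactSpace M] [FiniteDimensional ℝ F]
  {P : Module.End ℂ (Sec k q F E)}

/-- The slopes of the zero function. -/
def NormalForm.zeroSlopes (nf : NormalForm G P) : nf.Slopes (fun _ => 0) where
  b _ _ := 0
  b' _ _ := 0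
  smooth_b _ := contMDiff_const
  smooth_b' _ := contMDiff_const
  eq_b i p := by rw [dirDeriv_const, mul_zero]
  eq_b' i p := by rw [dirDeriv_const, mul_zero]

variable {e : ℝ → ℂ} {w : ℂ} {s₀ s₁ : ℝ}

/-- Where ψ lives, `e` behaves like s^w, an eigenfunction of s ∂_s. So the term a s ∂_s contributes
w a, which is the twist, plus a remainder in which the Euler operator falls on ψ. -/
theorem liftDer_tens_mul (he : ContDiff ℝ ∞ e) (hew : ∀ s ∈ Icc s₀ s₁, eulerOp e s = w * e s)
    (R : EdgeDerivation G F E) {ψ : ℝ → ℂ} (hψ : ContDiff ℝ ∞ ψ)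
    (hψ0 : ∀ s ∉ Icc s₀ s₁, ψ s = 0) (U : Sec k q F E) :
    CylSec.liftDer R (fun _ => 0) contMDiff_const (tens (fun s => e s * ψ s) (he.mul hψ) U) =
      tens (fun s => e s * ψ s) (he.mul hψ) ((R.twist w R.a R.smooth_a).D U) +
      tens (fun s => e s * eulerOp ψ s) (he.mul (contDiff_eulerOp hψ)) (mulOp R.a R.smooth_a U) := by
  rw [liftDer_tens]
  ext ⟨p, s⟩
  change (e s * ψ s) • (R.D U).1 p + eulerOp (fun s => e s * ψ s) s • R.a p • U.1 p =
    (e s * ψ s) • ((R.D U).1 p + w • R.a p • U.1 p) + (e s * eulerOp ψ s) • R.a p • U.1 p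
  have h1 : eulerOp (fun s => e s * ψ s) s = w * (e s * ψ s) + e s * eulerOp ψ s := by
    rw [eulerOp_mul he hψ]
    by_cases hs : s ∈ Icc s₀ s₁
    · rw [hew s hs]
      ring
    · rw [hψ0 s hs]
      ring
  rw [h1]
  module

/-- The indicial operator on `M`: `x^{-w} P x^{w}`. -/
def NormalForm.indicial (nf : NormalForm G P) (w : ℂ) : Module.End ℂ (Sec k q F E) :=
  nf.twistOp w (fun i => (nf.R i).smooth_a) (fun i => (nf.R' i).smooth_a)

/-- The two derivations of each summand are expanded in turn. The sections `U₁`, `U₂` do not depend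
on ψ, and every term besides the indicial one carries an Euler derivative of ψ. -/
theorem lift_tens_mul (nf : NormalForm G P) (he : ContDiff ℝ ∞ e)
    (hew : ∀ s ∈ Icc s₀ s₁, eulerOp e s = w * e s) (U : Sec k q F E) :
    ∃ U₁ U₂ : Sec k q F E, ∀ (ψ : ℝ → ℂ) (hψ : ContDiff ℝ ∞ ψ), (∀ s ∉ Icc s₀ s₁, ψ s = 0) →
    nf.lift nf.zeroSlopes (tens (fun s => e s * ψ s) (he.mul hψ) U) =
      tens (fun s => e s * ψ s) (he.mul hψ) (nf.indicial w U) +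
      tens (fun s => e s * eulerOp ψ s) (he.mul (contDiff_eulerOp hψ)) U₁ +
      tens (fun s => e s * eulerOp (eulerOp ψ) s)
        (he.mul (contDiff_eulerOp (contDiff_eulerOp hψ))) U₂ := by
  refine ⟨∑ i, nf.B i (mulOp (nf.R i).a (nf.R i).smooth_a
      (((nf.R' i).twist w (nf.R' i).a (nf.R' i).smooth_a).D U) +
      ((nf.R i).twist w (nf.R i).a (nf.R i).smooth_a).D (mulOp (nf.R' i).a (nf.R' i).smooth_a U)),
    ∑ i, nf.B i (mulOp (nf.R i).a (nf.R i).smooth_a (mulOp (nf.R' i).a (nf.R' i).smooth_a U)),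
    fun ψ hψ hψ0 => ?_⟩
  have hQ : nf.indicial w U = ∑ i, nf.B i (((nf.R i).twist w (nf.R i).a (nf.R i).smooth_a).D
      (((nf.R' i).twist w (nf.R' i).a (nf.R' i).smooth_a).D U)) :=
    (nf.twist w (fun i => (nf.R i).smooth_a) (fun i => (nf.R' i).smooth_a)).apply U
  rw [nf.lift_apply, hQ, tens_sum, tens_sum, tens_sum, ← Finset.sum_add_distrib,
    ← Finset.sum_add_distrib]
  refine Finset.sum_congr rfl fun i _ => ?_
  change CylSec.liftEnd (nf.isEnd i) (CylSec.liftDer (nf.R i) (fun _ => 0) contMDiff_const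
    (CylSec.liftDer (nf.R' i) (fun _ => 0) contMDiff_const _)) = _
  rw [liftDer_tens_mul he hew (nf.R' i) hψ hψ0, map_add, liftDer_tens_mul he hew (nf.R i) hψ hψ0,
    liftDer_tens_mul he hew (nf.R i) (contDiff_eulerOp hψ) (eulerOp_eq_zero_of_notMem hψ0),
    map_add, map_add, map_add, liftEnd_tens, liftEnd_tens, liftEnd_tens, liftEnd_tens, map_add, tens_add]
  abel

variable {e' : ℝ → ℂ} {w' : ℂ} {β φ : ℝ → ℝ}

/-- With ψ = sβ the factor s⁻¹ turns s ∂_s ψ into ψ', and likewise for the second Euler derivative.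
These compactly supported total derivatives integrate to zero, leaving s⁻¹ψ = β in front of the
indicial term. -/
theorem integral_cylPairing_lift_left (nf : NormalForm G P) (he : ContDiff ℝ ∞ e)
    (hew : ∀ s ∈ Icc s₀ s₁, eulerOp e s = w * e s) (he' : ContDiff ℝ ∞ e')
    (hee' : ∀ s ∈ Icc s₀ s₁, starRingEnd ℂ (e' s) * e s = 1)
    (hβ : ContDiff ℝ ∞ β) (hβ0 : ∀ s ∉ Icc s₀ s₁, β s = 0) (hs₀ : 0 < s₀)
    (hφ : ContDiff ℝ ∞ (fun s => (φ s : ℂ))) (hβφ : ∀ s ∈ tsupport β, φ =ᶠ[𝓝 s] fun _ => 1)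
    (hζ : ContDiff ℝ ∞ (fun s => ((s * β s : ℝ) : ℂ))) (U V : Sec k q F E) (p : M) :
    ∫ s in Ioi 0, cylPairing (nf.lift nf.zeroSlopes
      (tens (fun s => e s * ((s * β s : ℝ) : ℂ)) (he.mul hζ) U))
      (tens (fun s => e' s * φ s) (he'.mul hφ) V) (p, s) =
    ((∫ s in Ioi 0, β s : ℝ) : ℂ) * inner ℂ (V.1 p) ((nf.indicial w U).1 p) := by
  obtain ⟨U₁, U₂, hU⟩ := lift_tens_mul nf he hew U
  set ψ : ℝ → ℂ := fun s => ((s * β s : ℝ) : ℂ) with hψdef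
  have hψ0 : ∀ s ∉ Icc s₀ s₁, ψ s = 0 := fun s hs => by simp [ψ, hβ0 s hs]
  rw [hU ψ hζ hψ0]
  have hcs : ∀ {f : ℝ → ℂ}, (∀ s ∉ Icc s₀ s₁, f s = 0) → HasCompactSupport f := fun hf =>
    HasCompactSupport.of_support_subset_isCompact isCompact_Icc
      fun s hs => by by_contra h; exact hs (hf s h)
  have hpt : ∀ s ∈ Ioi (0 : ℝ), cylPairing
      (tens (fun s => e s * ψ s) (he.mul hζ) (nf.indicial w U) +
        tens (fun s => e s * eulerOp ψ s) (he.mul (contDiff_eulerOp hζ)) U₁ +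
        tens (fun s => e s * eulerOp (eulerOp ψ) s)
        (he.mul (contDiff_eulerOp (contDiff_eulerOp hζ))) U₂)
      (tens (fun s => e' s * φ s) (he'.mul hφ) V) (p, s) =
      (β s : ℂ) * inner ℂ (V.1 p) ((nf.indicial w U).1 p) + deriv ψ s * inner ℂ (V.1 p) (U₁.1 p) +
        deriv (eulerOp ψ) s * inner ℂ (V.1 p) (U₂.1 p) := by
    intro s hs
    have hs' : (s : ℂ) ≠ 0 := by exact_mod_cast (ne_of_gt hs)
    change ((s⁻¹ : ℝ) : ℂ) * inner ℂ ((e' s * φ s) • V.1 p) ((e s * ψ s) • (nf.indicial w U).1 p +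
      (e s * eulerOp ψ s) • U₁.1 p + (e s * eulerOp (eulerOp ψ) s) • U₂.1 p) = _
    simp only [inner_add_right, inner_smul_left, inner_smul_right, map_mul, Complex.conj_ofReal]
    by_cases h1 : s ∈ tsupport β
    · have h2 : s ∈ Icc s₀ s₁ := by
        have : tsupport β ⊆ Icc s₀ s₁ := closure_minimal
          (fun t ht => by by_contra h; exact ht (hβ0 t h)) isClosed_Icc
        exact this h1
      have h3 := hee' s h2
      have h4 : (φ s : ℂ) = 1 := by rw [(hβφ s h1).self_of_nhds, Complex.ofReal_one]
      have h5 : ψ s = s * β s := by simp [ψ]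
      rw [h4, h5, eulerOp, eulerOp]
      push_cast
      field_simp
      linear_combination (β s * inner ℂ (V.1 p) ((nf.indicial w U).1 p) +
        deriv ψ s * inner ℂ (V.1 p) (U₁.1 p) +
        deriv (eulerOp ψ) s * inner ℂ (V.1 p) (U₂.1 p)) * h3
    · have h2 : ψ =ᶠ[𝓝 s] fun _ => 0 := by
        filter_upwards [(isClosed_tsupport β).isOpen_compl.mem_nhds h1] with t ht
        simp [ψ, image_eq_zero_of_notMem_tsupport ht]
      have h3 := eulerOp_eq_zero h2
      rw [h2.deriv_eq, h3.deriv_eq, h2.self_of_nhds, h3.self_of_nhds,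
        (eulerOp_eq_zero h3).self_of_nhds, image_eq_zero_of_notMem_tsupport h1]
      simp
  rw [setIntegral_congr_fun measurableSet_Ioi hpt]
  have hψc := hcs hψ0
  have hδc := hcs (eulerOp_eq_zero_of_notMem hψ0)
  have i1 : Integrable (fun s => (β s : ℂ) * inner ℂ (V.1 p) ((nf.indicial w U).1 p))
      (volume.restrict (Ioi 0)) := by
    refine Integrable.mul_const (Integrable.integrableOn ?_) _
    have hβc : Continuous fun s => (β s : ℂ) := Complex.continuous_ofReal.comp hβ.continuous
    exact hβc.integrable_of_hasCompactSupport (hcs fun s hs => by rw [hβ0 s hs, Complex.ofReal_zero])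
  have i2 : Integrable (fun s => deriv ψ s * inner ℂ (V.1 p) (U₁.1 p))
      (volume.restrict (Ioi 0)) :=
    Integrable.mul_const (Integrable.integrableOn
      ((hζ.continuous_deriv (by simp)).integrable_of_hasCompactSupport hψc.deriv)) _
  have i3 : Integrable (fun s => deriv (eulerOp ψ) s * inner ℂ (V.1 p) (U₂.1 p))
      (volume.restrict (Ioi 0)) :=
    Integrable.mul_const (Integrable.integrableOn
      (((contDiff_eulerOp hζ).continuous_deriv (by simp)).integrable_of_hasCompactSupport
        hδc.deriv)) _
  have i12 : Integrable (fun s => (β s : ℂ) * inner ℂ (V.1 p) ((nf.indicial w U).1 p) +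
      deriv ψ s * inner ℂ (V.1 p) (U₁.1 p)) (volume.restrict (Ioi 0)) := i1.add i2
  have h0 : (0 : ℝ) ∉ Icc s₀ s₁ := fun h => absurd h.1 (not_le.2 hs₀)
  rw [integral_add i12 i3, integral_add i1 i2, integral_mul_const, integral_mul_const,
    integral_mul_const, hψc.integral_Ioi_deriv_eq (hζ.of_le (by norm_cast)),
    hδc.integral_Ioi_deriv_eq ((contDiff_eulerOp hζ).of_le (by norm_cast)), hψ0 0 h0,
    eulerOp_eq_zero_of_notMem hψ0 0 h0, integral_complex_ofReal]
  simp

/-- Here the error terms vanish pointwise: Euler derivatives of φ are zero on the support of β. -/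
theorem integral_cylPairing_lift_right (nf : NormalForm G P) (he : ContDiff ℝ ∞ e)
    (he' : ContDiff ℝ ∞ e') (hew' : ∀ s ∈ Icc s₀ s₁, eulerOp e' s = w' * e' s)
    (hee' : ∀ s ∈ Icc s₀ s₁, starRingEnd ℂ (e' s) * e s = 1)
    (hβ0 : ∀ s ∉ Icc s₀ s₁, β s = 0)
    (hφ : ContDiff ℝ ∞ (fun s => (φ s : ℂ))) (hφ0 : ∀ s ∉ Icc s₀ s₁, φ s = 0)
    (hβφ : ∀ s ∈ tsupport β, φ =ᶠ[𝓝 s] fun _ => 1)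
    (hζ : ContDiff ℝ ∞ (fun s => ((s * β s : ℝ) : ℂ))) (U V : Sec k q F E) (p : M) :
    ∫ s in Ioi 0, cylPairing (tens (fun s => e s * ((s * β s : ℝ) : ℂ)) (he.mul hζ) U)
      (nf.lift nf.zeroSlopes (tens (fun s => e' s * φ s) (he'.mul hφ) V)) (p, s) =
    ((∫ s in Ioi 0, β s : ℝ) : ℂ) * inner ℂ ((nf.indicial w' V).1 p) (U.1 p) := by
  obtain ⟨V₁, V₂, hV⟩ := lift_tens_mul nf he' hew' V
  rw [hV _ hφ fun s hs => by rw [hφ0 s hs, Complex.ofReal_zero], ← integral_complex_ofReal,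
    ← integral_mul_const]
  refine setIntegral_congr_fun measurableSet_Ioi fun s hs => ?_
  have hs' : (s : ℂ) ≠ 0 := by exact_mod_cast (ne_of_gt hs)
  change ((s⁻¹ : ℝ) : ℂ) * inner ℂ ((e' s * φ s) • (nf.indicial w' V).1 p +
    (e' s * eulerOp (fun s => (φ s : ℂ)) s) • V₁.1 p +
    (e' s * eulerOp (eulerOp (fun s => (φ s : ℂ))) s) • V₂.1 p)
    ((e s * ((s * β s : ℝ) : ℂ)) • U.1 p) = _
  by_cases h1 : s ∈ tsupport β
  · have h2 : s ∈ Icc s₀ s₁ := by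
      have : tsupport β ⊆ Icc s₀ s₁ := closure_minimal
        (fun t ht => by by_contra h; exact ht (hβ0 t h)) isClosed_Icc
      exact this h1
    have h3 := hee' s h2
    have h4 : (fun s => (φ s : ℂ)) =ᶠ[𝓝 s] fun _ => 1 := by
      filter_upwards [hβφ s h1] with t ht
      rw [ht, Complex.ofReal_one]
    have h5 := eulerOp_eq_zero h4
    have h6 : (φ s : ℂ) = 1 := h4.self_of_nhds
    rw [h5.self_of_nhds, (eulerOp_eq_zero h5).self_of_nhds, h6]
    simp only [mul_zero, zero_smul, add_zero, mul_one, inner_smul_left, inner_smul_right]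
    push_cast
    field_simp
    linear_combination (β s * inner ℂ ((nf.indicial w' V).1 p) (U.1 p)) * h3
  · simp [image_eq_zero_of_notMem_tsupport h1]

end Indicial

/-! ### Restriction of edge operators to a fibre -/

section Restriction

variable {k q : ℕ} {M N Y : Type*}
  [TopologicalSpace M] [ChartedSpace (EuclideanHalfSpace (k + q + 1)) M]
  [TopologicalSpace N] [ChartedSpace (EuclideanSpace ℝ (Fin (k + q))) N]
  [TopologicalSpace Y] [ChartedSpace (EuclideanSpace ℝ (Fin q)) Y]
  [IsManifold (𝓡∂ (k + q + 1)) ∞ M]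
  {G : FiberedBoundary k q M N Y}
  {F : Type*} [NormedAddCommGroup F] [NormedSpace ℝ F] {E : M → Type*}
  [TopologicalSpace (TotalSpace F E)] [∀ p, NormedAddCommGroup (E p)]
  [∀ p, InnerProductSpace ℂ (E p)] [FiberBundle F E] [VectorBundle ℝ F E]
  [ContMDiffVectorBundle ∞ F E (𝓡∂ (k + q + 1))]
  [SmoothHermitianBundle (𝓡∂ (k + q + 1)) F E]
  [T2Space M] [CompactSpace M] [FiniteDimensional ℝ F]
  [IsManifold (𝓡 (k + q)) ∞ N] [T2Space Y] [IsManifold (𝓡 q) ∞ Y]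
  {P : Module.End ℂ (Sec k q F E)} {y : Y}
  {Z : Type*} [TopologicalSpace Z] [ChartedSpace (EuclideanSpace ℝ (Fin k)) Z]
  [IsManifold (𝓡 k) ∞ Z]

/-- The restriction to the fibre of an edge operator. -/
def NormalForm.restrict (nf : NormalForm G P) (j : FiberModel G y Z) :
    Module.End ℂ (FiberSec F E j) where
  toFun u := ⟨fun z => (P (j.exists_sec_extension u).choose).1 (j.inclM z),
    (P (j.exists_sec_extension u).choose).2.comp_map j.contMDiff_inclM⟩
  map_add' u v := by
    refine Subtype.ext (funext fun z => ?_)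
    have h := nf.congr_on (isEdgeInvariant_fiber j)
      (u := (j.exists_sec_extension (u + v)).choose)
      (v := (j.exists_sec_extension u).choose + (j.exists_sec_extension v).choose) ?_ _
      (mem_range_self z)
    · rw [map_add] at h
      exact h
    · rintro _ ⟨z, rfl⟩
      rw [← (j.exists_sec_extension (u + v)).choose_spec]
      exact congrArg₂ (· + ·) ((j.exists_sec_extension u).choose_spec z)
        ((j.exists_sec_extension v).choose_spec z)
  map_smul' c u := by
    refine Subtype.ext (funext fun z => ?_)
    have h := nf.congr_on (isEdgeInvariant_fiber j)
      (u := (j.exists_sec_extension (c • u)).choose)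
      (v := c • (j.exists_sec_extension u).choose) ?_ _ (mem_range_self z)
    · rw [map_smul] at h
      exact h
    · rintro _ ⟨z, rfl⟩
      rw [← (j.exists_sec_extension (c • u)).choose_spec]
      exact congrArg (c • ·) ((j.exists_sec_extension u).choose_spec z)

theorem NormalForm.restrict_apply (nf : NormalForm G P) (j : FiberModel G y Z) {U : Sec k q F E}
    {u : FiberSec F E j} (h : ∀ z, u.1 z = U.1 (j.inclM z)) (z : Z) :
    (nf.restrict j u).1 z = (P U).1 (j.inclM z) := by
  refine nf.congr_on (isEdgeInvariant_fiber j) ?_ _ (mem_range_self z)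
  rintro _ ⟨z, rfl⟩
  rw [← (j.exists_sec_extension u).choose_spec, h]

end Restriction

/-! ### The indicial family and its symmetry -/

section Indicial

variable {k q : ℕ} {M N Y : Type*}
  [TopologicalSpace M] [ChartedSpace (EuclideanHalfSpace (k + q + 1)) M]
  [TopologicalSpace N] [ChartedSpace (EuclideanSpace ℝ (Fin (k + q))) N]
  [TopologicalSpace Y] [ChartedSpace (EuclideanSpace ℝ (Fin q)) Y]
  [IsManifold (𝓡∂ (k + q + 1)) ∞ M]
  {G : FiberedBoundary k q M N Y}
  {F : Type*} [NormedAddCommGroup F] [NormedSpace ℝ F] {E : M → Type*}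
  [TopologicalSpace (TotalSpace F E)] [∀ p, NormedAddCommGroup (E p)]
  [∀ p, InnerProductSpace ℂ (E p)] [FiberBundle F E] [VectorBundle ℝ F E]
  [ContMDiffVectorBundle ∞ F E (𝓡∂ (k + q + 1))]
  [SmoothHermitianBundle (𝓡∂ (k + q + 1)) F E]
  [T2Space M] [CompactSpace M] [FiniteDimensional ℝ F]
  {P : Module.End ℂ (Sec k q F E)}

theorem hasDerivAt_cexp_log {l : ℝ → ℝ} {δ : ℝ} (hδ : 0 < δ) (hl : ∀ s, δ ≤ s → l s = Real.log s)
    (w : ℂ) {s : ℝ} (hs : δ < s) :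
    HasDerivAt (fun s => Complex.exp (w * l s)) (w * (s⁻¹ : ℝ) * Complex.exp (w * l s)) s := by
  have h1 : HasDerivAt l s⁻¹ s := by
    refine (Real.hasDerivAt_log (by linarith)).congr_of_eventuallyEq ?_
    filter_upwards [Ioi_mem_nhds hs] with t ht using hl t (le_of_lt ht)
  have h2 := (h1.ofReal_comp.const_mul w).cexp
  convert h2 using 1
  ring

theorem contDiff_cexp_mul {l : ℝ → ℝ} (hl : ContDiff ℝ ∞ l) (w : ℂ) :
    ContDiff ℝ ∞ (fun s => Complex.exp (w * l s)) := by
  have h1 : ContDiff ℝ ∞ (fun s => (l s : ℂ)) := Complex.ofRealCLM.contDiff.comp hl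
  exact (contDiff_const.mul h1).cexp

/-- The power x^{iσ} is not smooth at the boundary. It is replaced by exp(iσ l(x)), with `l` smooth
and equal to the logarithm on [δ, ∞), which agrees with it on the support of `u` and near `p`. -/
theorem NormalForm.indicial_apply (nf : NormalForm G P) (σ : ℂ) {u : ∀ p, E p}
    (hu : u ∈ TestSec k q F E) {p : M} (hp : p ∈ (𝓡∂ (k + q + 1)).interior M) :
    applyOp (nf.indicial (Complex.I * σ)) u p = ((G.x p : ℂ) ^ (-(Complex.I * σ))) •
      applyOp P (fun p' => ((G.x p' : ℂ) ^ (Complex.I * σ)) • u p') p := by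
  obtain ⟨hu, K, hK, hKi, hK0⟩ := hu
  have hx := G.contMDiff_x.continuous
  have hxp : 0 < G.x p := (G.x_pos_iff p).2 hp
  -- The inequality at `p` is strict, so that `p` lies in the open set x > δ on which the
  -- conjugation identity is available.
  obtain ⟨δ, hδ, hδp, hδK⟩ : ∃ δ, 0 < δ ∧ δ < G.x p ∧ ∀ p' ∈ K, δ ≤ G.x p' := by
    rcases K.eq_empty_or_nonempty with h | h
    · exact ⟨G.x p / 2, by linarith, by linarith, by simp [h]⟩
    · obtain ⟨p₀, hp₀, hmin⟩ := hK.exists_isMinOn h hx.continuousOn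
      have h0 : 0 < G.x p₀ := (G.x_pos_iff p₀).2 (hKi hp₀)
      refine ⟨min (G.x p₀) (G.x p) / 2, by positivity, ?_, fun p' hp' => ?_⟩
      · have := min_le_right (G.x p₀) (G.x p)
        linarith
      · have h1 := min_le_left (G.x p₀) (G.x p)
        have h2 : G.x p₀ ≤ G.x p' := hmin hp'
        linarith
  obtain ⟨l, hl, hlog⟩ := exists_contDiff_eq_log hδ
  have hpow : ∀ (w : ℂ) (p' : M), δ ≤ G.x p' → (G.x p' : ℂ) ^ w = Complex.exp (w * l (G.x p')) := by
    intro w p' hp'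
    have h0 : 0 < G.x p' := lt_of_lt_of_le hδ hp'
    rw [Complex.cpow_def_of_ne_zero (by exact_mod_cast h0.ne'), hlog _ hp', Complex.ofReal_log h0.le,
      mul_comm]
  have hc : ContMDiff (𝓡∂ (k + q + 1)) 𝓘(ℝ, ℂ) ∞
      fun p' => Complex.exp (Complex.I * σ * l (G.x p')) :=
    (contDiff_cexp_mul hl (Complex.I * σ)).contMDiff.comp G.contMDiff_x
  have h1 : (fun p' => ((G.x p' : ℂ) ^ (Complex.I * σ)) • u p') = (mulSecC _ hc ⟨u, hu⟩).1 := by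
    funext p'
    change _ = Complex.exp (Complex.I * σ * l (G.x p')) • u p'
    by_cases h : p' ∈ K
    · rw [hpow _ _ (hδK p' h)]
    · rw [hK0 p' h, smul_zero, smul_zero]
  have hO : IsOpen {p' | δ < G.x p'} := isOpen_lt continuous_const hx
  have hder : ∀ (R : EdgeDerivation G F E), ∀ p' ∈ {p' | δ < G.x p'},
      dirDerivC R.V (fun p' => Complex.exp (Complex.I * σ * l (G.x p'))) p' =
        Complex.I * σ * R.a p' * Complex.exp (Complex.I * σ * l (G.x p')) := by
    intro R p' hp'
    have h0 : (G.x p' : ℂ) ≠ 0 := by exact_mod_cast (hδ.trans hp').ne'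
    rw [dirDerivC_comp (h := fun s => Complex.exp (Complex.I * σ * l s)) G.contMDiff_x
      (hasDerivAt_cexp_log hδ hlog _ hp'), R.V_x]
    push_cast
    field_simp
  have h2 := nf.apply_mulSecC (Complex.I * σ) (fun i => (nf.R i).smooth_a)
    (fun i => (nf.R' i).smooth_a) hc hO (fun i => hder (nf.R i)) (fun i => hder (nf.R' i))
    ⟨u, hu⟩ hδp
  rw [h1, applyOp_eq, h2, hpow _ _ hδp.le, smul_smul, ← Complex.exp_add, applyOp, dif_pos hu,
    show -(Complex.I * σ) * (l (G.x p) : ℂ) + Complex.I * σ * l (G.x p) = 0 by ring,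
    Complex.exp_zero, one_smul]
  rfl

variable [MeasurableSpace M] [BorelSpace M] [MeasurableSpace N] [BorelSpace N]
  {μ : Measure M} [IsFiniteMeasure μ] {μN : Measure N} [IsFiniteMeasure μN]
  [T2Space Y] [IsManifold (𝓡 (k + q)) ∞ N] [IsManifold (𝓡 q) ∞ Y]
  [MeasurableSpace Y] [BorelSpace Y] {y : Y}
  {Z : Type*} [TopologicalSpace Z] [ChartedSpace (EuclideanSpace ℝ (Fin k)) Z]
  [IsManifold (𝓡 k) ∞ Z] [MeasurableSpace Z] [BorelSpace Z] {j : FiberModel G y Z} {μY : Measure Y}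
  {μZ : Measure Z} [IsFiniteMeasure μZ]

/-- The exponents iσ and iσ̄ are chosen so that the conjugate of s^{iσ̄} is s^{−iσ}, cancelling
s^{iσ}. Fibre symmetry with zero phase then reads as the claim multiplied by ∫ β > 0. -/
theorem NormalForm.indicial_symmetric (nf : NormalForm G P) (hμN : IsBoundaryDensity G μ μN)
    (hμZ : IsFiberDensity j μN μY μZ) (hsymm : IsSymmetricOp G μ P) (σ : ℂ) (U V : Sec k q F E) :
    ∫ z, inner ℂ (V.1 (j.inclM z)) ((nf.indicial (Complex.I * σ) U).1 (j.inclM z)) ∂μZ =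
      ∫ z, inner ℂ ((nf.indicial (Complex.I * starRingEnd ℂ σ) V).1 (j.inclM z))
        (U.1 (j.inclM z)) ∂μZ := by
  obtain ⟨l, hl, hlog⟩ := exists_contDiff_eq_log (δ := 1 / 2) (by norm_num)
  obtain ⟨β, φ, hβ, hφ, hβpos, hβ0, hφ0, hβφ⟩ := exists_cutoffs
  have he := contDiff_cexp_mul hl (Complex.I * σ)
  have he' := contDiff_cexp_mul hl (Complex.I * starRingEnd ℂ σ)
  have hew : ∀ w : ℂ, ∀ s ∈ Icc (1 : ℝ) 3,
      eulerOp (fun s => Complex.exp (w * l s)) s = w * Complex.exp (w * l s) := by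
    intro w s hs
    have hs0 : (s : ℂ) ≠ 0 := by
      have : (0 : ℝ) < s := by linarith [hs.1]
      exact_mod_cast this.ne'
    rw [eulerOp, (hasDerivAt_cexp_log (by norm_num) hlog w (s := s) (by linarith [hs.1])).deriv]
    push_cast
    field_simp
  have hee' : ∀ s ∈ Icc (1 : ℝ) 3, starRingEnd ℂ (Complex.exp (Complex.I * starRingEnd ℂ σ * l s)) *
      Complex.exp (Complex.I * σ * l s) = 1 := by
    intro s _
    rw [← Complex.exp_conj, ← Complex.exp_add]
    simp
  have hφc : ContDiff ℝ ∞ fun s => (φ s : ℂ) := Complex.ofRealCLM.contDiff.comp hφ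
  have hζ : ContDiff ℝ ∞ fun s => ((s * β s : ℝ) : ℂ) :=
    Complex.ofRealCLM.contDiff.comp (contDiff_id.mul hβ)
  have hW : SuppIn (tens _ (he.mul hζ) U) 1 3 := fun p s hs => by
    rw [tens_apply, hβ0 s hs]
    simp
  have hW' : SuppIn (tens _ (he'.mul hφc) V) 1 3 := fun p s hs => by
    rw [tens_apply, hφ0 s hs]
    simp
  have h := fiber_symmetric hμN hμZ hsymm nf contMDiff_const nf.zeroSlopes hW hW' one_pos
  have e1 := fun z => integral_cylPairing_lift_left nf he (hew _) he' hee' hβ hβ0 one_pos hφc hβφ hζ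
    U V (j.inclM z)
  have e2 := fun z => integral_cylPairing_lift_right nf he he' (hew _) hee' hβ0 hφc hφ0 hβφ hζ
    U V (j.inclM z)
  simp only [e1, e2, integral_const_mul] at h
  exact mul_left_cancel₀ (by exact_mod_cast hβpos.ne') h

theorem exists_indicialOperator (nf : NormalForm G P) (hμN : IsBoundaryDensity G μ μN)
    (hμZ : IsFiberDensity j μN μY μZ) (hsymm : IsSymmetricOp G μ P) :
    ∃ L : ℂ → Module.End ℂ (FiberSec F E j), (∀ σ, IsIndicialOperator P j σ (L σ)) ∧
      ∀ (σ : ℂ) (u v : FiberSec F E j),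
        l2Pairing μZ (L σ u).1 v.1 = l2Pairing μZ u.1 (L (starRingEnd ℂ σ) v).1 := by
  let nf' : ∀ σ : ℂ, NormalForm G (nf.indicial (Complex.I * σ)) := fun σ =>
    nf.twist (Complex.I * σ) (fun i => (nf.R i).smooth_a) (fun i => (nf.R' i).smooth_a)
  refine ⟨fun σ => (nf' σ).restrict j, fun σ => ⟨_, (nf' σ).mem_edgeDiffOps,
    fun u hu p hp => nf.indicial_apply σ hu hp, fun U u h => (nf' σ).restrict_apply j h⟩,
    fun σ u v => ?_⟩
  obtain ⟨U, hU⟩ := j.exists_sec_extension u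
  obtain ⟨V, hV⟩ := j.exists_sec_extension v
  have h := nf.indicial_symmetric hμN hμZ hsymm σ U V
  simp only [l2Pairing]
  rw [funext fun z => congrArg₂ (inner ℂ) (hV z) ((nf' σ).restrict_apply j hU z),
    funext fun z => congrArg₂ (inner ℂ) ((nf' (starRingEnd ℂ σ)).restrict_apply j hV z) (hU z)]
  exact h

end Indicial

/-! ### From the quadratic form to symmetry and spectrum -/

section LinearAlgebra

/-- Over ℂ a real quadratic form already forces symmetry. In finite dimension spectral values are
eigenvalues, and evaluating the form on an eigenvector gives their sign. -/
theorem isSymmetric_and_spectrum_of_nonneg {W : Type*} [NormedAddCommGroup W]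
    [InnerProductSpace ℂ W] [FiniteDimensional ℂ W] {S : W →ₗ[ℂ] W}
    (h : ∀ v, 0 ≤ (inner ℂ v (S v) : ℂ).re ∧ (inner ℂ v (S v) : ℂ).im = 0) :
    S.IsSymmetric ∧ spectrum ℂ S ⊆ (fun t : ℝ => (t : ℂ)) '' Ici 0 := by
  refine ⟨(LinearMap.isSymmetric_iff_inner_map_self_real S).2 fun v => ?_, fun c hc => ?_⟩
  · rw [inner_conj_symm, ← inner_conj_symm (S v) v]
    exact (Complex.conj_eq_iff_im.2 (h v).2).symm
  · obtain ⟨v, hv⟩ := (Module.End.hasEigenvalue_iff_mem_spectrum.2 hc).exists_hasEigenvector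
    have h1 := h v
    have h2 : (inner ℂ v v : ℂ) = ((‖v‖ ^ 2 : ℝ) : ℂ) := by
      rw [inner_self_eq_norm_sq_to_K]
      norm_cast
    have h3 : 0 < ‖v‖ ^ 2 := by have := norm_pos_iff.2 hv.2; positivity
    rw [hv.apply_eq_smul, inner_smul_right, h2, Complex.re_mul_ofReal, Complex.im_mul_ofReal] at h1
    have h4 : c.im = 0 := (mul_eq_zero.1 h1.2).resolve_right h3.ne'
    exact ⟨c.re, nonneg_of_mul_nonneg_left h1.1 h3, Complex.ext rfl h4.symm⟩

end LinearAlgebra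

/-! ### Slopes of wedge forms and the symbol -/

section Slopes

variable {k q : ℕ} {M N Y : Type*}
  [TopologicalSpace M] [ChartedSpace (EuclideanHalfSpace (k + q + 1)) M]
  [TopologicalSpace N] [ChartedSpace (EuclideanSpace ℝ (Fin (k + q))) N]
  [TopologicalSpace Y] [ChartedSpace (EuclideanSpace ℝ (Fin q)) Y]
  [IsManifold (𝓡∂ (k + q + 1)) ∞ M]
  {G : FiberedBoundary k q M N Y}
  {F : Type*} [NormedAddCommGroup F] [NormedSpace ℝ F] {E : M → Type*}
  [TopologicalSpace (TotalSpace F E)] [∀ p, NormedAddCommGroup (E p)]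
  [∀ p, InnerProductSpace ℂ (E p)] [FiberBundle F E] [VectorBundle ℝ F E]
  [ContMDiffVectorBundle ∞ F E (𝓡∂ (k + q + 1))]
  [SmoothHermitianBundle (𝓡∂ (k + q + 1)) F E]
  [T2Space M] [CompactSpace M] [FiniteDimensional ℝ F]
  {P : Module.End ℂ (Sec k q F E)}

/-- Along the boundary the field is tangent to the fibres and the form is conormal to them, so their
pairing vanishes there and is divisible by `x`. -/
theorem EdgeDerivation.exists_slope (R : EdgeDerivation G F E) (φ : wedgeForms G) :
    ∃ a : M → ℝ, ContMDiff (𝓡∂ (k + q + 1)) 𝓘(ℝ, ℝ) ∞ a ∧ ∀ p, φ.1 p (R.V p) = G.x p * a p := by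
  refine G.exists_eq_x_mul' (f := fun p => φ.1 p (R.V p)) (φ.2.1 _ R.isEdge.1) fun z => ?_
  obtain ⟨w, hw, hwV⟩ := R.isEdge.2 z
  simp only [← hwV]
  exact φ.2.2 z w hw

/-- The pairing of an edge vector field with a section of the wedge cotangent bundle, divided by
`x`. -/
def EdgeDerivation.slope (R : EdgeDerivation G F E) (φ : wedgeForms G) : M → ℝ :=
  (R.exists_slope φ).choose

theorem EdgeDerivation.smooth_slope (R : EdgeDerivation G F E) (φ : wedgeForms G) :
    ContMDiff (𝓡∂ (k + q + 1)) 𝓘(ℝ, ℝ) ∞ (R.slope φ) := (R.exists_slope φ).choose_spec.1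

theorem EdgeDerivation.apply_V (R : EdgeDerivation G F E) (φ : wedgeForms G) (p : M) :
    φ.1 p (R.V p) = G.x p * R.slope φ p := (R.exists_slope φ).choose_spec.2 p

/-- A generator h ψ of the relations has slope h times that of ψ, zero at `p`; quotients by `x` are
unique because the interior is dense. Hence the symbol is a function on the wedge cotangent bundle,
also over the boundary. -/
theorem EdgeDerivation.slope_congr (R : EdgeDerivation G F E) {φ ψ : wedgeForms G} {p : M}
    (h : φ.1 - ψ.1 ∈ vanishingForms G p) : R.slope φ p = R.slope ψ p := by
  have key : ∀ χ ∈ vanishingForms G p, ∃ a : M → ℝ, Continuous a ∧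
      (∀ p', χ p' (R.V p') = G.x p' * a p') ∧ a p = 0 := by
    intro χ hχ
    induction hχ using Submodule.span_induction with
    | mem χ hχ =>
      obtain ⟨f, ψ, hψ, hf, hfp, hfψ⟩ := hχ
      refine ⟨fun p' => f p' * R.slope ⟨ψ, hψ⟩ p', hf.continuous.mul (R.smooth_slope _).continuous,
        fun p' => ?_, by simp only [hfp, zero_mul]⟩
      have h1 : ψ p' (R.V p') = _ := R.apply_V ⟨ψ, hψ⟩ p'
      have h2 : χ p' (R.V p') = f p' * ψ p' (R.V p') := by rw [hfψ]; rfl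
      rw [h2, h1]
      ring
    | zero => exact ⟨fun _ => 0, continuous_const, fun p' => (mul_zero (G.x p')).symm, rfl⟩
    | add χ χ' _ _ h h' =>
      obtain ⟨a, ha, hax, hap⟩ := h
      obtain ⟨a', ha', hax', hap'⟩ := h'
      refine ⟨fun p => a p + a' p, ha.add ha', fun p' => ?_, by simp only [hap, hap', add_zero]⟩
      rw [mul_add, ← hax, ← hax']
      rfl
    | smul c χ _ h =>
      obtain ⟨a, ha, hax, hap⟩ := h
      refine ⟨fun p => c * a p, continuous_const.mul ha, fun p' => ?_, by simp only [hap, mul_zero]⟩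
      rw [mul_left_comm, ← hax]
      rfl
  obtain ⟨a, ha, hax, hap⟩ := key _ h
  have h1 : a = fun p' => R.slope φ p' - R.slope ψ p' := by
    refine G.eq_of_x_mul_eq ha
      ((R.smooth_slope φ).continuous.sub (R.smooth_slope ψ).continuous) fun p' => ?_
    rw [← hax, mul_sub, ← R.apply_V, ← R.apply_V]
    rfl
  have h2 := congrFun h1 p
  rw [hap] at h2
  exact (sub_eq_zero.1 h2.symm)

variable (Φ : GlobalFrame (𝓡∂ (k + q + 1)) F E)

/-- The wedge-principal symbol of `x⁻² P` on a section of the wedge cotangent bundle, at a point. -/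
def NormalForm.symbolAt (nf : NormalForm G P) (φ : wedgeForms G) (p : M) : E p →ₗ[ℂ] E p :=
  -∑ i, (((nf.R i).slope φ p * (nf.R' i).slope φ p : ℝ) : ℂ) • fiberEnd Φ (nf.isEnd i) p

/-- The wedge-principal symbol of `x⁻² P`, as an operator on sections. -/
def NormalForm.symbolSec (nf : NormalForm G P) (φ : wedgeForms G) (u : Sec k q F E) :
    Sec k q F E :=
  -∑ i, nf.B i (mulOp _ ((nf.R i).smooth_slope φ) (mulOp _ ((nf.R' i).smooth_slope φ) u))

theorem NormalForm.symbolSec_apply (nf : NormalForm G P) (φ : wedgeForms G) (u : Sec k q F E)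
    (p : M) : (nf.symbolSec φ u).1 p = nf.symbolAt Φ φ p (u.1 p) := by
  rw [NormalForm.symbolAt, LinearMap.neg_apply, LinearMap.sum_apply]
  change -(∑ i, nf.B i _ : Sec k q F E).1 p = _
  rw [sec_sum_apply]
  congr 1
  refine Finset.sum_congr rfl fun i _ => ?_
  rw [← fiberEnd_apply Φ (nf.isEnd i), mulOp_apply, mulOp_apply, LinearMap.smul_apply, smul_smul,
    ← Complex.coe_smul, map_smul]

/-- Expanding (D + w m)(D' + w m') gives a polynomial in w whose top coefficient is of order zero.
-/
theorem NormalForm.exists_twistOp_expansion (nf : NormalForm G P) {m m' : nf.ι → M → ℝ}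
    (hm : ∀ i, ContMDiff (𝓡∂ (k + q + 1)) 𝓘(ℝ, ℝ) ∞ (m i))
    (hm' : ∀ i, ContMDiff (𝓡∂ (k + q + 1)) 𝓘(ℝ, ℝ) ∞ (m' i)) (u : Sec k q F E) :
    ∃ U : Sec k q F E, ∀ w : ℂ, nf.twistOp w hm hm' u = P u + w • U +
      w ^ 2 • ∑ i, nf.B i (mulOp _ (hm i) (mulOp _ (hm' i) u)) := by
  refine ⟨∑ i, nf.B i ((nf.R i).D (mulOp _ (hm' i) u) + mulOp _ (hm i) ((nf.R' i).D u)), fun w => ?_⟩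
  rw [(nf.twist w hm hm').apply, nf.apply, Finset.smul_sum, Finset.smul_sum, ← Finset.sum_add_distrib,
    ← Finset.sum_add_distrib]
  refine Finset.sum_congr rfl fun i _ => ?_
  have h1 : ∀ (R : EdgeDerivation G F E) {m : M → ℝ} (hm : ContMDiff (𝓡∂ (k + q + 1)) 𝓘(ℝ, ℝ) ∞ m)
      (v : Sec k q F E), (R.twist w m hm).D v = R.D v + w • mulOp m hm v := fun _ _ _ _ => rfl
  change nf.B i (((nf.R i).twist w (m i) (hm i)).D (((nf.R' i).twist w (m' i) (hm' i)).D u)) = _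
  rw [h1, h1]
  simp only [map_add, map_smul]
  module

/-- Conjugation of `P` by `e^{iρf}`. -/
theorem NormalForm.exists_conj_expansion (nf : NormalForm G P) {f : M → ℝ} {φ : wedgeForms G}
    (hf : ContMDiff (𝓡∂ (k + q + 1)) 𝓘(ℝ, ℝ) ∞ f)
    (hφ : ∀ p v, φ.1 p v = mfderiv (𝓡∂ (k + q + 1)) 𝓘(ℝ, ℝ) f p v) (u : Sec k q F E) :
    ∃ U : Sec k q F E, ∀ (ρ : ℝ) (p : M), (P (mulSecC _ (contMDiff_phase ρ hf) u)).1 p =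
      phase ρ f p • ((P u).1 p + (Complex.I * ρ) • U.1 p +
        ((ρ ^ 2 * G.x p ^ 2 : ℝ) : ℂ) • (nf.symbolSec φ u).1 p) := by
  obtain ⟨Φ⟩ := nonempty_globalFrame (𝓡∂ (k + q + 1)) F E
  have hm : ∀ R : EdgeDerivation G F E, ContMDiff (𝓡∂ (k + q + 1)) 𝓘(ℝ, ℝ) ∞ (dirDeriv R.V f) :=
    fun R => contMDiff_dirDeriv R.isEdge.1 hf
  obtain ⟨U, hU⟩ := nf.exists_twistOp_expansion (fun i => hm (nf.R i)) (fun i => hm (nf.R' i)) u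
  refine ⟨U, fun ρ p => ?_⟩
  have hc : ∀ R : EdgeDerivation G F E, ∀ p ∈ (univ : Set M), dirDerivC R.V (phase ρ f) p =
      Complex.I * ρ * dirDeriv R.V f p * phase ρ f p := fun R p _ => by
    rw [dirDerivC_phase ρ hf]
    push_cast
    ring
  rw [nf.apply_mulSecC (Complex.I * ρ) (fun i => hm (nf.R i)) (fun i => hm (nf.R' i))
    (contMDiff_phase ρ hf) isOpen_univ (fun i => hc (nf.R i)) (fun i => hc (nf.R' i)) u (mem_univ p),
    hU]
  congr 1
  change (P u).1 p + (Complex.I * ρ) • U.1 p + ((Complex.I * ρ) ^ 2 : ℂ) •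
    (∑ i, nf.B i (mulOp _ (hm (nf.R i)) (mulOp _ (hm (nf.R' i)) u)) : Sec k q F E).1 p = _
  congr 1
  rw [sec_sum_apply]
  rw [nf.symbolSec_apply Φ, NormalForm.symbolAt, LinearMap.neg_apply, LinearMap.sum_apply,
    ← Finset.sum_neg_distrib, Finset.smul_sum, Finset.smul_sum]
  refine Finset.sum_congr rfl fun i _ => ?_
  -- The two factors V f supply x², which later cancels x⁻²; the square (iρ)² = −ρ² accounts for the
  -- sign in `symbolAt`.
  have hs : ∀ R : EdgeDerivation G F E, dirDeriv R.V f p = G.x p * R.slope φ p := fun R => by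
    rw [← R.apply_V, hφ]
    rfl
  rw [← fiberEnd_apply Φ (nf.isEnd i), mulOp_apply, mulOp_apply, hs, hs, LinearMap.smul_apply]
  simp only [← Complex.coe_smul, map_smul, smul_smul, ← neg_smul]
  congr 1
  push_cast
  linear_combination (ρ ^ 2 * (G.x p * (nf.R i).slope φ p) * (G.x p * (nf.R' i).slope φ p) : ℂ) *
    Complex.I_sq

end Slopes

/-! ### Functions with prescribed differential -/

section Covectors

/-- The covector is composed with the inverse derivative of the chart to give a linear function of
the coordinates, then cut off by a bump equal to 1 near `p`. -/
theorem exists_contMDiff_tsupport_subset_mfderiv_eq {n : ℕ} {H X : Type*} [TopologicalSpace H]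
    {J : ModelWithCorners ℝ (EuclideanSpace ℝ (Fin n)) H} [TopologicalSpace X] [ChartedSpace H X]
    [IsManifold J ∞ X] [T2Space X] {p : X} {O : Set X} (hO : O ∈ 𝓝 p) (ℓ : TangentSpace J p →L[ℝ] ℝ) :
    ∃ f : X → ℝ, ContMDiff J 𝓘(ℝ, ℝ) ∞ f ∧ tsupport f ⊆ O ∧ ∀ v, mfderiv J 𝓘(ℝ, ℝ) f p v = ℓ v := by
  obtain ⟨θ, -, hθ⟩ := (SmoothBumpFunction.nhds_basis_tsupport (I := J) p).mem_iff.1 hO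
  obtain ⟨Λ, hΛ⟩ := isInvertible_mfderiv_extChartAt (I := J) (mem_extChartAt_source (I := J) p)
  let ℓ' : EuclideanSpace ℝ (Fin n) →L[ℝ] ℝ := ℓ.comp Λ.symm.toContinuousLinearMap
  let h : X → ℝ := fun p' => ℓ' (extChartAt J p p')
  have hh : ContMDiffOn J 𝓘(ℝ, ℝ) ∞ h (chartAt H p).source :=
    (ℓ'.contMDiff (n := ∞)).comp_contMDiffOn contMDiffOn_extChartAt
  have hf : ContMDiff J 𝓘(ℝ, ℝ) ∞ fun p' => θ p' • h p' := θ.contMDiff_smul hh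
  refine ⟨fun p' => θ p' • h p', hf, (tsupport_smul_subset_left _ _).trans hθ, fun v => ?_⟩
  have h1 : (fun p' => θ p' • h p') =ᶠ[𝓝 p] h := by
    filter_upwards [θ.eventuallyEq_one] with p' hp'
    rw [hp', Pi.one_apply, one_smul]
  rw [h1.mfderiv_eq]
  have h2 : MDifferentiableAt J 𝓘(ℝ, EuclideanSpace ℝ (Fin n)) (extChartAt J p) p :=
    mdifferentiableAt_extChartAt (mem_chart_source _ p)
  have h3 : HasMFDerivAt 𝓘(ℝ, EuclideanSpace ℝ (Fin n)) 𝓘(ℝ, ℝ)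
      ℓ' (extChartAt J p p) ℓ' := ContinuousLinearMap.hasMFDerivAt _
  have h4 := (h3.comp p h2.hasMFDerivAt).mfderiv
  refine (congrArg (fun L => L v) h4).trans ?_
  rw [← hΛ]
  change ℓ (Λ.symm (Λ v)) = ℓ v
  rw [Λ.symm_apply_apply]

end Covectors

/-! ### The symbol as a limit -/

section Symbol

variable {k q : ℕ} {M N Y : Type*}
  [TopologicalSpace M] [ChartedSpace (EuclideanHalfSpace (k + q + 1)) M]
  [TopologicalSpace N] [ChartedSpace (EuclideanSpace ℝ (Fin (k + q))) N]
  [TopologicalSpace Y] [ChartedSpace (EuclideanSpace ℝ (Fin q)) Y]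
  [IsManifold (𝓡∂ (k + q + 1)) ∞ M]
  {G : FiberedBoundary k q M N Y}
  {F : Type*} [NormedAddCommGroup F] [NormedSpace ℝ F] {E : M → Type*}
  [TopologicalSpace (TotalSpace F E)] [∀ p, NormedAddCommGroup (E p)]
  [∀ p, InnerProductSpace ℂ (E p)] [FiberBundle F E] [VectorBundle ℝ F E]
  [ContMDiffVectorBundle ∞ F E (𝓡∂ (k + q + 1))]
  [SmoothHermitianBundle (𝓡∂ (k + q + 1)) F E]
  [T2Space M] [CompactSpace M] [FiniteDimensional ℝ F]
  {P : Module.End ℂ (Sec k q F E)}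

theorem NormalForm.tendsto_symbolAt (nf : NormalForm G P) (Φ : GlobalFrame (𝓡∂ (k + q + 1)) F E)
    {f : M → ℝ} {φ : wedgeForms G} (hf : ContMDiff (𝓡∂ (k + q + 1)) 𝓘(ℝ, ℝ) ∞ f)
    (hφ : ∀ p v, φ.1 p v = mfderiv (𝓡∂ (k + q + 1)) 𝓘(ℝ, ℝ) f p v) (u : Sec k q F E) {p : M}
    (hp : p ∈ (𝓡∂ (k + q + 1)).interior M) :
    Tendsto (fun ρ : ℝ => (ρ ^ 2)⁻¹ • Complex.exp (-(Complex.I * ρ * f p)) •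
          wedgeOp G P (fun p' => Complex.exp (Complex.I * ρ * f p') • u.1 p') p)
        atTop (𝓝 (nf.symbolAt Φ φ p (u.1 p))) := by
  obtain ⟨U, hU⟩ := nf.exists_conj_expansion hf hφ u
  have hx : G.x p ≠ 0 := ((G.x_pos_iff p).2 hp).ne'
  have h1 : ∀ᶠ ρ : ℝ in atTop, (G.x p ^ 2)⁻¹ • ((ρ⁻¹ ^ 2) • (P u).1 p +
      ρ⁻¹ • Complex.I • U.1 p) + (nf.symbolSec φ u).1 p =
      (ρ ^ 2)⁻¹ • Complex.exp (-(Complex.I * ρ * f p)) •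
          wedgeOp G P (fun p' => Complex.exp (Complex.I * ρ * f p') • u.1 p') p := by
    filter_upwards [eventually_gt_atTop 0] with ρ hρ
    have e1 : (fun p' => Complex.exp (Complex.I * ρ * f p') • u.1 p') =
        (mulSecC _ (contMDiff_phase ρ hf) u).1 := rfl
    rw [wedgeOp, e1, applyOp_eq, hU ρ p, smul_comm (G.x p ^ 2)⁻¹ (phase ρ f p),
      smul_smul (Complex.exp _), phase, ← Complex.exp_add, neg_add_cancel, Complex.exp_zero, one_smul]
    simp only [smul_add, smul_smul, ← Complex.coe_smul]
    have h2 : (ρ : ℂ) ≠ 0 := by exact_mod_cast hρ.ne'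
    have h3 : (G.x p : ℂ) ≠ 0 := by exact_mod_cast hx
    congr 1
    · congr 1
      · congr 1
        push_cast
        field_simp
      · congr 1
        push_cast
        field_simp
    · rw [eq_comm, ← one_smul ℂ ((nf.symbolSec φ u).1 p), smul_smul]
      congr 1
      push_cast
      field_simp
  refine Tendsto.congr' h1 ?_
  have h2 : Tendsto (fun ρ : ℝ => ρ⁻¹) atTop (𝓝 0) := tendsto_inv_atTop_zero
  have h3 := ((((h2.pow 2).smul_const ((P u).1 p)).add
    (h2.smul_const (Complex.I • U.1 p))).const_smul (G.x p ^ 2)⁻¹).add_const ((nf.symbolSec φ u).1 p)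
  rw [← nf.symbolSec_apply Φ]
  simpa using h3

theorem mulSec_mem_testSec {χ : M → ℝ} (hχ : ContMDiff (𝓡∂ (k + q + 1)) 𝓘(ℝ, ℝ) ∞ χ)
    (hχi : tsupport χ ⊆ (𝓡∂ (k + q + 1)).interior M) (u : Sec k q F E) :
    (mulSec χ hχ u).1 ∈ TestSec k q F E := by
  refine ⟨(mulSec χ hχ u).2, tsupport χ, (isClosed_tsupport χ).isCompact, hχi, fun p hp => ?_⟩
  change χ p • u.1 p = 0
  rw [image_eq_zero_of_notMem_tsupport hp, zero_smul]

theorem mulSecC_mem_testSec {c : M → ℂ} (hc : ContMDiff (𝓡∂ (k + q + 1)) 𝓘(ℝ, ℂ) ∞ c)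
    {u : Sec k q F E} (hu : u.1 ∈ TestSec k q F E) : (mulSecC c hc u).1 ∈ TestSec k q F E := by
  obtain ⟨-, K, hK, hKi, hK0⟩ := hu
  refine ⟨(mulSecC c hc u).2, K, hK, hKi, fun p hp => ?_⟩
  change c p • u.1 p = 0
  rw [hK0 p hp, smul_zero]

/-- A support inside x > 0 makes the function basic, with boundary value zero. -/
theorem exists_contMDiff_mfderiv_eq {p : M} (hp : p ∈ (𝓡∂ (k + q + 1)).interior M)
    (ℓ : TangentSpace (𝓡∂ (k + q + 1)) p →L[ℝ] ℝ) :
    ∃ f : M → ℝ, IsBasic G f ∧ ∀ v, mfderiv (𝓡∂ (k + q + 1)) 𝓘(ℝ, ℝ) f p v = ℓ v := by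
  have hO : IsOpen {p' | 0 < G.x p'} := isOpen_lt continuous_const G.contMDiff_x.continuous
  obtain ⟨f, hf, hfO, hfℓ⟩ := exists_contMDiff_tsupport_subset_mfderiv_eq
    (hO.mem_nhds ((G.x_pos_iff p).2 hp)) ℓ
  refine ⟨f, ⟨hf, fun _ => 0, contMDiff_const, fun z => ?_⟩, hfℓ⟩
  refine image_eq_zero_of_notMem_tsupport fun h1 => ?_
  have h2 : 0 < G.x (G.incl z) := hfO h1
  rw [G.x_incl] at h2
  exact lt_irrefl _ h2

/-- The differential of a basic function, as a section of the wedge cotangent bundle. -/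
theorem IsBasic.exists_differential {f : M → ℝ} (hf : IsBasic G f) [IsManifold (𝓡 (k + q)) ∞ N]
    [IsManifold (𝓡 q) ∞ Y] : ∃ φ : wedgeForms G,
      ∀ p, φ.1 p = mfderiv (𝓡∂ (k + q + 1)) 𝓘(ℝ, ℝ) f p := by
  refine ⟨⟨fun p => mfderiv (𝓡∂ (k + q + 1)) 𝓘(ℝ, ℝ) f p,
    fun V hV => contMDiff_dirDeriv hV hf.1, fun z w hw => ?_⟩, fun _ => rfl⟩
  obtain ⟨hf, g, hg, hfg⟩ := hf
  have h1 := mfderiv_comp z (hf.mdifferentiableAt (by simp) (x := G.incl z))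
    (G.contMDiff_incl.mdifferentiableAt (by simp))
  have h2 := mfderiv_comp z (hg.mdifferentiableAt (by simp) (x := G.proj z))
    (G.isSubmersion_proj.contMDiff.mdifferentiableAt (by simp))
  have h3 : f ∘ G.incl = g ∘ G.proj := funext hfg
  have h4 : (mfderiv (𝓡 (k + q)) 𝓘(ℝ, ℝ) (f ∘ G.incl) z w : ℝ) =
      mfderiv (𝓡 (k + q)) 𝓘(ℝ, ℝ) (g ∘ G.proj) z w := by rw [h3]
  rw [h1, h2] at h4
  refine Eq.trans h4 ?_
  change mfderiv (𝓡 q) 𝓘(ℝ, ℝ) g (G.proj z) (mfderiv (𝓡 (k + q)) (𝓡 q) G.proj z w) = 0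
  rw [hw, map_zero]

end Symbol

/-! ### Symmetry and positivity of the symbol -/

section SymbolPositivity

variable {k q : ℕ} {M N Y : Type*}
  [TopologicalSpace M] [ChartedSpace (EuclideanHalfSpace (k + q + 1)) M]
  [TopologicalSpace N] [ChartedSpace (EuclideanSpace ℝ (Fin (k + q))) N]
  [TopologicalSpace Y] [ChartedSpace (EuclideanSpace ℝ (Fin q)) Y]
  [IsManifold (𝓡∂ (k + q + 1)) ∞ M]
  {G : FiberedBoundary k q M N Y}
  {F : Type*} [NormedAddCommGroup F] [NormedSpace ℝ F] {E : M → Type*}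
  [TopologicalSpace (TotalSpace F E)] [∀ p, NormedAddCommGroup (E p)]
  [∀ p, InnerProductSpace ℂ (E p)] [FiberBundle F E] [VectorBundle ℝ F E]
  [ContMDiffVectorBundle ∞ F E (𝓡∂ (k + q + 1))]
  [SmoothHermitianBundle (𝓡∂ (k + q + 1)) F E]
  [T2Space M] [CompactSpace M] [FiniteDimensional ℝ F]
  [MeasurableSpace M] [BorelSpace M] {μ : Measure M}
  {P : Module.End ℂ (Sec k q F E)}

theorem l2Pairing_conj {X : Type*} [MeasurableSpace X] {W : X → Type*} [∀ p, NormedAddCommGroup (W p)]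
    [∀ p, InnerProductSpace ℂ (W p)] (μ : Measure X) (u v : ∀ p, W p) :
    starRingEnd ℂ (l2Pairing μ u v) = l2Pairing μ v u := by
  rw [l2Pairing, ← integral_conj]
  simp only [inner_conj_symm]
  rfl

theorem IsSymmetricOp.im_eq_zero (h : IsSymmetricOp G μ P) {u : ∀ p, E p}
    (hu : u ∈ TestSec k q F E) : (l2Pairing (wedgeMeasure μ G.x) (wedgeOp G P u) u).im = 0 := by
  refine Complex.conj_eq_iff_im.1 ?_
  rw [l2Pairing_conj]
  exact (h u hu u hu).symm

theorem continuous_inner_sec (u v : Sec k q F E) : Continuous fun p => (inner ℂ (u.1 p) (v.1 p) : ℂ) :=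
  v.2.continuous_inner u.2

/-- The test-section pairing with `x⁻² P`, after conjugation by `e^{iρf}`. -/
theorem NormalForm.tendsto_pairing_conj [IsFiniteMeasure μ] (nf : NormalForm G P) {f : M → ℝ}
    {φ : wedgeForms G} (hf : ContMDiff (𝓡∂ (k + q + 1)) 𝓘(ℝ, ℝ) ∞ f)
    (hφ : ∀ p v, φ.1 p v = mfderiv (𝓡∂ (k + q + 1)) 𝓘(ℝ, ℝ) f p v) (u : Sec k q F E) {χ : M → ℝ}
    (hχ : ContMDiff (𝓡∂ (k + q + 1)) 𝓘(ℝ, ℝ) ∞ χ)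
    (hχi : tsupport χ ⊆ (𝓡∂ (k + q + 1)).interior M) :
    Tendsto (fun ρ : ℝ => (((ρ ^ 2)⁻¹ : ℝ) : ℂ) * l2Pairing (wedgeMeasure μ G.x)
        (wedgeOp G P (mulSecC _ (contMDiff_phase ρ hf) (mulSec χ hχ u)).1)
        (mulSecC _ (contMDiff_phase ρ hf) (mulSec χ hχ u)).1) atTop
      (𝓝 (∫ p, ((χ p ^ 2 * G.x p : ℝ) : ℂ) * inner ℂ (u.1 p) ((nf.symbolSec φ u).1 p) ∂μ)) := by
  obtain ⟨Φ⟩ := nonempty_globalFrame (𝓡∂ (k + q + 1)) F E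
  obtain ⟨U, hU⟩ := nf.exists_conj_expansion hf hφ (mulSec χ hχ u)
  -- The support of χ avoids x = 0, so the weight x · x⁻² causes no trouble in the lower order
  -- terms.
  have hχx : Continuous fun p => (G.x p)⁻¹ * χ p := by
    rw [continuous_iff_continuousAt]
    intro p
    by_cases hp : p ∈ tsupport χ
    · exact (G.contMDiff_x.continuous.continuousAt.inv₀ ((G.x_pos_iff p).2 (hχi hp)).ne').mul
        hχ.continuous.continuousAt
    · refine (continuousAt_const (y := (0 : ℝ))).congr ?_
      filter_upwards [(isClosed_tsupport χ).isOpen_compl.mem_nhds hp] with p' hp'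
      rw [image_eq_zero_of_notMem_tsupport hp', mul_zero]
  have hJ : ∀ v : Sec k q F E,
      Integrable (fun p => (((G.x p)⁻¹ * χ p : ℝ) : ℂ) * inner ℂ (u.1 p) (v.1 p)) μ := fun v =>
    integrable_of_continuous ((Complex.continuous_ofReal.comp hχx).mul (continuous_inner_sec u v))
  have hx0 : ∀ p, p ∉ (𝓡∂ (k + q + 1)).interior M → χ p = 0 := fun p hp =>
    image_eq_zero_of_notMem_tsupport fun h => hp (hχi h)
  have hsym : ∀ p, (nf.symbolSec φ (mulSec χ hχ u)).1 p = (χ p : ℂ) • (nf.symbolSec φ u).1 p := by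
    intro p
    rw [nf.symbolSec_apply Φ, nf.symbolSec_apply Φ, ← map_smul, Complex.coe_smul]
    rfl
  have h1 : ∀ ρ : ℝ, l2Pairing (wedgeMeasure μ G.x)
        (wedgeOp G P (mulSecC _ (contMDiff_phase ρ hf) (mulSec χ hχ u)).1)
        (mulSecC _ (contMDiff_phase ρ hf) (mulSec χ hχ u)).1 =
      (∫ p, (((G.x p)⁻¹ * χ p : ℝ) : ℂ) * inner ℂ (u.1 p) ((P (mulSec χ hχ u)).1 p) ∂μ) +
        (Complex.I * ρ) * (∫ p, (((G.x p)⁻¹ * χ p : ℝ) : ℂ) * inner ℂ (u.1 p) (U.1 p) ∂μ) +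
        ((ρ ^ 2 : ℝ) : ℂ) *
        ∫ p, ((χ p ^ 2 * G.x p : ℝ) : ℂ) * inner ℂ (u.1 p) ((nf.symbolSec φ u).1 p) ∂μ := by
    intro ρ
    have i3 : Integrable (fun p => ((χ p ^ 2 * G.x p : ℝ) : ℂ) *
        inner ℂ (u.1 p) ((nf.symbolSec φ u).1 p)) μ := by
      have c1 := hχ.continuous
      have c2 := G.contMDiff_x.continuous
      have c3 := continuous_inner_sec u (nf.symbolSec φ u)
      exact integrable_of_continuous (by fun_prop)
    have i12 : ∀ ρ : ℝ, Integrable (fun p =>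
        (((G.x p)⁻¹ * χ p : ℝ) : ℂ) * inner ℂ (u.1 p) ((P (mulSec χ hχ u)).1 p) +
        Complex.I * ρ * ((((G.x p)⁻¹ * χ p : ℝ) : ℂ) * inner ℂ (u.1 p) (U.1 p))) μ :=
      fun ρ => (hJ _).add ((hJ _).const_mul _)
    rw [l2Pairing, integral_wedgeMeasure G.contMDiff_x.continuous.measurable
      (Eventually.of_forall G.x_nonneg), ← integral_const_mul, ← integral_const_mul,
      ← integral_add (hJ _) ((hJ _).const_mul _), ← integral_add (i12 ρ) (i3.const_mul _)]
    refine integral_congr_ae (Eventually.of_forall fun p => ?_)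
    have e1 : (mulSecC _ (contMDiff_phase ρ hf) (mulSec χ hχ u)).1 p = phase ρ f p • χ p • u.1 p := rfl
    dsimp only [wedgeOp]
    rw [applyOp_eq, hU ρ p, e1, smul_comm (G.x p ^ 2)⁻¹ (phase ρ f p),
      inner_phase_smul (norm_phase ρ f p), hsym]
    simp only [← Complex.coe_smul, inner_smul_left, inner_smul_right, inner_add_right,
      Complex.conj_ofReal, smul_eq_mul]
    by_cases hp : p ∈ (𝓡∂ (k + q + 1)).interior M
    · have hx : (G.x p : ℂ) ≠ 0 := by exact_mod_cast ((G.x_pos_iff p).2 hp).ne'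
      push_cast
      field_simp
    · simp [hx0 p hp]
  have h2 : ∀ c d e : ℂ, Tendsto (fun ρ : ℝ => (((ρ ^ 2)⁻¹ : ℝ) : ℂ) *
      (c + (Complex.I * ρ) * d + ((ρ ^ 2 : ℝ) : ℂ) * e)) atTop (𝓝 e) := by
    intro c d e
    have h3 : Tendsto (fun ρ : ℝ => ((ρ⁻¹ : ℝ) : ℂ)) atTop (𝓝 0) := by
      have := (Complex.continuous_ofReal.tendsto 0).comp tendsto_inv_atTop_zero
      rwa [Complex.ofReal_zero] at this
    have h4 := (((h3.pow 2).mul_const c).add (h3.mul_const (Complex.I * d))).add_const e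
    have h5 : (0 : ℂ) ^ 2 * c + 0 * (Complex.I * d) + e = e := by ring
    rw [h5] at h4
    refine h4.congr' ?_
    filter_upwards [eventually_gt_atTop 0] with ρ hρ
    have h6 : (ρ : ℂ) ≠ 0 := by exact_mod_cast hρ.ne'
    push_cast
    field_simp
  simp only [h1]
  exact h2 _ _ _

theorem NormalForm.inner_symbolSec_nonneg_of_differential (nf : NormalForm G P)
    (hμ : IsSmoothPositiveDensity (𝓡∂ (k + q + 1)) μ) (hsymm : IsSymmetricOp G μ P)
    (hpos : IsNonnegOp G μ P) {f : M → ℝ} {φ : wedgeForms G}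
    (hf : ContMDiff (𝓡∂ (k + q + 1)) 𝓘(ℝ, ℝ) ∞ f)
    (hφ : ∀ p v, φ.1 p v = mfderiv (𝓡∂ (k + q + 1)) 𝓘(ℝ, ℝ) f p v) (u : Sec k q F E) {p : M}
    (hp : p ∈ (𝓡∂ (k + q + 1)).interior M) :
    0 ≤ (inner ℂ (u.1 p) ((nf.symbolSec φ u).1 p) : ℂ).re ∧
      (inner ℂ (u.1 p) ((nf.symbolSec φ u).1 p) : ℂ).im = 0 := by
  have := hμ.isFiniteMeasure
  have hx := G.contMDiff_x.continuous
  have hc := continuous_inner_sec u (nf.symbolSec φ u)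
  have hU : IsOpen ((𝓡∂ (k + q + 1)).interior M) := by
    have : (𝓡∂ (k + q + 1)).interior M = {p | 0 < G.x p} := by
      ext p
      exact (G.x_pos_iff p).symm
    rw [this]
    exact isOpen_lt continuous_const hx
  have hxp := (G.x_pos_iff p).2 hp
  -- The pairings are real and nonnegative. Testing with L = Re, Im and −Im yields nonnegativity and
  -- realness of the symbol from a single argument on integrals.
  have key : ∀ (L : ℂ →L[ℝ] ℝ), (∀ c : ℂ, 0 ≤ c.re → c.im = 0 → 0 ≤ L c) →
      0 ≤ L (inner ℂ (u.1 p) ((nf.symbolSec φ u).1 p)) := by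
    intro L hL
    have h1 := hμ.nonneg_of_integral
      (f := fun p => G.x p * L (inner ℂ (u.1 p) ((nf.symbolSec φ u).1 p))) hU
      (fun p hp => hp) (by fun_prop) ?_ hp
    · exact nonneg_of_mul_nonneg_right h1 hxp
    · intro χ hχ hχi
      have hχc := hχ.continuous
      have h1 := nf.tendsto_pairing_conj (μ := μ) hf hφ u hχ hχi
      have h2 : ∀ p, χ p ^ 2 * (G.x p * L (inner ℂ (u.1 p) ((nf.symbolSec φ u).1 p))) =
          L (((χ p ^ 2 * G.x p : ℝ) : ℂ) * inner ℂ (u.1 p) ((nf.symbolSec φ u).1 p)) := by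
        intro p
        rw [← Complex.real_smul, map_smul, smul_eq_mul, mul_assoc]
      simp only [h2]
      rw [L.integral_comp_comm (integrable_of_continuous (by fun_prop))]
      refine ge_of_tendsto ((L.continuous.tendsto _).comp h1) ?_
      filter_upwards [eventually_gt_atTop 0] with ρ hρ
      have ht := mulSecC_mem_testSec (contMDiff_phase ρ hf) (mulSec_mem_testSec hχ hχi u)
      rw [Function.comp_apply, ← Complex.real_smul, map_smul, smul_eq_mul]
      exact mul_nonneg (by positivity) (hL _ (hpos _ ht) (hsymm.im_eq_zero ht))
  refine ⟨key Complex.reCLM fun c h _ => h, le_antisymm ?_ (key Complex.imCLM fun c _ h => h.ge)⟩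
  have := key (-Complex.imCLM) fun c _ h => by simp [h]
  simpa using this

/-- At an interior point the form agrees with the differential of a basic function, and as x ≠ 0
there the slopes agree too. Boundary points follow by continuity, the target set being closed and
the interior dense. -/
theorem NormalForm.inner_symbolAt_nonneg [IsManifold (𝓡 (k + q)) ∞ N] [IsManifold (𝓡 q) ∞ Y]
    (nf : NormalForm G P) (Φ : GlobalFrame (𝓡∂ (k + q + 1)) F E)
    (hμ : IsSmoothPositiveDensity (𝓡∂ (k + q + 1)) μ) (hsymm : IsSymmetricOp G μ P)
    (hpos : IsNonnegOp G μ P) (φ : wedgeForms G) (p : M) (v : E p) :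
    0 ≤ (inner ℂ v (nf.symbolAt Φ φ p v) : ℂ).re ∧ (inner ℂ v (nf.symbolAt Φ φ p v) : ℂ).im = 0 := by
  set u := Φ.through p v with hu
  have hc := continuous_inner_sec u (nf.symbolSec φ u)
  have hint : ∀ p' ∈ (𝓡∂ (k + q + 1)).interior M,
      0 ≤ (inner ℂ (u.1 p') ((nf.symbolSec φ u).1 p') : ℂ).re ∧
      (inner ℂ (u.1 p') ((nf.symbolSec φ u).1 p') : ℂ).im = 0 := by
    intro p' hp'
    obtain ⟨f, hf, hfφ⟩ := exists_contMDiff_mfderiv_eq (G := G) hp' (φ.1 p')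
    obtain ⟨ψ, hψ⟩ := hf.exists_differential
    have h1 := nf.inner_symbolSec_nonneg_of_differential hμ hsymm hpos hf.1
      (fun p v => congrArg (fun L => L v) (hψ p)) u hp'
    have hs : ∀ R : EdgeDerivation G F E, R.slope ψ p' = R.slope φ p' := fun R => by
      refine mul_left_cancel₀ ((G.x_pos_iff p').2 hp').ne' ?_
      rw [← R.apply_V, ← R.apply_V, hψ]
      exact hfφ _
    have h2 : nf.symbolAt Φ ψ p' = nf.symbolAt Φ φ p' := by
      simp only [NormalForm.symbolAt, hs]
    rw [nf.symbolSec_apply Φ, h2, ← nf.symbolSec_apply Φ] at h1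
    exact h1
  have hcl : IsClosed {c : ℂ | 0 ≤ c.re ∧ c.im = 0} :=
    (isClosed_le continuous_const Complex.continuous_re).inter
      (isClosed_eq Complex.continuous_im continuous_const)
  have h1 : (inner ℂ (u.1 p) ((nf.symbolSec φ u).1 p) : ℂ) ∈ {c : ℂ | 0 ≤ c.re ∧ c.im = 0} := by
    have h2 := (hcl.preimage hc).closure_subset_iff.2 (fun p' hp' => hint p' hp')
    exact h2 (dense_interior_manifold (k := k) (q := q) p)
  rwa [nf.symbolSec_apply Φ, hu, Φ.through_apply] at h1

theorem GlobalFrame.finiteDimensional (Φ : GlobalFrame (𝓡∂ (k + q + 1)) F E) (p : M) :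
    FiniteDimensional ℂ (E p) := by
  refine Module.finite_def.2 (Submodule.fg_def.2 ⟨range fun i => Φ.e i p, finite_range _, ?_⟩)
  refine eq_top_iff.2 fun v _ => ?_
  rw [← Φ.sum_coeff p v]
  refine Submodule.sum_mem _ fun i _ => ?_
  rw [← Complex.coe_smul]
  exact Submodule.smul_mem _ _ (Submodule.subset_span (mem_range_self i))

theorem exists_wedgeSymbol [IsManifold (𝓡 (k + q)) ∞ N] [IsManifold (𝓡 q) ∞ Y]
    (nf : NormalForm G P) (hμ : IsSmoothPositiveDensity (𝓡∂ (k + q + 1)) μ)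
    (hsymm : IsSymmetricOp G μ P) (hpos : IsNonnegOp G μ P) :
    ∃ S : ∀ p : M, WedgeCotangent G p → (E p →ₗ[ℂ] E p), IsWedgeSymbol G P S ∧
      ∀ (p : M) (ξ : WedgeCotangent G p), (S p ξ).IsSymmetric ∧
        spectrum ℂ (S p ξ) ⊆ (fun t : ℝ => (t : ℂ)) '' Ici 0 := by
  obtain ⟨Φ⟩ := nonempty_globalFrame (𝓡∂ (k + q + 1)) F E
  have hval : ∀ (φ : wedgeForms G) (p : M),
      nf.symbolAt Φ (Quotient.out (wedgeValue G p φ)) p = nf.symbolAt Φ φ p := by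
    intro φ p
    have h1 : (Quotient.out (wedgeValue G p φ)).1 - φ.1 ∈ vanishingForms G p :=
      Quotient.mk_out (s := wedgeSetoid G p) φ
    simp only [NormalForm.symbolAt, fun R : EdgeDerivation G F E => R.slope_congr h1]
  refine ⟨fun p ξ => nf.symbolAt Φ (Quotient.out ξ) p, ⟨fun f φ hf hφ ψ hψ p hp => ?_,
    fun φ ψ hψ => ?_⟩, fun p ξ => ?_⟩
  · simp only [hval]
    exact nf.tendsto_symbolAt Φ hf.1 hφ ⟨ψ, hψ.1⟩ hp
  · simp only [hval]
    have h1 : (fun p => nf.symbolAt Φ φ p (ψ p)) = (nf.symbolSec φ ⟨ψ, hψ⟩).1 := by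
      funext p
      rw [nf.symbolSec_apply Φ]
    rw [h1]
    exact (nf.symbolSec φ ⟨ψ, hψ⟩).2
  · have := Φ.finiteDimensional p
    exact isSymmetric_and_spectrum_of_nonneg
      (nf.inner_symbolAt_nonneg Φ hμ hsymm hpos (Quotient.out ξ) p)

end SymbolPositivity

/-! ### Comparison of the collar coordinate with x -/

section NormalCoordinate

variable {k q : ℕ} {M N Y : Type*}
  [TopologicalSpace M] [ChartedSpace (EuclideanHalfSpace (k + q + 1)) M]
  [TopologicalSpace N] [ChartedSpace (EuclideanSpace ℝ (Fin (k + q))) N]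
  [TopologicalSpace Y] [ChartedSpace (EuclideanSpace ℝ (Fin q)) Y]
  [IsManifold (𝓡∂ (k + q + 1)) ∞ M]
  {G : FiberedBoundary k q M N Y}
  {F : Type*} [NormedAddCommGroup F] [NormedSpace ℝ F] {E : M → Type*}
  [TopologicalSpace (TotalSpace F E)] [∀ p, NormedAddCommGroup (E p)]
  [∀ p, InnerProductSpace ℂ (E p)] [FiberBundle F E] [VectorBundle ℝ F E]
  [ContMDiffVectorBundle ∞ F E (𝓡∂ (k + q + 1))]
  [SmoothHermitianBundle (𝓡∂ (k + q + 1)) F E]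
  [T2Space M] [CompactSpace M] [FiniteDimensional ℝ F]

/-- On the compact complement of `O` the function `x` has a positive minimum. -/
theorem FiberedBoundary.exists_x_lt_subset (G : FiberedBoundary k q M N Y) {O : Set M}
    (hO : IsOpen O) (h : ∀ z, G.incl z ∈ O) : ∃ b, 0 < b ∧ ∀ p, G.x p < b → p ∈ O := by
  rcases (Oᶜ).eq_empty_or_nonempty with h0 | h0
  · exact ⟨1, one_pos, fun p _ => by simp [compl_empty_iff.1 h0]⟩
  · obtain ⟨p₀, hp₀, hmin⟩ := hO.isClosed_compl.isCompact.exists_isMinOn h0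
      G.contMDiff_x.continuous.continuousOn
    refine ⟨G.x p₀, lt_of_le_of_ne (G.x_nonneg p₀) fun h1 => hp₀ ?_, fun p hp => ?_⟩
    · obtain ⟨z, rfl⟩ : p₀ ∈ range G.incl := by
        rw [G.range_incl]
        exact (G.x_eq_zero_iff p₀).1 h1.symm
      exact h z
    · by_contra h1
      exact absurd (hmin h1) (not_le.2 hp)

/-- A cutoff function supported near the boundary. -/
def boundaryCutoff (G : FiberedBoundary k q M N Y) (b : ℝ) (p : M) : ℝ :=
  Real.smoothTransition ((2 * b / 3 - G.x p) / (b / 3))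

theorem contMDiff_boundaryCutoff (G : FiberedBoundary k q M N Y) (b : ℝ) :
    ContMDiff (𝓡∂ (k + q + 1)) 𝓘(ℝ, ℝ) ∞ (boundaryCutoff G b) := by
  have h : ContDiff ℝ ∞ fun t : ℝ => Real.smoothTransition ((2 * b / 3 - t) / (b / 3)) :=
    Real.smoothTransition.contDiff.comp (by fun_prop)
  exact h.contMDiff.comp G.contMDiff_x

theorem boundaryCutoff_eq_one {b : ℝ} (hb : 0 < b) {p : M} (hp : G.x p ≤ b / 3) :
    boundaryCutoff G b p = 1 := by
  refine Real.smoothTransition.one_of_one_le ?_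
  rw [le_div_iff₀ (by positivity)]
  linarith

theorem boundaryCutoff_eq_zero {b : ℝ} (hb : 0 < b) {p : M} (hp : 2 * b / 3 ≤ G.x p) :
    boundaryCutoff G b p = 0 :=
  Real.smoothTransition.zero_of_nonpos (div_nonpos_of_nonpos_of_nonneg (by linarith) (by positivity))

/-- The cutoff already vanishes from x = 2b/3 on, so the open sets x < b and x > 2b/3 cover, and on
the second one the product is zero. -/
theorem contMDiff_boundaryCutoff_mul {X EX HX : Type*} [NormedAddCommGroup EX] [NormedSpace ℝ EX]
    [TopologicalSpace HX] {J : ModelWithCorners ℝ EX HX} [TopologicalSpace X] [ChartedSpace HX X]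
    {r : X → M} (hr : ContMDiff J (𝓡∂ (k + q + 1)) ∞ r) {b : ℝ} (hb : 0 < b) {f : X → ℝ}
    (hf : ContMDiffOn J 𝓘(ℝ, ℝ) ∞ f {n | G.x (r n) < b}) :
    ContMDiff J 𝓘(ℝ, ℝ) ∞ fun n => boundaryCutoff G b (r n) * f n := by
  have hx := G.contMDiff_x.continuous.comp hr.continuous
  refine contMDiff_of_contMDiffOn_union_of_isOpen (t := {n | 2 * b / 3 < G.x (r n)})
    (((contMDiff_boundaryCutoff G b).comp hr).contMDiffOn.mul hf) ?_ ?_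
    (isOpen_lt hx continuous_const) (isOpen_lt continuous_const hx)
  · refine (contMDiffOn_const (c := (0 : ℝ))).congr fun n hn => ?_
    have hn' : 2 * b / 3 < G.x (r n) := hn
    rw [boundaryCutoff_eq_zero hb hn'.le, zero_mul]
  · refine eq_univ_of_forall fun n => ?_
    rcases lt_or_ge (G.x (r n)) b with h | h
    · exact Or.inl h
    · exact Or.inr (show 2 * b / 3 < G.x (r n) by linarith)

variable [MeasurableSpace M] [MeasurableSpace N] {μ : Measure M} {μN : Measure N}

theorem Collar.incl_mem (C : Collar G F E μ μN) (z : N) : (z, (0 : ℝ)) ∈ C.Φ.source := by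
  rw [C.source_eq]
  exact ⟨mem_univ _, le_refl _, C.ε_pos⟩

theorem Collar.incl_mem_target (C : Collar G F E μ μN) (z : N) : G.incl z ∈ C.Φ.target := by
  rw [← C.Φ_zero]
  exact C.Φ.map_source (C.incl_mem z)

theorem Collar.symm_incl (C : Collar G F E μ μN) (z : N) : C.Φ.symm (G.incl z) = (z, 0) := by
  rw [← C.Φ_zero]
  exact C.Φ.left_inv (C.incl_mem z)

/-- The ray over a boundary point, near the boundary. -/
theorem Collar.tendsto_ray (C : Collar G F E μ μN) (z : N) :
    Tendsto (fun t : ℝ => C.Φ (z, t)) (𝓝[≥] 0) (𝓝 (G.incl z)) := by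
  have h1 : ContinuousWithinAt C.Φ C.Φ.source (z, 0) :=
    C.contMDiffOn_Φ.continuousOn _ (C.incl_mem z)
  have h2 : Tendsto (fun t : ℝ => (z, t)) (𝓝[≥] 0) (𝓝[C.Φ.source] (z, 0)) := by
    refine tendsto_nhdsWithin_iff.2 ⟨?_, ?_⟩
    · exact (Continuous.prodMk_right z).continuousAt.tendsto.mono_left nhdsWithin_le_nhds
    · filter_upwards [Ico_mem_nhdsGE C.ε_pos] with t ht
      rw [C.source_eq]
      exact ⟨mem_univ _, ht⟩
  have h3 := h1.tendsto.comp h2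
  rwa [C.Φ_zero] at h3

theorem Collar.tendsto_x_div (C : Collar G F E μ μN) (z : N) :
    Tendsto (fun t : ℝ => t⁻¹ * G.x (C.Φ (z, t))) (𝓝[>] 0) (𝓝 1) := by
  have h := (hasDerivWithinAt_iff_tendsto_slope.1 (C.hasDerivWithinAt_x z))
  have h1 : Ici (0 : ℝ) \ {0} = Ioi 0 := by
    ext t
    simp only [Set.mem_sdiff, mem_Ici, mem_singleton_iff, mem_Ioi, lt_iff_le_and_ne, ne_comm]
  rw [h1] at h
  refine h.congr fun t => ?_
  rw [slope_def_field, C.Φ_zero, G.x_incl, sub_zero, sub_zero, div_eq_inv_mul]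

/-- A smooth function `c` with `τ = c x` near the boundary, where `τ` is the coordinate in
`[0, ε)` provided by the collar, together with bounds on the size of the collar. -/
structure NormalCoordinate (C : Collar G F E μ μN) where
  c : M → ℝ
  smooth_c : ContMDiff (𝓡∂ (k + q + 1)) 𝓘(ℝ, ℝ) ∞ c
  b : ℝ
  b_pos : 0 < b
  δ : ℝ
  δ_pos : 0 < δ
  c_incl : ∀ z, c (G.incl z) = 1
  mem_target : ∀ p, G.x p < b → p ∈ C.Φ.target
  snd_eq : ∀ p, G.x p < b → (C.Φ.symm p).2 = G.x p * c p
  half_lt : ∀ p, G.x p < b → 1 / 2 < c p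
  x_lt : ∀ p ∈ C.Φ.target, (C.Φ.symm p).2 < δ → G.x p < b

/-- Compactness of `N` makes the continuity of x ∘ Φ at collar coordinate 0 uniform over the
boundary. -/
theorem Collar.exists_x_lt (C : Collar G F E μ μN) {b : ℝ} (hb : 0 < b) :
    ∃ δ, 0 < δ ∧ ∀ p ∈ C.Φ.target, (C.Φ.symm p).2 < δ → G.x p < b := by
  have := G.compactSpace_boundary
  have h1 : ∀ᶠ t in 𝓝 (0 : ℝ), ∀ z ∈ (univ : Set N), (z, t) ∈ C.Φ.source → G.x (C.Φ (z, t)) < b := by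
    refine isCompact_univ.eventually_forall_of_forall_eventually fun z _ => ?_
    have h2 : ContinuousWithinAt (fun n => G.x (C.Φ n)) C.Φ.source (z, 0) :=
      G.contMDiff_x.continuous.continuousAt.comp_continuousWithinAt
        (C.contMDiffOn_Φ.continuousOn _ (C.incl_mem z))
    have h3 : ∀ᶠ n in 𝓝 ((z, (0 : ℝ))), n ∈ C.Φ.source → G.x (C.Φ n) < b := by
      refine eventually_nhdsWithin_iff.1 (h2.eventually_lt_const ?_)
      dsimp only
      rw [C.Φ_zero, G.x_incl]
      exact hb
    exact (continuous_swap.tendsto ((0 : ℝ), z)).eventually h3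
  obtain ⟨δ, hδ, h2⟩ := Metric.eventually_nhds_iff.1 h1
  refine ⟨δ, hδ, fun p hp hτ => ?_⟩
  have h3 := C.Φ.map_target hp
  have h4 : 0 ≤ (C.Φ.symm p).2 := by
    rw [C.source_eq] at h3
    exact h3.2.1
  have h5 := h2 (y := (C.Φ.symm p).2) (by rwa [Real.dist_eq, sub_zero, abs_of_nonneg h4])
    (C.Φ.symm p).1 (mem_univ _) h3
  rwa [C.Φ.right_inv hp] at h5

/-- The collar coordinate τ vanishes on the boundary, so τ = c x by division. Tangency of Φ to the
identity says x/τ → 1 along rays, whence c = 1 on the boundary and c > 1/2 nearby. -/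
theorem Collar.nonempty_normalCoordinate (C : Collar G F E μ μN) : Nonempty (NormalCoordinate C) := by
  obtain ⟨b₀, hb₀, h₀⟩ := G.exists_x_lt_subset C.isOpen_target C.incl_mem_target
  have hτ : ContMDiff (𝓡∂ (k + q + 1)) 𝓘(ℝ, ℝ) ∞
      fun p => boundaryCutoff G b₀ p * (C.Φ.symm p).2 :=
    contMDiff_boundaryCutoff_mul contMDiff_id hb₀
      (contMDiff_snd.comp_contMDiffOn (C.contMDiffOn_symm.mono fun p hp => h₀ p hp))
  obtain ⟨c, hc, hcx⟩ := G.exists_eq_x_mul' hτ fun z => by rw [C.symm_incl, mul_zero]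
  have hcτ : ∀ p, G.x p < b₀ / 3 → (C.Φ.symm p).2 = G.x p * c p := fun p hp => by
    rw [← hcx, boundaryCutoff_eq_one hb₀ hp.le, one_mul]
  have hc1 : ∀ z, c (G.incl z) = 1 := by
    intro z
    have hray := (C.tendsto_ray z).mono_left (nhdsWithin_mono 0 Ioi_subset_Ici_self)
    have h1 := (C.tendsto_x_div z).mul ((hc.continuous.tendsto _).comp hray)
    have h2 : Tendsto (fun _ : ℝ => (1 : ℝ)) (𝓝[>] 0) (𝓝 1) := tendsto_const_nhds
    have h3 : ∀ᶠ t in 𝓝[>] (0 : ℝ), G.x (C.Φ (z, t)) < b₀ / 3 := by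
      refine ((G.contMDiff_x.continuous.tendsto _).comp hray).eventually_lt_const ?_
      rw [G.x_incl]
      positivity
    have h4 := tendsto_nhds_unique (h1.congr' ?_) h2
    · rwa [one_mul] at h4
    · filter_upwards [h3, Ioo_mem_nhdsGT C.ε_pos] with t ht hts
      have h5 : (z, t) ∈ C.Φ.source := by
        rw [C.source_eq]
        exact ⟨mem_univ _, hts.1.le, hts.2⟩
      have h6 := hcτ _ ht
      rw [C.Φ.left_inv h5] at h6
      rw [Function.comp_apply, mul_assoc, ← h6, inv_mul_cancel₀ hts.1.ne']
  obtain ⟨b₁, hb₁, h₁⟩ := G.exists_x_lt_subset (isOpen_lt continuous_const hc.continuous :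
    IsOpen {p | 1 / 2 < c p}) fun z => by
      change 1 / 2 < c (G.incl z)
      rw [hc1]
      norm_num
  have hb : 0 < min (b₀ / 3) b₁ := by positivity
  obtain ⟨δ, hδ, hδx⟩ := C.exists_x_lt hb
  exact ⟨⟨c, hc, min (b₀ / 3) b₁, hb, δ, hδ, hc1,
    fun p hp => h₀ p (by linarith [hp.trans_le (min_le_left _ _)]),
    fun p hp => hcτ p (hp.trans_le (min_le_left _ _)),
    fun p hp => h₁ p (hp.trans_le (min_le_right _ _)), hδx⟩⟩

end NormalCoordinate

/-! ### Transport of test sections through the collar -/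

section CollarExtension

variable {k q : ℕ} {M N Y : Type*}
  [TopologicalSpace M] [ChartedSpace (EuclideanHalfSpace (k + q + 1)) M]
  [TopologicalSpace N] [ChartedSpace (EuclideanSpace ℝ (Fin (k + q))) N]
  [TopologicalSpace Y] [ChartedSpace (EuclideanSpace ℝ (Fin q)) Y]
  [IsManifold (𝓡∂ (k + q + 1)) ∞ M]
  {G : FiberedBoundary k q M N Y}
  {F : Type*} [NormedAddCommGroup F] [NormedSpace ℝ F] {E : M → Type*}
  [TopologicalSpace (TotalSpace F E)] [∀ p, NormedAddCommGroup (E p)]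
  [∀ p, InnerProductSpace ℂ (E p)] [FiberBundle F E] [VectorBundle ℝ F E]
  [ContMDiffVectorBundle ∞ F E (𝓡∂ (k + q + 1))]
  [SmoothHermitianBundle (𝓡∂ (k + q + 1)) F E]
  [T2Space M] [CompactSpace M] [FiniteDimensional ℝ F]
  [MeasurableSpace M] [MeasurableSpace N] {μ : Measure M} {μN : Measure N}
  {C : Collar G F E μ μN}

theorem exists_support_bounds {U : ∀ n : N × ℝ, E (G.incl n.1)}
    (hU : U ∈ NormalTestSec G F E (Ioi 0)) :
    ∃ s₀ s₁ : ℝ, 0 < s₀ ∧ ∀ z, ∀ s ∉ Icc s₀ s₁, U (z, s) = 0 := by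
  obtain ⟨-, K, hK, hKU, hK0⟩ := hU
  have hK' := hK.image continuous_snd
  rcases K.eq_empty_or_nonempty with h | h
  · exact ⟨1, 1, one_pos, fun z s _ => hK0 _ (by simp [h])⟩
  · obtain ⟨s₀, ⟨n, hn, rfl⟩, hmin⟩ := hK'.exists_isLeast (h.image _)
    obtain ⟨s₁, -, hmax⟩ := hK'.exists_isGreatest (h.image _)
    refine ⟨n.2, s₁, (hKU hn).2, fun z s hs => hK0 _ fun hmem => hs ?_⟩
    exact ⟨hmin ⟨_, hmem, rfl⟩, hmax ⟨_, hmem, rfl⟩⟩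

namespace NormalCoordinate

variable (nc : NormalCoordinate C)

/-- The cutoff function of the collar. -/
def χ : M → ℝ := boundaryCutoff G nc.b

theorem smooth_χ : ContMDiff (𝓡∂ (k + q + 1)) 𝓘(ℝ, ℝ) ∞ nc.χ := contMDiff_boundaryCutoff G nc.b

theorem χ_eq_one {p : M} (hp : G.x p ≤ nc.b / 3) : nc.χ p = 1 := boundaryCutoff_eq_one nc.b_pos hp

theorem χ_eq_zero {p : M} (hp : nc.b ≤ G.x p) : nc.χ p = 0 :=
  boundaryCutoff_eq_zero nc.b_pos (by linarith [nc.b_pos])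

theorem χ_incl (z : N) : nc.χ (G.incl z) = 1 :=
  nc.χ_eq_one (by rw [G.x_incl]; linarith [nc.b_pos])

theorem contMDiffOn_symm : ContMDiffOn (𝓡∂ (k + q + 1)) ((𝓡 (k + q)).prod 𝓘(ℝ, ℝ)) ∞ C.Φ.symm
    {p | G.x p < nc.b} := C.contMDiffOn_symm.mono nc.mem_target

/-- The extension of a function on `Y` by means of the collar. -/
def extendBase (g : Y → ℝ) (p : M) : ℝ := nc.χ p * g (G.proj (C.Φ.symm p).1)

theorem extendBase_incl (g : Y → ℝ) (z : N) : nc.extendBase g (G.incl z) = g (G.proj z) := by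
  rw [extendBase, C.symm_incl, nc.χ_incl, one_mul]

theorem isBasic_extendBase {g : Y → ℝ} (hg : ContMDiff (𝓡 q) 𝓘(ℝ, ℝ) ∞ g) :
    IsBasic G (nc.extendBase g) :=
  ⟨contMDiff_boundaryCutoff_mul contMDiff_id nc.b_pos
    ((hg.comp (G.isSubmersion_proj.contMDiff.comp contMDiff_fst)).comp_contMDiffOn
      nc.contMDiffOn_symm), g, hg, nc.extendBase_incl g⟩

theorem contMDiff_cutoff_transport {s : ∀ p, E p} (hs : IsSmoothAlong (𝓡∂ (k + q + 1)) F E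
    (𝓡∂ (k + q + 1)) (fun p : M => p) s) :
    IsSmoothAlong (𝓡∂ (k + q + 1)) F E (𝓡∂ (k + q + 1)) (fun p : M => p)
      (fun p => nc.χ p • C.T (C.Φ.symm p).1 p (s (G.incl (C.Φ.symm p).1))) := by
  have h1 := C.contMDiffOn_T (fun n => s (G.incl n.1))
    (hs.comp_map (G.contMDiff_incl.comp contMDiff_fst))
  have h2 : ContMDiffOn (𝓡∂ (k + q + 1)) ((𝓡∂ (k + q + 1)).prod 𝓘(ℝ, F)) ∞
      (fun p => TotalSpace.mk' F p (C.T (C.Φ.symm p).1 p (s (G.incl (C.Φ.symm p).1))))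
      {p | G.x p < nc.b} := by
    refine (h1.comp nc.contMDiffOn_symm fun p hp =>
      C.Φ.map_target (nc.mem_target p hp)).congr fun p hp => ?_
    have h3 : C.Φ (C.Φ.symm p) = p := C.Φ.right_inv (nc.mem_target p hp)
    exact (congrArg (fun p' => TotalSpace.mk' F p' (C.T (C.Φ.symm p).1 p'
      (s (G.incl (C.Φ.symm p).1)))) h3).symm
  have hx := G.contMDiff_x.continuous
  refine contMDiff_of_contMDiffOn_union_of_isOpen (t := {p | 2 * nc.b / 3 < G.x p})
    (nc.smooth_χ.contMDiffOn.smul_section h2) ?_ ?_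
    (isOpen_lt hx continuous_const) (isOpen_lt continuous_const hx)
  · refine ((Bundle.contMDiff_zeroSection ℝ E).contMDiffOn).congr fun p hp => ?_
    have h4 : nc.χ p = 0 := boundaryCutoff_eq_zero nc.b_pos (le_of_lt hp)
    simp only [h4, zero_smul]
    rfl
  · refine eq_univ_of_forall fun p => ?_
    rcases lt_or_ge (G.x p) nc.b with h | h
    · exact Or.inl h
    · exact Or.inr (show 2 * nc.b / 3 < G.x p by linarith [nc.b_pos])

/-- The extension to `M` of a family of sections over the collar. -/
def extendFun (U : ∀ n : N × ℝ, E (G.incl n.1)) (n : M × ℝ) : E n.1 :=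
  (nc.χ n.1 * nc.χ n.1) • C.T (C.Φ.symm n.1).1 n.1 (U ((C.Φ.symm n.1).1, nc.c n.1 * n.2))

/-- The square of the cutoff is shared: one factor makes the transported frame smooth on all of `M`,
the other does so for the coefficients of `U`. -/
theorem isSmoothAlong_extendFun {U : ∀ n : N × ℝ, E (G.incl n.1)}
    (hU : IsSmoothAlong (𝓡∂ (k + q + 1)) F E ((𝓡 (k + q)).prod 𝓘(ℝ, ℝ))
      (fun n : N × ℝ => G.incl n.1) U) :
    IsSmoothAlong (𝓡∂ (k + q + 1)) F E ((𝓡∂ (k + q + 1)).prod 𝓘(ℝ, ℝ)) (fun n : M × ℝ => n.1)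
      (nc.extendFun U) := by
  obtain ⟨Ψ⟩ := nonempty_globalFrame (𝓡∂ (k + q + 1)) F E
  have h1 : nc.extendFun U = fun n => ∑ i, (nc.χ n.1 * Ψ.coeff i (G.incl (C.Φ.symm n.1).1)
      (U ((C.Φ.symm n.1).1, nc.c n.1 * n.2))) •
      (nc.χ n.1 • C.T (C.Φ.symm n.1).1 n.1 (Ψ.e i (G.incl (C.Φ.symm n.1).1))) := by
    funext n
    rw [extendFun]
    conv_lhs => rw [← Ψ.sum_coeff (G.incl (C.Φ.symm n.1).1) (U ((C.Φ.symm n.1).1, nc.c n.1 * n.2))]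
    rw [map_sum, Finset.smul_sum]
    refine Finset.sum_congr rfl fun i _ => ?_
    have h2 : ∀ (z : N) (r : ℝ) (v : E (G.incl z)), C.T z n.1 (r • v) = r • C.T z n.1 v :=
      fun z r v => (C.T z n.1).toLinearMap.map_smul_of_tower r v
    rw [h2, smul_smul, smul_smul]
    congr 1
    ring
  rw [h1]
  refine IsSmoothAlong.sum _ contMDiff_fst fun i _ => IsSmoothAlong.smul ?_
    ((nc.contMDiff_cutoff_transport (Ψ.smooth_e i)).comp_map contMDiff_fst)
  refine contMDiff_boundaryCutoff_mul (r := Prod.fst) contMDiff_fst nc.b_pos ?_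
  have h2 : ContMDiffOn ((𝓡∂ (k + q + 1)).prod 𝓘(ℝ, ℝ)) (𝓡 (k + q)) ∞
      (fun n : M × ℝ => (C.Φ.symm n.1).1) {n | G.x n.1 < nc.b} :=
    contMDiff_fst.comp_contMDiffOn (nc.contMDiffOn_symm.comp contMDiffOn_fst fun n hn => hn)
  have h3 : ContMDiffOn ((𝓡∂ (k + q + 1)).prod 𝓘(ℝ, ℝ)) 𝓘(ℝ, ℝ) ∞
      (fun n : M × ℝ => nc.c n.1 * n.2) {n | G.x n.1 < nc.b} :=
    ((nc.smooth_c.comp contMDiff_fst).mul contMDiff_snd).contMDiffOn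
  exact (Ψ.smooth_coeff_along i hU).comp_contMDiffOn (h2.prodMk h3)

/-- The section over `M × ℝ` given by a section over the model collar. -/
def extend {U : ∀ n : N × ℝ, E (G.incl n.1)}
    (hU : U ∈ NormalTestSec G F E (Ioi 0)) : CylSec k q F E :=
  ⟨nc.extendFun U, nc.isSmoothAlong_extendFun hU.1⟩

theorem extend_incl {U : ∀ n : N × ℝ, E (G.incl n.1)} (hU : U ∈ NormalTestSec G F E (Ioi 0)) (z : N)
    (s : ℝ) : (nc.extend hU).1 (G.incl z, s) = U (z, s) := by
  change (nc.χ (G.incl z) * nc.χ (G.incl z)) • C.T (C.Φ.symm (G.incl z)).1 (G.incl z)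
    (U ((C.Φ.symm (G.incl z)).1, nc.c (G.incl z) * s)) = _
  rw [nc.χ_incl, nc.c_incl, one_mul, one_mul, one_smul, C.symm_incl, C.T_incl]
  rfl

/-- Where the cutoff is nonzero, c lies between 1/2 and max m 1, so c s in [s₀, s₁] confines s to
[s₀ / max m 1, 2 s₁]. -/
theorem exists_suppIn_extend {U : ∀ n : N × ℝ, E (G.incl n.1)}
    (hU : U ∈ NormalTestSec G F E (Ioi 0)) :
    ∃ s₀ s₁ : ℝ, 0 < s₀ ∧ SuppIn (nc.extend hU) s₀ s₁ := by
  obtain ⟨s₀, s₁, hs₀, h⟩ := exists_support_bounds hU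
  obtain ⟨m, hm⟩ := isCompact_univ.bddAbove_image nc.smooth_c.continuous.continuousOn
  have hm' : ∀ p, nc.c p ≤ max m 1 := fun p => (hm ⟨p, mem_univ _, rfl⟩).trans (le_max_left _ _)
  have hm0 : 0 < max m 1 := lt_max_of_lt_right one_pos
  refine ⟨s₀ / max m 1, 2 * s₁, by positivity, fun p s hs => ?_⟩
  change (nc.χ p * nc.χ p) • C.T (C.Φ.symm p).1 p (U ((C.Φ.symm p).1, nc.c p * s)) = 0
  rcases lt_or_ge (G.x p) nc.b with hp | hp
  · rw [h _ (nc.c p * s), map_zero, smul_zero]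
    rintro ⟨h1, h2⟩
    have hc := nc.half_lt p hp
    have hs0 : 0 < s := pos_of_mul_pos_right (hs₀.trans_le h1) (by linarith)
    refine hs ⟨?_, ?_⟩
    · rw [div_le_iff₀ hm0]
      nlinarith [hm' p]
    · nlinarith
  · rw [nc.χ_eq_zero hp, mul_zero, zero_smul]

/-- Because τ = c x, one has U(z, ρτ) = U(z, c · ρx), which is the extension evaluated at s = ρx.
For large ρ the support shrinks into the region where the cutoff is 1, and equality is exact. -/
theorem pushSec_eq {U : ∀ n : N × ℝ, E (G.incl n.1)} (hU : U ∈ NormalTestSec G F E (Ioi 0))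
    {g : Y → ℝ} (hg : ContMDiff (𝓡 q) 𝓘(ℝ, ℝ) ∞ g) : ∀ᶠ ρ : ℝ in atTop,
    pushSec G C.Φ C.T (modulate G ρ g (dilate G ρ U)) =
      (ρ • scaled G ρ (nc.extendBase g) (nc.isBasic_extendBase hg).1 (nc.extend hU)).1 := by
  obtain ⟨s₀, s₁, hs₀, h⟩ := exists_support_bounds hU
  have hb := nc.b_pos
  have h0 : ∀ z s, s₁ < s → U (z, s) = 0 := fun z s hs => h z s fun hs' => not_le.2 hs hs'.2
  -- If x ≥ b, then τ ≥ δ on the collar; if b/3 < x < b, then τ = x c > b/6. In both cases these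
  -- bounds on ρ give ρτ > s₁, beyond the support of `U`.
  filter_upwards [eventually_gt_atTop 0, eventually_gt_atTop (s₁ / nc.δ),
    eventually_gt_atTop (s₁ / (nc.b / 6))] with ρ hρ hρδ hρb
  rw [div_lt_iff₀ nc.δ_pos] at hρδ
  rw [div_lt_iff₀ (by positivity)] at hρb
  funext p
  change _ = ρ • (phase ρ (nc.extendBase g) p • (nc.χ p * nc.χ p) •
    C.T (C.Φ.symm p).1 p (U ((C.Φ.symm p).1, nc.c p * (ρ * G.x p))))
  rw [pushSec]
  have hpush : ∀ p, C.T (C.Φ.symm p).1 p (modulate G ρ g (dilate G ρ U) (C.Φ.symm p)) =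
      ρ • Complex.exp (Complex.I * ρ * g (G.proj (C.Φ.symm p).1)) •
        C.T (C.Φ.symm p).1 p (U ((C.Φ.symm p).1, ρ * (C.Φ.symm p).2)) := by
    intro p
    have h2 : ∀ (z : N) (r : ℝ) (v : E (G.incl z)), C.T z p (r • v) = r • C.T z p v :=
      fun z r v => (C.T z p).toLinearMap.map_smul_of_tower r v
    rw [modulate, dilate, map_smul, h2, smul_comm]
  rcases lt_or_ge (G.x p) nc.b with hp | hp
  · rw [if_pos (nc.mem_target p hp), hpush, nc.snd_eq p hp,
      show nc.c p * (ρ * G.x p) = ρ * (G.x p * nc.c p) by ring]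
    rcases le_or_gt (G.x p) (nc.b / 3) with hp3 | hp3
    · rw [phase, extendBase, nc.χ_eq_one hp3, one_mul, one_mul, one_smul]
    · have hc := nc.half_lt p hp
      have h1 : nc.b / 6 < G.x p * nc.c p := by nlinarith
      rw [h0 _ _ (hρb.trans (mul_lt_mul_of_pos_left h1 hρ)), map_zero]
      simp only [smul_zero]
  · rw [nc.χ_eq_zero hp, mul_zero, zero_smul, smul_zero, smul_zero]
    split_ifs with ht
    · have h1 : nc.δ ≤ (C.Φ.symm p).2 := by
        by_contra h1
        exact absurd (nc.x_lt p ht (not_le.1 h1)) (not_lt.2 hp)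
      rw [hpush, h0 _ _ (hρδ.trans_le (mul_le_mul_of_nonneg_left h1 hρ.le)), map_zero]
      simp only [smul_zero]
    · rfl

end NormalCoordinate

end CollarExtension

/-! ### The normal family as a limit of rescaled operators -/

section NormalLimit

variable {k q : ℕ} {M N Y : Type*}
  [TopologicalSpace M] [ChartedSpace (EuclideanHalfSpace (k + q + 1)) M]
  [TopologicalSpace N] [ChartedSpace (EuclideanSpace ℝ (Fin (k + q))) N]
  [TopologicalSpace Y] [ChartedSpace (EuclideanSpace ℝ (Fin q)) Y]
  [IsManifold (𝓡∂ (k + q + 1)) ∞ M]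
  {G : FiberedBoundary k q M N Y}
  {F : Type*} [NormedAddCommGroup F] [NormedSpace ℝ F] {E : M → Type*}
  [TopologicalSpace (TotalSpace F E)] [∀ p, NormedAddCommGroup (E p)]
  [∀ p, InnerProductSpace ℂ (E p)] [FiberBundle F E] [VectorBundle ℝ F E]
  [ContMDiffVectorBundle ∞ F E (𝓡∂ (k + q + 1))]
  [SmoothHermitianBundle (𝓡∂ (k + q + 1)) F E]
  [T2Space M] [CompactSpace M] [FiniteDimensional ℝ F]
  [MeasurableSpace M] [MeasurableSpace N] {μ : Measure M} {μN : Measure N}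
  {P : Module.End ℂ (Sec k q F E)}

/-- Smoothness of `T` is given, that of its inverse is not. In a trivialization `T` becomes a family
of invertible maps from a fixed finite-dimensional space, continuous at the boundary, and inversion
of linear maps is continuous. -/
theorem Collar.tendsto_T_symm (C : Collar G F E μ μN) (z : N) {ι : Type*} {l : Filter ι} {t : ι → ℝ}
    (ht : Tendsto t l (𝓝[≥] 0)) {w : ∀ i, E (C.Φ (z, t i))} {w₀ : E (G.incl z)}
    (hw : Tendsto (fun i => TotalSpace.mk' F (C.Φ (z, t i)) (w i)) l
      (𝓝 (TotalSpace.mk' F (G.incl z) w₀))) :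
    Tendsto (fun i => (C.T z (C.Φ (z, t i))).symm (w i)) l (𝓝 w₀) := by
  obtain ⟨Ψ⟩ := nonempty_globalFrame (𝓡∂ (k + q + 1)) F E
  set e := trivializationAt F E (G.incl z) with he
  have hz : G.incl z ∈ e.baseSet := FiberBundle.mem_baseSet_trivializationAt F E (G.incl z)
  let A₀ : E (G.incl z) ≃L[ℝ] F := e.continuousLinearEquivAt ℝ (G.incl z) hz
  have hfd : FiniteDimensional ℝ (E (G.incl z)) :=
    LinearEquiv.finiteDimensional A₀.symm.toLinearEquiv
  have hcomplete : CompleteSpace (E (G.incl z)) := FiniteDimensional.complete ℝ _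
  let A : ℝ → E (G.incl z) →L[ℝ] F := fun t => LinearMap.toContinuousLinearMap
    ((e.linearMapAt ℝ (C.Φ (z, t))) ∘ₗ ((C.T z (C.Φ (z, t))).toLinearMap.restrictScalars ℝ))
  have hbase : ∀ᶠ t in 𝓝[≥] (0 : ℝ), C.Φ (z, t) ∈ e.baseSet :=
    (C.tendsto_ray z).eventually (e.open_baseSet.mem_nhds hz)
  have hA_apply : ∀ t, C.Φ (z, t) ∈ e.baseSet → ∀ v,
      A t v = (e (TotalSpace.mk' F (C.Φ (z, t)) (C.T z (C.Φ (z, t)) v))).2 := by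
    intro t ht v
    change e.linearMapAt ℝ (C.Φ (z, t)) (C.T z (C.Φ (z, t)) v) = _
    rw [e.coe_linearMapAt_of_mem ht]
  have hmk : ∀ v, TotalSpace.mk' F (C.Φ (z, 0)) (C.T z (C.Φ (z, 0)) v) =
      TotalSpace.mk' F (G.incl z) v := by
    intro v
    rw [C.Φ_zero, C.T_incl]
    rfl
  have hA0 : A 0 = A₀ := by
    ext v
    rw [hA_apply 0 (by rwa [C.Φ_zero]) v, hmk]
    rfl
  -- In finite dimension pointwise continuity suffices; each vector is extended to a global section
  -- so that smoothness of `T` on sections applies.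
  have hA : ContinuousWithinAt A (Ici 0) 0 := by
    refine continuousWithinAt_clm_apply.2 fun v => ?_
    have h1 := (C.contMDiffOn_T (fun n => (Ψ.through (G.incl z) v).1 (G.incl n.1))
      ((Ψ.through (G.incl z) v).2.comp_map (G.contMDiff_incl.comp contMDiff_fst))).continuousOn
      _ (C.incl_mem z)
    have h2 : Tendsto (fun t : ℝ => (z, t)) (𝓝[≥] 0) (𝓝[C.Φ.source] (z, 0)) := by
      refine tendsto_nhdsWithin_iff.2 ⟨?_, ?_⟩
      · exact (Continuous.prodMk_right z).continuousAt.tendsto.mono_left nhdsWithin_le_nhds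
      · filter_upwards [Ico_mem_nhdsGE C.ε_pos] with t ht
        rw [C.source_eq]
        exact ⟨mem_univ _, ht⟩
    have h3 := h1.tendsto.comp h2
    simp only [Function.comp_def, Ψ.through_apply] at h3
    rw [hmk] at h3
    have h4 : ContinuousAt e (TotalSpace.mk' F (G.incl z) v) :=
      e.continuousOn.continuousAt (e.open_source.mem_nhds (e.mem_source.2 hz))
    have h5 := (continuous_snd.tendsto _).comp (h4.tendsto.comp h3)
    rw [ContinuousWithinAt, hA_apply 0 (by rwa [C.Φ_zero]) v, hmk]
    refine h5.congr' ?_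
    filter_upwards [hbase] with t ht
    exact (hA_apply t ht v).symm
  have hinv : Tendsto (fun i => (A (t i)).inverse) l (𝓝 (A₀.symm : F →L[ℝ] E (G.incl z))) := by
    have h1 : ContinuousAt ContinuousLinearMap.inverse (A₀ : E (G.incl z) →L[ℝ] F) :=
      (contDiffAt_map_inverse (n := 0) A₀).continuousAt
    have h2 := h1.tendsto
    rw [ContinuousLinearMap.inverse_equiv] at h2
    refine h2.comp ?_
    rw [← hA0]
    exact hA.tendsto.comp ht
  have hew : Tendsto (fun i => (e (TotalSpace.mk' F (C.Φ (z, t i)) (w i))).2) l (𝓝 (A₀ w₀)) := by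
    have h4 : ContinuousAt e (TotalSpace.mk' F (G.incl z) w₀) :=
      e.continuousOn.continuousAt (e.open_source.mem_nhds (e.mem_source.2 hz))
    exact (continuous_snd.tendsto _).comp (h4.tendsto.comp hw)
  have h6 : Tendsto (fun i => (A (t i)).inverse (e (TotalSpace.mk' F (C.Φ (z, t i)) (w i))).2) l
      (𝓝 (A₀.symm (A₀ w₀))) :=
    (isBoundedBilinearMap_apply (𝕜 := ℝ) (E := F) (F := E (G.incl z))).continuous.continuousAt.tendsto.comp
      (hinv.prodMk_nhds hew)
  rw [A₀.symm_apply_apply] at h6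
  refine h6.congr' ?_
  filter_upwards [ht.eventually hbase] with i hi
  let A₁ : E (G.incl z) ≃L[ℝ] F := (((C.T z (C.Φ (z, t i))).restrictScalars ℝ).trans
    (e.continuousLinearEquivAt ℝ _ hi).toLinearEquiv).toContinuousLinearEquiv
  have hA₁ : A (t i) = A₁ := by
    ext v
    rw [hA_apply _ hi v]
    rfl
  rw [hA₁, ContinuousLinearMap.inverse_equiv, ContinuousLinearEquiv.coe_coe,
    ContinuousLinearEquiv.symm_apply_eq]
  change _ = (e (TotalSpace.mk' F (C.Φ (z, t i)) (C.T z (C.Φ (z, t i))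
    ((C.T z (C.Φ (z, t i))).symm (w i))))).2
  rw [LinearEquiv.apply_symm_apply]

/-- For large ρ the phases and the powers of ρ cancel exactly, leaving (ρx)⁻² T⁻¹ L(p, ρx) at p =
Φ(z, s/ρ), where ρx → s. -/
theorem NormalCoordinate.tendsto_normalApprox {C : Collar G F E μ μN} (nc : NormalCoordinate C)
    (nf : NormalForm G P) {U : ∀ n : N × ℝ, E (G.incl n.1)} (hU : U ∈ NormalTestSec G F E (Ioi 0))
    {g : Y → ℝ} (hg : ContMDiff (𝓡 q) 𝓘(ℝ, ℝ) ∞ g) (sl : nf.Slopes (nc.extendBase g)) (z : N)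
    {s : ℝ} (hs : 0 < s) : Tendsto (fun ρ : ℝ => normalApprox C P g U ρ (z, s)) atTop
      (𝓝 ((s ^ 2)⁻¹ • (nf.lift sl (nc.extend hU)).1 (G.incl z, s))) := by
  set L := nf.lift sl (nc.extend hU) with hL
  have ht : Tendsto (fun ρ : ℝ => ρ⁻¹ * s) atTop (𝓝[>] 0) := by
    refine tendsto_nhdsWithin_iff.2 ⟨?_, ?_⟩
    · simpa using (tendsto_inv_atTop_zero (𝕜 := ℝ)).mul_const s
    · filter_upwards [eventually_gt_atTop 0] with ρ hρ
      exact mul_pos (inv_pos.2 hρ) hs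
  have ht' := ht.mono_right (nhdsWithin_mono 0 Ioi_subset_Ici_self)
  have hray := (C.tendsto_ray z).comp ht'
  have hx : Tendsto (fun ρ : ℝ => ρ * G.x (C.Φ (z, ρ⁻¹ * s))) atTop (𝓝 s) := by
    have h1 := ((C.tendsto_x_div z).comp ht).const_mul s
    rw [mul_one] at h1
    refine h1.congr' ?_
    filter_upwards [eventually_gt_atTop 0] with ρ hρ
    rw [Function.comp_apply]
    field_simp
  have hx0 : ∀ᶠ ρ : ℝ in atTop, G.x (C.Φ (z, ρ⁻¹ * s)) < nc.b / 3 := by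
    refine ((G.contMDiff_x.continuous.tendsto _).comp hray).eventually_lt_const ?_
    rw [G.x_incl]
    linarith [nc.b_pos]
  have hw : Tendsto (fun ρ : ℝ => TotalSpace.mk' F (C.Φ (z, ρ⁻¹ * s))
      (L.1 (C.Φ (z, ρ⁻¹ * s), ρ * G.x (C.Φ (z, ρ⁻¹ * s))))) atTop
      (𝓝 (TotalSpace.mk' F (G.incl z) (L.1 (G.incl z, s)))) :=
    (L.2.continuous.tendsto (G.incl z, s)).comp (hray.prodMk_nhds hx)
  have hT := C.tendsto_T_symm z ht' hw
  refine (((hx.pow 2).inv₀ (by positivity)).smul hT).congr' ?_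
  filter_upwards [eventually_gt_atTop 0, nc.pushSec_eq hU hg, hx0,
    ht (Ioo_mem_nhdsGT C.ε_pos)] with ρ hρ hpush hxb htε
  have hsource : (z, ρ⁻¹ * s) ∈ C.Φ.source := by
    rw [C.source_eq]
    exact ⟨mem_univ _, htε.1.le, htε.2⟩
  set p := C.Φ (z, ρ⁻¹ * s) with hp
  have hgp : nc.extendBase g p = g (G.proj z) := by
    rw [NormalCoordinate.extendBase, nc.χ_eq_one hxb.le, one_mul, hp, C.Φ.left_inv hsource]
  change _ = (ρ ^ 2)⁻¹ • ρ⁻¹ • Complex.exp (Complex.I * ((-ρ : ℝ) : ℂ) * g (G.proj z)) •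
    (C.T z p).symm ((G.x p ^ 2)⁻¹ • applyOp P
      (pushSec G C.Φ C.T (modulate G ρ g (dilate G ρ U))) p)
  rw [hpush, applyOp_eq, LinearMap.map_smul_of_tower, nf.apply_scaled _ sl, ← hL]
  change _ = (ρ ^ 2)⁻¹ • ρ⁻¹ • Complex.exp (Complex.I * ((-ρ : ℝ) : ℂ) * g (G.proj z)) •
    (C.T z p).symm ((G.x p ^ 2)⁻¹ • ρ • phase ρ (nc.extendBase g) p • L.1 (p, ρ * G.x p))
  have h2 : ∀ (r : ℝ) (v : E p), (C.T z p).symm (r • v) = r • (C.T z p).symm v :=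
    fun r v => (C.T z p).symm.toLinearMap.map_smul_of_tower r v
  rw [h2, h2, map_smul, phase, hgp]
  have h3 : Complex.exp (Complex.I * ((-ρ : ℝ) : ℂ) * g (G.proj z)) *
      Complex.exp (Complex.I * ρ * g (G.proj z)) = 1 := by
    rw [← Complex.exp_add]
    push_cast
    rw [show Complex.I * -(ρ : ℂ) * g (G.proj z) + Complex.I * ρ * g (G.proj z) = 0 by ring,
      Complex.exp_zero]
  rw [smul_comm _ (G.x p ^ 2)⁻¹, smul_comm _ ρ, smul_smul (Complex.exp _), h3, one_smul]
  simp only [smul_smul]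
  congr 1
  have hρ0 := hρ.ne'
  rw [mul_pow, mul_inv]
  field_simp

end NormalLimit

/-! ### The pairing on the model cone as an iterated integral -/

section CylinderIntegral

/-- The measure is s ds times that of the fibre, so the weighted integrand is `κ`; its compact
support permits Fubini. -/
theorem l2Pairing_cylinderMeasure {Z : Type*} [TopologicalSpace Z] [CompactSpace Z] [T2Space Z]
    [MeasurableSpace Z] [BorelSpace Z] {μZ : Measure Z} [IsFiniteMeasure μZ] {W : Z × ℝ → Type*}
    [∀ n, NormedAddCommGroup (W n)] [∀ n, InnerProductSpace ℂ (W n)] {u v : ∀ n, W n} {κ : Z × ℝ → ℂ}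
    (hκ : Continuous κ) {s₀ s₁ : ℝ} (hκ0 : ∀ z, ∀ s ∉ Icc s₀ s₁, κ (z, s) = 0)
    (h : ∀ n : Z × ℝ, 0 < n.2 → n.2 • (inner ℂ (v n) (u n) : ℂ) = κ n) :
    l2Pairing (cylinderMeasure μZ) u v = ∫ z, (∫ s in Ioi 0, κ (z, s)) ∂μZ := by
  have hae : ∀ᵐ n ∂(μZ.prod (volume.restrict (Ioi (0 : ℝ)))), 0 < n.2 := by
    have h1 : μZ.prod (volume.restrict (Ioi (0 : ℝ))) =
        (μZ.prod volume).restrict (univ ×ˢ Ioi 0) := by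
      rw [← Measure.prod_restrict, Measure.restrict_univ]
    rw [h1]
    filter_upwards [ae_restrict_mem (MeasurableSet.univ.prod measurableSet_Ioi)] with n hn
    exact hn.2
  have hint : Integrable κ (μZ.prod (volume.restrict (Ioi (0 : ℝ)))) := by
    refine hκ.integrable_of_hasCompactSupport ?_
    refine HasCompactSupport.of_support_subset_isCompact (isCompact_univ.prod isCompact_Icc)
      (K := univ ×ˢ Icc s₀ s₁) fun n hn => ⟨mem_univ _, ?_⟩
    by_contra hs
    exact hn (hκ0 n.1 n.2 hs)
  rw [l2Pairing, cylinderMeasure, integral_wedgeMeasure measurable_snd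
    (hae.mono fun n hn => le_of_lt hn), ← integral_prod _ hint]
  exact integral_congr_ae (hae.mono fun n hn => h n hn)

end CylinderIntegral

/-! ### The normal operator: existence, independence of choices, symmetry and positivity -/

section NormalFamily

variable {k q : ℕ} {M N Y : Type*}
  [TopologicalSpace M] [ChartedSpace (EuclideanHalfSpace (k + q + 1)) M]
  [TopologicalSpace N] [ChartedSpace (EuclideanSpace ℝ (Fin (k + q))) N]
  [TopologicalSpace Y] [ChartedSpace (EuclideanSpace ℝ (Fin q)) Y]
  [IsManifold (𝓡∂ (k + q + 1)) ∞ M]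
  {G : FiberedBoundary k q M N Y}
  {F : Type*} [NormedAddCommGroup F] [NormedSpace ℝ F] {E : M → Type*}
  [TopologicalSpace (TotalSpace F E)] [∀ p, NormedAddCommGroup (E p)]
  [∀ p, InnerProductSpace ℂ (E p)] [FiberBundle F E] [VectorBundle ℝ F E]
  [ContMDiffVectorBundle ∞ F E (𝓡∂ (k + q + 1))]
  [SmoothHermitianBundle (𝓡∂ (k + q + 1)) F E]
  [T2Space M] [CompactSpace M] [FiniteDimensional ℝ F]
  [MeasurableSpace M] [MeasurableSpace N] {μ : Measure M} {μN : Measure N}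
  {P : Module.End ℂ (Sec k q F E)} {C : Collar G F E μ μN}
  [IsManifold (𝓡 (k + q)) ∞ N] [IsManifold (𝓡 q) ∞ Y]

theorem SuppIn.mono {W : CylSec k q F E} {s₀ s₁ t₀ t₁ : ℝ} (h : SuppIn W s₀ s₁) (h₀ : t₀ ≤ s₀)
    (h₁ : s₁ ≤ t₁) : SuppIn W t₀ t₁ :=
  fun p s hs => h p s fun hs' => hs ⟨h₀.trans hs'.1, hs'.2.trans h₁⟩

/-- Along the fibres, the slopes of `extendBase g` depend only on the differential of `g`. -/
theorem NormalCoordinate.slope_eq (nc : NormalCoordinate C)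
    {V : ∀ p : M, TangentSpace (𝓡∂ (k + q + 1)) p} {g g' : Y → ℝ}
    (hg : ContMDiff (𝓡 q) 𝓘(ℝ, ℝ) ∞ g) (hg' : ContMDiff (𝓡 q) 𝓘(ℝ, ℝ) ∞ g') {y : Y}
    (hgg : ∀ w, (mfderiv (𝓡 q) 𝓘(ℝ, ℝ) g y w : ℝ) = mfderiv (𝓡 q) 𝓘(ℝ, ℝ) g' y w)
    {b b' : M → ℝ} (hb : Continuous b) (hb' : Continuous b')
    (h : ∀ p, dirDeriv V (nc.extendBase g) p = G.x p * b p)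
    (h' : ∀ p, dirDeriv V (nc.extendBase g') p = G.x p * b' p) {z : N} (hz : G.proj z = y) :
    b (G.incl z) = b' (G.incl z) := by
  -- The slope at a boundary point is the limit along its collar ray of V(g ∘ r)/x, where `r` is the
  -- collar projection to Y. On the ray `r` is constantly `y`, so only the differential of `g` at
  -- `y` enters.
  have hray := (C.tendsto_ray z).mono_left (nhdsWithin_mono 0 Ioi_subset_Ici_self)
  have h1 := (hb.tendsto _).comp hray
  have h2 := (hb'.tendsto _).comp hray
  refine tendsto_nhds_unique (h1.congr' ?_) h2
  have hxb : ∀ᶠ t in 𝓝[>] (0 : ℝ), G.x (C.Φ (z, t)) < nc.b / 3 := by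
    refine ((G.contMDiff_x.continuous.tendsto _).comp hray).eventually_lt_const ?_
    rw [G.x_incl]
    linarith [nc.b_pos]
  filter_upwards [hxb, (C.tendsto_x_div z).eventually (lt_mem_nhds one_pos), self_mem_nhdsWithin,
    Ioo_mem_nhdsGT C.ε_pos] with t ht htx ht0 htε
  have hsource : (z, t) ∈ C.Φ.source := by
    rw [C.source_eq]
    exact ⟨mem_univ _, htε.1.le, htε.2⟩
  rw [Function.comp_apply, Function.comp_apply]
  set p := C.Φ (z, t) with hp
  have hx : 0 < G.x p := pos_of_mul_pos_right htx (inv_pos.2 ht0).le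
  let r : M → Y := fun p' => G.proj (C.Φ.symm p').1
  have hr : MDifferentiableAt (𝓡∂ (k + q + 1)) (𝓡 q) r p := by
    have h3 : ContMDiffOn (𝓡∂ (k + q + 1)) (𝓡 q) ∞ r C.Φ.target :=
      (G.isSubmersion_proj.contMDiff.comp contMDiff_fst).comp_contMDiffOn C.contMDiffOn_symm
    exact (h3.contMDiffAt (C.isOpen_target.mem_nhds (C.Φ.map_source hsource))).mdifferentiableAt
      (by simp)
  have hrp : r p = y := by
    change G.proj (C.Φ.symm p).1 = y
    rw [hp, C.Φ.left_inv hsource, hz]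
  have hder : ∀ {g : Y → ℝ}, ContMDiff (𝓡 q) 𝓘(ℝ, ℝ) ∞ g → dirDeriv V (nc.extendBase g) p =
      (mfderiv (𝓡 q) 𝓘(ℝ, ℝ) g (r p) (mfderiv (𝓡∂ (k + q + 1)) (𝓡 q) r p (V p)) : ℝ) := by
    intro g hg
    have h4 : nc.extendBase g =ᶠ[𝓝 p] g ∘ r := by
      filter_upwards [(isOpen_lt G.contMDiff_x.continuous continuous_const).mem_nhds ht] with p' hp'
      rw [NormalCoordinate.extendBase, nc.χ_eq_one (le_of_lt hp'), one_mul]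
      rfl
    rw [dirDeriv_congr h4]
    change mfderiv (𝓡∂ (k + q + 1)) 𝓘(ℝ, ℝ) (g ∘ r) p (V p) = _
    rw [mfderiv_comp p (hg.mdifferentiableAt (by simp)) hr]
    rfl
  have hgg' : ∀ y', y' = y → ∀ w : TangentSpace (𝓡 q) y',
      (mfderiv (𝓡 q) 𝓘(ℝ, ℝ) g y' w : ℝ) = mfderiv (𝓡 q) 𝓘(ℝ, ℝ) g' y' w := by
    rintro _ rfl
    exact hgg
  refine mul_left_cancel₀ hx.ne' ?_
  rw [← h, ← h', hder hg, hder hg']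
  exact hgg' _ hrp _

variable [T2Space Y] {y : Y} {Z : Type*} [TopologicalSpace Z] [ChartedSpace (EuclideanSpace ℝ (Fin k)) Z]
  [IsManifold (𝓡 k) ∞ Z] (j : FiberModel G y Z)

theorem NormalForm.lift_fiber_congr (nf : NormalForm G P) {g g' : M → ℝ} (sl : nf.Slopes g)
    (sl' : nf.Slopes g') (hb : ∀ i z, sl.b i (j.inclM z) = sl'.b i (j.inclM z))
    (hb' : ∀ i z, sl.b' i (j.inclM z) = sl'.b' i (j.inclM z)) {W W' : CylSec k q F E}
    (hW : ∀ z s, W.1 (j.inclM z, s) = W'.1 (j.inclM z, s)) (z : Z) (s : ℝ) :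
    (nf.lift sl W).1 (j.inclM z, s) = (nf.lift sl' W').1 (j.inclM z, s) := by
  have h1 := (isEdgeInvariant_fiber j).lift_eq_smul nf (κ := fun _ => 1) (W := W) (W' := W')
    contMDiff_const (fun V _ p _ => dirDeriv_const _ _) sl sl'
    (by rintro i _ ⟨z, rfl⟩; exact hb i z) (by rintro i _ ⟨z, rfl⟩; exact hb' i z)
    (by rintro _ ⟨z, rfl⟩ s; rw [hW, one_smul]) _ (mem_range_self z) s
  rw [h1, one_smul]

variable (nc : NormalCoordinate C)

/-- An extension to `M × ℝ` of a section over the model of the fibre. -/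
def NormalCoordinate.fiberExtend (u : FiberTestSec F E j) : CylSec k q F E :=
  nc.extend (j.exists_normalTestSec_extension u).choose_spec.1

theorem NormalCoordinate.fiberExtend_apply (u : FiberTestSec F E j) (z : Z) (s : ℝ) :
    (nc.fiberExtend j u).1 (j.inclM z, s) = u.1 (z, s) :=
  (nc.extend_incl _ _ _).trans ((j.exists_normalTestSec_extension u).choose_spec.2 (z, s)).symm

theorem NormalForm.restrict_lift_mem (nf : NormalForm G P) {g : M → ℝ} (sl : nf.Slopes g)
    {W : CylSec k q F E} {s₀ s₁ : ℝ} (hs₀ : 0 < s₀) (hW : SuppIn W s₀ s₁) [CompactSpace Z] :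
    (fun n : Z × ℝ => (n.2 ^ 2)⁻¹ • (nf.lift sl W).1 (j.inclM n.1, n.2)) ∈ FiberTestSec F E j := by
  have hL := hW.lift nf sl
  refine ⟨?_, univ ×ˢ Icc s₀ s₁, isCompact_univ.prod isCompact_Icc,
    prod_mono_right fun s hs => hs₀.trans_le hs.1, fun n hn => ?_⟩
  -- The factor s⁻² is not smooth at 0; it is replaced by exp(−2 l(s)), which equals it on the
  -- support.
  · obtain ⟨l, hl, hlog⟩ := exists_contDiff_eq_log hs₀
    have h1 : (fun n : Z × ℝ => (n.2 ^ 2)⁻¹ • (nf.lift sl W).1 (j.inclM n.1, n.2)) =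
        fun n : Z × ℝ => Real.exp (-2 * l n.2) • (nf.lift sl W).1 (j.inclM n.1, n.2) := by
      funext n
      by_cases hs : n.2 ∈ Icc s₀ s₁
      · have h0 : 0 < n.2 := hs₀.trans_le hs.1
        rw [hlog _ hs.1, show -2 * Real.log n.2 = -Real.log (n.2 ^ 2) by rw [Real.log_pow]; ring,
          Real.exp_neg, Real.exp_log (by positivity)]
      · rw [hL _ _ hs, smul_zero, smul_zero]
    rw [h1]
    have h2 : ContDiff ℝ ∞ fun s => Real.exp (-2 * l s) := (contDiff_const.mul hl).exp
    refine IsSmoothAlong.smul (h2.contMDiff.comp contMDiff_snd) ?_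
    exact ContMDiff.comp (nf.lift sl W).2
      ((j.contMDiff_inclM.comp contMDiff_fst).prodMk contMDiff_snd)
  · dsimp only
    rw [hL _ _ fun h => hn ⟨mem_univ _, h⟩, smul_zero]

/-- The normal operator of `x⁻² P` on the model of a fibre. -/
def NormalForm.normalOp (nf : NormalForm G P) {g : M → ℝ} (sl : nf.Slopes g) :
    Module.End ℂ (FiberTestSec F E j) where
  toFun u := ⟨fun n => (n.2 ^ 2)⁻¹ • (nf.lift sl (nc.fiberExtend j u)).1 (j.inclM n.1, n.2), by
    have := G.compactSpace_boundary
    have := j.compactSpace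
    obtain ⟨s₀, s₁, hs₀, hs⟩ :=
      nc.exists_suppIn_extend (j.exists_normalTestSec_extension u).choose_spec.1
    exact nf.restrict_lift_mem j sl hs₀ hs⟩
  map_add' u v := by
    refine Subtype.ext (funext fun n => ?_)
    have h := nf.lift_fiber_congr j sl sl (fun _ _ => rfl) (fun _ _ => rfl)
      (W := nc.fiberExtend j (u + v)) (W' := nc.fiberExtend j u + nc.fiberExtend j v)
      (fun z s => (nc.fiberExtend_apply j _ z s).trans (congrArg₂ (· + ·)
        (nc.fiberExtend_apply j u z s).symm (nc.fiberExtend_apply j v z s).symm)) n.1 n.2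
    rw [map_add] at h
    exact (congrArg (fun w => (n.2 ^ 2)⁻¹ • w) h).trans (smul_add _ _ _)
  map_smul' c u := by
    refine Subtype.ext (funext fun n => ?_)
    have h := nf.lift_fiber_congr j sl sl (fun _ _ => rfl) (fun _ _ => rfl)
      (W := nc.fiberExtend j (c • u)) (W' := c • nc.fiberExtend j u)
      (fun z s => (nc.fiberExtend_apply j _ z s).trans (congrArg (c • ·)
        (nc.fiberExtend_apply j u z s).symm)) n.1 n.2
    rw [map_smul] at h
    exact (congrArg (fun w => (n.2 ^ 2)⁻¹ • w) h).trans (smul_comm _ c _)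

/-- A different phase with the same differential at `y` has the same slopes along the fibre, and a
different extension of `u` has the same values there; the lift restricted to the fibre sees nothing
else. -/
theorem NormalForm.isNormalOperator (nf : NormalForm G P) {g : Y → ℝ}
    (hg : ContMDiff (𝓡 q) 𝓘(ℝ, ℝ) ∞ g) (sl : nf.Slopes (nc.extendBase g))
    {η : TangentSpace (𝓡 q) y →L[ℝ] ℝ} (hη : ∀ w, mfderiv (𝓡 q) 𝓘(ℝ, ℝ) g y w = η w) :
    IsNormalOperator C P j η (nf.normalOp j nc sl) := by
  intro g' hg' hη' U hU u hu z s hs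
  obtain ⟨sl'⟩ := nf.nonempty_slopes (nc.isBasic_extendBase hg')
  have h1 := nc.tendsto_normalApprox nf hU hg' sl' (j.incl z) hs
  have hgg : ∀ w, (mfderiv (𝓡 q) 𝓘(ℝ, ℝ) g' y w : ℝ) = mfderiv (𝓡 q) 𝓘(ℝ, ℝ) g y w :=
    fun w => (hη' w).trans (hη w).symm
  have h2 := nf.lift_fiber_congr j sl' sl
    (fun i z => nc.slope_eq hg' hg hgg (sl'.smooth_b i).continuous (sl.smooth_b i).continuous
      (sl'.eq_b i) (sl.eq_b i) (j.proj_incl z))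
    (fun i z => nc.slope_eq hg' hg hgg (sl'.smooth_b' i).continuous (sl.smooth_b' i).continuous
      (sl'.eq_b' i) (sl.eq_b' i) (j.proj_incl z))
    (W := nc.extend hU) (W' := nc.fiberExtend j u)
    (fun z s => (nc.extend_incl hU _ s).trans ((hu (z, s)).symm.trans
      (nc.fiberExtend_apply j u z s).symm)) z s
  have h3 : (nf.lift sl' (nc.extend hU)).1 (G.incl (j.incl z), s) =
    (nf.lift sl (nc.fiberExtend j u)).1 (j.inclM z, s) := h2
  rw [h3] at h1
  exact h1

variable [BorelSpace M] [BorelSpace N] [IsFiniteMeasure μ] [IsFiniteMeasure μN]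
  [MeasurableSpace Y] [BorelSpace Y] [MeasurableSpace Z] [BorelSpace Z] {j} {μY : Measure Y}
  {μZ : Measure Z} [IsFiniteMeasure μZ]

theorem continuous_cylPairing_fiber (U : CylSec k q F E) {V : CylSec k q F E} {s₀ s₁ : ℝ}
    (hV : SuppIn V s₀ s₁) (hs₀ : 0 < s₀) :
    Continuous fun n : Z × ℝ => cylPairing U V (j.inclM n.1, n.2) :=
  (contMDiff_cylPairing U hV hs₀).continuous.comp
    ((j.contMDiff_inclM.continuous.comp continuous_fst).prodMk continuous_snd)

theorem NormalForm.normalOp_symmetric_nonneg (nf : NormalForm G P) (hμN : IsBoundaryDensity G μ μN)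
    (hμZ : IsFiberDensity j μN μY μZ) (hsymm : IsSymmetricOp G μ P) (hpos : IsNonnegOp G μ P)
    {g : M → ℝ} (hg : ContMDiff (𝓡∂ (k + q + 1)) 𝓘(ℝ, ℝ) ∞ g) (sl : nf.Slopes g)
    (u v : FiberTestSec F E j) :
    l2Pairing (cylinderMeasure μZ) (nf.normalOp j nc sl u).1 v.1 =
        l2Pairing (cylinderMeasure μZ) u.1 (nf.normalOp j nc sl v).1 ∧
      0 ≤ (l2Pairing (cylinderMeasure μZ) (nf.normalOp j nc sl u).1 u.1).re := by
  have := G.compactSpace_boundary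
  have := j.compactSpace
  have := G.t2Space_boundary
  have : T2Space Z := j.isSmoothEmbedding_incl.isEmbedding.t2Space
  have hsupp : ∀ u : FiberTestSec F E j, ∃ s₀ s₁ : ℝ, 0 < s₀ ∧ SuppIn (nc.fiberExtend j u) s₀ s₁ :=
    fun u => nc.exists_suppIn_extend (j.exists_normalTestSec_extension u).choose_spec.1
  -- The weight s of the measure times the factor s⁻² of the normal operator is the s⁻¹ of
  -- `cylPairing`.
  have hleft : ∀ u v : FiberTestSec F E j, l2Pairing (cylinderMeasure μZ) (nf.normalOp j nc sl u).1 v.1 =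
      ∫ z, (∫ s in Ioi 0, cylPairing (nf.lift sl (nc.fiberExtend j u)) (nc.fiberExtend j v)
        (j.inclM z, s)) ∂μZ := by
    intro u v
    obtain ⟨s₀, s₁, hs₀, hs⟩ := hsupp v
    refine l2Pairing_cylinderMeasure (continuous_cylPairing_fiber _ hs hs₀)
      (fun z => cylPairing_eq_zero hs (j.inclM z)) fun n hn => ?_
    change n.2 • inner ℂ (v.1 n) ((n.2 ^ 2)⁻¹ • (nf.lift sl (nc.fiberExtend j u)).1 (j.inclM n.1, n.2)) = _
    rw [cylPairing, nc.fiberExtend_apply, Complex.real_smul, ← Complex.coe_smul, inner_smul_right,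
      ← mul_assoc]
    congr 1
    have h0 : (n.2 : ℂ) ≠ 0 := by exact_mod_cast hn.ne'
    push_cast
    field_simp
  have hright : ∀ u v : FiberTestSec F E j, l2Pairing (cylinderMeasure μZ) u.1 (nf.normalOp j nc sl v).1 =
      ∫ z, (∫ s in Ioi 0, cylPairing (nc.fiberExtend j u) (nf.lift sl (nc.fiberExtend j v))
        (j.inclM z, s)) ∂μZ := by
    intro u v
    obtain ⟨s₀, s₁, hs₀, hs⟩ := hsupp v
    refine l2Pairing_cylinderMeasure (continuous_cylPairing_fiber _ (hs.lift nf sl) hs₀)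
      (fun z => cylPairing_eq_zero (hs.lift nf sl) (j.inclM z)) fun n hn => ?_
    change n.2 • inner ℂ ((n.2 ^ 2)⁻¹ • (nf.lift sl (nc.fiberExtend j v)).1 (j.inclM n.1, n.2)) (u.1 n) = _
    rw [cylPairing, nc.fiberExtend_apply, Complex.real_smul, ← Complex.coe_smul, inner_smul_left,
      Complex.conj_ofReal, ← mul_assoc]
    congr 1
    have h0 : (n.2 : ℂ) ≠ 0 := by exact_mod_cast hn.ne'
    push_cast
    field_simp
  obtain ⟨s₀, s₁, hs₀, hs⟩ := hsupp u
  obtain ⟨t₀, t₁, ht₀, ht⟩ := hsupp v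
  constructor
  · rw [hleft, hright]
    exact fiber_symmetric hμN hμZ hsymm nf hg sl (hs.mono (min_le_left s₀ t₀) (le_max_left s₁ t₁))
      (ht.mono (min_le_right s₀ t₀) (le_max_right s₁ t₁)) (lt_min hs₀ ht₀)
  · rw [hleft]
    exact fiber_nonneg hμN hμZ hpos nf hg sl hs hs₀

theorem exists_normalOperator (nf : NormalForm G P) (hμN : IsBoundaryDensity G μ μN)
    (hμZ : IsFiberDensity j μN μY μZ) (hsymm : IsSymmetricOp G μ P) (hpos : IsNonnegOp G μ P)
    (C : Collar G F E μ μN) :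
    ∃ A : (TangentSpace (𝓡 q) y →L[ℝ] ℝ) → Module.End ℂ (FiberTestSec F E j),
      (∀ η, IsNormalOperator C P j η (A η)) ∧
      ∀ η (u v : FiberTestSec F E j),
        l2Pairing (cylinderMeasure μZ) (A η u).1 v.1 =
            l2Pairing (cylinderMeasure μZ) u.1 (A η v).1 ∧
          0 ≤ (l2Pairing (cylinderMeasure μZ) (A η u).1 u.1).re := by
  obtain ⟨nc⟩ := C.nonempty_normalCoordinate
  have hη : ∀ η : TangentSpace (𝓡 q) y →L[ℝ] ℝ, ∃ g : Y → ℝ, ContMDiff (𝓡 q) 𝓘(ℝ, ℝ) ∞ g ∧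
      ∀ w, mfderiv (𝓡 q) 𝓘(ℝ, ℝ) g y w = η w := fun η => by
    obtain ⟨g, hg, -, hgη⟩ := exists_contMDiff_tsupport_subset_mfderiv_eq (O := univ) univ_mem η
    exact ⟨g, hg, hgη⟩
  choose g hg hgη using hη
  have hsl := fun η => nf.nonempty_slopes (nc.isBasic_extendBase (hg η))
  refine ⟨fun η => nf.normalOp j nc (hsl η).some,
    fun η => nf.isNormalOperator j nc (hg η) (hsl η).some (hgη η), fun η u v =>
    nf.normalOp_symmetric_nonneg nc hμN hμZ hsymm hpos (nc.isBasic_extendBase (hg η)).1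
      (hsl η).some u v⟩

end NormalFamily

end Wedge

end

theorem mainTheorem6 {k q : ℕ} {M N Y : Type*}
    -- the compact manifold with boundary `M`, its boundary `N`, fibred over `Y`
    [TopologicalSpace M] [T2Space M] [CompactSpace M]
    [ChartedSpace (EuclideanHalfSpace (k + q + 1)) M] [IsManifold (𝓡∂ (k + q + 1)) ∞ M]
    [MeasurableSpace M] [BorelSpace M]
    [TopologicalSpace N] [ChartedSpace (EuclideanSpace ℝ (Fin (k + q))) N]
    [IsManifold (𝓡 (k + q)) ∞ N] [MeasurableSpace N] [BorelSpace N]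
    [TopologicalSpace Y] [T2Space Y] [ChartedSpace (EuclideanSpace ℝ (Fin q)) Y]
    [IsManifold (𝓡 q) ∞ Y] [MeasurableSpace Y] [BorelSpace Y]
    (G : Wedge.FiberedBoundary k q M N Y)
    -- the Hermitian vector bundle `E → M`
    (F : Type*) [NormedAddCommGroup F] [NormedSpace ℝ F] [FiniteDimensional ℝ F]
    (E : M → Type*) [TopologicalSpace (TotalSpace F E)] [∀ p, NormedAddCommGroup (E p)]
    [∀ p, InnerProductSpace ℂ (E p)] [FiberBundle F E] [VectorBundle ℝ F E]
    [ContMDiffVectorBundle ∞ F E (𝓡∂ (k + q + 1))]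
    [Wedge.SmoothHermitianBundle (𝓡∂ (k + q + 1)) F E]
    -- the densities on `M`, on `N` (induced by the one on `M`) and on `Y`
    (μ : Measure M) (hμ : Wedge.IsSmoothPositiveDensity (𝓡∂ (k + q + 1)) μ)
    (μN : Measure N) [IsFiniteMeasure μN] (hμN : Wedge.IsBoundaryDensity G μ μN)
    (μY : Measure Y) (hμY : Wedge.IsSmoothPositiveDensity (𝓡 q) μY)
    -- the operator `A = x⁻² P`, symmetric and bounded below by `1`
    (P : Module.End ℂ (Wedge.Sec k q F E)) (hP : P ∈ Wedge.edgeDiffOps G F E 2)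
    (hsymm : ∀ u ∈ Wedge.TestSec k q F E, ∀ v ∈ Wedge.TestSec k q F E,
      Wedge.l2Pairing (Wedge.wedgeMeasure μ G.x) (Wedge.wedgeOp G P u) v =
        Wedge.l2Pairing (Wedge.wedgeMeasure μ G.x) u (Wedge.wedgeOp G P v))
    (hbound : ∀ u ∈ Wedge.TestSec k q F E,
      (Wedge.l2Pairing (Wedge.wedgeMeasure μ G.x) u u).re ≤
        (Wedge.l2Pairing (Wedge.wedgeMeasure μ G.x) (Wedge.wedgeOp G P u) u).re) :
    -- (a) the wedge-principal symbol
    (∃ S : ∀ p : M, Wedge.WedgeCotangent G p → (E p →ₗ[ℂ] E p), Wedge.IsWedgeSymbol G P S ∧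
      ∀ (p : M) (ξ : Wedge.WedgeCotangent G p), (S p ξ).IsSymmetric ∧
        spectrum ℂ (S p ξ) ⊆ (fun t : ℝ => (t : ℂ)) '' Ici 0) ∧
    -- (b) and (c), on the fibre `Z` over `y` with the density induced by `μN` and `μY`
    ∀ (y : Y) (Z : Type*) [TopologicalSpace Z] [ChartedSpace (EuclideanSpace ℝ (Fin k)) Z]
      [IsManifold (𝓡 k) ∞ Z] [MeasurableSpace Z] [BorelSpace Z] (j : Wedge.FiberModel G y Z)
      (μZ : Measure Z) [IsFiniteMeasure μZ], Wedge.IsFiberDensity j μN μY μZ →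
      (∃ L : ℂ → Module.End ℂ (Wedge.FiberSec F E j),
        (∀ σ, Wedge.IsIndicialOperator P j σ (L σ)) ∧
        ∀ (σ : ℂ) (u v : Wedge.FiberSec F E j),
          Wedge.l2Pairing μZ (L σ u).1 v.1 =
            Wedge.l2Pairing μZ u.1 (L (starRingEnd ℂ σ) v).1) ∧
      ∀ C : Wedge.Collar G F E μ μN,
        ∃ A : (TangentSpace (𝓡 q) y →L[ℝ] ℝ) → Module.End ℂ (Wedge.FiberTestSec F E j),
          (∀ η, Wedge.IsNormalOperator C P j η (A η)) ∧
          ∀ η (u v : Wedge.FiberTestSec F E j),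
            Wedge.l2Pairing (Wedge.cylinderMeasure μZ) (A η u).1 v.1 =
                Wedge.l2Pairing (Wedge.cylinderMeasure μZ) u.1 (A η v).1 ∧
              0 ≤ (Wedge.l2Pairing (Wedge.cylinderMeasure μZ) (A η u).1 u.1).re := by
  have := hμ.isFiniteMeasure
  -- The lower bound enters through ⟨Au, u⟩ ≥ ⟨u, u⟩ ≥ 0.
  have hpos : Wedge.IsNonnegOp G μ P := fun u hu => by
    refine le_trans ?_ (hbound u hu)
    have h1 : ∀ p, (inner ℂ (u p) (u p) : ℂ) = ((‖u p‖ ^ 2 : ℝ) : ℂ) := fun p => by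
      rw [inner_self_eq_norm_sq_to_K]
      norm_cast
    simp only [Wedge.l2Pairing, h1]
    rw [integral_complex_ofReal, Complex.ofReal_re]
    exact integral_nonneg fun p => by positivity
  obtain ⟨nf⟩ := Wedge.nonempty_normalForm hP
  refine ⟨Wedge.exists_wedgeSymbol nf hμ hsymm hpos, fun y Z _ _ _ _ _ j μZ _ hμZ =>
    ⟨Wedge.exists_indicialOperator nf hμN hμZ hsymm,
      fun C => Wedge.exists_normalOperator nf hμN hμZ hsymm hpos C⟩⟩
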